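/- Let $k$ be an algebraically closed field of characteristic $0$, let $S$ be a smooth separated scheme of finite type over $k$, let $E$ be a vector bundle of rank $n$ on $S$, $\mathcal L$ a line bundle on $S$, and $\sigma:\mathcal L\to S^2E^*$ a morphism which vanishes at no point of $S$ (so that the zeros of $\sigma$ in $\mathbb P_S(E)$ form a family of $(n-2)$-dimensional quadrics over $S$). Let $$\mathfrak B=T^\bullet(E)\big/\big\langle \operatorname{Ker}(\sigma^*:S^2E\to\mathcal L^*)\big\rangle$$ be the homogeneous Clifford algebra, where $S^2E\subset E\otimes E$ is the sheaf of symmetric tensors. It is a graded sheaf of $\mathcal O_S$-algebras, and $\mathcal L^*=S^2E/\operatorname{Ker}\sigma^*\subset\mathfrak B_2$ is central. Let $$\mathcal B_0=\varinjlim_{k\ge 0}\ \mathfrak B_{2k}\otimes\mathcal L^{k}$$ be the sheaf of even parts of Clifford algebras; for a graded right $\mathfrak B$-module $M$ the transition maps $M_{2k}\otimes\mathcal L^k\cong M_{2k}\otimes\mathcal L^*\otimes\mathcal L^{k+1}\to M_{2k+2}\otimes\mathcal L^{k+1}$ are given by the action of $\mathcal L^*\subset\mathfrak B_2$, and $\varinjlim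 M_{2k}\otimes\mathcal L^k$ is a right $\mathcal B_0$-module. For an open subset $W\subseteq S$ let $\operatorname{gr}_W\text{-}\mathfrak B$ be the category of finitely generated quasi-coherent sheaves of $\mathbb Z$-graded right $\mathfrak B$-modules on $W$ and degree-preserving morphisms, let $\operatorname{qgr}_W\text{-}\mathfrak B$ be its quotient by the subcategory of modules which are of finite rank (i.e. finitely generated) over $\mathcal O_W$, let $\pi:\operatorname{gr}_W\text{-}\mathfrak B\to\operatorname{qgr}_W\text{-}\mathfrak B$ be the quotient functor, and let $\operatorname{mod}_W\text{-}\mathcal B_0$ be the category of coherent sheaves of right $\mathcal B_0$-modules on $W$. Write $M\langle j\rangle_i=M_{i+j}$. Then, for each open subset $W\subseteq S$ (in particular for $W=S$), the following holds. 1. The functor $M\mapsto\varinjlim M_{2k}\otimes\mathcal L^k$ has coherent values and factors through $\pi$. The categories $\operatorname{qgr}_W\text{-}\mathfrak B$ and $\operatorname{mod}_W\text{-}\mathcal B_0$ are abelian, and the resulting functor $$q_*:\operatorname{qgr}_W\text{-}\mathfrak B\to\operatorname{mod}_W\text{-}\mathcal B_0,\qquad q_*(\pi M)=\varinjlim_k\,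 M_{2k}\otimes\mathcal L^k,$$ is an exact, $\Gamma(W,\mathcal O_S)$-linear equivalence of abelian categories. It commutes with restriction to smaller open subsets. 2. There are isomorphisms, functorial in $M\in\operatorname{qgr}_W\text{-}\mathfrak B$, $$q_*(M\langle 2l\rangle)\cong q_*(M)\otimes(\mathcal L^*)^{\otimes l}\qquad\text{for all } l\in\mathbb Z,$$ where $(\mathcal L^*)^{\otimes l}=\mathcal L^{\otimes(-l)}$ for $l<0$. 3. For all $M,N\in\operatorname{gr}_S\text{-}\mathfrak B$, $q_*$ induces an isomorphism of sheaves on $S$ $$\mathcal Hom_{S}(\pi M,\pi N)\cong\mathcal Hom_{\mathcal B_0}(q_*\pi M,q_*\pi N),$$ where $\Gamma(U,\mathcal Hom_S(\pi M,\pi N))=\operatorname{Hom}_{\operatorname{qgr}_U}(\pi M_U,\pi N_U)$ for $U\subseteq S$ open. Moreover, let $\mathcal Hom_{\operatorname{qgr}_S\text{-}\mathfrak B}(\pi M,\pi N)$ be the local $\mathcal Hom$ represented by the graded module $\bigoplus_j\mathcal Hom_S(\pi M,\pi N\langle j\rangle)$, so that, for $U\subseteq S$ affine open, $$\Gamma\big(U,q_*\mathcal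 Hom_{\operatorname{qgr}_S\text{-}\mathfrak B}(\pi M,\pi N)\big)=\varinjlim_{k\ge0}\operatorname{Hom}_{\operatorname{qgr}_U}(\pi M_U,\pi N_U\langle 2k\rangle)\otimes_{\Gamma(U,\mathcal O_S)}\Gamma(U,\mathcal L^k).$$ Then there are $\Gamma(U,\mathcal O_S)$-linear isomorphisms $$\Gamma\big(U,q_*\mathcal Hom_{\operatorname{qgr}_S\text{-}\mathfrak B}(\pi M,\pi N)\big)\cong\Gamma\big(U,\mathcal Hom_{\mathcal B_0}(q_*\pi M,q_*\pi N)\big),$$ compatible with restriction, which send the class of $g\otimes\ell$ to the composition of $q_*(g):q_*\pi M_U\to q_*(\pi N_U\langle 2k\rangle)$ with the morphism $q_*(\pi N_U\langle 2k\rangle)\to q_*\pi N_U$, $x\otimes\ell'\mapsto x\otimes\ell'\ell$. -/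

import Mathlib

open CategoryTheory AlgebraicGeometry
open scoped TensorProduct DirectSum MulOpposite

universe u

noncomputable section

namespace HomogClifford

section Algebra

variable {R E L : Type u} [CommRing R] [AddCommGroup E] [Module R E] [AddCommGroup L] [Module R L]

/-- The kernel of `σ^* : S²E → L^*`, where `S²E ⊆ E ⊗ E` is the module of symmetric tensors and
`σ : L → S²E^*` is viewed as a trilinear form `L × E × E → R`, symmetric in the last two
variables. -/
def quadRel (s : L →ₗ[R] E →ₗ[R] E →ₗ[R] R) : Submodule R (E ⊗[R] E) :=
  LinearMap.ker ((TensorProduct.comm R E E).toLinearMap - LinearMap.id) ⊓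
    ⨅ l : L, LinearMap.ker (TensorProduct.lift (s l))

variable (R E) in
/-- The inclusion of `E ⊗ E` as the degree two part of the tensor algebra. -/
def tensorTwo : E ⊗[R] E →ₗ[R] TensorAlgebra R E :=
  TensorProduct.lift ((LinearMap.mul R (TensorAlgebra R E)).compl₁₂
    (TensorAlgebra.ι R) (TensorAlgebra.ι R))

/-- The relations `t = 0` for `t ∈ Ker (σ^* : S²E → L^*)`. -/
def HCRel (s : L →ₗ[R] E →ₗ[R] E →ₗ[R] R) (x y : TensorAlgebra R E) : Prop :=
  (∃ t ∈ quadRel s, tensorTwo R E t = x) ∧ y = 0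

/-- The homogeneous Clifford algebra `T(E) / ⟨Ker (σ^* : S²E → L^*)⟩`. -/
def HC (s : L →ₗ[R] E →ₗ[R] E →ₗ[R] R) : Type u := RingQuot (HCRel s)

section Basic

variable (s : L →ₗ[R] E →ₗ[R] E →ₗ[R] R)

instance : Ring (HC s) := inferInstanceAs (Ring (RingQuot (HCRel s)))

instance : Algebra R (HC s) := inferInstanceAs (Algebra R (RingQuot (HCRel s)))

/-- The quotient map from the tensor algebra. -/
def HC.mk : TensorAlgebra R E →ₐ[R] HC s := RingQuot.mkAlgHom R (HCRel s)

/-- The inclusion of the degree one generators `E`. -/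
def HC.gen : E →ₗ[R] HC s := (HC.mk s).toLinearMap ∘ₗ TensorAlgebra.ι R

/-- The component of degree `j`, i.e. the image of `E^{⊗ j}`. -/
def HC.deg (j : ℕ) : Submodule R (HC s) := LinearMap.range (HC.gen s) ^ j

variable (R L) in
/-- `L^{⊗ k}` for an invertible module `L`, as the component of degree `k` of `Sym L`. -/
def tpow (k : ℕ) : Submodule R (SymmetricAlgebra R L) :=
  LinearMap.range (SymmetricAlgebra.ι R L) ^ k

/-- The bigraded algebra `HC ⊗ Sym L = ⨁ HC_j ⊗ L^k`. -/
abbrev HCL : Type u := HC s ⊗[R] SymmetricAlgebra R L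

/-- The submodule `HC_{2k} ⊗ L^k` of `HC ⊗ Sym L`. -/
def evenPiece (k : ℕ) : Submodule R (HCL s) :=
  Submodule.map₂ (TensorProduct.mk R (HC s) (SymmetricAlgebra R L)) (HC.deg s (2 * k)) (tpow R L k)

lemma evenPiece_mul_le (j k : ℕ) : evenPiece s j * evenPiece s k ≤ evenPiece s (j + k) := by
  unfold evenPiece
  simp only [Submodule.map₂_eq_span_image2, Submodule.span_mul_span]
  refine Submodule.span_le.2 ?_
  rintro _ ⟨_, ⟨b, hb, l, hl, rfl⟩, _, ⟨c, hc, m, hm, rfl⟩, rfl⟩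
  refine Submodule.subset_span ⟨b * c, ?_, l * m, ?_, ?_⟩
  · rw [SetLike.mem_coe, HC.deg, mul_add, pow_add]
    exact Submodule.mul_mem_mul hb hc
  · rw [SetLike.mem_coe, tpow, pow_add]
    exact Submodule.mul_mem_mul hl hm
  · simp

/-- The algebra `⨁ₖ HC_{2k} ⊗ L^k`, as a subalgebra of `HC ⊗ Sym L`. -/
def evenAlg : Subalgebra R (HCL s) :=
  (⨆ k, evenPiece s k).toSubalgebra
    (by
      refine Submodule.mem_iSup_of_mem 0 ?_
      refine Submodule.apply_mem_map₂ (TensorProduct.mk R (HC s) (SymmetricAlgebra R L))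
        (m := 1) (n := 1) ?_ ?_
      · simp [HC.deg, Submodule.one_le.1 le_rfl]
      · simp [tpow, Submodule.one_le.1 le_rfl])
    (by
      intro x y hx hy
      have h : (⨆ k, evenPiece s k) * (⨆ k, evenPiece s k) ≤ ⨆ k, evenPiece s k := by
        rw [Submodule.iSup_mul]
        refine iSup_le fun j => ?_
        rw [Submodule.mul_iSup]
        exact iSup_le fun k => (evenPiece_mul_le s j k).trans (le_iSup _ _)
      exact h (Submodule.mul_mem_mul hx hy))

lemma HC.gen_mem_deg (v : E) : HC.gen s v ∈ HC.deg s 1 := by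
  rw [HC.deg, pow_one]
  exact ⟨v, rfl⟩

lemma HC.gen_mul_gen_mem_deg (v w : E) : HC.gen s v * HC.gen s w ∈ HC.deg s 2 := by
  rw [HC.deg, pow_two]
  exact Submodule.mul_mem_mul ⟨v, rfl⟩ ⟨w, rfl⟩

lemma ι_mem_tpow (l : L) : SymmetricAlgebra.ι R L l ∈ tpow R L 1 := by
  rw [tpow, pow_one]
  exact ⟨l, rfl⟩

/-- The element `v² ⊗ l` of `HC_2 ⊗ L`. -/
def sqGen (v : E) (l : L) : evenAlg s :=
  ⟨(HC.gen s v * HC.gen s v) ⊗ₜ SymmetricAlgebra.ι R L l,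
    Submodule.mem_iSup_of_mem (p := evenPiece s) 1 <|
      Submodule.apply_mem_map₂ (TensorProduct.mk R (HC s) (SymmetricAlgebra R L))
        (HC.gen_mul_gen_mem_deg s v v) (ι_mem_tpow l)⟩

/-- The relations `v² ⊗ l = σ_l(v, v)`. The submodule `L^* = S²E / Ker σ^*` of `HC_2` is spanned by
the squares `v²`, and `v²` corresponds to the functional `l ↦ σ_l(v, v)`, so these relations identify
an element of `HC_{2k} ⊗ L^k` with its image in `HC_{2k+2} ⊗ L^{k+1}` under the multiplication
by the canonical element of `L^* ⊗ L`. -/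
def B0Rel (x y : evenAlg s) : Prop :=
  ∃ (v : E) (l : L), x = sqGen s v l ∧ y = algebraMap R (evenAlg s) (s l v v)

/-- The even part of the Clifford algebra: the direct limit of `HC_{2k} ⊗ L^k`. -/
def B0 : Type u := RingQuot (B0Rel s)

instance : Ring (B0 s) := RingQuot.instRing (R := evenAlg s) (B0Rel s)

instance : Algebra R (B0 s) := RingQuot.instAlgebra (B0Rel s)

/-- The canonical map `⨁ₖ HC_{2k} ⊗ L^k → B0`. -/
def B0.mk : evenAlg s →ₐ[R] B0 s := RingQuot.mkAlgHom R (B0Rel s)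

end Basic

end Algebra

section Map

/-! ### Functoriality of the algebras in the base ring -/

variable {R E L : Type u} [CommRing R] [AddCommGroup E] [Module R E] [AddCommGroup L] [Module R L]
variable {R' E' L' : Type u} [CommRing R'] [AddCommGroup E'] [Module R' E'] [AddCommGroup L']
  [Module R' L']

/-- A change of base ring for trilinear forms. -/
structure FormMap (s : L →ₗ[R] E →ₗ[R] E →ₗ[R] R) (s' : L' →ₗ[R'] E' →ₗ[R'] E' →ₗ[R'] R') where
  φ : R →+* R'
  fE : E →ₛₗ[φ] E'
  fL : L →ₛₗ[φ] L'
  compat : ∀ l v w, s' (fL l) (fE v) (fE w) = φ (s l v w)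
  span_fL : Submodule.span R' (Set.range fL) = ⊤

variable {s : L →ₗ[R] E →ₗ[R] E →ₗ[R] R} {s' : L' →ₗ[R'] E' →ₗ[R'] E' →ₗ[R'] R'}

lemma FormMap.map_mem_quadRel (F : FormMap s s') {t : E ⊗[R] E} (ht : t ∈ quadRel s) :
    TensorProduct.map F.fE F.fE t ∈ quadRel s' := by
  obtain ⟨h1, h2⟩ := Submodule.mem_inf.1 ht
  refine Submodule.mem_inf.2 ⟨?_, ?_⟩
  · have h1' : TensorProduct.comm R E E t = t := sub_eq_zero.1 h1
    have key : ∀ x : E ⊗[R] E, TensorProduct.comm R' E' E' (TensorProduct.map F.fE F.fE x) =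
        TensorProduct.map F.fE F.fE (TensorProduct.comm R E E x) := by
      intro x
      induction x with
      | zero => simp
      | tmul x y => simp
      | add x y hx hy => simp [hx, hy]
    refine sub_eq_zero.2 ?_
    change TensorProduct.comm R' E' E' _ = _
    rw [key, h1']
    rfl
  · rw [Submodule.mem_iInf] at h2 ⊢
    have key : ∀ (l : L) (x : E ⊗[R] E), TensorProduct.lift (s' (F.fL l))
        (TensorProduct.map F.fE F.fE x) = F.φ (TensorProduct.lift (s l) x) := by
      intro l x
      induction x with
      | zero => simp
      | tmul x y => simp [F.compat]
      | add x y hx hy => simp [hx, hy]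
    intro l'
    have hl' : l' ∈ Submodule.span R' (Set.range F.fL) := F.span_fL ▸ Submodule.mem_top
    induction hl' using Submodule.span_induction with
    | mem x hx =>
      obtain ⟨l, rfl⟩ := hx
      rw [LinearMap.mem_ker, key, LinearMap.mem_ker.1 (h2 l), map_zero]
    | zero =>
      have : TensorProduct.lift (s' 0) = 0 := by
        ext; simp
      rw [LinearMap.mem_ker, this, LinearMap.zero_apply]
    | add x y _ _ hx hy =>
      rw [LinearMap.mem_ker] at hx hy ⊢
      have : TensorProduct.lift (s' (x + y)) =
          TensorProduct.lift (s' x) + TensorProduct.lift (s' y) := by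
        ext; simp
      rw [this, LinearMap.add_apply, hx, hy, add_zero]
    | smul r x _ hx =>
      rw [LinearMap.mem_ker] at hx ⊢
      have : TensorProduct.lift (s' (r • x)) = r • TensorProduct.lift (s' x) := by
        ext; simp
      rw [this, LinearMap.smul_apply, hx, smul_zero]

/-- The homomorphism of tensor algebras defining `HC.map`. -/
def HC.mapAux (F : FormMap s s') : TensorAlgebra R E →+* HC s' :=
  letI : Algebra R (HC s') := ((algebraMap R' (HC s')).comp F.φ).toAlgebra'
      fun r x => Algebra.commutes (F.φ r) x
  (TensorAlgebra.lift R
    ({ toFun v := HC.gen s' (F.fE v)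
       map_add' v w := by simp
       map_smul' r v := by
        simp only [LinearMap.map_smulₛₗ, RingHom.id_apply, Algebra.smul_def]
        rfl } : E →ₗ[R] HC s')).toRingHom

lemma HC.mapAux_ι (F : FormMap s s') (v : E) :
    HC.mapAux F (TensorAlgebra.ι R v) = HC.gen s' (F.fE v) := by
  let : Algebra R (HC s') := ((algebraMap R' (HC s')).comp F.φ).toAlgebra'
      fun r x => Algebra.commutes (F.φ r) x
  exact TensorAlgebra.lift_ι_apply _ _

lemma HC.mapAux_algebraMap (F : FormMap s s') (r : R) :
    HC.mapAux F (algebraMap R _ r) = algebraMap R' (HC s') (F.φ r) := by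
  let : Algebra R (HC s') := ((algebraMap R' (HC s')).comp F.φ).toAlgebra'
      fun r x => Algebra.commutes (F.φ r) x
  exact AlgHom.commutes _ _

lemma HC.mapAux_tensorTwo (F : FormMap s s') (t : E ⊗[R] E) :
    HC.mapAux F (tensorTwo R E t) =
      HC.mk s' (tensorTwo R' E' (TensorProduct.map F.fE F.fE t)) := by
  induction t with
  | zero => simp
  | tmul x y => simp [tensorTwo, HC.mapAux_ι, HC.gen]
  | add x y hx hy => simp only [map_add, hx, hy]

/-- The homomorphism of homogeneous Clifford algebras induced by a change of base ring. -/
def HC.map (F : FormMap s s') : HC s →+* HC s' :=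
  RingQuot.lift ⟨HC.mapAux F, by
    rintro _ _ ⟨⟨t, ht, rfl⟩, rfl⟩
    have h := F.map_mem_quadRel ht
    have h2 := RingQuot.mkAlgHom_rel R' (s := HCRel s') ⟨⟨_, h, rfl⟩, rfl⟩
    exact ((HC.mapAux_tensorTwo F t).trans (h2.trans (map_zero _))).trans (map_zero _).symm⟩

lemma HC.mk_eq (x : TensorAlgebra R E) : HC.mk s x = RingQuot.mkRingHom (HCRel s) x :=
  congrArg (fun f : TensorAlgebra R E →+* RingQuot (HCRel s) => f x)
    (RingQuot.mkAlgHom_coe R (HCRel s))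

lemma HC.map_mk (F : FormMap s s') (x : TensorAlgebra R E) :
    HC.map F (HC.mk s x) = HC.mapAux F x := by
  rw [HC.mk_eq]
  exact RingQuot.lift_mkRingHom_apply _ _ _

@[simp]
lemma HC.map_gen (F : FormMap s s') (v : E) : HC.map F (HC.gen s v) = HC.gen s' (F.fE v) :=
  (HC.map_mk F _).trans (HC.mapAux_ι F v)

@[simp]
lemma HC.map_algebraMap (F : FormMap s s') (r : R) :
    HC.map F (algebraMap R (HC s) r) = algebraMap R' (HC s') (F.φ r) := by
  rw [← (HC.mk s).commutes, HC.map_mk, HC.mapAux_algebraMap]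

/-- `HC.map` as a semilinear map. -/
def HC.mapₛₗ (F : FormMap s s') : HC s →ₛₗ[F.φ] HC s' where
  toFun := HC.map F
  map_add' := map_add _
  map_smul' r x := by simp [Algebra.smul_def]

lemma HC.map_mem_deg (F : FormMap s s') {j : ℕ} {b : HC s} (hb : b ∈ HC.deg s j) :
    HC.map F b ∈ HC.deg s' j := by
  induction j generalizing b with
  | zero =>
    rw [HC.deg, pow_zero, Submodule.mem_one] at hb ⊢
    obtain ⟨r, rfl⟩ := hb
    exact ⟨F.φ r, by simp⟩
  | succ j ih =>
    rw [HC.deg, pow_succ] at hb ⊢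
    induction hb using Submodule.mul_induction_on' with
    | mem_mul_mem x hx y hy =>
      obtain ⟨v, rfl⟩ := hy
      rw [map_mul, HC.map_gen]
      exact Submodule.mul_mem_mul (ih hx) ⟨_, rfl⟩
    | add x _ y _ hx hy =>
      rw [map_add]
      exact add_mem hx hy

/-- The homomorphism of symmetric algebras induced by a semilinear map. -/
def symMap {φ : R →+* R'} (f : L →ₛₗ[φ] L') : SymmetricAlgebra R L →+* SymmetricAlgebra R' L' :=
  letI : Algebra R (SymmetricAlgebra R' L') :=
    ((algebraMap R' (SymmetricAlgebra R' L')).comp φ).toAlgebra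
  (SymmetricAlgebra.lift
    ({ toFun l := SymmetricAlgebra.ι R' L' (f l)
       map_add' v w := by simp
       map_smul' r v := by
        simp only [LinearMap.map_smulₛₗ, RingHom.id_apply, Algebra.smul_def]
        rfl } : L →ₗ[R] SymmetricAlgebra R' L')).toRingHom

@[simp]
lemma symMap_ι {φ : R →+* R'} (f : L →ₛₗ[φ] L') (l : L) :
    symMap f (SymmetricAlgebra.ι R L l) = SymmetricAlgebra.ι R' L' (f l) := by
  let : Algebra R (SymmetricAlgebra R' L') :=
    ((algebraMap R' (SymmetricAlgebra R' L')).comp φ).toAlgebra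
  exact SymmetricAlgebra.lift_ι_apply _ _

@[simp]
lemma symMap_algebraMap {φ : R →+* R'} (f : L →ₛₗ[φ] L') (r : R) :
    symMap f (algebraMap R _ r) = algebraMap R' _ (φ r) := by
  let : Algebra R (SymmetricAlgebra R' L') :=
    ((algebraMap R' (SymmetricAlgebra R' L')).comp φ).toAlgebra
  exact AlgHom.commutes _ _

/-- `symMap` as a semilinear map. -/
def symMapₛₗ {φ : R →+* R'} (f : L →ₛₗ[φ] L') :
    SymmetricAlgebra R L →ₛₗ[φ] SymmetricAlgebra R' L' where
  toFun := symMap f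
  map_add' := map_add _
  map_smul' r x := by simp [Algebra.smul_def]

lemma symMap_mem_tpow {φ : R →+* R'} (f : L →ₛₗ[φ] L') {j : ℕ} {b : SymmetricAlgebra R L}
    (hb : b ∈ tpow R L j) : symMap f b ∈ tpow R' L' j := by
  induction j generalizing b with
  | zero =>
    rw [tpow, pow_zero, Submodule.mem_one] at hb ⊢
    obtain ⟨r, rfl⟩ := hb
    exact ⟨φ r, by simp⟩
  | succ j ih =>
    rw [tpow, pow_succ] at hb ⊢
    induction hb using Submodule.mul_induction_on' with
    | mem_mul_mem x hx y hy =>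
      obtain ⟨v, rfl⟩ := hy
      rw [map_mul, symMap_ι]
      exact Submodule.mul_mem_mul (ih hx) ⟨_, rfl⟩
    | add x _ y _ hx hy =>
      rw [map_add]
      exact add_mem hx hy

/-- The semilinear map `HC ⊗ Sym L → HC' ⊗ Sym L'` induced by a change of base ring. -/
def HCL.mapₛₗ (F : FormMap s s') : HCL s →ₛₗ[F.φ] HCL s' :=
  TensorProduct.map (HC.mapₛₗ F) (symMapₛₗ F.fL)

lemma HCL.mapₛₗ_tmul (F : FormMap s s') (b : HC s) (l : SymmetricAlgebra R L) :
    HCL.mapₛₗ F (b ⊗ₜ l) = HC.map F b ⊗ₜ symMap F.fL l := rfl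

lemma HCL.mapₛₗ_mul (F : FormMap s s') (x y : HC s ⊗[R] SymmetricAlgebra R L) :
    HCL.mapₛₗ F (x * y) = HCL.mapₛₗ F x * HCL.mapₛₗ F y := by
  induction x with
  | zero => simp
  | add x y hx hy => simp only [add_mul, map_add, hx, hy]
  | tmul a l =>
    induction y with
    | zero => simp
    | add x y hx hy => simp only [mul_add, map_add, hx, hy]
    | tmul b m =>
      rw [Algebra.TensorProduct.tmul_mul_tmul, HCL.mapₛₗ_tmul, HCL.mapₛₗ_tmul, HCL.mapₛₗ_tmul,
        Algebra.TensorProduct.tmul_mul_tmul, map_mul, map_mul]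

/-- The homomorphism `HC ⊗ Sym L → HC' ⊗ Sym L'` induced by a change of base ring. -/
def HCL.map (F : FormMap s s') : HCL s →+* HCL s' :=
  { (HCL.mapₛₗ F).toAddMonoidHom with
    map_one' := by
      change HC.map F 1 ⊗ₜ symMap F.fL 1 = _
      rw [map_one, map_one]
      rfl
    map_mul' := HCL.mapₛₗ_mul F }

@[simp]
lemma HCL.map_tmul (F : FormMap s s') (b : HC s) (l : SymmetricAlgebra R L) :
    HCL.map F (b ⊗ₜ l) = HC.map F b ⊗ₜ symMap F.fL l := rfl

@[simp]
lemma HCL.map_algebraMap (F : FormMap s s') (r : R) :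
    HCL.map F (algebraMap R _ r) = algebraMap R' _ (F.φ r) := by
  rw [Algebra.TensorProduct.algebraMap_apply, HCL.map_tmul, HC.map_algebraMap, map_one,
    Algebra.TensorProduct.algebraMap_apply]

lemma HCL.map_mem_evenAlg (F : FormMap s s') {x : HCL s} (hx : x ∈ evenAlg s) :
    HCL.map F x ∈ evenAlg s' := by
  change x ∈ ⨆ k, evenPiece s k at hx
  change HCL.map F x ∈ ⨆ k, evenPiece s' k
  induction hx using Submodule.iSup_induction' with
  | zero => simp
  | add x y _ _ hx hy => rw [map_add]; exact add_mem hx hy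
  | mem k x hx =>
    refine Submodule.mem_iSup_of_mem k ?_
    rw [evenPiece, Submodule.map₂_eq_span_image2] at hx
    induction hx using Submodule.span_induction with
    | zero => simp
    | add x y _ _ hx hy => rw [map_add]; exact add_mem hx hy
    | smul r x _ hx =>
      change HCL.mapₛₗ F (r • x) ∈ _
      rw [LinearMap.map_smulₛₗ]
      exact Submodule.smul_mem _ _ hx
    | mem x hx =>
      obtain ⟨b, hb, l, hl, rfl⟩ := hx
      exact Submodule.apply_mem_map₂ (TensorProduct.mk R' (HC s') (SymmetricAlgebra R' L'))
        (HC.map_mem_deg F hb) (symMap_mem_tpow F.fL hl)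

/-- The homomorphism `⨁ HC_{2k} ⊗ L^k → ⨁ HC'_{2k} ⊗ L'^k` induced by a change of base ring. -/
def evenAlgMap (F : FormMap s s') : evenAlg s →+* evenAlg s' :=
  (HCL.map F).restrict (evenAlg s) (evenAlg s') fun _ hx => HCL.map_mem_evenAlg F hx

lemma evenAlgMap_sqGen (F : FormMap s s') (v : E) (l : L) :
    evenAlgMap F (sqGen s v l) = sqGen s' (F.fE v) (F.fL l) :=
  Subtype.ext <| by
    change HCL.map F ((HC.gen s v * HC.gen s v) ⊗ₜ SymmetricAlgebra.ι R L l) =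
      (HC.gen s' (F.fE v) * HC.gen s' (F.fE v)) ⊗ₜ SymmetricAlgebra.ι R' L' (F.fL l)
    simp

lemma evenAlgMap_algebraMap (F : FormMap s s') (r : R) :
    evenAlgMap F (algebraMap R _ r) = algebraMap R' _ (F.φ r) :=
  Subtype.ext <| HCL.map_algebraMap F r

lemma B0.mk_eq (x : evenAlg s) : B0.mk s x = RingQuot.mkRingHom (B0Rel s) x :=
  congrArg (fun f : evenAlg s →+* RingQuot (B0Rel s) => f x)
    (RingQuot.mkAlgHom_coe R (B0Rel s))

lemma B0.mk_surjective : Function.Surjective (B0.mk s) :=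
  RingQuot.mkAlgHom_surjective R (B0Rel s)

lemma B0.mk_rel (v : E) (l : L) : B0.mk s (sqGen s v l) = algebraMap R (B0 s) (s l v v) :=
  (RingQuot.mkAlgHom_rel R (s := B0Rel s) ⟨v, l, rfl, rfl⟩).trans ((B0.mk s).commutes _)

/-- The homomorphism of even Clifford algebras induced by a change of base ring. -/
def B0.map (F : FormMap s s') : B0 s →+* B0 s' :=
  RingQuot.lift (R := evenAlg s) ⟨((B0.mk s' : evenAlg s' →+* B0 s')).comp (evenAlgMap F), by
    rintro _ _ ⟨v, l, rfl, rfl⟩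
    change B0.mk s' _ = B0.mk s' _
    rw [evenAlgMap_sqGen, evenAlgMap_algebraMap, B0.mk_rel, F.compat, (B0.mk s').commutes]⟩

lemma B0.map_mk (F : FormMap s s') (x : evenAlg s) :
    B0.map F (B0.mk s x) = B0.mk s' (evenAlgMap F x) := by
  rw [B0.mk_eq]
  exact RingQuot.lift_mkRingHom_apply _ _ _

end Map
section Modules

/-! ### Graded modules and the direct limit `lim M_{2k} ⊗ L^k` over a fixed base ring -/

variable {R E L : Type u} [CommRing R] [AddCommGroup E] [Module R E] [AddCommGroup L] [Module R L]

/-- A `ℤ`-graded right module over the homogeneous Clifford algebra. -/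
structure GrModule (s : L →ₗ[R] E →ₗ[R] E →ₗ[R] R) where
  carrier : Type u
  [addCommGroup : AddCommGroup carrier]
  [module : Module R carrier]
  [rightModule : Module (HC s)ᵐᵒᵖ carrier]
  [isScalarTower : IsScalarTower R (HC s)ᵐᵒᵖ carrier]
  grade : ℤ → Submodule R carrier
  isInternal : DirectSum.IsInternal grade
  act_mem : ∀ {k : ℤ} {j : ℕ} {m : carrier} {b : HC s}, m ∈ grade k → b ∈ HC.deg s j →
    MulOpposite.op b • m ∈ grade (k + j)

attribute [instance] GrModule.addCommGroup GrModule.module GrModule.rightModule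
  GrModule.isScalarTower

instance {s : L →ₗ[R] E →ₗ[R] E →ₗ[R] R} : CoeSort (GrModule s) (Type u) := ⟨GrModule.carrier⟩

/-- The shift `M⟨j⟩`, with `M⟨j⟩_k = M_{k+j}`. -/
def GrModule.shift {s : L →ₗ[R] E →ₗ[R] E →ₗ[R] R} (M : GrModule s) (j : ℤ) : GrModule s where
  carrier := M
  grade k := M.grade (k + j)
  isInternal := by
    have h := M.isInternal
    rw [DirectSum.isInternal_submodule_iff_iSupIndep_and_iSup_eq_top] at h ⊢
    refine ⟨h.1.comp (add_left_injective j), ?_⟩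
    rw [← h.2]
    exact (Equiv.addRight j).surjective.iSup_comp M.grade
  act_mem := by
    intro k i m b hm hb
    have := M.act_mem hm hb
    rwa [add_right_comm] at this

variable {s : L →ₗ[R] E →ₗ[R] E →ₗ[R] R} (M : GrModule s)

/-- The right action of `HC ⊗ Sym L` on `M ⊗ Sym L`. -/
def actL : HCL s →ₗ[R] Module.End R (M ⊗[R] SymmetricAlgebra R L) :=
  TensorProduct.lift <| LinearMap.mk₂ R
    (fun b l => TensorProduct.map (Algebra.lsmul R R M (MulOpposite.op b)) (LinearMap.mulRight R l))
    (fun b c l => by ext; simp [TensorProduct.add_tmul])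
    (fun r b l => by ext; simp [TensorProduct.smul_tmul'])
    (fun b l m => by ext; simp [mul_add, TensorProduct.tmul_add])
    (fun r b l => by ext; simp)

@[simp]
lemma actL_tmul (b : HC s) (l : SymmetricAlgebra R L) (m : M) (x : SymmetricAlgebra R L) :
    actL M (b ⊗ₜ l) (m ⊗ₜ x) = (MulOpposite.op b • m) ⊗ₜ (x * l) := rfl

lemma actL_mul (a b : HC s ⊗[R] SymmetricAlgebra R L) (x : M ⊗[R] SymmetricAlgebra R L) :
    actL M (a * b) x = actL M b (actL M a x) := by
  induction x with
  | zero => simp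
  | add x y hx hy => simp only [map_add, hx, hy]
  | tmul m z =>
    induction a with
    | zero => simp
    | add x y hx hy => simp only [add_mul, map_add, LinearMap.add_apply, hx, hy]
    | tmul a l =>
      induction b with
      | zero => simp
      | add x y hx hy => simp only [mul_add, map_add, LinearMap.add_apply, hx, hy]
      | tmul b k =>
        rw [Algebra.TensorProduct.tmul_mul_tmul, actL_tmul, actL_tmul, actL_tmul,
          MulOpposite.op_mul, mul_smul, mul_assoc]

lemma actL_algebraMap (r : R) (x : M ⊗[R] SymmetricAlgebra R L) :
    actL M (algebraMap R (HCL s) r) x = r • x := by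
  induction x with
  | zero => simp
  | add x y hx hy => rw [map_add, hx, hy, smul_add]
  | tmul m z =>
    rw [Algebra.TensorProduct.algebraMap_apply, actL_tmul, mul_one, TensorProduct.smul_tmul',
      ← MulOpposite.algebraMap_apply, algebraMap_smul]

/-- The submodule `⨁ₖ M_{2k} ⊗ L^k` of `M ⊗ Sym L`, where `k ≥ 0`. -/
def colimSrc : Submodule R (M ⊗[R] SymmetricAlgebra R L) :=
  ⨆ k : ℕ, Submodule.map₂ (TensorProduct.mk R M (SymmetricAlgebra R L)) (M.grade (2 * k))
    (tpow R L k)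

lemma tmul_mem_colimSrc (k : ℕ) {m : M} (hm : m ∈ M.grade (2 * k)) {l : SymmetricAlgebra R L}
    (hl : l ∈ tpow R L k) : m ⊗ₜ[R] l ∈ colimSrc M :=
  Submodule.mem_iSup_of_mem k
    (Submodule.apply_mem_map₂ (TensorProduct.mk R M (SymmetricAlgebra R L)) hm hl)

lemma map₂_induction {A B C : Type u} [AddCommGroup A] [Module R A] [AddCommGroup B] [Module R B]
    [AddCommGroup C] [Module R C] {f : A →ₗ[R] B →ₗ[R] C} {U : Submodule R A} {V : Submodule R B}
    {p : C → Prop} (zero : p 0) (add : ∀ x y, p x → p y → p (x + y))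
    (apply : ∀ a ∈ U, ∀ b ∈ V, p (f a b)) {x : C} (hx : x ∈ Submodule.map₂ f U V) : p x := by
  rw [Submodule.map₂_eq_span_image2] at hx
  suffices h : ∀ r : R, p (r • x) by simpa using h 1
  induction hx using Submodule.span_induction with
  | zero => simpa using zero
  | add x y _ _ hx hy => exact fun r => by rw [smul_add]; exact add _ _ (hx r) (hy r)
  | smul c x _ hx => exact fun r => by rw [smul_smul]; exact hx _
  | mem x hx =>
    obtain ⟨a, ha, b, hb, rfl⟩ := hx
    intro r
    have := apply (r • a) (U.smul_mem r ha) b hb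
    rwa [map_smul, LinearMap.smul_apply] at this

lemma colimSrc_induction {p : M ⊗[R] SymmetricAlgebra R L → Prop} (zero : p 0)
    (add : ∀ x y, p x → p y → p (x + y))
    (tmul : ∀ (k : ℕ) (m : M) (l : SymmetricAlgebra R L), m ∈ M.grade (2 * k) → l ∈ tpow R L k →
      p (m ⊗ₜ l)) {x : M ⊗[R] SymmetricAlgebra R L} (hx : x ∈ colimSrc M) : p x := by
  unfold colimSrc at hx
  induction hx using Submodule.iSup_induction' with
  | zero => exact zero
  | add x y _ _ hx hy => exact add x y hx hy
  | mem k x hx => exact map₂_induction zero add (fun m hm l hl => tmul k m l hm hl) hx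

lemma evenAlg_induction {p : HCL s → Prop} (zero : p 0) (add : ∀ x y, p x → p y → p (x + y))
    (tmul : ∀ (k : ℕ) (b : HC s) (l : SymmetricAlgebra R L), b ∈ HC.deg s (2 * k) →
      l ∈ tpow R L k → p (b ⊗ₜ l)) {x : HCL s} (hx : x ∈ evenAlg s) : p x := by
  change x ∈ ⨆ k, evenPiece s k at hx
  induction hx using Submodule.iSup_induction' with
  | zero => exact zero
  | add x y _ _ hx hy => exact add x y hx hy
  | mem k x hx => exact map₂_induction zero add (fun m hm l hl => tmul k m l hm hl) hx

lemma actL_mem_colimSrc {a : HCL s} (ha : a ∈ evenAlg s) {x : M ⊗[R] SymmetricAlgebra R L}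
    (hx : x ∈ colimSrc M) : actL M a x ∈ colimSrc M := by
  refine evenAlg_induction (p := fun a => actL M a x ∈ colimSrc M) ?_ ?_ ?_ ha
  · simp
  · intro x y hx hy
    rw [map_add]; exact add_mem hx hy
  · intro j b l hb hl
    refine colimSrc_induction M (p := fun x => actL M (b ⊗ₜ l) x ∈ colimSrc M) ?_ ?_ ?_ hx
    · simp
    · intro x y hx hy
      rw [map_add]; exact add_mem hx hy
    · intro k m z hm hz
      rw [actL_tmul]
      refine tmul_mem_colimSrc M (k + j) ?_ ?_
      · have := M.act_mem hm hb
        push_cast at this ⊢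
        rwa [mul_add]
      · rw [tpow, pow_add]
        exact Submodule.mul_mem_mul hz hl

/-- The submodule of `⨁ₖ M_{2k} ⊗ L^k` (closed under the right action of `⨁ₖ HC_{2k} ⊗ L^k`)
generated by the elements `x · (v² ⊗ l) - σ_l(v, v) x`. For `x = m ⊗ l'` in `M_{2k} ⊗ L^k` this is
`m v² ⊗ l' l - σ_l(v, v) m ⊗ l'`: it identifies `x` with its image under the transition
map `M_{2k} ⊗ L^k = M_{2k} ⊗ L^* ⊗ L^{k+1} → M_{2k+2} ⊗ L^{k+1}` given by the action of the
submodule `L^* ⊆ HC_2`, which is spanned by the squares `v² = (l ↦ σ_l(v, v))`. -/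
def colimRel : Submodule R (M ⊗[R] SymmetricAlgebra R L) :=
  Submodule.span R {y | ∃ x ∈ colimSrc M, ∃ (v : E) (l : L), ∃ a ∈ evenAlg s,
    actL M a (actL M (sqGen s v l : HCL s) x - s l v v • x) = y}

/-- The direct limit of the modules `M_{2k} ⊗ L^k`, `k ≥ 0`. -/
def DirLim : Type u := colimSrc M ⧸ (colimRel M).submoduleOf (colimSrc M)

instance : AddCommGroup (DirLim M) :=
  inferInstanceAs (AddCommGroup (colimSrc M ⧸ (colimRel M).submoduleOf (colimSrc M)))

instance : Module R (DirLim M) :=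
  inferInstanceAs (Module R (colimSrc M ⧸ (colimRel M).submoduleOf (colimSrc M)))

/-- The quotient map `⨁ₖ M_{2k} ⊗ L^k → lim M_{2k} ⊗ L^k`. -/
def DirLim.proj : colimSrc M →ₗ[R] DirLim M :=
  ((colimRel M).submoduleOf (colimSrc M)).mkQ

/-- The class of `m ⊗ l ∈ M_{2k} ⊗ L^k` in the direct limit. -/
def DirLim.mk (k : ℕ) (m : M) (hm : m ∈ M.grade (2 * k)) (l : SymmetricAlgebra R L)
    (hl : l ∈ tpow R L k) : DirLim M :=
  DirLim.proj M ⟨m ⊗ₜ l, tmul_mem_colimSrc M k hm hl⟩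

variable {M} in
lemma DirLim.induction {p : DirLim M → Prop} (zero : p 0) (add : ∀ x y, p x → p y → p (x + y))
    (mk : ∀ k m hm l hl, p (DirLim.mk M k m hm l hl)) (x : DirLim M) : p x := by
  obtain ⟨⟨x, hx⟩, rfl⟩ := Submodule.mkQ_surjective _ x
  change p (DirLim.proj M ⟨x, hx⟩)
  have : ∀ h : x ∈ colimSrc M, p (DirLim.proj M ⟨x, h⟩) := by
    suffices h : x ∈ colimSrc M ∧ ∀ h : x ∈ colimSrc M, p (DirLim.proj M ⟨x, h⟩) from h.2
    refine colimSrc_induction M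
      (p := fun x => x ∈ colimSrc M ∧ ∀ h : x ∈ colimSrc M, p (DirLim.proj M ⟨x, h⟩)) ?_ ?_ ?_ hx
    · refine ⟨zero_mem _, fun h => ?_⟩
      have : (⟨0, h⟩ : colimSrc M) = 0 := rfl
      rw [this, map_zero]
      exact zero
    · intro x y hx hy
      refine ⟨add_mem hx.1 hy.1, fun h => ?_⟩
      have : (⟨x + y, h⟩ : colimSrc M) = ⟨x, hx.1⟩ + ⟨y, hy.1⟩ := rfl
      rw [this, map_add]
      exact add _ _ (hx.2 _) (hy.2 _)
    · exact fun k m l hm hl => ⟨tmul_mem_colimSrc M k hm hl, fun _ => mk k m hm l hl⟩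
  exact this hx

/-- The action of `a ∈ ⨁ₖ HC_{2k} ⊗ L^k` on the direct limit. -/
def DirLim.actEven (a : evenAlg s) : Module.End R (DirLim M) :=
  Submodule.mapQ _ _
    ((actL M (a : HCL s)).restrict fun _ hx => actL_mem_colimSrc M a.2 hx) (by
      rintro ⟨x, hx'⟩ hx
      change x ∈ colimRel M at hx
      change actL M (a : HCL s) x ∈ colimRel M
      clear hx'
      rw [colimRel] at hx
      induction hx using Submodule.span_induction with
      | zero => simp
      | add x y _ _ hx hy => rw [map_add]; exact add_mem hx hy
      | smul r x _ hx => rw [map_smul]; exact Submodule.smul_mem _ _ hx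
      | mem y hy =>
        obtain ⟨x, hx, v, l, b, hb, rfl⟩ := hy
        rw [← actL_mul]
        exact Submodule.subset_span ⟨x, hx, v, l, _, mul_mem hb a.2, rfl⟩)

lemma DirLim.actEven_proj (a : evenAlg s) (x : colimSrc M) :
    DirLim.actEven M a (DirLim.proj M x) =
      DirLim.proj M ⟨actL M (a : HCL s) x, actL_mem_colimSrc M a.2 x.2⟩ := rfl

/-- The action of `⨁ₖ HC_{2k} ⊗ L^k` on the direct limit. -/
def DirLim.actEvenHom : evenAlg s →ₐ[R] (Module.End R (DirLim M))ᵐᵒᵖ where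
  toFun a := MulOpposite.op (DirLim.actEven M a)
  map_one' := by
    refine congrArg MulOpposite.op (LinearMap.ext fun x => ?_)
    obtain ⟨x, rfl⟩ := Submodule.mkQ_surjective _ x
    refine congrArg (DirLim.proj M) (Subtype.ext ?_)
    have := actL_algebraMap M 1 (x : M ⊗[R] SymmetricAlgebra R L)
    rwa [map_one, one_smul] at this
  map_mul' a b := by
    refine congrArg MulOpposite.op (LinearMap.ext fun x => ?_)
    obtain ⟨x, rfl⟩ := Submodule.mkQ_surjective _ x
    exact congrArg (DirLim.proj M) (Subtype.ext (actL_mul M _ _ _))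
  map_zero' := by
    refine congrArg MulOpposite.op (LinearMap.ext fun x => ?_)
    obtain ⟨x, rfl⟩ := Submodule.mkQ_surjective _ x
    refine (congrArg (DirLim.proj M) (a₂ := 0) (Subtype.ext ?_)).trans (map_zero (DirLim.proj M))
    change actL M 0 (x : M ⊗[R] SymmetricAlgebra R L) = 0
    rw [map_zero, LinearMap.zero_apply]
  map_add' a b := by
    refine congrArg MulOpposite.op (LinearMap.ext fun x => ?_)
    obtain ⟨x, rfl⟩ := Submodule.mkQ_surjective _ x
    refine (congrArg (DirLim.proj M) (Subtype.ext ?_)).trans (map_add (DirLim.proj M)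
      ⟨actL M (a : HCL s) x, actL_mem_colimSrc M a.2 x.2⟩
      ⟨actL M (b : HCL s) x, actL_mem_colimSrc M b.2 x.2⟩)
    change actL M (a + b) (x : M ⊗[R] SymmetricAlgebra R L) = _
    rw [map_add, LinearMap.add_apply]
    rfl
  commutes' r := by
    refine congrArg MulOpposite.op (LinearMap.ext fun x => ?_)
    obtain ⟨x, rfl⟩ := Submodule.mkQ_surjective _ x
    exact (congrArg (DirLim.proj M) (Subtype.ext (actL_algebraMap M r _))).trans
      (map_smul (DirLim.proj M) r x)

/-- The action of `B0` on the direct limit. -/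
def DirLim.actB0 : B0 s →ₐ[R] (Module.End R (DirLim M))ᵐᵒᵖ :=
  RingQuot.liftAlgHom R (A := evenAlg s) ⟨DirLim.actEvenHom M, by
    rintro _ _ ⟨v, l, rfl, rfl⟩
    rw [AlgHom.commutes]
    refine congrArg MulOpposite.op (LinearMap.ext fun x => ?_)
    obtain ⟨⟨x, hx⟩, rfl⟩ := Submodule.mkQ_surjective _ x
    refine (Submodule.Quotient.eq _).2 ?_
    change actL M (sqGen s v l : HCL s) x - s l v v • x ∈ colimRel M
    refine Submodule.subset_span ⟨x, hx, v, l, 1, one_mem _, ?_⟩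
    have := actL_algebraMap M 1 (actL M (sqGen s v l : HCL s) x - s l v v • x)
    rwa [map_one, one_smul] at this⟩

lemma DirLim.actB0_mk (a : evenAlg s) :
    DirLim.actB0 M (B0.mk s a) = DirLim.actEvenHom M a :=
  RingQuot.liftAlgHom_mkAlgHom_apply R _ _ _

/-- The right `B0`-module structure on the direct limit. -/
instance : Module (B0 s)ᵐᵒᵖ (DirLim M) where
  smul b x := (DirLim.actB0 M b.unop).unop x
  one_smul x := by
    change (DirLim.actB0 M 1).unop x = x
    rw [map_one]; rfl
  mul_smul a b x := by
    change (DirLim.actB0 M (b.unop * a.unop)).unop x = _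
    rw [map_mul]; rfl
  smul_zero b := map_zero _
  smul_add b x y := map_add _ x y
  add_smul a b x := by
    change (DirLim.actB0 M (a.unop + b.unop)).unop x = _
    rw [map_add]; rfl
  zero_smul x := by
    change (DirLim.actB0 M 0).unop x = _
    rw [map_zero]; rfl

lemma DirLim.op_mk_smul (a : evenAlg s) (x : DirLim M) :
    MulOpposite.op (B0.mk s a) • x = DirLim.actEven M a x := by
  change (DirLim.actB0 M (B0.mk s a)).unop x = _
  rw [DirLim.actB0_mk]
  rfl

instance : IsScalarTower R (B0 s)ᵐᵒᵖ (DirLim M) where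
  smul_assoc r b x := by
    change (DirLim.actB0 M (r • b.unop)).unop x = r • (DirLim.actB0 M b.unop).unop x
    rw [map_smul]; rfl

end Modules

section ModuleMap

variable {R E L : Type u} [CommRing R] [AddCommGroup E] [Module R E] [AddCommGroup L] [Module R L]
variable {R' E' L' : Type u} [CommRing R'] [AddCommGroup E'] [Module R' E'] [AddCommGroup L']
  [Module R' L']
variable {s : L →ₗ[R] E →ₗ[R] E →ₗ[R] R} {s' : L' →ₗ[R'] E' →ₗ[R'] E' →ₗ[R'] R'}

/-- A degree preserving map of graded modules compatible with a change of base ring. -/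
structure GrMap (F : FormMap s s') (M : GrModule s) (M' : GrModule s') where
  toFun : M →ₛₗ[F.φ] M'
  map_act : ∀ (b : HC s) (m : M),
    toFun (MulOpposite.op b • m) = MulOpposite.op (HC.map F b) • toFun m
  map_grade : ∀ {k : ℤ} {m : M}, m ∈ M.grade k → toFun m ∈ M'.grade k

variable {F : FormMap s s'} {M : GrModule s} {M' : GrModule s'} (g : GrMap F M M')

/-- The induced map `M ⊗ Sym L → M' ⊗ Sym L'`. -/
def GrMap.tensor : M ⊗[R] SymmetricAlgebra R L →ₛₗ[F.φ] M' ⊗[R'] SymmetricAlgebra R' L' :=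
  TensorProduct.map g.toFun (symMapₛₗ F.fL)

lemma GrMap.tensor_tmul (m : M) (l : SymmetricAlgebra R L) :
    g.tensor (m ⊗ₜ l) = g.toFun m ⊗ₜ symMap F.fL l := rfl

lemma GrMap.tensor_actL (a : HC s ⊗[R] SymmetricAlgebra R L) (x : M ⊗[R] SymmetricAlgebra R L) :
    g.tensor (actL M a x) = actL M' (HCL.map F a) (g.tensor x) := by
  induction x with
  | zero => simp
  | add x y hx hy => simp only [map_add, hx, hy]
  | tmul m z =>
    induction a with
    | zero => simp
    | add x y hx hy => simp only [map_add, LinearMap.add_apply, hx, hy]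
    | tmul b l => simp [GrMap.tensor_tmul, g.map_act]

lemma GrMap.tensor_mem_colimSrc {x : M ⊗[R] SymmetricAlgebra R L} (hx : x ∈ colimSrc M) :
    g.tensor x ∈ colimSrc M' := by
  refine colimSrc_induction M (p := fun x => g.tensor x ∈ colimSrc M') ?_ ?_ ?_ hx
  · simp
  · intro x y hx hy
    rw [map_add]; exact add_mem hx hy
  · intro k m l hm hl
    exact tmul_mem_colimSrc M' k (g.map_grade hm) (symMap_mem_tpow F.fL hl)

lemma GrMap.tensor_mem_colimRel {x : M ⊗[R] SymmetricAlgebra R L} (hx : x ∈ colimRel M) :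
    g.tensor x ∈ colimRel M' := by
  rw [colimRel] at hx
  induction hx using Submodule.span_induction with
  | zero => simp
  | add x y _ _ hx hy => rw [map_add]; exact add_mem hx hy
  | smul r x _ hx => rw [LinearMap.map_smulₛₗ]; exact Submodule.smul_mem _ _ hx
  | mem y hy =>
    obtain ⟨x, hx, v, l, a, ha, rfl⟩ := hy
    refine Submodule.subset_span ⟨g.tensor x, g.tensor_mem_colimSrc hx, F.fE v, F.fL l,
      HCL.map F a, HCL.map_mem_evenAlg F ha, ?_⟩
    rw [g.tensor_actL, map_sub g.tensor, g.tensor_actL, LinearMap.map_smulₛₗ, F.compat,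
      ← evenAlgMap_sqGen]
    rfl

/-- The map of direct limits induced by a map of graded modules. -/
def DirLim.map : DirLim M →ₛₗ[F.φ] DirLim M' :=
  Submodule.mapQ _ _
    ((g.tensor.comp (colimSrc M).subtype).codRestrict (colimSrc M')
      fun x => g.tensor_mem_colimSrc x.2)
    (by
      rintro ⟨x, hx'⟩ hx
      exact g.tensor_mem_colimRel (M := M) hx)

lemma DirLim.map_proj (x : colimSrc M) :
    DirLim.map g (DirLim.proj M x) = DirLim.proj M' ⟨g.tensor x, g.tensor_mem_colimSrc x.2⟩ := rfl

@[simp]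
lemma DirLim.map_mk (k : ℕ) (m : M) (hm : m ∈ M.grade (2 * k)) (l : SymmetricAlgebra R L)
    (hl : l ∈ tpow R L k) : DirLim.map g (DirLim.mk M k m hm l hl) =
      DirLim.mk M' k (g.toFun m) (g.map_grade hm) (symMap F.fL l) (symMap_mem_tpow F.fL hl) := rfl

lemma DirLim.map_act (b : B0 s) (x : DirLim M) :
    DirLim.map g (MulOpposite.op b • x) = MulOpposite.op (B0.map F b) • DirLim.map g x := by
  obtain ⟨a, rfl⟩ := B0.mk_surjective b
  obtain ⟨x, rfl⟩ := Submodule.mkQ_surjective _ x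
  change DirLim.map g (MulOpposite.op (B0.mk s a) • DirLim.proj M x) =
    MulOpposite.op (B0.map F (B0.mk s a)) • DirLim.map g (DirLim.proj M x)
  rw [DirLim.op_mk_smul, B0.map_mk, DirLim.op_mk_smul, DirLim.actEven_proj, DirLim.map_proj,
    DirLim.map_proj, DirLim.actEven_proj]
  exact congrArg (DirLim.proj M') (Subtype.ext (g.tensor_actL _ _))

/-- The identity change of base ring. -/
def FormMap.id (s : L →ₗ[R] E →ₗ[R] E →ₗ[R] R) : FormMap s s where
  φ := RingHom.id R
  fE := LinearMap.id
  fL := LinearMap.id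
  compat _ _ _ := rfl
  span_fL := by simp

end ModuleMap
section Aux

variable {R E L : Type u} [CommRing R] [AddCommGroup E] [Module R E] [AddCommGroup L] [Module R L]
variable {R' E' L' : Type u} [CommRing R'] [AddCommGroup E'] [Module R' E'] [AddCommGroup L']
  [Module R' L']
variable {s : L →ₗ[R] E →ₗ[R] E →ₗ[R] R} {s' : L' →ₗ[R'] E' →ₗ[R'] E' →ₗ[R'] R'}

/-- A semilinear map `f : M → M'` over `φ : R → R'` induces an isomorphism
`R' ⊗ M ≅ M'`. -/
def IsExtensionOfScalars {M M' : Type u} [AddCommGroup M] [Module R M] [AddCommGroup M']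
    [Module R' M'] (φ : R →+* R') (f : M →ₛₗ[φ] M') : Prop :=
  letI : Algebra R R' := φ.toAlgebra
  letI : Module R M' := Module.compHom M' φ
  letI : IsScalarTower R R' M' := ⟨fun r x m => mul_smul (φ r) x m⟩
  IsBaseChange R' ({ toFun := f, map_add' := f.map_add, map_smul' := f.map_smulₛₗ } : M →ₗ[R] M')

lemma IsExtensionOfScalars.span_range {M M' : Type u} [AddCommGroup M] [Module R M]
    [AddCommGroup M'] [Module R' M'] {φ : R →+* R'} {f : M →ₛₗ[φ] M'}
    (h : IsExtensionOfScalars φ f) : Submodule.span R' (Set.range f) = ⊤ := by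
  let : Algebra R R' := φ.toAlgebra
  let : Module R M' := Module.compHom M' φ
  have : IsScalarTower R R' M' := ⟨fun r x m => mul_smul (φ r) x m⟩
  have h' : IsBaseChange R'
    ({ toFun := f, map_add' := f.map_add, map_smul' := f.map_smulₛₗ } : M →ₗ[R] M') := h
  refine eq_top_iff.2 fun x _ => ?_
  induction x using h'.inductionOn with
  | zero => exact zero_mem _
  | tmul m => exact Submodule.subset_span ⟨m, rfl⟩
  | smul r x hx => exact Submodule.smul_mem _ _ (hx trivial)
  | add x y hx hy => exact add_mem (hx trivial) (hy trivial)

/-- The functional on `M'` induced by a functional on `M`, when `M' = R' ⊗ M`. -/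
def IsExtensionOfScalars.dualMap {M M' : Type u} [AddCommGroup M] [Module R M]
    [AddCommGroup M'] [Module R' M'] {φ : R →+* R'} {f : M →ₛₗ[φ] M'}
    (h : IsExtensionOfScalars φ f) (a : Module.Dual R M) : Module.Dual R' M' :=
  letI : Algebra R R' := φ.toAlgebra
  letI : Module R M' := Module.compHom M' φ
  letI : IsScalarTower R R' M' := ⟨fun r x m => mul_smul (φ r) x m⟩
  IsBaseChange.lift (h : IsBaseChange R'
    ({ toFun := f, map_add' := f.map_add, map_smul' := f.map_smulₛₗ } : M →ₗ[R] M'))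
    ((Algebra.linearMap R R').comp a)

@[simp]
lemma IsExtensionOfScalars.dualMap_apply {M M' : Type u} [AddCommGroup M] [Module R M]
    [AddCommGroup M'] [Module R' M'] {φ : R →+* R'} {f : M →ₛₗ[φ] M'}
    (h : IsExtensionOfScalars φ f) (a : Module.Dual R M) (m : M) :
    h.dualMap a (f m) = φ (a m) := by
  let : Algebra R R' := φ.toAlgebra
  let : Module R M' := Module.compHom M' φ
  have : IsScalarTower R R' M' := ⟨fun r x m => mul_smul (φ r) x m⟩
  exact IsBaseChange.lift_eq (h : IsBaseChange R'
    ({ toFun := f, map_add' := f.map_add, map_smul' := f.map_smulₛₗ } : M →ₗ[R] M')) _ m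

lemma IsExtensionOfScalars.dual_ext {M M' : Type u} [AddCommGroup M] [Module R M]
    [AddCommGroup M'] [Module R' M'] {φ : R →+* R'} {f : M →ₛₗ[φ] M'}
    (h : IsExtensionOfScalars φ f) {a b : Module.Dual R' M'} (hab : ∀ m, a (f m) = b (f m)) :
    a = b :=
  LinearMap.ext_on h.span_range <| by
    rintro _ ⟨m, rfl⟩
    exact hab m

lemma symMap_eq_self {φ : R →+* R} (f : L →ₛₗ[φ] L) (hφ : ∀ r, φ r = r) (hf : ∀ l, f l = l)
    (x : SymmetricAlgebra R L) : symMap f x = x := by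
  induction x using SymmetricAlgebra.induction with
  | algebraMap r => rw [symMap_algebraMap, hφ]
  | ι l => rw [symMap_ι, hf]
  | mul a b ha hb => rw [map_mul, ha, hb]
  | add a b ha hb => rw [map_add, ha, hb]

lemma symMap_comp {R'' L'' : Type u} [CommRing R''] [AddCommGroup L''] [Module R'' L'']
    {φ : R →+* R'} {ψ : R' →+* R''} {χ : R →+* R''} (f : L →ₛₗ[φ] L') (g : L' →ₛₗ[ψ] L'')
    (h : L →ₛₗ[χ] L'') (hφ : ∀ r, ψ (φ r) = χ r) (hf : ∀ l, g (f l) = h l)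
    (x : SymmetricAlgebra R L) : symMap g (symMap f x) = symMap h x := by
  induction x using SymmetricAlgebra.induction with
  | algebraMap r => simp only [symMap_algebraMap, hφ]
  | ι l => simp only [symMap_ι, hf]
  | mul a b ha hb => simp only [map_mul, ha, hb]
  | add a b ha hb => simp only [map_add, ha, hb]

lemma HC.map_id_apply (b : HC s) : HC.map (FormMap.id s) b = b := by
  obtain ⟨x, rfl⟩ := RingQuot.mkAlgHom_surjective R (HCRel s) b
  change HC.map (FormMap.id s) (HC.mk s x) = HC.mk s x
  induction x using TensorAlgebra.induction with
  | algebraMap r =>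
    rw [AlgHom.commutes, HC.map_algebraMap]
    rfl
  | ι v => exact HC.map_gen _ v
  | mul a b ha hb => rw [map_mul, map_mul, ha, hb]
  | add a b ha hb => rw [map_add, map_add, ha, hb]

lemma B0.map_id_apply (b : B0 s) : B0.map (FormMap.id s) b = b := by
  obtain ⟨⟨a, ha⟩, rfl⟩ := B0.mk_surjective b
  rw [B0.map_mk]
  refine congrArg (B0.mk s) (Subtype.ext ?_)
  change HCL.map (FormMap.id s) a = a
  refine evenAlg_induction (p := fun a => HCL.map (FormMap.id s) a = a) (map_zero _) ?_ ?_ ha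
  · intro x y hx hy
    rw [map_add, hx, hy]
  · intro k b l _ _
    rw [HCL.map_tmul, HC.map_id_apply]
    exact congrArg (b ⊗ₜ[R] ·) (symMap_eq_self _ (fun _ => rfl) (fun _ => rfl) l)

/-- The restriction of `symMap` to `L^{⊗ k}`. -/
def tpowMap {φ : R →+* R'} (f : L →ₛₗ[φ] L') (k : ℕ) : tpow R L k →ₛₗ[φ] tpow R' L' k :=
  ((symMapₛₗ f).comp (tpow R L k).subtype).codRestrict (tpow R' L' k)
    fun x => symMap_mem_tpow f x.2

lemma DirLim.mk_congr (M : GrModule s) {k : ℕ} {m m' : M} {l l' : SymmetricAlgebra R L}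
    (hm : m ∈ M.grade (2 * k)) (hl : l ∈ tpow R L k) (e : m = m') (e' : l = l') :
    DirLim.mk M k m hm l hl = DirLim.mk M k m' (e ▸ hm) l' (e' ▸ hl) := by
  subst e e'
  rfl

lemma DirLim.map_eq_self {M : GrModule s} {F : FormMap s s} (g : GrMap F M M)
    (hφ : ∀ r, F.φ r = r) (hm : ∀ m : M, g.toFun m = m) (hl : ∀ l, F.fL l = l) (x : DirLim M) :
    DirLim.map g x = x := by
  induction x using DirLim.induction with
  | zero => rw [map_zero]
  | add x y hx hy => rw [map_add, hx, hy]
  | mk k m _ l _ =>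
    rw [DirLim.map_mk]
    exact DirLim.mk_congr _ _ _ (hm m) (symMap_eq_self _ hφ hl l)

lemma DirLim.map_map {R'' E'' L'' : Type u} [CommRing R''] [AddCommGroup E''] [Module R'' E'']
    [AddCommGroup L''] [Module R'' L''] {s'' : L'' →ₗ[R''] E'' →ₗ[R''] E'' →ₗ[R''] R''}
    {F : FormMap s s'} {F' : FormMap s' s''} {F'' : FormMap s s''}
    {M : GrModule s} {M' : GrModule s'} {M'' : GrModule s''}
    (g : GrMap F M M') (g' : GrMap F' M' M'') (g'' : GrMap F'' M M'')
    (hφ : ∀ r, F'.φ (F.φ r) = F''.φ r) (hm : ∀ m : M, g'.toFun (g.toFun m) = g''.toFun m)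
    (hl : ∀ l, F'.fL (F.fL l) = F''.fL l) (x : DirLim M) :
    DirLim.map g' (DirLim.map g x) = DirLim.map g'' x := by
  induction x using DirLim.induction with
  | zero => simp only [map_zero]
  | add x y hx hy => simp only [map_add, hx, hy]
  | mk k m _ l _ =>
    rw [DirLim.map_mk, DirLim.map_mk, DirLim.map_mk]
    exact DirLim.mk_congr _ _ _ (hm m) (symMap_comp _ _ _ hφ hl l)

lemma mul_mem_tpow {j k : ℕ} {x y : SymmetricAlgebra R L} (hx : x ∈ tpow R L j)
    (hy : y ∈ tpow R L k) : x * y ∈ tpow R L (j + k) := by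
  rw [tpow, pow_add]
  exact Submodule.mul_mem_mul hx hy

/-- The multiplication `L^{⊗ k} × L → L^{⊗ (k + 1)}`. -/
def tpowMul {k : ℕ} (x : tpow R L k) (l : L) : tpow R L (k + 1) :=
  ⟨x * SymmetricAlgebra.ι R L l, mul_mem_tpow x.2 (ι_mem_tpow l)⟩

lemma GrModule.mem_of_mem_shift {M : GrModule s} {j k : ℕ} {m : M}
    (hm : m ∈ (M.shift (2 * (k : ℤ))).grade (2 * (j : ℤ))) : m ∈ M.grade (2 * ((j + k : ℕ) : ℤ)) := by
  rw [Nat.cast_add, mul_add]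
  exact hm

/-- The semilinear map `N ⊗ L^{⊗ k} → N' ⊗ L'^{⊗ k}` induced by semilinear maps. -/
def twistMap {N N' : Type u} [AddCommGroup N] [Module R N] [AddCommGroup N'] [Module R' N']
    {φ : R →+* R'} (f : N →ₛₗ[φ] N') (g : L →ₛₗ[φ] L') (k : ℕ) :
    N ⊗[R] tpow R L k →ₛₗ[φ] N' ⊗[R'] tpow R' L' k :=
  TensorProduct.map f (tpowMap g k)

lemma twistMap_tmul {N N' : Type u} [AddCommGroup N] [Module R N] [AddCommGroup N'] [Module R' N']
    {φ : R →+* R'} (f : N →ₛₗ[φ] N') (g : L →ₛₗ[φ] L') (k : ℕ) (x : N) (l : tpow R L k) :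
    twistMap f g k (x ⊗ₜ l) = f x ⊗ₜ tpowMap g k l := rfl

lemma twistMap_act {A A' : Type u} [Ring A] [Algebra R A] [Ring A'] [Algebra R' A']
    {N N' : Type u} [AddCommGroup N] [Module R N] [AddCommGroup N'] [Module R' N']
    [Module Aᵐᵒᵖ N] [IsScalarTower R Aᵐᵒᵖ N] [Module A'ᵐᵒᵖ N'] [IsScalarTower R' A'ᵐᵒᵖ N']
    {φ : R →+* R'} (f : N →ₛₗ[φ] N') (g : L →ₛₗ[φ] L') (k : ℕ) (a : A) (a' : A')
    (h : ∀ x, f (MulOpposite.op a • x) = MulOpposite.op a' • f x) (x : N ⊗[R] tpow R L k) :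
    twistMap f g k (MulOpposite.op a • x) = MulOpposite.op a' • twistMap f g k x := by
  induction x with
  | zero => simp
  | add x y hx hy => simp only [smul_add, map_add, hx, hy]
  | tmul x y =>
    rw [TensorProduct.smul_tmul', twistMap_tmul, twistMap_tmul, h, TensorProduct.smul_tmul']

lemma twistMap_eq_self {N : Type u} [AddCommGroup N] [Module R N] {φ : R →+* R} (f : N →ₛₗ[φ] N)
    (g : L →ₛₗ[φ] L) (k : ℕ) (hφ : ∀ r, φ r = r) (hf : ∀ x, f x = x) (hg : ∀ l, g l = l)
    (x : N ⊗[R] tpow R L k) : twistMap f g k x = x := by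
  induction x with
  | zero => simp
  | add x y hx hy => simp only [map_add, hx, hy]
  | tmul x y =>
    rw [twistMap_tmul, hf]
    exact congrArg (x ⊗ₜ ·) (Subtype.ext (symMap_eq_self _ hφ hg _))

lemma twistMap_comp {R'' L'' : Type u} [CommRing R''] [AddCommGroup L''] [Module R'' L'']
    {N N' N'' : Type u} [AddCommGroup N] [Module R N] [AddCommGroup N'] [Module R' N']
    [AddCommGroup N''] [Module R'' N'']
    {φ : R →+* R'} {ψ : R' →+* R''} {χ : R →+* R''} (f : N →ₛₗ[φ] N') (f' : N' →ₛₗ[ψ] N'')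
    (f'' : N →ₛₗ[χ] N'') (g : L →ₛₗ[φ] L') (g' : L' →ₛₗ[ψ] L'') (g'' : L →ₛₗ[χ] L'') (k : ℕ)
    (hφ : ∀ r, ψ (φ r) = χ r) (hf : ∀ x, f' (f x) = f'' x) (hg : ∀ l, g' (g l) = g'' l)
    (x : N ⊗[R] tpow R L k) : twistMap f' g' k (twistMap f g k x) = twistMap f'' g'' k x := by
  induction x with
  | zero => simp
  | add x y hx hy => simp only [map_add, hx, hy]
  | tmul x y =>
    rw [twistMap_tmul, twistMap_tmul, twistMap_tmul, hf]
    exact congrArg (_ ⊗ₜ ·) (Subtype.ext (symMap_comp _ _ _ hφ hg _))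

lemma twistMap_map {A A' : Type u} [Ring A] [Algebra R A] [Ring A'] [Algebra R' A']
    {N N' P P' : Type u} [AddCommGroup N] [Module R N] [AddCommGroup N'] [Module R' N']
    [AddCommGroup P] [Module R P] [AddCommGroup P'] [Module R' P']
    [Module Aᵐᵒᵖ N] [IsScalarTower R Aᵐᵒᵖ N] [Module A'ᵐᵒᵖ N'] [IsScalarTower R' A'ᵐᵒᵖ N']
    [Module Aᵐᵒᵖ P] [IsScalarTower R Aᵐᵒᵖ P] [Module A'ᵐᵒᵖ P'] [IsScalarTower R' A'ᵐᵒᵖ P']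
    {φ : R →+* R'} (f : N →ₛₗ[φ] N') (f' : P →ₛₗ[φ] P') (g : L →ₛₗ[φ] L') (k : ℕ)
    (h : N →ₗ[Aᵐᵒᵖ] P) (h' : N' →ₗ[A'ᵐᵒᵖ] P') (hh : ∀ x, h' (f x) = f' (h x))
    (x : N ⊗[R] tpow R L k) :
    TensorProduct.AlgebraTensorModule.map h' LinearMap.id (twistMap f g k x) =
      twistMap f' g k (TensorProduct.AlgebraTensorModule.map h LinearMap.id x) := by
  induction x with
  | zero => simp
  | add x y hx hy => simp only [map_add, hx, hy]
  | tmul x y =>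
    change h' (f x) ⊗ₜ _ = f' (h x) ⊗ₜ _
    rw [hh]
    rfl

end Aux
section Sheaves

/-! ### Sheaves on a scheme

Quasi-coherent sheaves on a scheme `S` are described by their sections over the affine open subsets
of `S`: a quasi-coherent sheaf is a compatible family of modules `M(U)` over `Γ(S, U)`, for `U` affine
open, such that `Γ(S, V) ⊗ M(U) → M(V)` is an isomorphism for all `V ⊆ U`. -/

variable {S : Scheme.{u}}

/-- The restriction of functions between affine open subsets. -/
def resO {U V : S.affineOpens} (h : V ≤ U) : Γ(S, U) →+* Γ(S, V) :=
  (S.presheaf.map (homOfLE h).op).hom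

lemma resO_id (U : S.affineOpens) (r : Γ(S, U)) : resO (le_refl U) r = r := by
  have := S.presheaf.map_id (Opposite.op U.1)
  exact congr($(this).hom r)

lemma resO_comp {U V T : S.affineOpens} (h : V ≤ U) (h' : T ≤ V) (r : Γ(S, U)) :
    resO h' (resO h r) = resO (h'.trans h) r := by
  have := S.presheaf.map_comp (homOfLE (show V.1 ≤ U.1 from h)).op
    (homOfLE (show T.1 ≤ V.1 from h')).op
  exact congr($(this).hom r).symm

variable (S) in
/-- A presheaf of `𝒪_S`-modules on the affine open subsets of `S`. -/
structure AffPresheaf where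
  obj : S.affineOpens → Type u
  [addCommGroup : ∀ U : S.affineOpens, AddCommGroup (obj U)]
  [module : ∀ U : S.affineOpens, Module Γ(S, U) (obj U)]
  res : ∀ {U V : S.affineOpens} (h : V ≤ U), obj U →ₛₗ[resO h] obj V
  res_id : ∀ (U : S.affineOpens) (x : obj U), res (le_refl U) x = x
  res_comp : ∀ {U V T : S.affineOpens} (h : V ≤ U) (h' : T ≤ V) (x : obj U),
    res h' (res h x) = res (h'.trans h) x

attribute [instance] AffPresheaf.addCommGroup AffPresheaf.module

/-- Quasi-coherence. -/
def AffPresheaf.IsQCoh (M : AffPresheaf S) : Prop :=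
  ∀ {U V : S.affineOpens} (h : V ≤ U), IsExtensionOfScalars (resO h) (M.res h)

/-- `M` is a vector bundle of rank `n`. -/
structure AffPresheaf.IsVectorBundle (M : AffPresheaf S) (n : ℕ) : Prop where
  isQCoh : M.IsQCoh
  finite : ∀ U : S.affineOpens, Module.Finite Γ(S, U) (M.obj U)
  projective : ∀ U : S.affineOpens, Module.Projective Γ(S, U) (M.obj U)
  rank : ∀ (U : S.affineOpens) (p : PrimeSpectrum Γ(S, U)), Module.rankAtStalk (M.obj U) p = n

/-- `M` is a line bundle. -/
structure AffPresheaf.IsLineBundle (M : AffPresheaf S) : Prop where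
  isQCoh : M.IsQCoh
  invertible : ∀ U : S.affineOpens, Module.Invertible Γ(S, U) (M.obj U)

/-- The dual sheaf `M^*`, for `M` quasi-coherent. -/
def AffPresheaf.dual (M : AffPresheaf S) (hM : M.IsQCoh) : AffPresheaf S where
  obj U := Module.Dual Γ(S, U) (M.obj U)
  res h :=
    { toFun := (hM h).dualMap
      map_add' a b := (hM h).dual_ext fun m => by
        rw [LinearMap.add_apply]; simp
      map_smul' r a := (hM h).dual_ext fun m => by
        rw [LinearMap.smul_apply]; simp }
  res_id U a := (hM (le_refl U)).dual_ext fun m => by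
    change (hM _).dualMap a _ = _
    rw [IsExtensionOfScalars.dualMap_apply, M.res_id, resO_id]
  res_comp h h' a := (hM (h'.trans h)).dual_ext fun m => by
    change (hM h').dualMap ((hM h).dualMap a) _ = (hM (h'.trans h)).dualMap a _
    rw [IsExtensionOfScalars.dualMap_apply, ← M.res_comp h h',
      IsExtensionOfScalars.dualMap_apply, IsExtensionOfScalars.dualMap_apply, resO_comp]

variable (S) in
/-- The data defining a quadric fibration over `S`: a vector bundle `E` of rank `n`, a line bundle `L`,
and a nowhere vanishing morphism `σ : L → S²E^*`, given as a symmetric form `L × E × E → 𝒪_S`. -/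
structure QuadricData (n : ℕ) where
  E : AffPresheaf S
  L : AffPresheaf S
  isVectorBundle : E.IsVectorBundle n
  isLineBundle : L.IsLineBundle
  form : ∀ U : S.affineOpens, L.obj U →ₗ[Γ(S, U)] E.obj U →ₗ[Γ(S, U)] E.obj U →ₗ[Γ(S, U)] Γ(S, U)
  form_symm : ∀ U l v w, form U l v w = form U l w v
  form_res : ∀ {U V : S.affineOpens} (h : V ≤ U) l v w,
    form V (L.res h l) (E.res h v) (E.res h w) = resO h (form U l v w)
  nowhere_zero : ∀ U, Ideal.span {r | ∃ l v w, form U l v w = r} = ⊤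

variable {n : ℕ} (D : QuadricData S n)

/-- The restriction maps of the sheaves `E`, `L` and `σ`. -/
def QuadricData.formMap {U V : S.affineOpens} (h : V ≤ U) : FormMap (D.form U) (D.form V) where
  φ := resO h
  fE := D.E.res h
  fL := D.L.res h
  compat := D.form_res h
  span_fL := (D.isLineBundle.isQCoh h).span_range

/-- The sheaf of homogeneous Clifford algebras. -/
abbrev QuadricData.FB (U : S.affineOpens) : Type u := HC (D.form U)

/-- The sheaf of even parts of Clifford algebras. -/
abbrev QuadricData.B0 (U : S.affineOpens) : Type u := HomogClifford.B0 (D.form U)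

/-- The restriction maps of the sheaf of homogeneous Clifford algebras. -/
abbrev QuadricData.resFB {U V : S.affineOpens} (h : V ≤ U) : D.FB U →+* D.FB V :=
  HC.map (D.formMap h)

/-- The restriction maps of the sheaf of even parts of Clifford algebras. -/
abbrev QuadricData.resB0 {U V : S.affineOpens} (h : V ≤ U) : D.B0 U →+* D.B0 V :=
  B0.map (D.formMap h)

/-- The affine open subsets contained in an open subset `W`. -/
abbrev AffIn (W : S.Opens) : Type u := {U : S.affineOpens // (U : S.Opens) ≤ W}

/-- The restriction of functions from `W` to an affine open subset of `W`. -/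
def resTo {W : S.Opens} (U : AffIn W) : Γ(S, W) →+* Γ(S, U.1) :=
  (S.presheaf.map (homOfLE U.2).op).hom

lemma resO_resTo {W : S.Opens} {U V : AffIn W} (h : V ≤ U) (r : Γ(S, W)) :
    resO h (resTo U r) = resTo V r := by
  have := S.presheaf.map_comp (homOfLE U.2).op
    (homOfLE (show V.1.1 ≤ U.1.1 from h)).op
  exact congr($(this).hom r).symm

/-- A finitely generated quasi-coherent sheaf of `ℤ`-graded right modules over the sheaf of
homogeneous Clifford algebras, on the open subset `W` of `S`. -/
structure GrMod (W : S.Opens) where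
  obj : ∀ U : AffIn W, GrModule (D.form U.1)
  res : ∀ {U V : AffIn W} (h : V ≤ U), GrMap (D.formMap h) (obj U) (obj V)
  res_id : ∀ (U : AffIn W) (x : obj U), (res (le_refl U)).toFun x = x
  res_comp : ∀ {U V T : AffIn W} (h : V ≤ U) (h' : T ≤ V) (x : obj U),
    (res h').toFun ((res h).toFun x) = (res (h'.trans h)).toFun x
  isQCoh : ∀ {U V : AffIn W} (h : V ≤ U), IsExtensionOfScalars (resO h) (res h).toFun
  finite : ∀ U : AffIn W, Module.Finite (D.FB U.1)ᵐᵒᵖ (obj U)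

variable {D} {W : S.Opens}

/-- Morphisms of sheaves of graded modules. -/
@[ext]
structure GrMod.Hom (M N : GrMod D W) where
  app : ∀ U, M.obj U →ₗ[Γ(S, U.1)] N.obj U
  map_act : ∀ U (b : D.FB U.1) (m : M.obj U),
    app U (MulOpposite.op b • m) = MulOpposite.op b • app U m
  map_grade : ∀ U {k : ℤ} {m : M.obj U}, m ∈ (M.obj U).grade k → app U m ∈ (N.obj U).grade k
  naturality : ∀ {U V : AffIn W} (h : V ≤ U) (m : M.obj U),
    app V ((M.res h).toFun m) = (N.res h).toFun (app U m)

instance : Category (GrMod D W) where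
  Hom := GrMod.Hom
  id M :=
    { app U := LinearMap.id
      map_act _ _ _ := rfl
      map_grade _ _ _ h := h
      naturality _ _ := rfl }
  comp f g :=
    { app U := (g.app U).comp (f.app U)
      map_act U b m := by
        simp only [LinearMap.comp_apply, f.map_act, g.map_act]
      map_grade U _ _ h := g.map_grade U (f.map_grade U h)
      naturality h m := by
        simp only [LinearMap.comp_apply, f.naturality, g.naturality] }

@[ext]
lemma GrMod.hom_ext {M N : GrMod D W} {f g : M ⟶ N} (h : ∀ U m, f.app U m = g.app U m) : f = g :=
  GrMod.Hom.ext (funext fun U => LinearMap.ext (h U))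

lemma GrMod.comp_app {M N P : GrMod D W} (f : M ⟶ N) (g : N ⟶ P) (U : AffIn W) (m : M.obj U) :
    (f ≫ g).app U m = g.app U (f.app U m) := rfl

section

variable {M N : GrMod D W}

instance : Zero (M ⟶ N) := ⟨
  { app U := 0
    map_act _ _ _ := by simp
    map_grade _ _ _ _ := zero_mem _
    naturality _ _ := by simp }⟩

instance : Add (M ⟶ N) := ⟨fun f g =>
  { app U := f.app U + g.app U
    map_act _ _ _ := by simp [f.map_act, g.map_act]
    map_grade U _ _ h := add_mem (f.map_grade U h) (g.map_grade U h)
    naturality h m := by simp [f.naturality, g.naturality] }⟩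

instance : Neg (M ⟶ N) := ⟨fun f =>
  { app U := -f.app U
    map_act _ _ _ := by simp [f.map_act]
    map_grade U _ _ h := neg_mem (f.map_grade U h)
    naturality h m := by simp [f.naturality] }⟩

instance : AddCommGroup (M ⟶ N) where
  add_assoc f g h := GrMod.hom_ext fun U m => add_assoc (f.app U m) (g.app U m) (h.app U m)
  zero_add f := GrMod.hom_ext fun U m => zero_add (f.app U m)
  add_zero f := GrMod.hom_ext fun U m => add_zero (f.app U m)
  neg_add_cancel f := GrMod.hom_ext fun U m => neg_add_cancel (f.app U m)
  add_comm f g := GrMod.hom_ext fun U m => add_comm (f.app U m) (g.app U m)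
  nsmul := nsmulRec
  zsmul := zsmulRec

instance : Module Γ(S, W) (M ⟶ N) where
  smul r f :=
    { app U := resTo U r • f.app U
      map_act U b m := by
        simp only [LinearMap.smul_apply, f.map_act]
        rw [smul_comm]
      map_grade U _ _ h := Submodule.smul_mem _ _ (f.map_grade U h)
      naturality h m := by
        simp only [LinearMap.smul_apply, f.naturality]
        rw [LinearMap.map_smulₛₗ]
        exact congrArg (· • _) (resO_resTo h r).symm }
  one_smul f := GrMod.hom_ext fun U m => by
    change resTo U 1 • f.app U m = _
    rw [map_one, one_smul]
  mul_smul r t f := GrMod.hom_ext fun U m => by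
    change resTo U (r * t) • f.app U m = resTo U r • resTo U t • f.app U m
    rw [map_mul, mul_smul]
  smul_zero r := GrMod.hom_ext fun U m => smul_zero (resTo U r)
  smul_add r f g := GrMod.hom_ext fun U m => smul_add (resTo U r) (f.app U m) (g.app U m)
  add_smul r t f := GrMod.hom_ext fun U m => by
    change resTo U (r + t) • f.app U m = resTo U r • f.app U m + resTo U t • f.app U m
    rw [map_add, add_smul]
  zero_smul f := GrMod.hom_ext fun U m => by
    change resTo U 0 • f.app U m = 0
    rw [map_zero, zero_smul]

end

instance : Preadditive (GrMod D W) where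
  add_comp _ _ _ f f' g := GrMod.hom_ext fun U m => map_add (g.app U) (f.app U m) (f'.app U m)
  comp_add _ _ _ _ _ _ := rfl

instance : Linear Γ(S, W) (GrMod D W) where
  smul_comp _ _ _ r f g := GrMod.hom_ext fun U m => map_smul (g.app U) (resTo U r) (f.app U m)
  comp_smul _ _ _ _ _ _ := rfl


variable (D W) in
/-- A presheaf of right modules over the sheaf of even parts of Clifford algebras, on the affine open
subsets of `W`. -/
structure PMod where
  obj : AffIn W → Type u
  [addCommGroup : ∀ U : AffIn W, AddCommGroup (obj U)]
  [module : ∀ U : AffIn W, Module Γ(S, U.1) (obj U)]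
  [rightModule : ∀ U : AffIn W, Module (D.B0 U.1)ᵐᵒᵖ (obj U)]
  [isScalarTower : ∀ U : AffIn W, IsScalarTower Γ(S, U.1) (D.B0 U.1)ᵐᵒᵖ (obj U)]
  res : ∀ {U V : AffIn W} (h : V ≤ U), obj U →ₛₗ[resO h] obj V
  res_act : ∀ {U V : AffIn W} (h : V ≤ U) (b : D.B0 U.1) (x : obj U),
    res h (MulOpposite.op b • x) = MulOpposite.op (D.resB0 h b) • res h x
  res_id : ∀ (U : AffIn W) (x : obj U), res (le_refl U) x = x
  res_comp : ∀ {U V T : AffIn W} (h : V ≤ U) (h' : T ≤ V) (x : obj U),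
    res h' (res h x) = res (h'.trans h) x

attribute [instance] PMod.addCommGroup PMod.module PMod.rightModule PMod.isScalarTower

/-- Morphisms of presheaves of right modules. -/
@[ext]
structure PMod.Hom (M N : PMod D W) where
  app : ∀ U, M.obj U →ₗ[(D.B0 U.1)ᵐᵒᵖ] N.obj U
  naturality : ∀ {U V : AffIn W} (h : V ≤ U) (m : M.obj U),
    app V (M.res h m) = N.res h (app U m)

instance : Category (PMod D W) where
  Hom := PMod.Hom
  id M :=
    { app U := LinearMap.id
      naturality _ _ := rfl }
  comp f g :=
    { app U := (g.app U).comp (f.app U)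
      naturality h m := by
        simp only [LinearMap.comp_apply, f.naturality, g.naturality] }

@[ext]
lemma PMod.hom_ext {M N : PMod D W} {f g : M ⟶ N} (h : ∀ U m, f.app U m = g.app U m) : f = g :=
  PMod.Hom.ext (funext fun U => LinearMap.ext (h U))

lemma PMod.Hom.app_smul {M N : PMod D W} (f : PMod.Hom M N) (U : AffIn W) (r : Γ(S, U.1))
    (m : M.obj U) : f.app U (r • m) = r • f.app U m :=
  LinearMap.map_smul_of_tower (f.app U) r m

section

variable {M N : PMod D W}

instance : Zero (M ⟶ N) := ⟨
  { app U := 0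
    naturality _ _ := by simp }⟩

instance : Add (M ⟶ N) := ⟨fun f g =>
  { app U := f.app U + g.app U
    naturality h m := by simp [f.naturality, g.naturality] }⟩

instance : Neg (M ⟶ N) := ⟨fun f =>
  { app U := -f.app U
    naturality h m := by simp [f.naturality] }⟩

instance : AddCommGroup (M ⟶ N) where
  add_assoc f g h := PMod.hom_ext fun U m => add_assoc (f.app U m) (g.app U m) (h.app U m)
  zero_add f := PMod.hom_ext fun U m => zero_add (f.app U m)
  add_zero f := PMod.hom_ext fun U m => add_zero (f.app U m)
  neg_add_cancel f := PMod.hom_ext fun U m => neg_add_cancel (f.app U m)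
  add_comm f g := PMod.hom_ext fun U m => add_comm (f.app U m) (g.app U m)
  nsmul := nsmulRec
  zsmul := zsmulRec

instance : Module Γ(S, W) (M ⟶ N) where
  smul r f :=
    { app U :=
        { toFun m := resTo U r • f.app U m
          map_add' x y := by rw [map_add, smul_add]
          map_smul' b x := by
            rw [map_smul, RingHom.id_apply, smul_comm] }
      naturality {U V} h m := by
        change resTo V r • f.app V (M.res h m) = N.res h (resTo U r • f.app U m)
        rw [f.naturality, LinearMap.map_smulₛₗ]
        exact congrArg (· • _) (resO_resTo h r).symm }
  one_smul f := PMod.hom_ext fun U m => by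
    change resTo U 1 • f.app U m = _
    rw [map_one, one_smul]
  mul_smul r t f := PMod.hom_ext fun U m => by
    change resTo U (r * t) • f.app U m = resTo U r • resTo U t • f.app U m
    rw [map_mul, mul_smul]
  smul_zero r := PMod.hom_ext fun U m => smul_zero (resTo U r)
  smul_add r f g := PMod.hom_ext fun U m => smul_add (resTo U r) (f.app U m) (g.app U m)
  add_smul r t f := PMod.hom_ext fun U m => by
    change resTo U (r + t) • f.app U m = resTo U r • f.app U m + resTo U t • f.app U m
    rw [map_add, add_smul]
  zero_smul f := PMod.hom_ext fun U m => by
    change resTo U 0 • f.app U m = 0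
    rw [map_zero, zero_smul]

end

instance : Preadditive (PMod D W) where
  add_comp _ _ _ f f' g := PMod.hom_ext fun U m => map_add (g.app U) (f.app U m) (f'.app U m)
  comp_add _ _ _ _ _ _ := rfl

instance : Linear Γ(S, W) (PMod D W) where
  smul_comp _ _ _ r f g := PMod.hom_ext fun U m => g.app_smul U (resTo U r) (f.app U m)
  comp_smul _ _ _ _ _ _ := rfl

variable (D W) in
/-- Coherent sheaves of right modules over the sheaf of even parts of Clifford algebras, on the locally
noetherian scheme `W`: the presheaves which are quasi-coherent with finitely generated modules of
sections over `𝒪`. -/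
def isCoherent : ObjectProperty (PMod D W) := fun M =>
  (∀ {U V : AffIn W} (h : V ≤ U), IsExtensionOfScalars (resO h) (M.res h)) ∧
    ∀ U : AffIn W, Module.Finite Γ(S, U.1) (M.obj U)

variable (D W) in
/-- The category `mod-B0` of coherent sheaves of right `B0`-modules on `W`. -/
abbrev CohB0 : Type (u + 1) := (isCoherent D W).FullSubcategory

/-! ### The functor `M ↦ lim M_{2k} ⊗ L^k` -/

/-- The map of graded modules of sections underlying a morphism. -/
def GrMod.Hom.grMap {M N : GrMod D W} (f : GrMod.Hom M N) (U : AffIn W) :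
    GrMap (FormMap.id (D.form U.1)) (M.obj U) (N.obj U) where
  toFun := f.app U
  map_act b m := by
    rw [HC.map_id_apply]
    exact f.map_act U b m
  map_grade h := f.map_grade U h

/-- The sheaf `lim M_{2k} ⊗ L^k` of right `B0`-modules. -/
def dirLimObj (M : GrMod D W) : PMod D W where
  obj U := DirLim (M.obj U)
  res h := DirLim.map (M.res h)
  res_act h b x := DirLim.map_act (M.res h) b x
  res_id U x := DirLim.map_eq_self (M.res (le_refl U)) (resO_id U.1) (M.res_id U)
    (D.L.res_id U.1) x
  res_comp h h' x := DirLim.map_map (M.res h) (M.res h') (M.res (h'.trans h))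
    (resO_comp _ _) (M.res_comp h h') (D.L.res_comp _ _) x

variable (D W) in
/-- The functor `M ↦ lim M_{2k} ⊗ L^k` on graded modules. -/
def dirLim : GrMod D W ⥤ PMod D W where
  obj M := dirLimObj M
  map {M N} f :=
    { app U :=
        { toFun := DirLim.map (f.grMap U)
          map_add' := map_add _
          map_smul' b x := by
            have h := DirLim.map_act (f.grMap U) b.unop x
            rw [B0.map_id_apply] at h
            exact h }
      naturality h x := by
        change DirLim.map (f.grMap _) (DirLim.map (M.res h) x) =
          DirLim.map (N.res h) (DirLim.map (f.grMap _) x)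
        induction x using DirLim.induction with
        | zero => simp only [map_zero]
        | add x y hx hy => simp only [map_add, hx, hy]
        | mk k m hm l hl =>
          rw [DirLim.map_mk, DirLim.map_mk, DirLim.map_mk, DirLim.map_mk]
          refine DirLim.mk_congr _ _ _ (f.naturality h m) ?_
          exact (symMap_eq_self _ (fun _ => rfl) (fun _ => rfl) _).trans
            (congrArg _ (symMap_eq_self _ (fun _ => rfl) (fun _ => rfl) l).symm) }
  map_id M := PMod.hom_ext fun U x => by
    change DirLim.map (GrMod.Hom.grMap (𝟙 M) U) x = x
    induction x using DirLim.induction with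
    | zero => rw [map_zero]
    | add x y hx hy => rw [map_add, hx, hy]
    | mk k m hm l hl =>
      rw [DirLim.map_mk]
      exact DirLim.mk_congr _ _ _ rfl (symMap_eq_self _ (fun _ => rfl) (fun _ => rfl) l)
  map_comp f g := PMod.hom_ext fun U x => by
    change DirLim.map (GrMod.Hom.grMap (f ≫ g) U) x =
      DirLim.map (g.grMap U) (DirLim.map (f.grMap U) x)
    induction x using DirLim.induction with
    | zero => simp only [map_zero]
    | add x y hx hy => simp only [map_add, hx, hy]
    | mk k m hm l hl =>
      rw [DirLim.map_mk, DirLim.map_mk, DirLim.map_mk]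
      refine DirLim.mk_congr _ _ _ rfl ?_
      exact (symMap_eq_self _ (fun _ => rfl) (fun _ => rfl) _).symm

variable (D W) in
/-- The morphisms whose kernel and cokernel have finite rank over `𝒪`, i.e. are torsion. -/
def torsionIso : MorphismProperty (GrMod D W) := fun _ _ f =>
  ∀ U : AffIn W, Module.Finite Γ(S, U.1) (LinearMap.ker (f.app U)) ∧
    Module.Finite Γ(S, U.1) (_ ⧸ LinearMap.range (f.app U))

variable (D W) in
/-- The quotient of the category of finitely generated graded modules by the
subcategory of modules of finite rank over `𝒪`. -/
abbrev Qgr : Type (u + 1) := (torsionIso D W).Localization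

variable (D W) in
/-- The quotient functor. -/
abbrev toQgr : GrMod D W ⥤ Qgr D W := (torsionIso D W).Q

variable (D W) in
/-- The shift of the grading `M⟨j⟩_k = M_{k+j}`. -/
def GrMod.shift (j : ℤ) : GrMod D W ⥤ GrMod D W where
  obj M :=
    { obj U := (M.obj U).shift j
      res h :=
        { toFun := (M.res h).toFun
          map_act := (M.res h).map_act
          map_grade hm := (M.res h).map_grade hm }
      res_id := M.res_id
      res_comp := M.res_comp
      isQCoh := M.isQCoh
      finite := M.finite }
  map f :=
    { app := f.app
      map_act := f.map_act
      map_grade U _ _ hm := f.map_grade U hm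
      naturality := f.naturality }

variable (D W) in
lemma GrMod.shift_isInvertedBy (j : ℤ) :
    (torsionIso D W).IsInvertedBy (GrMod.shift D W j ⋙ toQgr D W) := fun _ _ f hf =>
  (torsionIso D W).Q_inverts ((GrMod.shift D W j).map f) hf

variable (D W) in
/-- The shift of the grading on the quotient category. -/
def Qgr.shift (j : ℤ) : Qgr D W ⥤ Qgr D W :=
  Localization.Construction.lift (GrMod.shift D W j ⋙ toQgr D W) (GrMod.shift_isInvertedBy D W j)

/-! ### Tensor products with powers of a line bundle -/

/-- The sections of `P^{⊗ k}`, for a line bundle `P`. -/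
abbrev AffPresheaf.pow (P : AffPresheaf S) (k : ℕ) (U : S.affineOpens) :=
  tpow (S.presheaf.obj (Opposite.op (U : S.Opens))) (P.obj U) k

variable (D W) in
/-- The functor `N ↦ N ⊗ P^{⊗ k}` on presheaves of right `B0`-modules. -/
def twist (P : AffPresheaf S) (k : ℕ) : PMod D W ⥤ PMod D W where
  obj N :=
    { obj U := TensorProduct (S.presheaf.obj (Opposite.op (U.1 : S.Opens))) (N.obj U) (P.pow k U.1)
      res h := twistMap (N.res h) (P.res h) k
      res_act h b x := twistMap_act (N.res h) (P.res h) k b (D.resB0 h b) (N.res_act h b) x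
      res_id U x := twistMap_eq_self (N.res _) (P.res _) k (resO_id U.1) (N.res_id U)
        (P.res_id U.1) x
      res_comp h h' x := twistMap_comp (N.res h) (N.res h') (N.res (h'.trans h)) (P.res h)
        (P.res h') (P.res (h'.trans h)) k (resO_comp _ _) (N.res_comp h h') (P.res_comp _ _) x }
  map {N N'} f :=
    { app U := TensorProduct.AlgebraTensorModule.map (f.app U) LinearMap.id
      naturality {U V} h x := twistMap_map (N.res h) (N'.res h) (P.res h) k (f.app U) (f.app V)
        (f.naturality h) x }
  map_id _ := PMod.hom_ext fun _ x =>
    DFunLike.congr_fun TensorProduct.AlgebraTensorModule.map_id x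
  map_comp f g := PMod.hom_ext fun U x => DFunLike.congr_fun
    (TensorProduct.AlgebraTensorModule.map_comp (g.app U) (f.app U) LinearMap.id LinearMap.id) x

/-! ### Restriction to open subsets -/

/-- Affine open subsets of a smaller open subset. -/
def AffIn.incl {W W' : S.Opens} (i : W' ≤ W) (U : AffIn W') : AffIn W := ⟨U.1, U.2.trans i⟩

variable (D) in
/-- The restriction of graded modules to an open subset. -/
def GrMod.restr {W W' : S.Opens} (i : W' ≤ W) : GrMod D W ⥤ GrMod D W' where
  obj M :=
    { obj U := M.obj (U.incl i)
      res h := M.res (U := AffIn.incl i _) (V := AffIn.incl i _) h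
      res_id U := M.res_id (U.incl i)
      res_comp h h' := M.res_comp (U := AffIn.incl i _) (V := AffIn.incl i _)
        (T := AffIn.incl i _) h h'
      isQCoh h := M.isQCoh (U := AffIn.incl i _) (V := AffIn.incl i _) h
      finite U := M.finite (U.incl i) }
  map f :=
    { app U := f.app (U.incl i)
      map_act U := f.map_act (U.incl i)
      map_grade U _ _ hm := f.map_grade (U.incl i) hm
      naturality h := f.naturality (U := AffIn.incl i _) (V := AffIn.incl i _) h }

variable (D) in
lemma GrMod.restr_isInvertedBy {W W' : S.Opens} (i : W' ≤ W) :
    (torsionIso D W).IsInvertedBy (GrMod.restr D i ⋙ toQgr D W') := fun _ _ f hf =>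
  (torsionIso D W').Q_inverts ((GrMod.restr D i).map f) fun U => hf (U.incl i)

variable (D) in
/-- The restriction functor `qgr_W → qgr_{W'}`. -/
def Qgr.restr {W W' : S.Opens} (i : W' ≤ W) : Qgr D W ⥤ Qgr D W' :=
  Localization.Construction.lift (GrMod.restr D i ⋙ toQgr D W') (GrMod.restr_isInvertedBy D i)

variable (D) in
/-- The restriction of presheaves of `B0`-modules to an open subset. -/
def PMod.restr {W W' : S.Opens} (i : W' ≤ W) : PMod D W ⥤ PMod D W' where
  obj M :=
    { obj := fun U => M.obj (U.incl i)
      addCommGroup := fun U => M.addCommGroup (U.incl i)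
      module := fun U => M.module (U.incl i)
      rightModule := fun U => M.rightModule (U.incl i)
      isScalarTower := fun U => M.isScalarTower (U.incl i)
      res h := M.res (U := AffIn.incl i _) (V := AffIn.incl i _) h
      res_act h := M.res_act (U := AffIn.incl i _) (V := AffIn.incl i _) h
      res_id U := M.res_id (U.incl i)
      res_comp h h' := M.res_comp (U := AffIn.incl i _) (V := AffIn.incl i _)
        (T := AffIn.incl i _) h h' }
  map f :=
    { app U := f.app (U.incl i)
      naturality h := f.naturality (U := AffIn.incl i _) (V := AffIn.incl i _) h }

/-! ### The local `Hom` -/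




variable (D W) in
/-- The functor `q_* : qgr → mod-B0` induced by the functor `M ↦ lim M_{2k} ⊗ L^k`, when the latter
inverts the morphisms with torsion kernel and cokernel. -/
def pushforward (h : (torsionIso D W).IsInvertedBy (dirLim D W)) : Qgr D W ⥤ PMod D W :=
  Localization.Construction.lift (dirLim D W) h

/-- The morphism `N⟨2k⟩ → N⟨2k+2⟩` is the multiplication by `v²`, where `v` is a section of `E`.
(These morphisms exist, because the submodule `L^*` of the homogeneous Clifford algebra,
spanned by the squares, is central.) -/
def IsMulSq {U : S.affineOpens} (N : GrMod D U) (k : ℕ) (v : D.E.obj U)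
    (μ : (GrMod.shift D U (2 * (k : ℤ))).obj N ⟶
      (GrMod.shift D U (2 * ((k + 1 : ℕ) : ℤ))).obj N) : Prop :=
  ∀ (V : AffIn (U : S.Opens)) (m : N.obj V), μ.app V m =
    (MulOpposite.op (HC.gen (D.form V.1) (D.E.res V.2 v) * HC.gen (D.form V.1) (D.E.res V.2 v)) • m :
      N.obj V)

section

variable {U : S.affineOpens} [Preadditive (Qgr D U)]
  [Linear (S.presheaf.obj (Opposite.op (U : S.Opens))) (Qgr D U)]

/-- The direct sum of the modules `Hom_{qgr_U}(M, N⟨2k⟩) ⊗ L^k`, `k ≥ 0`. -/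
abbrev HomSum (M N : GrMod D U) : Type (u + 1) :=
  ⨁ k : ℕ, TensorProduct (S.presheaf.obj (Opposite.op (U : S.Opens)))
    ((toQgr D U).obj M ⟶ (toQgr D U).obj ((GrMod.shift D U (2 * (k : ℤ))).obj N)) (D.L.pow k U)

/-- The element `g ⊗ l` of `Hom_{qgr_U}(M, N⟨2k⟩) ⊗ L^k`, in the direct sum. -/
def HomSum.of {M N : GrMod D U} (k : ℕ)
    (g : (toQgr D U).obj M ⟶ (toQgr D U).obj ((GrMod.shift D U (2 * (k : ℤ))).obj N))
    (l : D.L.pow k U) : HomSum M N :=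
  DirectSum.lof (S.presheaf.obj (Opposite.op (U : S.Opens))) ℕ (fun k : ℕ =>
    TensorProduct (S.presheaf.obj (Opposite.op (U : S.Opens)))
    ((toQgr D U).obj M ⟶ (toQgr D U).obj ((GrMod.shift D U (2 * (k : ℤ))).obj N)) (D.L.pow k U))
    k (g ⊗ₜ l)

/-- The relations defining the direct limit of the modules `Hom_{qgr_U}(M, N⟨2k⟩) ⊗ L^k`: the
transition maps are induced by `N⟨2k⟩ ⊗ L^* → N⟨2k+2⟩`, where `v²` is the section
`l ↦ σ_l(v, v)` of `L^*`. -/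
def HomSum.rel (M N : GrMod D U) :
    Submodule (S.presheaf.obj (Opposite.op (U : S.Opens))) (HomSum M N) :=
  Submodule.span _ {y | ∃ (k : ℕ)
    (g : (toQgr D U).obj M ⟶ (toQgr D U).obj ((GrMod.shift D U (2 * (k : ℤ))).obj N))
    (l : D.L.pow k U) (v : D.E.obj U) (l₀ : D.L.obj U) (μ : _) (_ : IsMulSq N k v μ),
    y = HomSum.of (k + 1) (g ≫ (toQgr D U).map μ) (tpowMul l l₀) -
      D.form U l₀ v v • HomSum.of k g l}

/-- The direct limit of the modules `Hom_{qgr_U}(M, N⟨2k⟩) ⊗ L^k`: the module of sections over the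
affine open subset `U` of the direct image of the local `Hom` of `M` and `N`. -/
abbrev HomLim (M N : GrMod D U) : Type (u + 1) := HomSum M N ⧸ HomSum.rel M N

/-- The class of `g ⊗ l`, for `g : M → N⟨2k⟩`, in the direct limit. -/
def HomLim.mk {M N : GrMod D U} (k : ℕ)
    (g : (toQgr D U).obj M ⟶ (toQgr D U).obj ((GrMod.shift D U (2 * (k : ℤ))).obj N))
    (l : D.L.pow k U) : HomLim M N :=
  (HomSum.rel M N).mkQ (HomSum.of k g l)

end

/-- The morphism `μ : lim N_{2j+2k} ⊗ L^j → lim N_{2j} ⊗ L^j` is given by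
`n ⊗ l' ↦ n ⊗ l' l ∈ N_{2(j+k)} ⊗ L^{j+k}`, where `l` is a section of `L^k`. -/
def IsMulTpow {U : S.affineOpens} (N : GrMod D U) (k : ℕ) (l : D.L.pow k U)
    (μ : (dirLim D U).obj ((GrMod.shift D U (2 * (k : ℤ))).obj N) ⟶ (dirLim D U).obj N) : Prop :=
  ∀ (V : AffIn (U : S.Opens)) (j : ℕ) (m : N.obj V)
    (hm : m ∈ ((N.obj V).shift (2 * (k : ℤ))).grade (2 * (j : ℤ))) (l' : D.L.pow j V.1),
    μ.app V (DirLim.mk ((N.obj V).shift (2 * (k : ℤ))) j m hm l' l'.2) =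
      DirLim.mk (N.obj V) (j + k) m (GrModule.mem_of_mem_shift hm)
        (l' * (tpowMap (D.L.res V.2) k l : SymmetricAlgebra Γ(S, V.1) (D.L.obj V.1)))
        (mul_mem_tpow l'.2 (tpowMap (D.L.res V.2) k l).2)

/-- The restriction `M_W` of a sheaf of graded modules `M` on `S` to `W`. -/
abbrev GrMod.on (M : GrMod D ⊤) (W : S.Opens) : GrMod D W := (GrMod.restr D le_top).obj M



/-- The restriction of a morphism `M_U → N_U⟨j⟩` in `qgr_U` to a smaller open subset. -/
def restrQgrHom {W W' : S.Opens} (i : W' ≤ W) {M N : GrMod D ⊤} {j : ℤ}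
    (g : (toQgr D W).obj (M.on W) ⟶ (toQgr D W).obj ((GrMod.shift D W j).obj (N.on W))) :
    (toQgr D W').obj (M.on W') ⟶ (toQgr D W').obj ((GrMod.shift D W' j).obj (N.on W')) :=
  (Qgr.restr D i).map g

/-- The restriction of a morphism `q_* M_U → q_* N_U` to a smaller open subset. -/
def restrDirLimHom {W W' : S.Opens} (i : W' ≤ W) {M N : GrMod D ⊤}
    (g : (dirLim D W).obj (M.on W) ⟶ (dirLim D W).obj (N.on W)) :
    (dirLim D W').obj (M.on W') ⟶ (dirLim D W').obj (N.on W') :=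
  (PMod.restr D i).map g

/-- The map `Hom_{qgr}(M, N) → Hom_{B0}(q_* M, q_* N)` given by the functor `q_*`. -/
def pushforwardHom (h : (torsionIso D W).IsInvertedBy (dirLim D W)) {M N : GrMod D W}
    (g : (toQgr D W).obj M ⟶ (toQgr D W).obj N) : (dirLim D W).obj M ⟶ (dirLim D W).obj N :=
  (pushforward D W h).map g

end Sheaves

end HomogClifford

end

/-!
Over an affine open subset, let `R` be the ring of functions, which is noetherian and contains `1/2`,
and write `HC` for the homogeneous Clifford algebra. The form `σ` vanishes nowhere, so by polarization
there are sections `v_i` of `E` and `l_i` of `L` with `∑ σ_{l_i}(v_i, v_i) = 1`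
(`NondegForm.exists_partition`). Since `L` is invertible, the squares `v²` of two sections are
proportional, and hence central in `HC` (`HC.sq_mul`); the element `κ = ∑ v_i² ⊗ l_i` of `HC_2 ⊗ L` is
the canonical element of `L^* ⊗ L`, and the transition maps `M_{2k} ⊗ L^k → M_{2k+2} ⊗ L^{k+1}` are
the multiplications by `κ` (`mem_colimRel_iff`).

The quotient of `HC` by the squares is a quotient of the exterior algebra of `E`, so that
`HC_{j+2}` is spanned by the products of `HC_j` with squares for large `j`
(`HC.exists_deg_le_sqMul`). For a finitely generated module `M` the transition maps are therefore
surjective in large degrees, and injective as well because `R` is noetherian. So the direct limit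
`F M = lim M_{2k} ⊗ L^k` is equal to `M_{2k} ⊗ L^k` for large `k` (`DirLim.exists_bijective`). It follows
that `F M` is finite, that `F` inverts the morphisms with torsion kernel and cokernel
(`DirLim.map_bijective`), and that `F` commutes with extension of scalars
(`DirLim.map_isExtensionOfScalars`); in particular, `F M` is a coherent sheaf.

A quasi-inverse of `q_*` is `N ↦ ⨁_{j ≥ 0} Hom_{B0}(F (HC⟨-j⟩), N)`, where `HC` acts by its left
multiplications on the modules `HC⟨-j⟩` (`homFamily`, `gradedHom`). The identity
`∑ σ_{l_i}(v_i, v_i) = 1` exhibits `F (HC⟨-j-1⟩)` as a retract of a power of `F (HC⟨-j⟩)`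
(`FreeLim.sum_genTwist`), and `F HC = B0` is free of rank one. Hence the values of this functor are
finitely generated and compatible with extension of scalars. The unit
`⨁_{j ≥ 0} M_j → ⨁ Hom(F (HC⟨-j⟩), F M)` is bijective in large degrees
(`GrModule.unit_finite_ker_coker`), and so is an isomorphism of the quotient category; the
counit `F (⨁ Hom(F (HC⟨-j⟩), N)) → N` is bijective (`counit_bijective`). This gives the equivalence of
categories (`pushforwardEquivalence`). Coherent sheaves of `B0`-modules form an abelian category,
as the restriction maps of the structure sheaf are flat, and the quotient category inherits its
abelian and linear structures.

The isomorphisms for the shifts of the grading come from the multiplication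
`F M ⊗ L^l → F (M⟨-2l⟩)`, whose inverse multiplies by powers of the `v_i²` (`DirLim.shiftMul_bijective`),
and from the contraction of `L^l` with `(L^*)^l` (`tpowContract_bijective`). For the local `Hom`, the
sections of `L` are divided out by the same identity, so that every class of the direct limit comes from
a morphism `M → N` (`homLimZero_surjective`), and the claim reduces to the full faithfulness of `q_*`.
-/

noncomputable section

namespace HomogClifford

/-! ### Forms whose values generate the unit ideal -/

section Form

variable {R E L : Type u} [CommRing R] [AddCommGroup E] [Module R E] [AddCommGroup L] [Module R L]

/-- The properties, over an affine open subset, of a nowhere vanishing morphism `σ : L → S²E^*`, where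
`E` is finitely generated, `L` is invertible and `2` is a unit. -/
class NondegForm (s : L →ₗ[R] E →ₗ[R] E →ₗ[R] R) : Prop where
  two : IsUnit (2 : R)
  symm : ∀ l v w, s l v w = s l w v
  span : Ideal.span {r | ∃ l v w, s l v w = r} = ⊤
  invertible : Module.Invertible R L
  finite : Module.Finite R E

/-- Elements `v_i` of `E` and `l_i` of `L` with `∑ σ_{l_i}(v_i, v_i) = 1`. -/
structure SqPartition (s : L →ₗ[R] E →ₗ[R] E →ₗ[R] R) where
  r : ℕ
  v : Fin r → E
  l : Fin r → L
  sum_eq : ∑ i, s (l i) (v i) (v i) = 1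

variable (s : L →ₗ[R] E →ₗ[R] E →ₗ[R] R)

/-- The values `σ_l(v, v)` also generate the unit ideal, by polarization, as `2` is a unit. -/
lemma NondegForm.span_sq [h : NondegForm s] : Ideal.span {r | ∃ l v, s l v v = r} = ⊤ := by
  rw [← h.span]
  refine le_antisymm (Ideal.span_mono ?_) (Ideal.span_le.2 ?_)
  · rintro _ ⟨l, v, rfl⟩
    exact ⟨l, v, v, rfl⟩
  · rintro _ ⟨l, v, w, rfl⟩
    have hmem : ∀ u, s l u u ∈ Ideal.span {r | ∃ l v, s l v v = r} :=
      fun u => Ideal.subset_span ⟨l, u, rfl⟩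
    have h2 : 2 * s l v w ∈ Ideal.span {r | ∃ l v, s l v v = r} := by
      have := sub_mem (sub_mem (hmem (v + w)) (hmem v)) (hmem w)
      convert this using 1
      simp only [map_add, LinearMap.add_apply]
      rw [h.symm l w v]
      ring
    exact ((Ideal.unit_mul_mem_iff_mem _ h.two).1 h2)

lemma NondegForm.exists_partition [NondegForm s] : Nonempty (SqPartition s) := by
  have h1 : (1 : R) ∈ Ideal.span {r | ∃ l v, s l v v = r} := by
    rw [NondegForm.span_sq]; trivial
  obtain ⟨n, c, g, hg⟩ := Submodule.mem_span_set'.1 h1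
  choose l v hlv using fun i => (g i).2
  exact ⟨⟨n, v, fun i => c i • l i, by simp [hlv, ← hg]⟩⟩

variable {s}

lemma SqPartition.exists_pow (π : SqPartition s) (k : ℕ) :
    ∃ c : Fin π.r → R, ∑ i, c i * s (π.l i) (π.v i) (π.v i) ^ k = 1 := by
  have h : Ideal.span (Set.range fun i => s (π.l i) (π.v i) (π.v i)) = ⊤ := by
    rw [Ideal.eq_top_iff_one, ← π.sum_eq]
    exact sum_mem fun i _ => Ideal.subset_span ⟨i, rfl⟩
  have h' := Ideal.span_pow_eq_top _ h k
  rw [← Set.range_comp, Ideal.eq_top_iff_one] at h'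
  exact Ideal.mem_span_range_iff_exists_fun.1 h'

/-- The partition over a larger base ring induced by a change of base ring. -/
def SqPartition.map {R' E' L' : Type u} [CommRing R'] [AddCommGroup E'] [Module R' E']
    [AddCommGroup L'] [Module R' L'] {s' : L' →ₗ[R'] E' →ₗ[R'] E' →ₗ[R'] R'} (π : SqPartition s)
    (F : FormMap s s') : SqPartition s' where
  r := π.r
  v i := F.fE (π.v i)
  l i := F.fL (π.l i)
  sum_eq := by
    simp only [F.compat, ← map_sum, π.sum_eq, map_one]

lemma eq_zero_of_pow_smul [NondegForm s] {M : Type*} [AddCommGroup M] [Module R M] (k : ℕ) {x : M}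
    (h : ∀ l v, s l v v ^ k • x = 0) : x = 0 := by
  obtain ⟨π⟩ := NondegForm.exists_partition s
  obtain ⟨c, hc⟩ := π.exists_pow k
  rw [← one_smul R x, ← hc, Finset.sum_smul]
  exact Finset.sum_eq_zero fun i _ => by rw [mul_smul, h, smul_zero]

/-- As `L ⊗ L` is symmetric for an invertible module `L`, two elements of `L` are exchanged by every
functional. -/
lemma dual_smul_comm [Module.Invertible R L] (f : L →ₗ[R] R) (l l' : L) :
    f l • l' = f l' • l := by
  have h := congrArg (TensorProduct.lid R L ∘ TensorProduct.map f LinearMap.id)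
    (Module.Invertible.tmul_comm (R := R) (m₁ := l) (m₂ := l'))
  simpa using h

lemma form_smul_comm [h : NondegForm s] (v w : E) (l l' : L) : s l v w • l' = s l' v w • l := by
  have := h.invertible
  exact dual_smul_comm ((s.flip v).flip w) l l'

lemma SqPartition.sum_smul [NondegForm s] (π : SqPartition s) (l : L) :
    ∑ i, s l (π.v i) (π.v i) • π.l i = l := by
  simp_rw [form_smul_comm (s := s) _ _ l]
  rw [← Finset.sum_smul, π.sum_eq, one_smul]

/-- The homomorphism `Sym L → R` induced by the functional `l ↦ σ_l(v, v)`. -/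
def evalSym (s : L →ₗ[R] E →ₗ[R] E →ₗ[R] R) (v : E) : SymmetricAlgebra R L →ₐ[R] R :=
  SymmetricAlgebra.lift ((s.flip v).flip v)

@[simp]
lemma evalSym_ι (v : E) (l : L) : evalSym s v (SymmetricAlgebra.ι R L l) = s l v v :=
  SymmetricAlgebra.lift_ι_apply _ _

lemma tpow_induction {k : ℕ} {p : SymmetricAlgebra R L → Prop}
    (mul : ∀ x ∈ tpow R L k, ∀ l, p (x * SymmetricAlgebra.ι R L l))
    (add : ∀ x y, p x → p y → p (x + y)) {x : SymmetricAlgebra R L} (hx : x ∈ tpow R L (k + 1)) :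
    p x := by
  rw [tpow, pow_succ] at hx
  induction hx using Submodule.mul_induction_on' with
  | mem_mul_mem x hx y hy =>
    obtain ⟨l, rfl⟩ := hy
    exact mul x hx l
  | add x _ y _ hx hy => exact add x y hx hy

lemma evalSym_smul_comm [NondegForm s] (v : E) {k : ℕ} {x y : SymmetricAlgebra R L}
    (hx : x ∈ tpow R L k) (hy : y ∈ tpow R L k) : evalSym s v x • y = evalSym s v y • x := by
  induction k generalizing x y with
  | zero =>
    rw [tpow, pow_zero, Submodule.mem_one] at hx hy
    obtain ⟨r, rfl⟩ := hx
    obtain ⟨t, rfl⟩ := hy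
    simp only [AlgHom.commutes, Algebra.algebraMap_self, RingHom.id_apply]
    rw [Algebra.smul_def, Algebra.smul_def, ← map_mul, ← map_mul, mul_comm]
  | succ k ih =>
    refine tpow_induction (p := fun x => evalSym s v x • y = evalSym s v y • x) ?_ ?_ hx
    · intro x hx l
      refine tpow_induction (p := fun y => evalSym s v (x * SymmetricAlgebra.ι R L l) • y =
        evalSym s v y • (x * SymmetricAlgebra.ι R L l)) ?_ ?_ hy
      · intro y hy l'
        rw [map_mul, map_mul, evalSym_ι, evalSym_ι, ← smul_mul_smul_comm, ← smul_mul_smul_comm,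
          ih hx hy, ← map_smul, ← map_smul, form_smul_comm]
      · intro y z hy hz
        rw [smul_add, hy, hz, map_add, add_smul]
    · intro x z hx hz
      rw [map_add, add_smul, hx, hz, smul_add]

lemma pow_mem_tpow (l : L) (k : ℕ) : SymmetricAlgebra.ι R L l ^ k ∈ tpow R L k :=
  Submodule.pow_mem_pow _ (LinearMap.mem_range_self _ l) k

end Form

/-! ### The squares of the generators and the grading of the homogeneous Clifford algebra -/

section Squares

variable {R E L : Type u} [CommRing R] [AddCommGroup E] [Module R E] [AddCommGroup L] [Module R L]
variable (s : L →ₗ[R] E →ₗ[R] E →ₗ[R] R)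

/-- The element `v²` of degree two. -/
abbrev HC.sq (v : E) : HC s := HC.gen s v * HC.gen s v

@[elab_as_elim]
lemma HC.induction {p : HC s → Prop} (algebraMap : ∀ r, p (algebraMap R _ r))
    (gen : ∀ v, p (HC.gen s v)) (mul : ∀ x y, p x → p y → p (x * y))
    (add : ∀ x y, p x → p y → p (x + y)) (x : HC s) : p x := by
  obtain ⟨x, rfl⟩ := RingQuot.mkAlgHom_surjective R (HCRel s) x
  change p (HC.mk s x)
  induction x using TensorAlgebra.induction with
  | algebraMap r => rw [AlgHom.commutes]; exact algebraMap r
  | ι v => exact gen v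
  | mul a b ha hb => rw [map_mul]; exact mul _ _ ha hb
  | add a b ha hb => rw [map_add]; exact add _ _ ha hb

lemma HC.mk_tensorTwo_eq_zero {t : E ⊗[R] E} (ht : t ∈ quadRel s) :
    HC.mk s (tensorTwo R E t) = 0 :=
  (RingQuot.mkAlgHom_rel R (s := HCRel s) ⟨⟨_, ht, rfl⟩, rfl⟩).trans (map_zero _)

variable {s}

lemma HC.smul_sq_comm [NondegForm s] (l : L) (v w : E) :
    s l v v • HC.sq s w = s l w w • HC.sq s v := by
  have ht : s l v v • w ⊗ₜ[R] w - s l w w • v ⊗ₜ[R] v ∈ quadRel s := by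
    refine Submodule.mem_inf.2 ⟨?_, ?_⟩
    · simp
    · rw [Submodule.mem_iInf]
      intro l'
      have h := congrArg (fun x => s x v v) (form_smul_comm (s := s) w w l l')
      simp only [map_smul, LinearMap.smul_apply, smul_eq_mul] at h
      simp only [LinearMap.mem_ker, map_sub, map_smul, TensorProduct.lift.tmul, smul_eq_mul]
      rw [h]
      ring
  have h := HC.mk_tensorTwo_eq_zero s ht
  simp only [map_sub, map_smul, tensorTwo, TensorProduct.lift.tmul, LinearMap.compl₁₂_apply,
    LinearMap.mul_apply', map_mul] at h
  exact sub_eq_zero.1 h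

/-- The squares commute with the generators: the commutator `[v², w]` vanishes for `w = v`, and the
general case follows by polarization, as the squares of two elements are proportional. -/
lemma HC.sq_mul_gen [h : NondegForm s] (u w : E) :
    HC.sq s u * HC.gen s w = HC.gen s w * HC.sq s u := by
  have h1 : ∀ (l : L) (v : E),
      s l v v • (HC.sq s u * HC.gen s v - HC.gen s v * HC.sq s u) = 0 := by
    intro l v
    rw [smul_sub, ← smul_mul_assoc (s l v v) (HC.sq s u), ← mul_smul_comm (s l v v) _ (HC.sq s u),
      HC.smul_sq_comm, smul_mul_assoc, mul_smul_comm, mul_assoc, sub_self]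
  have h2 : ∀ (l : L) (v : E), s l v v • (HC.sq s u * HC.gen s w - HC.gen s w * HC.sq s u) +
      (2 * s l v w) • (HC.sq s u * HC.gen s v - HC.gen s v * HC.sq s u) = 0 := by
    intro l v
    have h3 := h1 l (v + w)
    have h4 := h1 l (v - w)
    have h5 := h1 l w
    simp only [map_add, map_sub, LinearMap.add_apply, LinearMap.sub_apply] at h3 h4
    rw [h.symm l w v] at h3 h4
    -- expand the identity of `h1` for `v + w` and for `v - w`, and subtract
    refine h.two.smul_eq_zero.1 ?_
    have h6 := h1 l v
    generalize HC.gen s w = W at *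
    generalize HC.gen s v = V at *
    generalize HC.sq s u = U at *
    generalize s l v w = c at *
    generalize s l w w = d at *
    generalize s l v v = a at *
    have e : (2 : R) • (a • (U * W - W * U) + (2 * c) • (U * V - V * U)) =
        ((a + c + (c + d)) • (U * (V + W) - (V + W) * U)) -
        ((a - c - (c - d)) • (U * (V - W) - (V - W) * U)) - (2 : R) • (d • (U * W - W * U)) := by
      simp only [mul_add, add_mul, mul_sub, sub_mul]
      module
    rw [e, h3, h4, h5]
    simp
  refine sub_eq_zero.1 (eq_zero_of_pow_smul (s := s) 2 fun l v => ?_)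
  -- multiplied by `σ_l(v, v)`, the second term of `h2` vanishes by `h1`
  have h7 := congrArg (fun x => s l v v • x) (h2 l v)
  simp only [smul_add, smul_zero] at h7
  rw [smul_comm (s l v v) (2 * s l v w), h1, smul_zero, add_zero, smul_smul, ← pow_two] at h7
  exact h7

lemma HC.sq_mul [NondegForm s] (u : E) (x : HC s) : HC.sq s u * x = x * HC.sq s u := by
  induction x using HC.induction with
  | algebraMap r => exact (Algebra.commutes r _).symm
  | gen w => exact HC.sq_mul_gen u w
  | mul x y hx hy => rw [← mul_assoc, hx, mul_assoc, hy, mul_assoc]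
  | add x y hx hy => rw [mul_add, add_mul, hx, hy]

instance HC.gradedMonoid : SetLike.GradedMonoid (HC.deg s) :=
  inferInstanceAs (SetLike.GradedMonoid ((LinearMap.range (HC.gen s) ^ ·) : ℕ → Submodule R (HC s)))

variable (s) in
/-- The inclusion of the generators in the direct sum of the graded components. -/
def HC.genDirectSum : E →ₗ[R] ⨁ i, HC.deg s i :=
  DirectSum.lof R ℕ (fun i => HC.deg s i) 1 ∘ₗ
    (HC.gen s).codRestrict _ fun v => HC.gen_mem_deg s v

lemma HC.lift_genDirectSum_tensorTwo (t : E ⊗[R] E) : ∃ y,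
    TensorAlgebra.lift R (HC.genDirectSum s) (tensorTwo R E t) =
      DirectSum.lof R ℕ (fun i => HC.deg s i) 2 y := by
  induction t with
  | zero => exact ⟨0, by simp⟩
  | add x y hx hy =>
    obtain ⟨a, ha⟩ := hx
    obtain ⟨b, hb⟩ := hy
    exact ⟨a + b, by rw [map_add, map_add, ha, hb, map_add]⟩
  | tmul v w =>
    refine ⟨⟨HC.gen s v * HC.gen s w, HC.gen_mul_gen_mem_deg s v w⟩, ?_⟩
    simp only [tensorTwo, TensorProduct.lift.tmul, LinearMap.compl₁₂_apply, LinearMap.mul_apply',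
      map_mul, TensorAlgebra.lift_ι_apply]
    simp only [HC.genDirectSum, LinearMap.comp_apply, DirectSum.lof_eq_of, DirectSum.of_mul_of]
    rfl

lemma HC.coe_lift_genDirectSum (x : TensorAlgebra R E) :
    DirectSum.coeAlgHom (HC.deg s) (TensorAlgebra.lift R (HC.genDirectSum s) x) = HC.mk s x := by
  have : (DirectSum.coeAlgHom (HC.deg s)).comp (TensorAlgebra.lift R (HC.genDirectSum s)) =
      HC.mk s := by
    refine TensorAlgebra.hom_ext (LinearMap.ext fun v => ?_)
    simp only [LinearMap.comp_apply, AlgHom.toLinearMap_apply, AlgHom.comp_apply,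
      TensorAlgebra.lift_ι_apply]
    rw [HC.genDirectSum, LinearMap.comp_apply, DirectSum.lof_eq_of, DirectSum.coeAlgHom_of]
    rfl
  exact DFunLike.congr_fun this x

variable (s) in
/-- The decomposition of the homogeneous Clifford algebra in graded components. -/
def HC.toDirectSum : HC s →ₐ[R] ⨁ i, HC.deg s i :=
  RingQuot.liftAlgHom R ⟨TensorAlgebra.lift R (HC.genDirectSum s), by
    rintro _ _ ⟨⟨t, ht, rfl⟩, rfl⟩
    obtain ⟨y, hy⟩ := HC.lift_genDirectSum_tensorTwo (s := s) t
    have h := HC.coe_lift_genDirectSum (s := s) (tensorTwo R E t)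
    rw [hy, HC.mk_tensorTwo_eq_zero s ht, DirectSum.lof_eq_of, DirectSum.coeAlgHom_of] at h
    have h0 : y = 0 := Subtype.ext h
    rw [hy, h0, map_zero, map_zero]⟩

lemma HC.toDirectSum_gen (v : E) : HC.toDirectSum s (HC.gen s v) = HC.genDirectSum s v :=
  (RingQuot.liftAlgHom_mkAlgHom_apply R _ _ _).trans (TensorAlgebra.lift_ι_apply _ _)

instance HC.gradedAlgebra : GradedAlgebra (HC.deg s) :=
  GradedAlgebra.ofAlgHom _ (HC.toDirectSum s)
    (by
      refine AlgHom.ext fun x => ?_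
      obtain ⟨x, rfl⟩ := RingQuot.mkAlgHom_surjective R (HCRel s) x
      refine (congrArg (DirectSum.coeAlgHom (HC.deg s))
        (RingQuot.liftAlgHom_mkAlgHom_apply R _ _ _)).trans ?_
      exact HC.coe_lift_genDirectSum x)
    fun i x => by
      obtain ⟨x, hx⟩ := x
      dsimp only [Subtype.coe_mk, DirectSum.lof_eq_of]
      change x ∈ LinearMap.range (HC.gen s) ^ i at hx
      induction hx using Submodule.pow_induction_on_left' with
      | algebraMap r =>
        rw [AlgHom.commutes, DirectSum.algebraMap_apply]; rfl
      | add x y i hx hy ihx ihy =>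
        rw [map_add, ihx, ihy, ← map_add]
        rfl
      | mem_mul m hm i x hx ih =>
        obtain ⟨v, rfl⟩ := hm
        rw [map_mul, ih, HC.toDirectSum_gen, HC.genDirectSum, LinearMap.comp_apply,
          DirectSum.lof_eq_of, DirectSum.of_mul_of]
        exact DirectSum.of_eq_of_gradedMonoid_eq (Sigma.subtype_ext (add_comm _ _) rfl)

lemma HC.deg_fg [h : NondegForm s] (j : ℕ) : (HC.deg s j).FG := by
  have := h.finite
  exact Submodule.FG.pow ((LinearMap.range_eq_map (HC.gen s)) ▸ Module.Finite.fg_top.map _) j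

lemma HC.sq_mem_deg (v : E) : HC.sq s v ∈ HC.deg s 2 := HC.gen_mul_gen_mem_deg s v v

variable (s) in
/-- The submodule spanned by the products `v² a`, where `a` has degree `j`. -/
def HC.sqMul (j : ℕ) : Submodule R (HC s) :=
  Submodule.span R {y | ∃ v, ∃ a ∈ HC.deg s j, HC.sq s v * a = y}

variable (s) in
/-- The two-sided ideal of the elements `∑ v_i² a_i`. -/
def HC.sqIdeal [NondegForm s] : TwoSidedIdeal (HC s) :=
  TwoSidedIdeal.mk' (Submodule.span R {y | ∃ v a, HC.sq s v * a = y} : Submodule R (HC s))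
    (zero_mem _) add_mem neg_mem
    (by
      intro x y hy
      rw [SetLike.mem_coe] at hy ⊢
      induction hy using Submodule.span_induction with
      | zero => rw [mul_zero]; exact zero_mem _
      | add y z _ _ hy hz => rw [mul_add]; exact add_mem hy hz
      | smul r y _ hy => rw [mul_smul_comm]; exact Submodule.smul_mem _ _ hy
      | mem y hy =>
        obtain ⟨v, a, rfl⟩ := hy
        exact Submodule.subset_span ⟨v, x * a, by rw [← mul_assoc, HC.sq_mul, mul_assoc]⟩)
    (by
      intro y x hy
      rw [SetLike.mem_coe] at hy ⊢
      induction hy using Submodule.span_induction with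
      | zero => rw [zero_mul]; exact zero_mem _
      | add y z _ _ hy hz => rw [add_mul]; exact add_mem hy hz
      | smul r y _ hy => rw [smul_mul_assoc]; exact Submodule.smul_mem _ _ hy
      | mem y hy =>
        obtain ⟨v, a, rfl⟩ := hy
        exact Submodule.subset_span ⟨v, a * x, by rw [← mul_assoc]⟩)

lemma HC.mem_sqIdeal [NondegForm s] {x : HC s} :
    x ∈ HC.sqIdeal s ↔ x ∈ Submodule.span R {y | ∃ v a, HC.sq s v * a = y} :=
  TwoSidedIdeal.mem_mk' _ _ _ _ _ _ _

/-- The components of large degree are contained in the ideal generated by the squares, because the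
quotient by this ideal is a quotient of the exterior algebra of `E`. -/
lemma HC.exists_deg_le_sqIdeal [h : NondegForm s] :
    ∃ N, ∀ x ∈ HC.deg s (N + 2), x ∈ HC.sqIdeal s := by
  have := h.finite
  obtain ⟨N, e, he⟩ := Module.Finite.exists_fin (R := R) (M := E)
  refine ⟨N, fun x hx => ?_⟩
  let p : HC s →ₐ[R] (HC.sqIdeal s).ringCon.Quotient := RingCon.mkₐ R _
  have hp : ∀ y, p y = 0 ↔ y ∈ HC.sqIdeal s := by
    intro y
    rw [TwoSidedIdeal.mem_iff, ← map_zero p]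
    exact RingCon.eq _
  let g : ExteriorAlgebra R E →ₐ[R] (HC.sqIdeal s).ringCon.Quotient :=
    ExteriorAlgebra.lift R ⟨p.toLinearMap ∘ₗ HC.gen s, fun v => by
      refine (map_mul p _ _).symm.trans ((hp _).2 (HC.mem_sqIdeal.2 (Submodule.subset_span ?_)))
      exact ⟨v, 1, mul_one _⟩⟩
  have hg : g.toLinearMap ∘ₗ ExteriorAlgebra.ι R = p.toLinearMap ∘ₗ HC.gen s :=
    LinearMap.ext fun v => ExteriorAlgebra.lift_ι_apply R _ _ v
  -- the exterior powers of degree larger than the number of generators of `E` vanish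
  have hbot : LinearMap.range (ExteriorAlgebra.ι R : E →ₗ[R] _) ^ (N + 2) = ⊥ := by
    have h1 := exteriorPower.ιMulti_family_span_fixedDegree_of_span (R := R) (n := N + 2) (v := e) he
    have h2 : IsEmpty (Set.powersetCard (Fin N) (N + 2)) := by
      refine ⟨fun t => ?_⟩
      have h3 := Finset.card_le_univ (t : Finset (Fin N))
      rw [t.2, Fintype.card_fin] at h3
      omega
    rw [Set.range_eq_empty, Submodule.span_empty] at h1
    exact h1.symm
  refine (hp x).1 ?_
  have h3 : p x ∈ Submodule.map p.toLinearMap (HC.deg s (N + 2)) := ⟨x, hx, rfl⟩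
  rw [HC.deg, Submodule.map_pow, ← LinearMap.range_comp, ← hg, LinearMap.range_comp,
    ← Submodule.map_pow, hbot, Submodule.map_bot] at h3
  exact h3

lemma HC.exists_deg_le_sqMul [NondegForm s] : ∃ N, HC.deg s (N + 2) ≤ HC.sqMul s N := by
  obtain ⟨N, hN⟩ := HC.exists_deg_le_sqIdeal (s := s)
  refine ⟨N, fun x hx => ?_⟩
  have h := HC.mem_sqIdeal.1 (hN x hx)
  rw [← DirectSum.decompose_of_mem_same (HC.deg s) hx]
  clear hx
  induction h using Submodule.span_induction with
  | zero => simp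
  | add y z _ _ hy hz =>
    rw [DirectSum.decompose_add, DirectSum.add_apply, Submodule.coe_add]
    exact add_mem hy hz
  | smul r y _ hy =>
    rw [DirectSum.decompose_smul, DirectSum.smul_apply, Submodule.coe_smul]
    exact Submodule.smul_mem _ _ hy
  | mem y hy =>
    obtain ⟨v, a, rfl⟩ := hy
    rw [add_comm, DirectSum.coe_decompose_mul_add_of_left_mem (HC.deg s) (HC.sq_mem_deg v)]
    exact Submodule.subset_span ⟨v, _, SetLike.coe_mem _, rfl⟩

end Squares

/-! ### Graded modules and the canonical central element -/

section GradedModules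

variable {R E L : Type u} [CommRing R] [AddCommGroup E] [Module R E] [AddCommGroup L] [Module R L]
variable {s : L →ₗ[R] E →ₗ[R] E →ₗ[R] R} (M : GrModule s)

/-- The projection of a graded module to its component of degree `j`. -/
def GrModule.proj (j : ℤ) : M →ₗ[R] M :=
  (M.grade j).subtype ∘ₗ DirectSum.component R ℤ (fun i => M.grade i) j ∘ₗ
    (LinearEquiv.ofBijective (DirectSum.coeLinearMap M.grade) M.isInternal).symm.toLinearMap

variable {M}

lemma GrModule.proj_mem (j : ℤ) (m : M) : M.proj j m ∈ M.grade j := SetLike.coe_mem _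

lemma GrModule.proj_coe (i j : ℤ) (m : M.grade i) :
    M.proj j (m : M) = if i = j then (m : M) else 0 := by
  have h : (LinearEquiv.ofBijective (DirectSum.coeLinearMap M.grade) M.isInternal).symm (m : M) =
      DirectSum.lof R ℤ (fun i => M.grade i) i m := by
    rw [LinearEquiv.symm_apply_eq]
    exact (DirectSum.coeLinearMap_lof _ _ _).symm
  simp only [GrModule.proj, LinearMap.comp_apply, LinearEquiv.coe_coe, h]
  split_ifs with hij
  · subst hij
    rw [DirectSum.component.lof_self]
    rfl
  · rw [DirectSum.component.of, dif_neg hij]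
    rfl

lemma GrModule.proj_of_mem {j : ℤ} {m : M} (hm : m ∈ M.grade j) : M.proj j m = m := by
  rw [GrModule.proj_coe j j ⟨m, hm⟩, if_pos rfl]

lemma GrModule.proj_of_mem_ne {i j : ℤ} (h : i ≠ j) {m : M} (hm : m ∈ M.grade i) :
    M.proj j m = 0 := by
  rw [GrModule.proj_coe i j ⟨m, hm⟩, if_neg h]

lemma GrModule.grade_induction {p : M → Prop} (mem : ∀ j, ∀ m ∈ M.grade j, p m)
    (add : ∀ x y, p x → p y → p (x + y)) (m : M) : p m := by
  have h : m ∈ ⨆ j, M.grade j := by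
    rw [M.isInternal.submodule_iSup_eq_top]; trivial
  induction h using Submodule.iSup_induction' with
  | zero => exact mem 0 0 (zero_mem _)
  | add x y _ _ hx hy => exact add x y hx hy
  | mem k x hx => exact mem k x hx

lemma GrModule.proj_op_smul (j : ℤ) {i : ℕ} {b : HC s} (hb : b ∈ HC.deg s i) (m : M) :
    M.proj (j + i) (MulOpposite.op b • m) = MulOpposite.op b • M.proj j m := by
  induction m using GrModule.grade_induction with
  | add x y hx hy => rw [smul_add, map_add, map_add, smul_add, hx, hy]
  | mem k m hm =>
    by_cases hk : k = j
    · subst hk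
      rw [proj_of_mem hm, proj_of_mem (M.act_mem hm hb)]
    · rw [proj_of_mem_ne hk hm, smul_zero,
        proj_of_mem_ne (fun h => hk (by omega)) (M.act_mem hm hb)]

lemma GrModule.exists_bound (m : M) : ∃ D : ℤ, ∀ j, D < j → M.proj j m = 0 := by
  induction m using GrModule.grade_induction with
  | add x y hx hy =>
    obtain ⟨a, ha⟩ := hx
    obtain ⟨b, hb⟩ := hy
    exact ⟨max a b, fun j hj => by rw [map_add, ha j (by omega), hb j (by omega), add_zero]⟩
  | mem k m hm => exact ⟨k, fun j hj => proj_of_mem_ne (by omega) hm⟩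

lemma GrModule.exists_bound_of_fg {P : Submodule R M} (hP : P.FG) :
    ∃ D : ℤ, ∀ m ∈ P, ∀ j, D < j → M.proj j m = 0 := by
  obtain ⟨T, rfl⟩ := hP
  choose d hd using fun m : M => GrModule.exists_bound m
  obtain ⟨D, hD⟩ := (T.image d).bddAbove
  refine ⟨D, fun m hm j hj => ?_⟩
  induction hm using Submodule.span_induction with
  | zero => rw [map_zero]
  | add x y _ _ hx hy => rw [map_add, hx, hy, add_zero]
  | smul r x _ hx => rw [map_smul, hx, smul_zero]
  | mem x hx => exact hd x j ((hD (Finset.mem_coe.2 (Finset.mem_image_of_mem d hx))).trans_lt hj)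

variable (M) in
/-- The submodule `M_j ⊗ L^k` of `M ⊗ Sym L`. -/
def piece (j : ℤ) (k : ℕ) : Submodule R (M ⊗[R] SymmetricAlgebra R L) :=
  Submodule.map₂ (TensorProduct.mk R M (SymmetricAlgebra R L)) (M.grade j) (tpow R L k)

lemma tmul_mem_piece {j : ℤ} {k : ℕ} {m : M} {y : SymmetricAlgebra R L} (hm : m ∈ M.grade j)
    (hy : y ∈ tpow R L k) : m ⊗ₜ[R] y ∈ piece M j k :=
  Submodule.apply_mem_map₂ _ hm hy

lemma piece_le_colimSrc (k : ℕ) : piece M (2 * k) k ≤ colimSrc M :=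
  le_iSup (fun k : ℕ => piece M (2 * k) k) k

/-- The map `M ⊗ Sym L → M` induced by `Sym L → R`, `l ↦ σ_l(v, v)`. -/
def evalRight (M : GrModule s) (v : E) : M ⊗[R] SymmetricAlgebra R L →ₗ[R] M :=
  (TensorProduct.rid R M).toLinearMap ∘ₗ TensorProduct.map LinearMap.id (evalSym s v).toLinearMap

@[simp]
lemma evalRight_tmul (v : E) (m : M) (y : SymmetricAlgebra R L) :
    evalRight M v (m ⊗ₜ y) = evalSym s v y • m := by
  simp [evalRight]

lemma evalRight_mem (v : E) {j : ℤ} {k : ℕ} {x : M ⊗[R] SymmetricAlgebra R L}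
    (hx : x ∈ piece M j k) : evalRight M v x ∈ M.grade j :=
  map₂_induction (p := fun x => evalRight M v x ∈ M.grade j) (by simp)
    (fun x y hx hy => by rw [map_add]; exact add_mem hx hy)
    (fun m hm y hy => by
      change evalRight M v (m ⊗ₜ y) ∈ _
      rw [evalRight_tmul]; exact Submodule.smul_mem _ _ hm) hx

/-- An element of `M_j ⊗ L^k` is determined by its images in `M_j` under functionals on `L^k`. -/
lemma piece_eq_sum [NondegForm s] (π : SqPartition s) {k : ℕ} {c : Fin π.r → R}
    (hc : ∑ i, c i * s (π.l i) (π.v i) (π.v i) ^ k = 1) {j : ℤ}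
    {x : M ⊗[R] SymmetricAlgebra R L} (hx : x ∈ piece M j k) :
    ∑ i, c i • (evalRight M (π.v i) x) ⊗ₜ[R] (SymmetricAlgebra.ι R L (π.l i) ^ k) = x :=
  map₂_induction (p := fun x =>
      ∑ i, c i • (evalRight M (π.v i) x) ⊗ₜ[R] (SymmetricAlgebra.ι R L (π.l i) ^ k) = x) (by simp)
    (fun x y hx hy => by
      simp only [map_add, TensorProduct.add_tmul, smul_add, Finset.sum_add_distrib, hx, hy])
    (fun m hm y hy => by
      change ∑ i, c i • (evalRight M (π.v i) (m ⊗ₜ y)) ⊗ₜ[R] _ = m ⊗ₜ y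
      have h : ∀ i, c i • (evalRight M (π.v i) (m ⊗ₜ y)) ⊗ₜ[R]
          (SymmetricAlgebra.ι R L (π.l i) ^ k) =
          (c i * s (π.l i) (π.v i) (π.v i) ^ k) • m ⊗ₜ[R] y := by
        intro i
        rw [evalRight_tmul, TensorProduct.smul_tmul, evalSym_smul_comm _ hy (pow_mem_tpow _ k),
          TensorProduct.tmul_smul, map_pow, evalSym_ι, mul_smul]
      rw [Finset.sum_congr rfl fun i _ => h i, ← Finset.sum_smul, hc, one_smul]) hx

lemma eq_zero_of_tmul_eq_zero [NondegForm s] (k : ℕ) {m : M}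
    (h : ∀ l : L, m ⊗ₜ[R] (SymmetricAlgebra.ι R L l ^ k) = 0) : m = 0 :=
  eq_zero_of_pow_smul (s := s) k fun l v => by
    have := congrArg (evalRight M v) (h l)
    rwa [evalRight_tmul, map_pow, evalSym_ι, map_zero] at this

/-- The canonical element `∑ v_i² ⊗ l_i` of `L^* ⊗ L ⊆ HC_2 ⊗ L`. -/
def kappa (π : SqPartition s) : HCL s := ∑ i, HC.sq s (π.v i) ⊗ₜ[R] SymmetricAlgebra.ι R L (π.l i)

lemma sq_tmul_ι [NondegForm s] (π : SqPartition s) (v : E) (l : L) :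
    (HC.sq s v ⊗ₜ[R] SymmetricAlgebra.ι R L l : HCL s) = s l v v • kappa π := by
  rw [kappa, Finset.smul_sum]
  have h : ∀ i, s l v v • (HC.sq s (π.v i) ⊗ₜ[R] SymmetricAlgebra.ι R L (π.l i) : HCL s) =
      HC.sq s v ⊗ₜ SymmetricAlgebra.ι R L (s l (π.v i) (π.v i) • π.l i) := by
    intro i
    rw [TensorProduct.smul_tmul', HC.smul_sq_comm, TensorProduct.smul_tmul, map_smul]
  rw [Finset.sum_congr rfl fun i _ => h i, ← TensorProduct.tmul_sum, ← map_sum, π.sum_smul]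

lemma kappa_mul [NondegForm s] (π : SqPartition s) (x : HC s ⊗[R] SymmetricAlgebra R L) :
    kappa π * x = x * kappa π := by
  induction x with
  | zero => simp
  | add x y hx hy => rw [mul_add, add_mul, hx, hy]
  | tmul b y =>
    simp only [kappa, Finset.sum_mul, Finset.mul_sum, Algebra.TensorProduct.tmul_mul_tmul,
      HC.sq_mul, mul_comm y]

lemma kappa_mem_evenAlg (π : SqPartition s) : kappa π ∈ evenAlg s :=
  sum_mem fun i _ => (sqGen s (π.v i) (π.l i)).2

variable (M) in
/-- The action of the canonical element `∑ v_i² ⊗ l_i` on `M ⊗ Sym L`. -/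
def actKappa (π : SqPartition s) : Module.End R (M ⊗[R] SymmetricAlgebra R L) := actL M (kappa π)

lemma actL_sq [NondegForm s] (π : SqPartition s) (v : E) (l : L)
    (x : M ⊗[R] SymmetricAlgebra R L) :
    actL M (HC.sq s v ⊗ₜ[R] SymmetricAlgebra.ι R L l) x = s l v v • actKappa M π x := by
  rw [sq_tmul_ι π, map_smul]
  rfl

lemma actKappa_tmul (π : SqPartition s) (m : M) (y : SymmetricAlgebra R L) :
    actKappa M π (m ⊗ₜ y) = ∑ i, (MulOpposite.op (HC.sq s (π.v i)) • m) ⊗ₜ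
      (y * SymmetricAlgebra.ι R L (π.l i)) := by
  rw [actKappa, kappa, map_sum, LinearMap.sum_apply]
  exact Finset.sum_congr rfl fun i _ => actL_tmul M _ _ _ _

lemma actKappa_actL [NondegForm s] (π : SqPartition s) (a : HCL s)
    (x : M ⊗[R] SymmetricAlgebra R L) :
    actKappa M π (actL M a x) = actL M a (actKappa M π x) := by
  rw [actKappa, ← actL_mul, ← actL_mul, kappa_mul]

lemma actKappa_mem_colimSrc (π : SqPartition s) {x : M ⊗[R] SymmetricAlgebra R L}
    (hx : x ∈ colimSrc M) : actKappa M π x ∈ colimSrc M :=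
  actL_mem_colimSrc M (kappa_mem_evenAlg π) hx

lemma actKappa_mem_piece (π : SqPartition s) {j : ℤ} {k : ℕ} {x : M ⊗[R] SymmetricAlgebra R L}
    (hx : x ∈ piece M j k) : actKappa M π x ∈ piece M (j + 2) (k + 1) :=
  map₂_induction (p := fun x => actKappa M π x ∈ piece M (j + 2) (k + 1)) (by simp)
    (fun x y hx hy => by rw [map_add]; exact add_mem hx hy)
    (fun m hm y hy => by
      change actKappa M π (m ⊗ₜ y) ∈ _
      rw [actKappa_tmul]
      exact sum_mem fun i _ => tmul_mem_piece (M.act_mem hm (HC.sq_mem_deg _))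
        (mul_mem_tpow hy (ι_mem_tpow _))) hx

/-- The relations defining the direct limit identify `x` with its product with the canonical
element. -/
lemma mem_colimRel_iff [NondegForm s] (π : SqPartition s) {x : M ⊗[R] SymmetricAlgebra R L} :
    x ∈ colimRel M ↔ ∃ y ∈ colimSrc M, actKappa M π y - y = x := by
  constructor
  · intro hx
    have hle : colimRel M ≤ (colimSrc M).map (actKappa M π - LinearMap.id) := by
      refine Submodule.span_le.2 ?_
      rintro _ ⟨x, hx, v, l, a, ha, rfl⟩
      refine ⟨s l v v • actL M a x, Submodule.smul_mem _ _ (actL_mem_colimSrc M ha hx), ?_⟩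
      change actKappa M π (s l v v • actL M a x) - s l v v • actL M a x =
        actL M a (actL M (HC.sq s v ⊗ₜ[R] SymmetricAlgebra.ι R L l) x - s l v v • x)
      rw [actL_sq π, map_smul, map_sub, map_smul, map_smul, actKappa_actL]
    obtain ⟨y, hy, hyx⟩ := hle hx
    exact ⟨y, hy, hyx⟩
  · rintro ⟨y, hy, rfl⟩
    have h1 : ∀ x, actL M 1 x = x := fun x => by
      have := actL_algebraMap M 1 x
      rwa [map_one, one_smul] at this
    have : actKappa M π y - y = ∑ i, actL M 1 (actL M (sqGen s (π.v i) (π.l i) : HCL s) y -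
        s (π.l i) (π.v i) (π.v i) • y) := by
      simp only [h1, Finset.sum_sub_distrib, ← Finset.sum_smul, π.sum_eq, one_smul]
      rw [actKappa, kappa, map_sum, LinearMap.sum_apply]
      rfl
    rw [this]
    exact sum_mem fun i _ => Submodule.subset_span ⟨y, hy, _, _, 1, one_mem _, rfl⟩

variable (M) in
/-- The projection of `M ⊗ Sym L` to `M_j ⊗ Sym L`. -/
def projTensor (j : ℤ) : Module.End R (M ⊗[R] SymmetricAlgebra R L) :=
  TensorProduct.map (M.proj j) LinearMap.id

lemma projTensor_actKappa (π : SqPartition s) (j : ℤ) (x : M ⊗[R] SymmetricAlgebra R L) :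
    projTensor M (j + 2) (actKappa M π x) = actKappa M π (projTensor M j x) := by
  induction x with
  | zero => simp
  | add x y hx hy => simp only [map_add, hx, hy]
  | tmul m y =>
    rw [actKappa_tmul, map_sum]
    simp only [projTensor, TensorProduct.map_tmul, LinearMap.id_apply]
    rw [actKappa_tmul]
    refine Finset.sum_congr rfl fun i _ => ?_
    rw [← GrModule.proj_op_smul j (HC.sq_mem_deg (s := s) (π.v i)) m]
    rfl

lemma projTensor_of_mem {j : ℤ} {k : ℕ} {x : M ⊗[R] SymmetricAlgebra R L} (hx : x ∈ piece M j k) :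
    projTensor M j x = x :=
  map₂_induction (p := fun x => projTensor M j x = x) (map_zero _)
    (fun x y hx hy => by rw [map_add, hx, hy])
    (fun m hm y hy => by
      change M.proj j m ⊗ₜ[R] y = m ⊗ₜ[R] y
      rw [GrModule.proj_of_mem hm]) hx

lemma projTensor_of_mem_ne {i j : ℤ} (h : i ≠ j) {k : ℕ} {x : M ⊗[R] SymmetricAlgebra R L}
    (hx : x ∈ piece M i k) : projTensor M j x = 0 :=
  map₂_induction (p := fun x => projTensor M j x = 0) (map_zero _)
    (fun x y hx hy => by rw [map_add, hx, hy, add_zero])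
    (fun m hm y hy => by
      change M.proj j m ⊗ₜ[R] y = 0
      rw [GrModule.proj_of_mem_ne h hm, TensorProduct.zero_tmul]) hx

lemma exists_bound_tensor (x : M ⊗[R] SymmetricAlgebra R L) :
    ∃ D : ℤ, ∀ j, D < j → projTensor M j x = 0 := by
  induction x with
  | zero => exact ⟨0, fun j _ => map_zero _⟩
  | add x y hx hy =>
    obtain ⟨a, ha⟩ := hx
    obtain ⟨b, hb⟩ := hy
    exact ⟨max a b, fun j hj => by rw [map_add, ha j (by omega), hb j (by omega), add_zero]⟩
  | tmul m y =>
    obtain ⟨D, hD⟩ := GrModule.exists_bound m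
    refine ⟨D, fun j hj => ?_⟩
    change M.proj j m ⊗ₜ[R] y = 0
    rw [hD j hj, TensorProduct.zero_tmul]

lemma projTensor_colimSrc_neg {x : M ⊗[R] SymmetricAlgebra R L} (hx : x ∈ colimSrc M) {j : ℤ}
    (hj : j < 0) : projTensor M j x = 0 :=
  colimSrc_induction M (p := fun x => projTensor M j x = 0) (map_zero _)
    (fun x y hx hy => by rw [map_add, hx, hy, add_zero])
    (fun k m y hm hy => projTensor_of_mem_ne (by omega) (tmul_mem_piece hm hy)) hx

/-- An element of `M_{2k} ⊗ L^k` vanishes in the direct limit only if one of its images under the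
transition maps vanishes. -/
lemma exists_actKappa_pow_eq_zero [NondegForm s] (π : SqPartition s) {k : ℕ}
    {x : M ⊗[R] SymmetricAlgebra R L} (hx : x ∈ piece M (2 * k) k) (h : x ∈ colimRel M) :
    ∃ r, (actKappa M π ^ r) x = 0 := by
  obtain ⟨y, hy, hyx⟩ := (mem_colimRel_iff π).1 h
  -- Write `x = κ y - y` and compare the components: those of `y` below `2k` vanish, the component
  -- of degree `2k` is `-x`, and then the component of degree `2k + 2r` is `-κ^r x`.
  have hstep : ∀ j : ℤ, j ≠ 2 * k → projTensor M j y = actKappa M π (projTensor M (j - 2) y) := by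
    intro j hj
    have := congrArg (projTensor M j) hyx
    rw [map_sub, projTensor_of_mem_ne hj.symm hx, sub_eq_zero] at this
    rw [← this, ← projTensor_actKappa, sub_add_cancel]
  have hlow : ∀ n : ℕ, n < k → projTensor M (2 * n) y = 0 := by
    intro n hn
    induction n with
    | zero =>
      rw [hstep _ (by omega), projTensor_colimSrc_neg hy (by simp), map_zero]
    | succ n ih =>
      rw [hstep _ (by push_cast; omega)]
      have e : (2 * ((n + 1 : ℕ) : ℤ) - 2) = 2 * (n : ℤ) := by push_cast; ring
      rw [e, ih (by omega), map_zero]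
  have hk : projTensor M (2 * k) y = - x := by
    have h1 := congrArg (projTensor M (2 * k)) hyx
    have e : (2 * (k : ℤ)) = 2 * k - 2 + 2 := by ring
    have h2 : projTensor M (2 * k) (actKappa M π y) = 0 := by
      rw [e, projTensor_actKappa]
      rcases Nat.eq_zero_or_pos k with rfl | hk
      · rw [projTensor_colimSrc_neg hy (by simp), map_zero]
      · have e' : (2 * (k : ℤ) - 2) = 2 * ((k - 1 : ℕ) : ℤ) := by omega
        rw [e', hlow _ (by omega), map_zero]
    rw [map_sub, h2, zero_sub, projTensor_of_mem hx] at h1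
    rw [← h1, neg_neg]
  have hhigh : ∀ r : ℕ, projTensor M (2 * k + 2 * r) y = - (actKappa M π ^ r) x := by
    intro r
    induction r with
    | zero => simpa using hk
    | succ r ih =>
      rw [hstep _ (by push_cast; omega)]
      have e : (2 * (k : ℤ) + 2 * ((r + 1 : ℕ) : ℤ) - 2) = 2 * k + 2 * r := by push_cast; ring
      rw [e, ih, map_neg, pow_succ', Module.End.mul_apply]
  obtain ⟨D, hD⟩ := exists_bound_tensor y
  refine ⟨D.toNat + 1, ?_⟩
  have := hhigh (D.toNat + 1)
  rw [hD _ (by push_cast; omega)] at this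
  exact neg_eq_zero.1 this.symm

end GradedModules

/-! ### The direct limit -/

section Limit

variable {R E L : Type u} [CommRing R] [AddCommGroup E] [Module R E] [AddCommGroup L] [Module R L]
variable {s : L →ₗ[R] E →ₗ[R] E →ₗ[R] R} {M : GrModule s}

lemma DirLim.proj_eq_zero_iff (x : colimSrc M) :
    DirLim.proj M x = 0 ↔ (x : M ⊗[R] SymmetricAlgebra R L) ∈ colimRel M :=
  Submodule.Quotient.mk_eq_zero _

lemma DirLim.proj_actKappa [NondegForm s] (π : SqPartition s) (x : colimSrc M) :
    DirLim.proj M ⟨actKappa M π x, actKappa_mem_colimSrc π x.2⟩ = DirLim.proj M x := by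
  rw [← sub_eq_zero, ← map_sub, DirLim.proj_eq_zero_iff]
  exact (mem_colimRel_iff π).2 ⟨x, x.2, rfl⟩

lemma DirLim.proj_surjective : Function.Surjective (DirLim.proj M) := Submodule.mkQ_surjective _

variable (M) in
/-- The canonical map `M_{2k} ⊗ L^k → lim M_{2k} ⊗ L^k`. -/
def DirLim.ofPiece (k : ℕ) : piece M (2 * k) k →ₗ[R] DirLim M :=
  DirLim.proj M ∘ₗ Submodule.inclusion (piece_le_colimSrc k)

lemma DirLim.range_ofPiece_le [NondegForm s] (k : ℕ) :
    LinearMap.range (DirLim.ofPiece M k) ≤ LinearMap.range (DirLim.ofPiece M (k + 1)) := by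
  obtain ⟨π⟩ := NondegForm.exists_partition s
  rintro _ ⟨⟨x, hx⟩, rfl⟩
  have h := actKappa_mem_piece π hx
  have e : 2 * (k : ℤ) + 2 = 2 * ((k + 1 : ℕ) : ℤ) := by push_cast; ring
  rw [e] at h
  exact ⟨⟨_, h⟩, DirLim.proj_actKappa π ⟨x, piece_le_colimSrc k hx⟩⟩

lemma DirLim.range_ofPiece_mono [NondegForm s] :
    Monotone fun k => LinearMap.range (DirLim.ofPiece M k) :=
  monotone_nat_of_le_succ DirLim.range_ofPiece_le

lemma DirLim.exists_mem_range [NondegForm s] (y : DirLim M) :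
    ∃ k, ∀ k' ≥ k, y ∈ LinearMap.range (DirLim.ofPiece M k') := by
  induction y using DirLim.induction with
  | zero => exact ⟨0, fun _ _ => zero_mem _⟩
  | add x y hx hy =>
    obtain ⟨a, ha⟩ := hx
    obtain ⟨b, hb⟩ := hy
    exact ⟨max a b, fun k hk => add_mem (ha k (by omega)) (hb k (by omega))⟩
  | mk k m hm l hl =>
    exact ⟨k, fun k' hk' => DirLim.range_ofPiece_mono hk' ⟨⟨_, tmul_mem_piece hm hl⟩, rfl⟩⟩

end Limit

/-! ### Finitely generated graded modules -/

section Finite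

variable {R E L : Type u} [CommRing R] [AddCommGroup E] [Module R E] [AddCommGroup L] [Module R L]
variable {s : L →ₗ[R] E →ₗ[R] E →ₗ[R] R} {M : GrModule s}

/-- The map `b ↦ m b`. -/
def GrModule.orbit (m : M) : HC s →ₗ[R] M where
  toFun b := MulOpposite.op b • m
  map_add' a b := by rw [MulOpposite.op_add, add_smul]
  map_smul' r b := by rw [MulOpposite.op_smul, smul_assoc, RingHom.id_apply]

@[simp]
lemma GrModule.orbit_apply (m : M) (b : HC s) : M.orbit m b = MulOpposite.op b • m := rfl

lemma GrModule.proj_op_smul_of_mem {d : ℤ} {t : M} (ht : t ∈ M.grade d) (b : HC s) (i : ℕ) :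
    M.proj (d + i) (MulOpposite.op b • t) =
      MulOpposite.op (DirectSum.decompose (HC.deg s) b i : HC s) • t := by
  refine DirectSum.Decomposition.inductionOn (HC.deg s) (motive := fun b =>
    M.proj (d + i) (MulOpposite.op b • t) =
      MulOpposite.op (DirectSum.decompose (HC.deg s) b i : HC s) • t) ?_ ?_ ?_ b
  · simp
  · intro j b
    by_cases h : j = i
    · subst h
      rw [GrModule.proj_of_mem (M.act_mem ht b.2), DirectSum.decompose_of_mem_same _ b.2]
    · rw [GrModule.proj_of_mem_ne (by omega) (M.act_mem ht b.2),
        DirectSum.decompose_of_mem_ne _ b.2 h, MulOpposite.op_zero, zero_smul]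
  · intro a b ha hb
    rw [MulOpposite.op_add, add_smul, map_add, ha, hb, DirectSum.decompose_add,
      DirectSum.add_apply, Submodule.coe_add, MulOpposite.op_add, add_smul]

lemma GrModule.proj_op_smul_of_lt {d j : ℤ} {t : M} (ht : t ∈ M.grade d) (b : HC s) (hj : j < d) :
    M.proj j (MulOpposite.op b • t) = 0 := by
  refine DirectSum.Decomposition.inductionOn (HC.deg s) (motive := fun b =>
    M.proj j (MulOpposite.op b • t) = 0) ?_ ?_ ?_ b
  · simp
  · intro i b
    exact GrModule.proj_of_mem_ne (by omega) (M.act_mem ht b.2)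
  · intro a b ha hb
    rw [MulOpposite.op_add, add_smul, map_add, ha, hb, add_zero]

lemma GrModule.exists_generators (M : GrModule s) [Module.Finite (HC s)ᵐᵒᵖ M] :
    ∃ (T : Finset M) (d : M → ℤ), (∀ t ∈ T, t ∈ M.grade (d t)) ∧
      Submodule.span (HC s)ᵐᵒᵖ (T : Set M) = ⊤ := by
  have h1 : Submodule.span (HC s)ᵐᵒᵖ {t : M | ∃ d, t ∈ M.grade d} = ⊤ := by
    refine eq_top_iff.2 fun m _ => ?_
    induction m using GrModule.grade_induction with
    | mem j m hm => exact Submodule.subset_span ⟨j, hm⟩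
    | add x y hx hy => exact add_mem (hx trivial) (hy trivial)
  have h2 : (Submodule.span (HC s)ᵐᵒᵖ {t : M | ∃ d, t ∈ M.grade d}).FG :=
    h1 ▸ Module.Finite.fg_top
  obtain ⟨T, hT, hT'⟩ := (Submodule.fg_span_iff_fg_span_finset_subset _).1 h2
  choose! d hd using fun t (ht : t ∈ T) => hT (Finset.mem_coe.2 ht)
  exact ⟨T, d, hd, hT'.symm.trans h1⟩

/-- The submodule `t A_i`, where `A_i = 0` for negative `i`. -/
def GrModule.genPiece (t : M) (i : ℤ) : Submodule R M :=
  if 0 ≤ i then (HC.deg s i.toNat).map (M.orbit t) else ⊥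

lemma GrModule.grade_le_iSup {T : Finset M} {d : M → ℤ} (hd : ∀ t ∈ T, t ∈ M.grade (d t))
    (hT : Submodule.span (HC s)ᵐᵒᵖ (T : Set M) = ⊤) (j : ℤ) :
    M.grade j ≤ ⨆ t ∈ T, GrModule.genPiece t (j - d t) := by
  intro m hm
  have hm' : m ∈ Submodule.span (HC s)ᵐᵒᵖ (T : Set M) := by rw [hT]; trivial
  obtain ⟨b, hb⟩ := Submodule.mem_span_finset'.1 hm'
  rw [← GrModule.proj_of_mem hm, ← hb, map_sum]
  refine sum_mem fun t _ => ?_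
  refine Submodule.mem_iSup_of_mem (t : M) (Submodule.mem_iSup_of_mem t.2 ?_)
  rw [GrModule.genPiece]
  split_ifs with h
  · have e : j = d t + ((j - d t).toNat : ℕ) := by omega
    have := GrModule.proj_op_smul_of_mem (hd t t.2) (b t).unop (j - d t).toNat
    rw [← e] at this
    exact ⟨_, SetLike.coe_mem _, this.symm⟩
  · exact (Submodule.mem_bot R).2 (GrModule.proj_op_smul_of_lt (hd t t.2) (b t).unop (by omega))

lemma GrModule.grade_fg [IsNoetherianRing R] [NondegForm s] [Module.Finite (HC s)ᵐᵒᵖ M] (j : ℤ) :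
    (M.grade j).FG := by
  obtain ⟨T, d, hd, hT⟩ := GrModule.exists_generators M
  have hfg : (⨆ t ∈ T, GrModule.genPiece t (j - d t)).FG := by
    refine Submodule.fg_biSup _ _ fun t _ => ?_
    rw [GrModule.genPiece]
    split_ifs
    · exact (HC.deg_fg _).map _
    · exact Submodule.fg_bot
  exact hfg.of_le (GrModule.grade_le_iSup hd hT j)

lemma GrModule.exists_lower_bound (M : GrModule s) [Module.Finite (HC s)ᵐᵒᵖ M] :
    ∃ D : ℤ, ∀ j < D, M.grade j = ⊥ := by
  obtain ⟨T, d, hd, hT⟩ := GrModule.exists_generators M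
  obtain ⟨D, hD⟩ := (T.image d).bddBelow
  refine ⟨D, fun j hj => eq_bot_iff.2 ((GrModule.grade_le_iSup hd hT j).trans ?_)⟩
  refine iSup₂_le fun t ht => ?_
  rw [GrModule.genPiece, if_neg]
  have := hD (Finset.mem_coe.2 (Finset.mem_image_of_mem d ht))
  omega

/-- If `A_{N+i} ⊆ A_N P`, then `M_{j+i} ⊆ M_j P` for large `j`: it is enough that the degree exceeds the
degrees of the generators of `M` by at least `N`. -/
lemma GrModule.exists_grade_add_le (M : GrModule s) [Module.Finite (HC s)ᵐᵒᵖ M] (N i : ℕ)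
    (P : Submodule R (HC s)) (hP : HC.deg s (N + i) ≤ HC.deg s N * P) :
    ∃ D : ℤ, ∀ j, D ≤ j → M.grade (j + i) ≤
      Submodule.span R {y | ∃ m ∈ M.grade j, ∃ b ∈ P, MulOpposite.op b • m = y} := by
  obtain ⟨T, d, hd, hT⟩ := GrModule.exists_generators M
  obtain ⟨D, hD⟩ := (T.image d).bddAbove
  refine ⟨D + N, fun j hj => (GrModule.grade_le_iSup hd hT _).trans (iSup₂_le fun t ht => ?_)⟩
  have h1 := hD (Finset.mem_coe.2 (Finset.mem_image_of_mem d ht))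
  rw [GrModule.genPiece, if_pos (by omega), Submodule.map_le_iff_le_comap]
  intro b hb
  obtain ⟨a, ha⟩ : ∃ a : ℕ, j = d t + (a + N) := ⟨(j - d t - N).toNat, by omega⟩
  have e : (j + i - d t).toNat = a + (N + i) := by omega
  rw [e, HC.deg, pow_add] at hb
  have h2 : HC.deg s a * HC.deg s (N + i) ≤ HC.deg s (a + N) * P := by
    refine (mul_le_mul_right hP _).trans ?_
    simp only [HC.deg, pow_add, mul_assoc, le_refl]
  have hb' := h2 hb
  clear hb
  induction hb' using Submodule.mul_induction_on' with
  | add x _ y _ hx hy => exact add_mem hx hy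
  | mem_mul_mem x hx y hy =>
    refine Submodule.subset_span ⟨MulOpposite.op x • t, ?_, y, hy, ?_⟩
    · have := M.act_mem (hd t ht) hx
      rwa [Nat.cast_add, ← ha] at this
    · rw [GrModule.orbit_apply, MulOpposite.op_mul, mul_smul]

lemma GrModule.exists_grade_succ_le (M : GrModule s) [Module.Finite (HC s)ᵐᵒᵖ M] :
    ∃ D : ℤ, ∀ j, D ≤ j → M.grade (j + 1) ≤
      Submodule.span R {y | ∃ m ∈ M.grade j, ∃ v, MulOpposite.op (HC.gen s v) • m = y} := by
  obtain ⟨D, hD⟩ := GrModule.exists_grade_add_le M 0 1 (LinearMap.range (HC.gen s))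
    (by simp [HC.deg])
  refine ⟨D, fun j hj => (hD j hj).trans (Submodule.span_mono ?_)⟩
  rintro _ ⟨m, hm, _, ⟨v, rfl⟩, rfl⟩
  exact ⟨m, hm, v, rfl⟩

lemma HC.sqMul_le [NondegForm s] (N : ℕ) :
    HC.sqMul s N ≤ HC.deg s N * Submodule.span R (Set.range (HC.sq s)) := by
  refine Submodule.span_le.2 ?_
  rintro _ ⟨v, a, ha, rfl⟩
  rw [HC.sq_mul]
  exact Submodule.mul_mem_mul ha (Submodule.subset_span ⟨v, rfl⟩)

/-- In large degrees, a finitely generated module is generated by the action of the squares. -/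
lemma GrModule.exists_grade_add_two_le (M : GrModule s) [NondegForm s]
    [Module.Finite (HC s)ᵐᵒᵖ M] :
    ∃ D : ℤ, ∀ j, D ≤ j → M.grade (j + 2) ≤
      Submodule.span R {y | ∃ m ∈ M.grade j, ∃ v, MulOpposite.op (HC.sq s v) • m = y} := by
  obtain ⟨N, hN⟩ := HC.exists_deg_le_sqMul (s := s)
  obtain ⟨D, hD⟩ := GrModule.exists_grade_add_le M N 2 _ (hN.trans (HC.sqMul_le N))
  refine ⟨D, fun j hj => (hD j hj).trans (Submodule.span_le.2 ?_)⟩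
  rintro _ ⟨m, hm, b, hb, rfl⟩
  induction hb using Submodule.span_induction with
  | zero => simp
  | add x y _ _ hx hy =>
    rw [MulOpposite.op_add, add_smul]; exact add_mem hx hy
  | smul r x _ hx =>
    rw [MulOpposite.op_smul, smul_assoc]; exact Submodule.smul_mem _ _ hx
  | mem b hb =>
    obtain ⟨v, rfl⟩ := hb
    exact Submodule.subset_span ⟨m, hm, v, rfl⟩

lemma piece_fg [IsNoetherianRing R] [h : NondegForm s] [Module.Finite (HC s)ᵐᵒᵖ M] (j : ℤ) (k : ℕ) :
    (piece M j k).FG := by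
  have := h.invertible
  refine Submodule.FG.map₂ _ (GrModule.grade_fg j) (Submodule.FG.pow ?_ k)
  exact (LinearMap.range_eq_map (SymmetricAlgebra.ι R L)) ▸ Module.Finite.fg_top.map _

variable (M) in
/-- In large degrees, the transition maps `M_j ⊗ L^k → M_{j+2} ⊗ L^{k+1}` are surjective. -/
lemma exists_piece_le_map [NondegForm s] [Module.Finite (HC s)ᵐᵒᵖ M] (π : SqPartition s) :
    ∃ D : ℤ, ∀ j, D ≤ j → ∀ k, piece M (j + 2) (k + 1) ≤ (piece M j k).map (actKappa M π) := by
  obtain ⟨D, hD⟩ := GrModule.exists_grade_add_two_le M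
  refine ⟨D, fun j hj k => Submodule.map₂_le.2 fun m hm y hy => ?_⟩
  refine tpow_induction (p := fun y => TensorProduct.mk R M (SymmetricAlgebra R L) m y ∈
    (piece M j k).map (actKappa M π)) ?_ ?_ hy
  · intro y hy l
    have hm' := hD j hj hm
    clear hm
    induction hm' using Submodule.span_induction with
    | zero => simp
    | add a b _ _ ha hb => rw [map_add, LinearMap.add_apply]; exact add_mem ha hb
    | smul r a _ ha => rw [map_smul, LinearMap.smul_apply]; exact Submodule.smul_mem _ _ ha
    | mem x hx =>
      obtain ⟨m, hm, v, rfl⟩ := hx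
      have h := actL_sq π v l (m ⊗ₜ[R] y)
      rw [actL_tmul] at h
      rw [TensorProduct.mk_apply, h]
      exact Submodule.smul_mem _ _ ⟨_, tmul_mem_piece hm hy, rfl⟩
  · intro x y hx hy
    rw [map_add]
    exact add_mem hx hy

/-- For large degrees, the transition maps `M_j ⊗ L^k → M_{j+2} ⊗ L^{k+1}` are injective: the kernels
of the iterated transition maps stabilize, as `M_j ⊗ L^k` is noetherian, and the transition maps are
surjective. -/
lemma exists_piece_injective [IsNoetherianRing R] [NondegForm s] [Module.Finite (HC s)ᵐᵒᵖ M]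
    (π : SqPartition s) {j : ℤ} (k : ℕ)
    (hj : ∀ j' ≥ j, ∀ k, piece M (j' + 2) (k + 1) ≤ (piece M j' k).map (actKappa M π)) :
    ∃ i₀ : ℕ, ∀ i ≥ i₀, ∀ z ∈ piece M (j + 2 * i) (k + i), ∀ r,
      (actKappa M π ^ r) z = 0 → z = 0 := by
  have := isNoetherian_of_fg_of_noetherian _ (piece_fg (M := M) j k)
  let f : ℕ →o Submodule R (piece M j k) :=
    ⟨fun i => (LinearMap.ker (actKappa M π ^ i)).comap (piece M j k).subtype, by
      refine monotone_nat_of_le_succ fun i x hx => ?_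
      change (actKappa M π ^ (i + 1)) (x : M ⊗[R] SymmetricAlgebra R L) = 0
      rw [pow_succ', Module.End.mul_apply]
      exact (congrArg _ hx).trans (map_zero _)⟩
  obtain ⟨i₀, h0⟩ := monotone_stabilizes_iff_noetherian.2 this f
  have hsurj : ∀ i : ℕ, piece M (j + 2 * i) (k + i) ≤ (piece M j k).map (actKappa M π ^ i) := by
    intro i
    induction i with
    | zero =>
      intro x hx
      exact ⟨x, by simpa using hx, rfl⟩
    | succ i ih =>
      intro x hx
      have e : j + 2 * ((i + 1 : ℕ) : ℤ) = j + 2 * i + 2 := by push_cast; ring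
      rw [e] at hx
      obtain ⟨y, hy, rfl⟩ := hj _ (by omega) _ hx
      obtain ⟨z, hz, rfl⟩ := ih hy
      exact ⟨z, hz, by rw [pow_succ', Module.End.mul_apply]⟩
  refine ⟨i₀, fun i hi z hz r hr => ?_⟩
  obtain ⟨x, hx, rfl⟩ := hsurj i hz
  rw [← Module.End.mul_apply, ← pow_add] at hr
  have h1 : (⟨x, hx⟩ : piece M j k) ∈ f (r + i) := hr
  rw [← h0 _ (by omega), h0 i hi] at h1
  exact h1

/-- In large degrees, no nonzero element of a finitely generated module is killed by all squares. -/
lemma GrModule.exists_sq_faithful [IsNoetherianRing R] [NondegForm s]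
    (M : GrModule s) [Module.Finite (HC s)ᵐᵒᵖ M] :
    ∃ D : ℤ, ∀ j, D ≤ j → ∀ m ∈ M.grade j,
      (∀ v, MulOpposite.op (HC.sq s v) • m = 0) → m = 0 := by
  obtain ⟨π⟩ := NondegForm.exists_partition s
  obtain ⟨D, hD⟩ := exists_piece_le_map M π
  obtain ⟨a, ha⟩ := exists_piece_injective π 0 fun j' (hj' : j' ≥ D) => hD j' hj'
  obtain ⟨b, hb⟩ := exists_piece_injective π 0
    fun j' (hj' : j' ≥ D + 1) => hD j' (by omega)
  refine ⟨D + 2 * a + 2 * b + 1, fun j hj m hm hv => ?_⟩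
  have key : ∀ y : SymmetricAlgebra R L, (actKappa M π ^ 1) (m ⊗ₜ y) = 0 := by
    intro y
    rw [pow_one, actKappa_tmul]
    exact Finset.sum_eq_zero fun i _ => by rw [hv, TensorProduct.zero_tmul]
  -- the kernels stabilize separately in the degrees of each parity
  rcases Int.even_or_odd' (j - D) with ⟨c, hc | hc⟩
  · refine eq_zero_of_tmul_eq_zero c.toNat fun l => ha c.toNat (by omega) _ ?_ 1 (key _)
    have e : D + 2 * (c.toNat : ℤ) = j := by omega
    rw [e, zero_add]
    exact tmul_mem_piece hm (pow_mem_tpow l _)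
  · refine eq_zero_of_tmul_eq_zero c.toNat fun l => hb c.toNat (by omega) _ ?_ 1 (key _)
    have e : D + 1 + 2 * (c.toNat : ℤ) = j := by omega
    rw [e, zero_add]
    exact tmul_mem_piece hm (pow_mem_tpow l _)

/-- The direct limit is attained: `M_{2k} ⊗ L^k → lim M_{2k} ⊗ L^k` is bijective for large `k`. -/
lemma DirLim.exists_bijective [IsNoetherianRing R] [NondegForm s]
    (M : GrModule s) [Module.Finite (HC s)ᵐᵒᵖ M] :
    ∃ K, ∀ k ≥ K, Function.Bijective (DirLim.ofPiece M k) := by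
  obtain ⟨π⟩ := NondegForm.exists_partition s
  obtain ⟨D, hD⟩ := exists_piece_le_map M π
  obtain ⟨a, ha⟩ := exists_piece_injective (j := 2 * (D.toNat : ℤ)) π D.toNat
    fun j' hj' => hD j' (by omega)
  refine ⟨D.toNat + a, fun k hk => ⟨?_, ?_⟩⟩
  · rw [← LinearMap.ker_eq_bot, eq_bot_iff]
    rintro ⟨x, hx⟩ h
    obtain ⟨r, hr⟩ := exists_actKappa_pow_eq_zero π hx ((DirLim.proj_eq_zero_iff _).1 h)
    refine Subtype.ext (ha (k - D.toNat) (by omega) x ?_ r hr)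
    convert hx using 1
    congr 1 <;> omega
  · have hle : ∀ k' ≥ k, LinearMap.range (DirLim.ofPiece M k') ≤
        LinearMap.range (DirLim.ofPiece M k) := by
      intro k' hk'
      induction k', hk' using Nat.le_induction with
      | base => exact le_rfl
      | succ n hn ih =>
        refine le_trans ?_ ih
        rintro _ ⟨⟨x, hx⟩, rfl⟩
        have hx' := hx
        have e : 2 * ((n + 1 : ℕ) : ℤ) = 2 * n + 2 := by push_cast; ring
        rw [e] at hx'
        obtain ⟨y, hy, rfl⟩ := hD (2 * n) (by omega) n hx'
        exact ⟨⟨y, hy⟩, (DirLim.proj_actKappa π ⟨y, piece_le_colimSrc n hy⟩).symm⟩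
    intro y
    obtain ⟨k₀, h0⟩ := DirLim.exists_mem_range y
    exact hle (max k k₀) (by omega) (h0 _ (by omega))

instance DirLim.finite [IsNoetherianRing R] [NondegForm s] [Module.Finite (HC s)ᵐᵒᵖ M] :
    Module.Finite R (DirLim M) := by
  obtain ⟨K, hK⟩ := DirLim.exists_bijective M
  have : Module.Finite R (piece M (2 * K) K) := Module.Finite.iff_fg.2 (piece_fg _ _)
  exact Module.Finite.of_surjective _ (hK K le_rfl).2

end Finite

/-! ### Morphisms with torsion kernel and cokernel -/

section Torsion

variable {R E L : Type u} [CommRing R] [AddCommGroup E] [Module R E] [AddCommGroup L] [Module R L]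
variable {s : L →ₗ[R] E →ₗ[R] E →ₗ[R] R} {M N : GrModule s}

lemma GrMap.proj_apply {R' E' L' : Type u} [CommRing R'] [AddCommGroup E'] [Module R' E']
    [AddCommGroup L'] [Module R' L'] {s' : L' →ₗ[R'] E' →ₗ[R'] E' →ₗ[R'] R'} {F : FormMap s s'}
    {M' : GrModule s'} (g : GrMap F M M') (j : ℤ) (m : M) :
    M'.proj j (g.toFun m) = g.toFun (M.proj j m) := by
  induction m using GrModule.grade_induction with
  | add x y hx hy => simp only [map_add, hx, hy]
  | mem k m hm =>
    by_cases h : k = j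
    · subst h
      rw [GrModule.proj_of_mem hm, GrModule.proj_of_mem (g.map_grade hm)]
    · rw [GrModule.proj_of_mem_ne h hm, GrModule.proj_of_mem_ne h (g.map_grade hm), map_zero]

lemma GrMap.evalRight_tensor {R' E' L' : Type u} [CommRing R'] [AddCommGroup E'] [Module R' E']
    [AddCommGroup L'] [Module R' L'] {s' : L' →ₗ[R'] E' →ₗ[R'] E' →ₗ[R'] R'} {F : FormMap s s'}
    {M' : GrModule s'} (g : GrMap F M M') (v : E) (x : M ⊗[R] SymmetricAlgebra R L) :
    evalRight M' (F.fE v) (g.tensor x) = g.toFun (evalRight M v x) := by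
  induction x with
  | zero => simp
  | add x y hx hy => simp only [map_add, hx, hy]
  | tmul m y =>
    have h : evalSym s' (F.fE v) (symMap F.fL y) = F.φ (evalSym s v y) := by
      induction y using SymmetricAlgebra.induction with
      | algebraMap r => simp
      | ι l => simp [F.compat]
      | mul a b ha hb => simp only [map_mul, ha, hb]
      | add a b ha hb => simp only [map_add, ha, hb]
    rw [GrMap.tensor_tmul, evalRight_tmul, evalRight_tmul, h, LinearMap.map_smulₛₗ]

lemma GrMap.tensor_mem_piece {R' E' L' : Type u} [CommRing R'] [AddCommGroup E'] [Module R' E']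
    [AddCommGroup L'] [Module R' L'] {s' : L' →ₗ[R'] E' →ₗ[R'] E' →ₗ[R'] R'} {F : FormMap s s'}
    {M' : GrModule s'} (g : GrMap F M M') {j : ℤ} {k : ℕ} {x : M ⊗[R] SymmetricAlgebra R L}
    (hx : x ∈ piece M j k) : g.tensor x ∈ piece M' j k :=
  map₂_induction (p := fun x => g.tensor x ∈ piece M' j k) (by simp)
    (fun x y hx hy => by rw [map_add]; exact add_mem hx hy)
    (fun m hm y hy => tmul_mem_piece (g.map_grade hm) (symMap_mem_tpow F.fL hy)) hx

lemma DirLim.map_ofPiece {R' E' L' : Type u} [CommRing R'] [AddCommGroup E'] [Module R' E']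
    [AddCommGroup L'] [Module R' L'] {s' : L' →ₗ[R'] E' →ₗ[R'] E' →ₗ[R'] R'} {F : FormMap s s'}
    {M' : GrModule s'} (g : GrMap F M M') {k : ℕ} (x : piece M (2 * k) k) :
    DirLim.map g (DirLim.ofPiece M k x) =
      DirLim.ofPiece M' k ⟨g.tensor x, g.tensor_mem_piece x.2⟩ := rfl

/-- A map with finitely generated kernel is injective in large degrees. -/
lemma exists_injective_of_ker_finite (f : M →ₗ[R] N)
    (h : Module.Finite R (LinearMap.ker f)) :
    ∃ D : ℤ, ∀ j, D < j → ∀ m ∈ M.grade j, f m = 0 → m = 0 := by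
  obtain ⟨D, hD⟩ := GrModule.exists_bound_of_fg (Module.Finite.iff_fg.1 h)
  exact ⟨D, fun j hj m hm h0 => (GrModule.proj_of_mem hm).symm.trans (hD m h0 j hj)⟩

/-- A map with finitely generated cokernel is surjective in large degrees. -/
lemma exists_surjective_of_coker_finite (g : GrMap (FormMap.id s) M N) (f : M →ₗ[R] N)
    (hfg : ∀ m, g.toFun m = f m) (h : Module.Finite R (N ⧸ LinearMap.range f)) :
    ∃ D : ℤ, ∀ j, D < j → ∀ n ∈ N.grade j, ∃ m ∈ M.grade j, f m = n := by
  obtain ⟨n, q, hq⟩ := Module.Finite.exists_fin (R := R) (M := N ⧸ LinearMap.range f)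
  choose x hx using fun i => Submodule.mkQ_surjective _ (q i)
  have hx' : (Submodule.mkQ _ ∘ x) = q := funext hx
  let P : Submodule R N := Submodule.span R (Set.range x)
  have hP : P.FG := Submodule.fg_span (Set.finite_range x)
  obtain ⟨D, hD⟩ := GrModule.exists_bound_of_fg hP
  refine ⟨D, fun j hj y hy => ?_⟩
  have h1 : P.map (LinearMap.range f).mkQ = ⊤ := by
    rw [Submodule.map_span, ← Set.range_comp, hx', hq]
  have h2 : (LinearMap.range f).mkQ y ∈ P.map (LinearMap.range f).mkQ := by
    rw [h1]; trivial
  obtain ⟨p, hp, hpy⟩ := h2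
  obtain ⟨m, hm⟩ := (Submodule.Quotient.eq _).1 hpy.symm
  refine ⟨M.proj j m, GrModule.proj_mem j m, ?_⟩
  rw [← hfg, ← g.proj_apply, hfg, hm, map_sub, hD p hp j hj, sub_zero, GrModule.proj_of_mem hy]

/-- The direct limit sends the morphisms with torsion kernel and cokernel to isomorphisms. -/
lemma DirLim.map_bijective [IsNoetherianRing R] [NondegForm s]
    [Module.Finite (HC s)ᵐᵒᵖ M] [Module.Finite (HC s)ᵐᵒᵖ N] (g : GrMap (FormMap.id s) M N)
    (f : M →ₗ[R] N) (hfg : ∀ m, g.toFun m = f m) (hk : Module.Finite R (LinearMap.ker f))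
    (hc : Module.Finite R (N ⧸ LinearMap.range f)) :
    Function.Bijective (DirLim.map g) := by
  obtain ⟨π⟩ := NondegForm.exists_partition s
  obtain ⟨KM, hKM⟩ := DirLim.exists_bijective M
  obtain ⟨KN, hKN⟩ := DirLim.exists_bijective N
  obtain ⟨D, hD⟩ := exists_injective_of_ker_finite f hk
  obtain ⟨D', hD'⟩ := exists_surjective_of_coker_finite g f hfg hc
  let k := KM + KN + D.toNat + D'.toNat + 1
  have hM := hKM k (by omega)
  have hN := hKN k (by omega)
  obtain ⟨c, hc⟩ := π.exists_pow k
  constructor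
  · intro y y' hyy
    rw [← sub_eq_zero, ← map_sub] at hyy
    rw [← sub_eq_zero]
    generalize y - y' = y at hyy
    obtain ⟨⟨x, hx⟩, rfl⟩ := hM.2 y
    rw [DirLim.map_ofPiece] at hyy
    have h0 : g.tensor x = 0 := congrArg Subtype.val (hN.1 (hyy.trans (map_zero _).symm))
    have hx0 : x = 0 := by
      -- functionals on `L^k` reduce the injectivity on `M_{2k} ⊗ L^k` to that on `M_{2k}`
      rw [← piece_eq_sum π hc hx]
      refine Finset.sum_eq_zero fun i _ => ?_
      rw [hD (2 * k) (by omega) _ (evalRight_mem _ hx), TensorProduct.zero_tmul, smul_zero]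
      rw [← hfg, ← g.evalRight_tensor, h0, map_zero]
    subst hx0
    exact map_zero _
  · intro y
    obtain ⟨⟨x, hx⟩, rfl⟩ := hN.2 y
    have : ∃ z ∈ piece M (2 * k) k, g.tensor z = x :=
      map₂_induction (p := fun x => ∃ z ∈ piece M (2 * k) k, g.tensor z = x)
        ⟨0, zero_mem _, map_zero _⟩
        (by
          rintro _ _ ⟨a, ha, rfl⟩ ⟨b, hb, rfl⟩
          exact ⟨a + b, add_mem ha hb, map_add _ _ _⟩)
        (fun n hn y hy => by
          obtain ⟨m, hm, rfl⟩ := hD' (2 * k) (by omega) n hn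
          refine ⟨m ⊗ₜ y, tmul_mem_piece hm hy, ?_⟩
          rw [GrMap.tensor_tmul, hfg]
          exact congrArg (f m ⊗ₜ[R] ·) (symMap_eq_self _ (fun _ => rfl) (fun _ => rfl) y)) hx
    obtain ⟨z, hz, rfl⟩ := this
    exact ⟨DirLim.ofPiece M k ⟨z, hz⟩, rfl⟩

end Torsion

/-! ### Extension of scalars -/

section Extension

variable {R R' : Type u} [CommRing R] [CommRing R'] {φ : R →+* R'}

section

variable {A B C A' B' C' : Type u} [AddCommGroup A] [Module R A] [AddCommGroup B] [Module R B]
  [AddCommGroup C] [Module R C] [AddCommGroup A'] [Module R' A'] [AddCommGroup B'] [Module R' B']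
  [AddCommGroup C'] [Module R' C'] {α : A →ₛₗ[φ] A'} {β : B →ₛₗ[φ] B'} {γ : C →ₛₗ[φ] C'}
  {f : A →ₗ[R] B} {g : B →ₗ[R] C} {f' : A' →ₗ[R'] B'} {g' : B' →ₗ[R'] C'}

lemma IsExtensionOfScalars.of_right_exact (hα : IsExtensionOfScalars φ α)
    (hβ : IsExtensionOfScalars φ β) (h₁ : ∀ x, β (f x) = f' (α x)) (h₂ : ∀ x, γ (g x) = g' (β x))
    (e : Function.Exact f g) (hg : Function.Surjective g) (e' : Function.Exact f' g')
    (hg' : Function.Surjective g') : IsExtensionOfScalars φ γ := by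
  let : Algebra R R' := φ.toAlgebra
  let : Module R A' := Module.compHom A' φ
  let : Module R B' := Module.compHom B' φ
  let : Module R C' := Module.compHom C' φ
  have : IsScalarTower R R' A' := ⟨fun r x m => mul_smul (φ r) x m⟩
  have : IsScalarTower R R' B' := ⟨fun r x m => mul_smul (φ r) x m⟩
  have : IsScalarTower R R' C' := ⟨fun r x m => mul_smul (φ r) x m⟩
  exact IsBaseChange.of_right_exact R' _ _ _ (LinearMap.ext h₁) (LinearMap.ext h₂) hα hβ e hg e' hg'

lemma IsExtensionOfScalars.of_left_exact (hφ : φ.Flat) (hβ : IsExtensionOfScalars φ β)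
    (hγ : IsExtensionOfScalars φ γ) (h₁ : ∀ x, β (f x) = f' (α x)) (h₂ : ∀ x, γ (g x) = g' (β x))
    (e : Function.Exact f g) (hf : Function.Injective f) (e' : Function.Exact f' g')
    (hf' : Function.Injective f') : IsExtensionOfScalars φ α := by
  let : Algebra R R' := φ.toAlgebra
  let : Module R A' := Module.compHom A' φ
  let : Module R B' := Module.compHom B' φ
  let : Module R C' := Module.compHom C' φ
  have : IsScalarTower R R' A' := ⟨fun r x m => mul_smul (φ r) x m⟩
  have : IsScalarTower R R' B' := ⟨fun r x m => mul_smul (φ r) x m⟩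
  have : IsScalarTower R R' C' := ⟨fun r x m => mul_smul (φ r) x m⟩
  have : Module.Flat R R' := hφ
  exact IsBaseChange.of_left_exact R' _ _ _ (LinearMap.ext h₁) (LinearMap.ext h₂) hβ hγ e hf e' hf'

/-- A retract of an extension of scalars is an extension of scalars. -/
lemma IsExtensionOfScalars.retract (hβ : IsExtensionOfScalars φ β) (i : A →ₗ[R] B) (p : B →ₗ[R] A)
    (i' : A' →ₗ[R'] B') (p' : B' →ₗ[R'] A') (hi : ∀ x, β (i x) = i' (α x))
    (hp : ∀ x, α (p x) = p' (β x)) (h : ∀ x, p (i x) = x) (h' : ∀ x, p' (i' x) = x) :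
    IsExtensionOfScalars φ α := by
  refine hβ.of_right_exact (f := LinearMap.id - i ∘ₗ p) (f' := LinearMap.id - i' ∘ₗ p') hβ
    ?_ hp ?_ (fun x => ⟨i x, h x⟩) ?_ fun x => ⟨i' x, h' x⟩
  · intro x
    simp [hi, hp]
  · intro x
    constructor
    · intro hx
      exact ⟨x, by simp [hx]⟩
    · rintro ⟨y, rfl⟩
      simp [h]
  · intro x
    constructor
    · intro hx
      exact ⟨x, by simp [hx]⟩
    · rintro ⟨y, rfl⟩
      simp [h']

end

/-- The semilinear map of products induced by semilinear maps. -/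
def semilinearPi {ι : Type} {A A' : ι → Type u} [∀ i, AddCommGroup (A i)] [∀ i, Module R (A i)]
    [∀ i, AddCommGroup (A' i)] [∀ i, Module R' (A' i)] (α : ∀ i, A i →ₛₗ[φ] A' i) :
    (∀ i, A i) →ₛₗ[φ] ∀ i, A' i where
  toFun x i := α i (x i)
  map_add' _ _ := funext fun i => map_add (α i) _ _
  map_smul' r x := funext fun i => (α i).map_smulₛₗ r (x i)

lemma IsExtensionOfScalars.pi {ι : Type} [Finite ι] {A A' : ι → Type u} [∀ i, AddCommGroup (A i)]
    [∀ i, Module R (A i)] [∀ i, AddCommGroup (A' i)] [∀ i, Module R' (A' i)]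
    {α : ∀ i, A i →ₛₗ[φ] A' i} (h : ∀ i, IsExtensionOfScalars φ (α i)) :
    IsExtensionOfScalars φ (semilinearPi α) := by
  let : Algebra R R' := φ.toAlgebra
  let (i : ι) : Module R (A' i) := Module.compHom (A' i) φ
  have (i : ι) : IsScalarTower R R' (A' i) := ⟨fun r x m => mul_smul (φ r) x m⟩
  exact IsBaseChange.pi (fun i => ({ toFun := α i, map_add' := (α i).map_add, map_smul' := (α i).map_smulₛₗ } : A i →ₗ[R] A' i)) h

/-- The semilinear map of direct sums induced by semilinear maps. -/
def directSumMap {ι : Type} [DecidableEq ι] {A A' : ι → Type u} [∀ i, AddCommGroup (A i)]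
    [∀ i, Module R (A i)] [∀ i, AddCommGroup (A' i)] [∀ i, Module R' (A' i)]
    (α : ∀ i, A i →ₛₗ[φ] A' i) : (⨁ i, A i) →ₛₗ[φ] ⨁ i, A' i where
  toFun := DirectSum.map fun i => (α i).toAddMonoidHom
  map_add' := map_add _
  map_smul' r x := by
    ext i
    simp [DirectSum.map_apply, DirectSum.smul_apply]

lemma directSumMap_lof {ι : Type} [DecidableEq ι] {A A' : ι → Type u} [∀ i, AddCommGroup (A i)]
    [∀ i, Module R (A i)] [∀ i, AddCommGroup (A' i)] [∀ i, Module R' (A' i)]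
    (α : ∀ i, A i →ₛₗ[φ] A' i) (i : ι) (x : A i) :
    directSumMap α (DirectSum.lof R ι A i x) = DirectSum.lof R' ι A' i (α i x) :=
  DirectSum.map_of _ _ _

lemma IsExtensionOfScalars.of_isBaseChange {A B : Type u} [AddCommGroup A] [Module R A]
    [AddCommGroup B] [Module R' B] (f : A →ₛₗ[φ] B) [m : Module R B]
    (t : letI := φ.toAlgebra; IsScalarTower R R' B) (f₀ : A →ₗ[R] B) (h : ∀ x, f₀ x = f x)
    (hb : letI := φ.toAlgebra; IsBaseChange R' f₀) : IsExtensionOfScalars φ f := by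
  let : Algebra R R' := φ.toAlgebra
  have hm : m = Module.compHom B φ := Module.ext' _ _ fun r x => (algebraMap_smul R' r x).symm
  subst hm
  let : Module R B := Module.compHom B φ
  have hf : f₀ = { toFun := f, map_add' := f.map_add, map_smul' := f.map_smulₛₗ } :=
    LinearMap.ext h
  subst hf
  exact hb

lemma IsExtensionOfScalars.directSum {ι : Type} [DecidableEq ι] {A A' : ι → Type u}
    [∀ i, AddCommGroup (A i)] [∀ i, Module R (A i)] [∀ i, AddCommGroup (A' i)]
    [∀ i, Module R' (A' i)] {α : ∀ i, A i →ₛₗ[φ] A' i} (h : ∀ i, IsExtensionOfScalars φ (α i)) :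
    IsExtensionOfScalars φ (directSumMap α) := by
  let : Algebra R R' := φ.toAlgebra
  let (i : ι) : Module R (A' i) := Module.compHom (A' i) φ
  have (i : ι) : IsScalarTower R R' (A' i) := ⟨fun r x m => mul_smul (φ r) x m⟩
  let ε (i : ι) : A i →ₗ[R] A' i :=
    { toFun := α i, map_add' := (α i).map_add, map_smul' := (α i).map_smulₛₗ }
  exact IsExtensionOfScalars.of_isBaseChange _ inferInstance _ (fun x => rfl)
    (IsBaseChange.directSum (S := R') (ε := ε) h)

end Extension

section LimitBaseChange

variable {R E L : Type u} [CommRing R] [AddCommGroup E] [Module R E] [AddCommGroup L] [Module R L]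
variable {R' E' L' : Type u} [CommRing R'] [AddCommGroup E'] [Module R' E'] [AddCommGroup L']
  [Module R' L']
variable {s : L →ₗ[R] E →ₗ[R] E →ₗ[R] R} {s' : L' →ₗ[R'] E' →ₗ[R'] E' →ₗ[R'] R'}
variable {F : FormMap s s'} {M : GrModule s} {M' : GrModule s'}

/-- The map `M_j ⊗ L^k → M^r` given by functionals `l ↦ σ_l(v_i, v_i)`. -/
def pieceCoord {r : ℕ} (v : Fin r → E) (j : ℤ) (k : ℕ) : piece M j k →ₗ[R] (Fin r → M) :=
  LinearMap.pi fun i => evalRight M (v i) ∘ₗ (piece M j k).subtype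

variable (M) in
/-- The map `m ↦ ∑ c_i m_i ⊗ l_i^k` from `M^r` to `M_j ⊗ L^k`. -/
def pieceComb {r : ℕ} (l : Fin r → L) (c : Fin r → R) (j : ℤ) (k : ℕ) :
    (Fin r → M) →ₗ[R] piece M j k :=
  ∑ i, c i • ((TensorProduct.mk R M (SymmetricAlgebra R L)).flip
    (SymmetricAlgebra.ι R L (l i) ^ k) ∘ₗ M.proj j).codRestrict (piece M j k)
      (fun m => tmul_mem_piece (M.proj_mem j m) (pow_mem_tpow _ k)) ∘ₗ LinearMap.proj i

lemma pieceComb_coe {r : ℕ} (l : Fin r → L) (c : Fin r → R) (j : ℤ) (k : ℕ) (m : Fin r → M) :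
    (pieceComb M l c j k m : M ⊗[R] SymmetricAlgebra R L) =
      ∑ i, c i • M.proj j (m i) ⊗ₜ[R] (SymmetricAlgebra.ι R L (l i) ^ k) := by
  simp only [pieceComb, LinearMap.sum_apply, AddSubmonoidClass.coe_finsetSum]
  rfl

lemma pieceComb_pieceCoord [NondegForm s] (π : SqPartition s) {c : Fin π.r → R} {k : ℕ}
    (hc : ∑ i, c i * s (π.l i) (π.v i) (π.v i) ^ k = 1) {j : ℤ} (x : piece M j k) :
    pieceComb M π.l c j k (pieceCoord π.v j k x) = x := by
  refine Subtype.ext ?_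
  rw [pieceComb_coe]
  refine Eq.trans (Finset.sum_congr rfl fun i _ => ?_) (piece_eq_sum π hc x.2)
  congr 2
  exact GrModule.proj_of_mem (evalRight_mem _ x.2)

/-- The formation of the direct limit commutes with extension of scalars: in large degrees, the direct
limit is `M_{2k} ⊗ L^k`, a retract of a power of `M`. -/
lemma DirLim.map_isExtensionOfScalars [IsNoetherianRing R] [IsNoetherianRing R'] [NondegForm s]
    [NondegForm s'] [Module.Finite (HC s)ᵐᵒᵖ M] [Module.Finite (HC s')ᵐᵒᵖ M'] (g : GrMap F M M')
    (h : IsExtensionOfScalars F.φ g.toFun) : IsExtensionOfScalars F.φ (DirLim.map g) := by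
  obtain ⟨π⟩ := NondegForm.exists_partition s
  obtain ⟨K, hK⟩ := DirLim.exists_bijective M
  obtain ⟨K', hK'⟩ := DirLim.exists_bijective M'
  let k := max K K'
  let e := LinearEquiv.ofBijective _ (hK k (le_max_left _ _))
  let e' := LinearEquiv.ofBijective _ (hK' k (le_max_right _ _))
  obtain ⟨c, hc⟩ := π.exists_pow k
  let v' : Fin π.r → E' := fun i => F.fE (π.v i)
  let l' : Fin π.r → L' := fun i => F.fL (π.l i)
  let c' : Fin π.r → R' := fun i => F.φ (c i)
  have hc' : ∑ i, c' i * s' (l' i) (v' i) (v' i) ^ k = 1 := by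
    have := congrArg F.φ hc
    simpa only [map_sum, c', v', l', F.compat, map_mul, map_pow, map_one] using this
  have he : ∀ y, ∃ x, y = e x := fun y => ⟨e.symm y, (e.apply_symm_apply y).symm⟩
  have he' : ∀ x : piece M (2 * k) k, DirLim.map g (e x) =
      e' ⟨g.tensor x, g.tensor_mem_piece x.2⟩ := fun x => rfl
  refine IsExtensionOfScalars.retract
    (IsExtensionOfScalars.pi fun _ : Fin π.r => h) (pieceCoord π.v (2 * k) k ∘ₗ e.symm.toLinearMap)
    (e.toLinearMap ∘ₗ pieceComb M π.l c (2 * k) k) (pieceCoord v' (2 * k) k ∘ₗ e'.symm.toLinearMap)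
    (e'.toLinearMap ∘ₗ pieceComb M' l' c' (2 * k) k) ?_ ?_ ?_ ?_
  · intro y
    obtain ⟨x, rfl⟩ := he y
    rw [he', LinearMap.comp_apply, LinearMap.comp_apply, LinearEquiv.coe_coe, LinearEquiv.coe_coe,
      LinearEquiv.symm_apply_apply, LinearEquiv.symm_apply_apply]
    exact funext fun i => (g.evalRight_tensor (π.v i) x).symm
  · intro m
    rw [LinearMap.comp_apply, LinearMap.comp_apply, LinearEquiv.coe_coe, LinearEquiv.coe_coe, he']
    refine congrArg e' (Subtype.ext ?_)
    refine (congrArg g.tensor (pieceComb_coe _ _ _ _ _)).trans ?_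
    refine Eq.trans ?_ (pieceComb_coe _ _ _ _ _).symm
    rw [map_sum]
    refine Finset.sum_congr rfl fun i _ => ?_
    rw [LinearMap.map_smulₛₗ, GrMap.tensor_tmul, ← g.proj_apply, map_pow, symMap_ι]
    rfl
  · intro y
    obtain ⟨x, rfl⟩ := he y
    simp only [LinearMap.comp_apply, LinearEquiv.coe_coe, LinearEquiv.symm_apply_apply]
    rw [pieceComb_pieceCoord π hc]
  · intro y
    refine (congrArg e' (pieceComb_pieceCoord (π.map F) hc' _)).trans ?_
    exact e'.apply_symm_apply y

end LimitBaseChange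

/-! ### Maps out of the direct limit -/

section Descent

variable {R E L : Type u} [CommRing R] [AddCommGroup E] [Module R E] [AddCommGroup L] [Module R L]
variable {s : L →ₗ[R] E →ₗ[R] E →ₗ[R] R} {M M' : GrModule s}
variable {N : Type*} [AddCommGroup N] [Module (B0 s)ᵐᵒᵖ N]

lemma DirLim.mk_eq_mk {k k' : ℕ} {m m' : M} {y y' : SymmetricAlgebra R L}
    (hm : m ∈ M.grade (2 * k)) (hy : y ∈ tpow R L k) (hm' : m' ∈ M.grade (2 * k'))
    (hy' : y' ∈ tpow R L k') (h : m ⊗ₜ[R] y = m' ⊗ₜ y') :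
    DirLim.mk M k m hm y hy = DirLim.mk M k' m' hm' y' hy' :=
  congrArg (DirLim.proj M) (Subtype.ext h)

lemma DirLim.mk_add {k : ℕ} {m m' : M} {y : SymmetricAlgebra R L}
    (hm : m ∈ M.grade (2 * k)) (hm' : m' ∈ M.grade (2 * k)) (hy : y ∈ tpow R L k) :
    DirLim.mk M k (m + m') (add_mem hm hm') y hy =
      DirLim.mk M k m hm y hy + DirLim.mk M k m' hm' y hy :=
  (congrArg (DirLim.proj M) (Subtype.ext (TensorProduct.add_tmul m m' y))).trans
    (map_add (DirLim.proj M) ⟨_, tmul_mem_colimSrc M k hm hy⟩ ⟨_, tmul_mem_colimSrc M k hm' hy⟩)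

lemma DirLim.mk_smul {k : ℕ} (r : R) {m : M} {y : SymmetricAlgebra R L}
    (hm : m ∈ M.grade (2 * k)) (hy : y ∈ tpow R L k) :
    DirLim.mk M k (r • m) (Submodule.smul_mem _ r hm) y hy = r • DirLim.mk M k m hm y hy :=
  (congrArg (DirLim.proj M) (Subtype.ext (TensorProduct.smul_tmul' r m y).symm)).trans
    (map_smul (DirLim.proj M) r ⟨_, tmul_mem_colimSrc M k hm hy⟩)

lemma DirLim.mk_tmul_add {k : ℕ} {m : M} {y y' : SymmetricAlgebra R L}
    (hm : m ∈ M.grade (2 * k)) (hy : y ∈ tpow R L k) (hy' : y' ∈ tpow R L k) :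
    DirLim.mk M k m hm (y + y') (add_mem hy hy') =
      DirLim.mk M k m hm y hy + DirLim.mk M k m hm y' hy' :=
  (congrArg (DirLim.proj M) (Subtype.ext (TensorProduct.tmul_add m y y'))).trans
    (map_add (DirLim.proj M) ⟨_, tmul_mem_colimSrc M k hm hy⟩ ⟨_, tmul_mem_colimSrc M k hm hy'⟩)

lemma DirLim.mk_tmul_smul {k : ℕ} (r : R) {m : M} {y : SymmetricAlgebra R L}
    (hm : m ∈ M.grade (2 * k)) (hy : y ∈ tpow R L k) :
    DirLim.mk M k m hm (r • y) (Submodule.smul_mem _ r hy) = r • DirLim.mk M k m hm y hy :=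
  (congrArg (DirLim.proj M) (Subtype.ext (TensorProduct.tmul_smul r m y))).trans
    (map_smul (DirLim.proj M) r ⟨_, tmul_mem_colimSrc M k hm hy⟩)

/-- The relations in the direct limit. -/
lemma DirLim.mk_sq {k : ℕ} {m : M} {y : SymmetricAlgebra R L} (v : E) (l : L)
    (hm : m ∈ M.grade (2 * k)) (hy : y ∈ tpow R L k)
    (hm' : MulOpposite.op (HC.sq s v) • m ∈ M.grade (2 * (k + 1 : ℕ))) :
    DirLim.mk M (k + 1) (MulOpposite.op (HC.sq s v) • m) hm' (y * SymmetricAlgebra.ι R L l)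
      (mul_mem_tpow hy (ι_mem_tpow l)) = s l v v • DirLim.mk M k m hm y hy := by
  have h := DirLim.op_mk_smul M (sqGen s v l) (DirLim.mk M k m hm y hy)
  rw [B0.mk_rel, ← MulOpposite.algebraMap_apply, algebraMap_smul] at h
  exact h.symm

lemma sq_smul_mem_grade (v : E) {k : ℕ} {m : M} (hm : m ∈ M.grade (2 * k)) :
    MulOpposite.op (HC.sq s v) • m ∈ M.grade (2 * (k + 1 : ℕ)) := by
  have := M.act_mem hm (HC.sq_mem_deg v)
  push_cast at this ⊢
  rwa [mul_add, mul_one]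

lemma SqPartition.sum_mk [NondegForm s] (π : SqPartition s) {k : ℕ} {m : M}
    {y : SymmetricAlgebra R L} (hm : m ∈ M.grade (2 * k)) (hy : y ∈ tpow R L k) :
    ∑ i, DirLim.mk M (k + 1) (MulOpposite.op (HC.sq s (π.v i)) • m) (sq_smul_mem_grade _ hm)
      (y * SymmetricAlgebra.ι R L (π.l i)) (mul_mem_tpow hy (ι_mem_tpow _)) =
      DirLim.mk M k m hm y hy := by
  simp only [DirLim.mk_sq _ _ hm hy]
  rw [← Finset.sum_smul, π.sum_eq, one_smul]

lemma DirLim.hom_ext {f g : DirLim M →ₗ[(B0 s)ᵐᵒᵖ] N}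
    (h : ∀ k m hm y hy, f (DirLim.mk M k m hm y hy) = g (DirLim.mk M k m hm y hy)) : f = g := by
  refine LinearMap.ext fun x => ?_
  induction x using DirLim.induction with
  | zero => rw [map_zero, map_zero]
  | add x y hx hy => rw [map_add, map_add, hx, hy]
  | mk k m hm y hy => exact h k m hm y hy

variable [Module R N] [IsScalarTower R (B0 s)ᵐᵒᵖ N]

/-- A linear map on `⨁ M_{2k} ⊗ L^k` compatible with the action of `⨁ HC_{2k} ⊗ L^k` descends to
the direct limit. -/
def DirLim.desc (ψ : colimSrc M →ₗ[R] N) (h : ∀ (a : evenAlg s) (x : colimSrc M),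
    ψ ⟨actL M a x, actL_mem_colimSrc M a.2 x.2⟩ = MulOpposite.op (B0.mk s a) • ψ x) :
    DirLim M →ₗ[(B0 s)ᵐᵒᵖ] N :=
  let p : DirLim M →ₗ[R] N := Submodule.liftQ _ ψ <| by
    rintro ⟨x, hx⟩ hx'
    change x ∈ colimRel M at hx'
    suffices H : ∀ x ∈ colimRel M, ∃ hx : x ∈ colimSrc M, ψ ⟨x, hx⟩ = 0 from (H x hx').2
    intro x hx
    rw [colimRel] at hx
    induction hx using Submodule.span_induction with
    | zero => exact ⟨zero_mem _, map_zero ψ⟩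
    | add x y _ _ hx hy =>
      obtain ⟨hx, hx'⟩ := hx
      obtain ⟨hy, hy'⟩ := hy
      refine ⟨add_mem hx hy, (map_add ψ ⟨x, hx⟩ ⟨y, hy⟩).trans ?_⟩
      rw [hx', hy', add_zero]
    | smul r x _ hx =>
      obtain ⟨hx, hx'⟩ := hx
      refine ⟨Submodule.smul_mem _ r hx, (map_smul ψ r ⟨x, hx⟩).trans ?_⟩
      rw [hx', smul_zero]
    | mem y hy =>
      obtain ⟨x, hx, v, l, a, ha, rfl⟩ := hy
      have hs := actL_mem_colimSrc M (sqGen s v l).2 hx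
      refine ⟨actL_mem_colimSrc M ha (sub_mem hs (Submodule.smul_mem _ _ hx)), ?_⟩
      refine (h ⟨a, ha⟩ (⟨_, hs⟩ - s l v v • ⟨x, hx⟩)).trans ?_
      rw [map_sub, map_smul, h (sqGen s v l) ⟨x, hx⟩, B0.mk_rel, ← MulOpposite.algebraMap_apply,
        algebraMap_smul, sub_self, smul_zero]
  { toFun := p
    map_add' := map_add p
    map_smul' b x := by
      obtain ⟨a, ha⟩ := B0.mk_surjective b.unop
      obtain ⟨x, rfl⟩ := DirLim.proj_surjective x
      have hb : b = MulOpposite.op (B0.mk s a) := by rw [ha]; rfl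
      rw [hb, DirLim.op_mk_smul, DirLim.actEven_proj]
      exact h a x }

section MapShift

variable (g : M →ₗ[R] M')

/-- The map `M ⊗ Sym L → M' ⊗ Sym L`, `m ⊗ y ↦ g m ⊗ y z`. -/
def tensorShift (z : SymmetricAlgebra R L) :
    M ⊗[R] SymmetricAlgebra R L →ₗ[R] M' ⊗[R] SymmetricAlgebra R L :=
  TensorProduct.map g (LinearMap.mulRight R z)

variable {g}

lemma tensorShift_actL (hg : ∀ (b : HC s) m, g (MulOpposite.op b • m) = MulOpposite.op b • g m)
    (z : SymmetricAlgebra R L) (a : HC s ⊗[R] SymmetricAlgebra R L)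
    (x : M ⊗[R] SymmetricAlgebra R L) :
    tensorShift g z (actL M a x) = actL M' a (tensorShift g z x) := by
  induction x with
  | zero => simp
  | add x y hx hy => simp only [map_add, hx, hy]
  | tmul m y =>
    induction a with
    | zero => simp
    | add x y hx hy => simp only [map_add, LinearMap.add_apply, hx, hy]
    | tmul b l =>
      change g (MulOpposite.op b • m) ⊗ₜ[R] (y * l * z) =
        (MulOpposite.op b • g m) ⊗ₜ[R] (y * z * l)
      rw [hg, mul_right_comm]

lemma tensorShift_mem_colimSrc {k : ℕ}
    (hk : ∀ (i : ℕ) m, m ∈ M.grade (2 * i) → g m ∈ M'.grade (2 * (i + k : ℕ)))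
    {z : SymmetricAlgebra R L} (hz : z ∈ tpow R L k) {x : M ⊗[R] SymmetricAlgebra R L}
    (hx : x ∈ colimSrc M) : tensorShift g z x ∈ colimSrc M' := by
  refine colimSrc_induction M (p := fun x => tensorShift g z x ∈ colimSrc M') ?_ ?_ ?_ hx
  · rw [map_zero]
    exact zero_mem _
  · intro x y hx hy
    rw [map_add]
    exact add_mem hx hy
  · intro i m l hm hl
    exact tmul_mem_colimSrc M' (i + k) (hk i m hm) (mul_mem_tpow hl hz)

/-- The map of direct limits `m ⊗ y ↦ g m ⊗ y z`, for a map `g` which shifts the degree by `2k` and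
a section `z` of `L^k`. -/
def DirLim.mapShift (hg : ∀ (b : HC s) m, g (MulOpposite.op b • m) = MulOpposite.op b • g m) {k : ℕ}
    (hk : ∀ (i : ℕ) m, m ∈ M.grade (2 * i) → g m ∈ M'.grade (2 * (i + k : ℕ)))
    {z : SymmetricAlgebra R L} (hz : z ∈ tpow R L k) : DirLim M →ₗ[(B0 s)ᵐᵒᵖ] DirLim M' :=
  DirLim.desc (DirLim.proj M' ∘ₗ
    (tensorShift g z).restrict fun _ hx => tensorShift_mem_colimSrc hk hz hx) fun a x => by
      rw [LinearMap.comp_apply, LinearMap.comp_apply, DirLim.op_mk_smul, DirLim.actEven_proj]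
      exact congrArg (DirLim.proj M') (Subtype.ext (tensorShift_actL hg z a x))

lemma DirLim.mapShift_mk
    (hg : ∀ (b : HC s) m, g (MulOpposite.op b • m) = MulOpposite.op b • g m) {k : ℕ}
    (hk : ∀ (i : ℕ) m, m ∈ M.grade (2 * i) → g m ∈ M'.grade (2 * (i + k : ℕ)))
    {z : SymmetricAlgebra R L} (hz : z ∈ tpow R L k) (i : ℕ) (m : M) (hm)
    (y : SymmetricAlgebra R L) (hy) : DirLim.mapShift hg hk hz (DirLim.mk M i m hm y hy) =
      DirLim.mk M' (i + k) (g m) (hk i m hm) (y * z) (mul_mem_tpow hy hz) := rfl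

end MapShift

end Descent

/-! ### The projections of the symmetric algebra to its graded components -/

section SymProjection

variable (R L : Type u) [CommRing R] [AddCommGroup L] [Module R L]

/-- The homomorphism `Sym L → (Sym L)[T]` sending `l` to `l T`. -/
def symGrading : SymmetricAlgebra R L →ₐ[R] Polynomial (SymmetricAlgebra R L) :=
  SymmetricAlgebra.lift
    { toFun l := Polynomial.monomial 1 (SymmetricAlgebra.ι R L l)
      map_add' _ _ := by rw [map_add, map_add]
      map_smul' r l := by rw [map_smul, RingHom.id_apply, Polynomial.smul_monomial] }

variable {R L} in
lemma symGrading_ι (l : L) : symGrading R L (SymmetricAlgebra.ι R L l) =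
    Polynomial.monomial 1 (SymmetricAlgebra.ι R L l) := SymmetricAlgebra.lift_ι_apply _ _

lemma symGrading_coeff_mem (y : SymmetricAlgebra R L) (k : ℕ) :
    (symGrading R L y).coeff k ∈ tpow R L k := by
  induction y using SymmetricAlgebra.induction generalizing k with
  | algebraMap r =>
    rw [AlgHom.commutes, Polynomial.algebraMap_apply, Polynomial.coeff_C]
    split_ifs with h
    · subst h
      rw [tpow, pow_zero]
      exact Submodule.algebraMap_mem r
    · exact zero_mem _
  | ι l =>
    rw [symGrading_ι, Polynomial.coeff_monomial]
    split_ifs with h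
    · subst h
      exact ι_mem_tpow l
    · exact zero_mem _
  | mul a b ha hb =>
    rw [map_mul, Polynomial.coeff_mul]
    refine sum_mem fun p hp => ?_
    rw [← Finset.HasAntidiagonal.mem_antidiagonal.1 hp]
    exact mul_mem_tpow (ha _) (hb _)
  | add a b ha hb =>
    rw [map_add, Polynomial.coeff_add]
    exact add_mem (ha k) (hb k)

/-- The projection of `Sym L` to its component of degree `k`. -/
def symProj (k : ℕ) : SymmetricAlgebra R L →ₗ[R] tpow R L k :=
  (((Polynomial.lcoeff (SymmetricAlgebra R L) k).restrictScalars R) ∘ₗ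
    (symGrading R L).toLinearMap).codRestrict _ fun y => symGrading_coeff_mem R L y k

variable {R L} in
lemma symGrading_of_mem {k : ℕ} {y : SymmetricAlgebra R L} (hy : y ∈ tpow R L k) :
    symGrading R L y = Polynomial.monomial k y := by
  induction k generalizing y with
  | zero =>
    rw [tpow, pow_zero, Submodule.mem_one] at hy
    obtain ⟨r, rfl⟩ := hy
    rw [AlgHom.commutes]
    rfl
  | succ k ih =>
    refine tpow_induction (p := fun y => symGrading R L y = Polynomial.monomial (k + 1) y)
      (fun x hx l => ?_) (fun x y hx hy => ?_) hy
    · rw [map_mul, ih hx, symGrading_ι, Polynomial.monomial_mul_monomial]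
    · rw [map_add, hx, hy, map_add]

variable {R L} in
lemma symProj_of_mem {k : ℕ} {y : SymmetricAlgebra R L} (hy : y ∈ tpow R L k) :
    symProj R L k y = ⟨y, hy⟩ := by
  refine Subtype.ext ?_
  change (symGrading R L y).coeff k = y
  rw [symGrading_of_mem hy, Polynomial.coeff_monomial, if_pos rfl]

end SymProjection

/-! ### The homogeneous Clifford algebra as a graded module -/

section IntGrade

variable {R M : Type u} [CommRing R] [AddCommGroup M] [Module R M]

/-- The `ℤ`-grading, concentrated in nonnegative degrees, given by an `ℕ`-grading. -/
def intGrade (g : ℕ → Submodule R M) : ℤ → Submodule R M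
  | Int.ofNat n => g n
  | Int.negSucc _ => ⊥

lemma intGrade_natCast (g : ℕ → Submodule R M) (n : ℕ) : intGrade g n = g n := rfl

lemma exists_of_intGrade_ne_bot {g : ℕ → Submodule R M} {k : ℤ} (h : intGrade g k ≠ ⊥) :
    ∃ n : ℕ, k = n := by
  rcases k with n | n
  · exact ⟨n, rfl⟩
  · exact absurd rfl h

lemma isInternal_intGrade {g : ℕ → Submodule R M} (h : DirectSum.IsInternal g) :
    DirectSum.IsInternal (intGrade g) := by
  rw [DirectSum.isInternal_submodule_iff_iSupIndep_and_iSup_eq_top] at h ⊢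
  constructor
  · rw [← iSupIndep_ne_bot]
    have hn (k : {k // intGrade g k ≠ ⊥}) : k.1 = (k.1.toNat : ℤ) := by
      obtain ⟨n, hn⟩ := exists_of_intGrade_ne_bot k.2
      rw [hn]; rfl
    have := h.1.comp (f := fun k : {k // intGrade g k ≠ ⊥} => k.1.toNat) fun k k' hk =>
      Subtype.ext ((hn k).trans ((congrArg Nat.cast hk).trans (hn k').symm))
    refine (congrArg iSupIndep (funext fun k => ?_)).mp this
    rw [hn k]
    rfl
  · rw [eq_top_iff, ← h.2]
    exact iSup_le fun n => le_iSup (intGrade g) n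

lemma mem_intGrade {g : ℕ → Submodule R M} {k : ℤ} {m : M} (hm : m ∈ intGrade g k) :
    (∃ n : ℕ, k = n ∧ m ∈ g n) ∨ m = 0 := by
  rcases k with n | n
  · exact Or.inl ⟨n, rfl, hm⟩
  · exact Or.inr hm

end IntGrade

section Regular

variable {R E L : Type u} [CommRing R] [AddCommGroup E] [Module R E] [AddCommGroup L] [Module R L]
variable (s : L →ₗ[R] E →ₗ[R] E →ₗ[R] R)

instance : IsScalarTower R (HC s)ᵐᵒᵖ (HC s) := ⟨fun r b x => by
  change x * (r • b.unop) = r • (x * b.unop)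
  rw [mul_smul_comm]⟩

/-- The homogeneous Clifford algebra, as a graded right module over itself. -/
def HC.regular [NondegForm s] : GrModule s where
  carrier := HC s
  grade := intGrade (HC.deg s)
  isInternal := isInternal_intGrade (DirectSum.Decomposition.isInternal (HC.deg s))
  act_mem {k j m b} hm hb := by
    rcases mem_intGrade hm with ⟨n, rfl, hm⟩ | rfl
    · rw [← Nat.cast_add, intGrade_natCast]
      exact SetLike.mul_mem_graded hm hb
    · rw [smul_zero]
      exact zero_mem _

variable {s}

lemma HC.mul_mem_regular [NondegForm s] {k : ℤ} {j : ℕ} {a b : HC s} (hb : b ∈ HC.deg s j)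
    (ha : a ∈ (HC.regular s).grade k) : (b * a : HC s) ∈ (HC.regular s).grade (k + j) := by
  rcases mem_intGrade ha with ⟨n, rfl, hm⟩ | rfl
  · change _ ∈ intGrade (HC.deg s) _
    rw [← Nat.cast_add, add_comm, intGrade_natCast]
    exact SetLike.mul_mem_graded hb hm
  · rw [mul_zero]
    exact zero_mem _

variable (s) in
/-- The graded module `HC⟨-j⟩`. -/
abbrev HC.free [NondegForm s] (j : ℕ) : GrModule s := (HC.regular s).shift (-j)

variable (s) in
/-- The right `B0`-module associated with the graded module `HC⟨-j⟩`. -/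
abbrev FreeLim [NondegForm s] (j : ℕ) : Type u := DirLim (HC.free s j)

lemma HC.mem_free [NondegForm s] {j : ℕ} {k : ℤ} {n : ℕ} (h : k = n + j) {a : HC s}
    (ha : a ∈ HC.deg s n) : a ∈ (HC.free s j).grade k := by
  change a ∈ intGrade (HC.deg s) (k + -j)
  rwa [h, add_neg_cancel_right]

/-- The left multiplication by an element `b` of degree `i` and a section `z` of `L^k`, as a map of direct
limits. -/
def FreeLim.mulLeft [NondegForm s] {i k : ℕ} {b : HC s} (hb : b ∈ HC.deg s i)
    {z : SymmetricAlgebra R L} (hz : z ∈ tpow R L k) {j j' : ℕ} (h : i + j' = 2 * k + j) :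
    FreeLim s j →ₗ[(B0 s)ᵐᵒᵖ] FreeLim s j' :=
  DirLim.mapShift (M := HC.free s j) (M' := HC.free s j') (g := LinearMap.mulLeft R b)
    (fun (a m : HC s) => (mul_assoc b m a).symm)
    (by
      intro t m hm
      have hm' := HC.mul_mem_regular hb hm
      have e : 2 * (t : ℤ) + -(j : ℤ) + i = 2 * ((t + k : ℕ) : ℤ) + -(j' : ℤ) := by
        push_cast
        linarith [show (i : ℤ) + j' = 2 * k + j by exact_mod_cast h]
      rw [e] at hm'
      exact hm') hz

lemma FreeLim.mulLeft_mk [NondegForm s] {i k : ℕ} {b : HC s} (hb : b ∈ HC.deg s i)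
    {z : SymmetricAlgebra R L} (hz : z ∈ tpow R L k) {j j' : ℕ} (h : i + j' = 2 * k + j)
    (t : ℕ) (a : HC s) (ha : a ∈ (HC.free s j).grade (2 * t)) (y : SymmetricAlgebra R L) (hy) :
    ∃ h' : (b * a : HC s) ∈ (HC.free s j').grade (2 * (t + k : ℕ)),
      FreeLim.mulLeft hb hz h (DirLim.mk (HC.free s j) t a ha y hy) =
        DirLim.mk (HC.free s j') (t + k) (b * a : HC s) h' (y * z) (mul_mem_tpow hy hz) :=
  ⟨_, DirLim.mapShift_mk _ _ _ _ _ _ _ _⟩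

lemma one_mem_tpow : (1 : SymmetricAlgebra R L) ∈ tpow R L 0 := by
  rw [tpow, pow_zero]
  exact Submodule.one_le.1 le_rfl

variable (s) in
/-- The map given by the left multiplication by a generator. -/
def FreeLim.gen [NondegForm s] (j : ℕ) (v : E) : FreeLim s (j + 1) →ₗ[(B0 s)ᵐᵒᵖ] FreeLim s j :=
  FreeLim.mulLeft (HC.gen_mem_deg s v) (one_mem_tpow (R := R) (L := L)) (by ring)

variable (s) in
/-- The map given by the left multiplication by a generator and a section of `L`. -/
def FreeLim.genTwist [NondegForm s] (j : ℕ) (v : E) (l : L) :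
    FreeLim s j →ₗ[(B0 s)ᵐᵒᵖ] FreeLim s (j + 1) :=
  FreeLim.mulLeft (HC.gen_mem_deg s v) (ι_mem_tpow l) (by ring)

lemma HC.one_mem_deg : (1 : HC s) ∈ HC.deg s 0 := by
  rw [HC.deg, pow_zero]
  exact Submodule.one_le.1 le_rfl

variable (s) in
/-- The map given by the multiplication by a section of `L`. -/
def FreeLim.twist [NondegForm s] (j : ℕ) (l : L) :
    FreeLim s j →ₗ[(B0 s)ᵐᵒᵖ] FreeLim s (j + 1 + 1) :=
  FreeLim.mulLeft HC.one_mem_deg (ι_mem_tpow l) (by ring)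

/-- The identity `∑ l_i v_i v_i = 1` on `HC⟨-j-1⟩`: the multiplications by `v_i` and by `v_i l_i` make
`HC⟨-j-1⟩` a retract of a power of `HC⟨-j⟩` after passage to the direct limits. -/
lemma FreeLim.sum_genTwist [NondegForm s] (π : SqPartition s) (j : ℕ) (x : FreeLim s (j + 1)) :
    ∑ i, FreeLim.genTwist s j (π.v i) (π.l i) (FreeLim.gen s j (π.v i) x) = x := by
  induction x using DirLim.induction with
  | zero => simp
  | add x y hx hy => simp only [map_add, Finset.sum_add_distrib, hx, hy]
  | mk k a ha y hy =>
    refine Eq.trans (Finset.sum_congr rfl fun i _ => ?_) (π.sum_mk ha hy)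
    obtain ⟨h₁, e₁⟩ := FreeLim.mulLeft_mk (HC.gen_mem_deg s (π.v i))
      (one_mem_tpow (R := R) (L := L)) (j' := j) (by ring) k a ha y hy
    obtain ⟨h₂, e₂⟩ := FreeLim.mulLeft_mk (HC.gen_mem_deg s (π.v i))
      (ι_mem_tpow (π.l i)) (j' := j + 1) (by ring) _ _ h₁ _ (mul_mem_tpow hy one_mem_tpow)
    rw [FreeLim.gen, FreeLim.genTwist, e₁, e₂]
    refine DirLim.mk_eq_mk _ _ _ _
      (congrArg₂ (fun (b : HC s) z => (b ⊗ₜ[R] z : HCL s)) ?_ (by rw [mul_one]))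
    exact (mul_assoc _ _ _).symm.trans (HC.sq_mul (π.v i) a)

lemma FreeLim.sum_twist [NondegForm s] (π : SqPartition s) (j : ℕ) (x : FreeLim s (j + 1 + 1)) :
    ∑ i, FreeLim.twist s j (π.l i) (FreeLim.gen s j (π.v i) (FreeLim.gen s (j + 1) (π.v i) x)) =
      x := by
  induction x using DirLim.induction with
  | zero => simp
  | add x y hx hy => simp only [map_add, Finset.sum_add_distrib, hx, hy]
  | mk k a ha y hy =>
    refine Eq.trans (Finset.sum_congr rfl fun i _ => ?_) (π.sum_mk ha hy)
    obtain ⟨h₁, e₁⟩ := FreeLim.mulLeft_mk (HC.gen_mem_deg s (π.v i))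
      (one_mem_tpow (R := R) (L := L)) (j' := j + 1) (by ring) k a ha y hy
    have hy₁ := mul_mem_tpow hy (one_mem_tpow (R := R) (L := L))
    obtain ⟨h₂, e₂⟩ := FreeLim.mulLeft_mk (HC.gen_mem_deg s (π.v i))
      (one_mem_tpow (R := R) (L := L)) (j' := j) (by ring) _ _ h₁ _ hy₁
    obtain ⟨h₃, e₃⟩ := FreeLim.mulLeft_mk HC.one_mem_deg
      (ι_mem_tpow (π.l i)) (j' := j + 1 + 1) (by ring) _ _ h₂ _ (mul_mem_tpow hy₁ one_mem_tpow)
    rw [FreeLim.gen, FreeLim.gen, FreeLim.twist, e₁, e₂, e₃]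
    refine DirLim.mk_eq_mk _ _ _ _
      (congrArg₂ (fun (b : HC s) z => (b ⊗ₜ[R] z : HCL s)) ?_ (by rw [mul_one, mul_one]))
    exact (one_mul _).trans ((mul_assoc _ _ _).symm.trans (HC.sq_mul (π.v i) a))

section HomFree

variable [NondegForm s] (N : Type u) [AddCommGroup N] [Module (B0 s)ᵐᵒᵖ N]

/-- The `B0`-linear maps to `N` from the module associated with `HC⟨-j⟩`. -/
abbrev HomFree (j : ℕ) : Type u := FreeLim s j →ₗ[(B0 s)ᵐᵒᵖ] N

lemma HC.mem_free_zero {k : ℕ} {a : HC s} :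
    a ∈ (HC.free s 0).grade (2 * k) ↔ a ∈ HC.deg s (2 * k) := by
  change a ∈ intGrade (HC.deg s) (2 * (k : ℤ) + -((0 : ℕ) : ℤ)) ↔ _
  have : 2 * (k : ℤ) + -((0 : ℕ) : ℤ) = ((2 * k : ℕ) : ℤ) := by simp
  rw [this, intGrade_natCast]

lemma HC.mem_evenAlg_of_mem_colimSrc {x : HC s ⊗[R] SymmetricAlgebra R L}
    (hx : x ∈ colimSrc (HC.free s 0)) : x ∈ evenAlg s := by
  refine colimSrc_induction (HC.free s 0) (p := fun x => (x : HCL s) ∈ evenAlg s) ?_ ?_ ?_ hx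
  · exact zero_mem _
  · intro x y hx hy
    exact add_mem hx hy
  · intro k m l hm hl
    exact Submodule.mem_iSup_of_mem (p := evenPiece s) k
      (Submodule.apply_mem_map₂ (TensorProduct.mk R (HC s) (SymmetricAlgebra R L))
        (HC.mem_free_zero.1 hm) hl)

variable (s) in
/-- The generator `1 ⊗ 1`. -/
def FreeLim.one : FreeLim s 0 :=
  DirLim.mk (HC.free s 0) 0 (1 : HC s) (HC.mem_free_zero.2 HC.one_mem_deg) 1 one_mem_tpow

lemma actL_free_zero (a x : HCL s) : actL (HC.free s 0) a x = (x * a : HCL s) := by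
  induction x using TensorProduct.induction_on with
  | zero => exact (map_zero (actL (HC.free s 0) a)).trans (zero_mul a).symm
  | add x y hx hy =>
    exact (map_add (actL (HC.free s 0) a) x y).trans
      ((congrArg₂ (fun p q : HCL s => p + q) hx hy).trans (add_mul x y a).symm)
  | tmul c y =>
    induction a using TensorProduct.induction_on with
    | zero => rw [map_zero, mul_zero]; rfl
    | add a b ha hb =>
      rw [map_add, mul_add]
      exact congrArg₂ (fun p q : HCL s => p + q) ha hb
    | tmul b z =>
      rw [Algebra.TensorProduct.tmul_mul_tmul]
      exact actL_tmul (HC.free s 0) b z c y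

lemma FreeLim.eq_smul_one (x : colimSrc (HC.free s 0)) : DirLim.proj (HC.free s 0) x =
    MulOpposite.op (B0.mk s ⟨x.1, HC.mem_evenAlg_of_mem_colimSrc x.2⟩) • FreeLim.one s := by
  rw [DirLim.op_mk_smul]
  refine congrArg (DirLim.proj _) (Subtype.ext ?_)
  exact ((actL_free_zero (x.1 : HCL s) 1).trans (one_mul (M := HCL s) x.1)).symm

lemma FreeLim.zero_hom_ext {f g : HomFree N 0} (h : f (FreeLim.one s) = g (FreeLim.one s)) :
    f = g := by
  refine LinearMap.ext fun x => ?_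
  obtain ⟨x, rfl⟩ := DirLim.proj_surjective x
  rw [FreeLim.eq_smul_one, map_smul, map_smul, h]

variable [Module R N] [IsScalarTower R (B0 s)ᵐᵒᵖ N]

variable {N} in
/-- The `B0`-linear map sending the generator `1 ⊗ 1` to `n`. -/
def FreeLim.ofElement (n : N) : HomFree (s := s) N 0 :=
  DirLim.desc
    ({ toFun x := MulOpposite.op (B0.mk s ⟨x.1, HC.mem_evenAlg_of_mem_colimSrc x.2⟩) • n
       map_add' x y := by
        rw [← add_smul, ← MulOpposite.op_add, ← map_add]
        rfl
       map_smul' r x := by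
        rw [RingHom.id_apply, ← smul_assoc, ← MulOpposite.op_smul, ← map_smul]
        rfl } : colimSrc (HC.free s 0) →ₗ[R] N) fun a x => by
    change _ = MulOpposite.op (B0.mk s a) •
      MulOpposite.op (B0.mk s ⟨x.1, HC.mem_evenAlg_of_mem_colimSrc x.2⟩) • n
    rw [← mul_smul, ← MulOpposite.op_mul, ← map_mul]
    exact congrArg (fun b => MulOpposite.op (B0.mk s b) • n)
      (Subtype.ext (actL_free_zero (a : HCL s) (x.1 : HCL s)))

variable {N} in
lemma FreeLim.ofElement_one (n : N) : FreeLim.ofElement n (FreeLim.one s) = n := by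
  change MulOpposite.op (B0.mk s ⟨_, _⟩) • n = n
  refine Eq.trans (congrArg (fun b => MulOpposite.op b • n) (a₂ := 1) ?_) (one_smul _ n)
  exact map_one (B0.mk s)

/-- The evaluation at the generator. -/
def homFreeZeroEquiv : HomFree (s := s) N 0 ≃ₗ[R] N where
  toFun f := f (FreeLim.one s)
  map_add' _ _ := rfl
  map_smul' _ _ := rfl
  invFun := FreeLim.ofElement
  left_inv _ := FreeLim.zero_hom_ext N (FreeLim.ofElement_one _)
  right_inv := FreeLim.ofElement_one

end HomFree

end Regular


/-! ### Graded modules given by their components -/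

section Family

variable {R E L : Type u} [CommRing R] [AddCommGroup E] [Module R E] [AddCommGroup L] [Module R L]
variable {R' E' L' : Type u} [CommRing R'] [AddCommGroup E'] [Module R' E'] [AddCommGroup L']
  [Module R' L']
variable {s : L →ₗ[R] E →ₗ[R] E →ₗ[R] R} {s' : L' →ₗ[R'] E' →ₗ[R'] E' →ₗ[R'] R'}

/-- The composition of two maps `X → Y → Z` depending on elements of `E`, as a function of an element
of `E ⊗ E`. -/
def actTwo {X Y Z : Type u} [AddCommGroup X] [Module R X] [AddCommGroup Y] [Module R Y]
    [AddCommGroup Z] [Module R Z] (f : E →ₗ[R] X →ₗ[R] Y) (g : E →ₗ[R] Y →ₗ[R] Z) :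
    E ⊗[R] E →ₗ[R] X →ₗ[R] Z :=
  TensorProduct.lift (LinearMap.mk₂ R (fun v w => g w ∘ₗ f v)
    (fun _ _ _ => by ext; simp) (fun _ _ _ => by ext; simp) (fun _ _ _ => by ext; simp)
    (fun _ _ _ => by ext; simp))

lemma actTwo_tmul {X Y Z : Type u} [AddCommGroup X] [Module R X] [AddCommGroup Y] [Module R Y]
    [AddCommGroup Z] [Module R Z] (f : E →ₗ[R] X →ₗ[R] Y) (g : E →ₗ[R] Y →ₗ[R] Z) (v w : E) (x : X) :
    actTwo f g (v ⊗ₜ w) x = g w (f v x) := rfl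

variable (s) in
/-- The components, in degrees `j ≥ 0`, of a graded right module over the homogeneous Clifford algebra,
with the action of the generators. -/
structure GrFamily where
  obj : ℕ → Type u
  [addCommGroup : ∀ j, AddCommGroup (obj j)]
  [module : ∀ j, Module R (obj j)]
  act : ∀ j, E →ₗ[R] obj j →ₗ[R] obj (j + 1)
  act_rel : ∀ j, ∀ t ∈ quadRel s, actTwo (act j) (act (j + 1)) t = 0

attribute [instance] GrFamily.addCommGroup GrFamily.module

namespace GrFamily

variable (X : GrFamily s)

/-- The direct sum of the components. -/
def Total : Type u := ⨁ j, X.obj j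

instance : AddCommGroup X.Total := inferInstanceAs (AddCommGroup (⨁ j, X.obj j))

instance : Module R X.Total := inferInstanceAs (Module R (⨁ j, X.obj j))

/-- The inclusion of a component. -/
def of (j : ℕ) : X.obj j →ₗ[R] X.Total := DirectSum.lof R ℕ X.obj j

variable {X} in
lemma induction {p : X.Total → Prop} (zero : p 0) (add : ∀ x y, p x → p y → p (x + y))
    (of : ∀ j x, p (X.of j x)) (x : X.Total) : p x :=
  DirectSum.induction_on x zero of add

variable {X} in
lemma linearMap_ext {N : Type*} [AddCommGroup N] [Module R N] {f g : X.Total →ₗ[R] N}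
    (h : ∀ j x, f (X.of j x) = g (X.of j x)) : f = g :=
  DirectSum.linearMap_ext R fun j => LinearMap.ext (h j)

/-- The projection to a component. -/
def component (j : ℕ) : X.Total →ₗ[R] X.obj j := DirectSum.component R ℕ X.obj j

lemma component_of_self (j : ℕ) (x : X.obj j) : X.component j (X.of j x) = x :=
  DirectSum.component.lof_self R j x

lemma component_of_ne {i j : ℕ} (h : i ≠ j) (x : X.obj i) : X.component j (X.of i x) = 0 :=
  (DirectSum.component.of R j i x).trans (dif_neg h)

/-- The linear map given by its restrictions to the components. -/
def desc {N : Type*} [AddCommGroup N] [Module R N] (f : ∀ j, X.obj j →ₗ[R] N) : X.Total →ₗ[R] N :=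
  DirectSum.toModule R ℕ N f

@[simp]
lemma desc_of {N : Type*} [AddCommGroup N] [Module R N] (f : ∀ j, X.obj j →ₗ[R] N) (j : ℕ)
    (x : X.obj j) : X.desc f (X.of j x) = f j x := DirectSum.toModule_lof R j x

/-- The action of the generators. -/
def actGen : E →ₗ[R] (Module.End R X.Total)ᵐᵒᵖ where
  toFun v := MulOpposite.op (X.desc fun j => X.of (j + 1) ∘ₗ X.act j v)
  map_add' v w := congrArg MulOpposite.op (linearMap_ext fun j x => by simp)
  map_smul' r v := congrArg MulOpposite.op (linearMap_ext fun j x => by simp)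

lemma actGen_of (v : E) (j : ℕ) (x : X.obj j) :
    (X.actGen v).unop (X.of j x) = X.of (j + 1) (X.act j v x) := X.desc_of _ _ _

lemma lift_actGen_tensorTwo (t : E ⊗[R] E) (j : ℕ) (x : X.obj j) :
    (TensorAlgebra.lift R X.actGen (tensorTwo R E t)).unop (X.of j x) =
      X.of (j + 1 + 1) (actTwo (X.act j) (X.act (j + 1)) t x) := by
  induction t with
  | zero => simp
  | add t t' h h' =>
    rw [map_add, map_add, map_add, LinearMap.add_apply, map_add, ← h, ← h', MulOpposite.unop_add,
      LinearMap.add_apply]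
  | tmul v w =>
    simp only [tensorTwo, TensorProduct.lift.tmul, LinearMap.compl₁₂_apply, LinearMap.mul_apply',
      map_mul, TensorAlgebra.lift_ι_apply, MulOpposite.unop_mul, Module.End.mul_apply, actGen_of,
      actTwo_tmul]

/-- The action of the homogeneous Clifford algebra. -/
def actHC : HC s →ₐ[R] (Module.End R X.Total)ᵐᵒᵖ :=
  RingQuot.liftAlgHom R ⟨TensorAlgebra.lift R X.actGen, by
    rintro _ _ ⟨⟨t, ht, rfl⟩, rfl⟩
    refine MulOpposite.unop_injective (linearMap_ext fun j x => ?_)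
    rw [lift_actGen_tensorTwo, X.act_rel j t ht, map_zero, LinearMap.zero_apply, map_zero]
    rfl⟩

lemma actHC_gen (v : E) : X.actHC (HC.gen s v) = X.actGen v :=
  (RingQuot.liftAlgHom_mkAlgHom_apply R _ _ _).trans (TensorAlgebra.lift_ι_apply _ _)

instance : Module (HC s)ᵐᵒᵖ X.Total where
  smul b x := (X.actHC b.unop).unop x
  one_smul x := by
    change (X.actHC 1).unop x = x
    rw [map_one]; rfl
  mul_smul a b x := by
    change (X.actHC (b.unop * a.unop)).unop x = _
    rw [map_mul]; rfl
  smul_zero b := map_zero _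
  smul_add b x y := map_add _ x y
  add_smul a b x := by
    change (X.actHC (a.unop + b.unop)).unop x = _
    rw [map_add]; rfl
  zero_smul x := by
    change (X.actHC 0).unop x = _
    rw [map_zero]; rfl

instance : IsScalarTower R (HC s)ᵐᵒᵖ X.Total where
  smul_assoc r b x := by
    change (X.actHC (r • b.unop)).unop x = r • (X.actHC b.unop).unop x
    rw [map_smul]; rfl

lemma gen_smul_of (v : E) (j : ℕ) (x : X.obj j) :
    MulOpposite.op (HC.gen s v) • X.of j x = X.of (j + 1) (X.act j v x) := by
  change (X.actHC (HC.gen s v)).unop _ = _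
  rw [actHC_gen, actGen_of]

lemma isInternal_range_of : DirectSum.IsInternal fun j => LinearMap.range (X.of j) := by
  have hinj (j : ℕ) : Function.Injective (X.of j) := DirectSum.of_injective j
  let e (j : ℕ) : X.obj j →ₗ[R] LinearMap.range (X.of j) := (X.of j).rangeRestrict
  have he : Function.Bijective (DirectSum.lmap e) :=
    ⟨(DirectSum.lmap_injective e).2 fun j x y h => hinj j (congrArg Subtype.val h),
      (DirectSum.lmap_surjective e).2 fun j => (X.of j).surjective_rangeRestrict⟩
  have h : DirectSum.coeLinearMap (fun j => LinearMap.range (X.of j)) ∘ₗ DirectSum.lmap e =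
      (LinearMap.id : X.Total →ₗ[R] X.Total) := by
    refine DirectSum.linearMap_ext R fun j => LinearMap.ext fun x => ?_
    simp only [LinearMap.comp_apply, DirectSum.lmap_lof, DirectSum.coeLinearMap_lof]
    rfl
  have hb : Function.Bijective (DirectSum.coeLinearMap fun j => LinearMap.range (X.of j)) := by
    refine (Function.Bijective.of_comp_iff _ he).1 ?_
    rw [← LinearMap.coe_comp, h]
    exact Function.bijective_id
  exact hb

lemma op_smul_of_mem {n j : ℕ} {b : HC s} (hb : b ∈ HC.deg s n) {m : X.Total}
    (hm : m ∈ LinearMap.range (X.of j)) :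
    MulOpposite.op b • m ∈ LinearMap.range (X.of (j + n)) := by
  induction n generalizing b with
  | zero =>
    rw [HC.deg, pow_zero, Submodule.mem_one] at hb
    obtain ⟨r, rfl⟩ := hb
    rw [← MulOpposite.algebraMap_apply, algebraMap_smul]
    exact Submodule.smul_mem _ r hm
  | succ n ih =>
    rw [HC.deg, pow_succ] at hb
    induction hb using Submodule.mul_induction_on' with
    | mem_mul_mem x hx y hy =>
      obtain ⟨v, rfl⟩ := hy
      obtain ⟨z, hz⟩ := ih hx
      rw [MulOpposite.op_mul, mul_smul, ← hz, gen_smul_of]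
      exact ⟨_, rfl⟩
    | add x _ y _ hx hy =>
      rw [MulOpposite.op_add, add_smul]
      exact add_mem hx hy

/-- The graded module with the given components. -/
def toGrModule : GrModule s where
  carrier := X.Total
  grade := intGrade fun j => LinearMap.range (X.of j)
  isInternal := isInternal_intGrade X.isInternal_range_of
  act_mem {k j m b} hm hb := by
    rcases mem_intGrade hm with ⟨n, rfl, hm⟩ | rfl
    · exact X.op_smul_of_mem hb hm
    · rw [smul_zero]
      exact zero_mem _

lemma of_mem_grade (j : ℕ) (x : X.obj j) : X.of j x ∈ X.toGrModule.grade j := ⟨x, rfl⟩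

variable {X} in
lemma exists_of_mem_grade {k : ℤ} {j : ℕ} (h : k = j) {m : X.Total} (hm : m ∈ X.toGrModule.grade k) :
    ∃ x, X.of j x = m := by
  subst h
  exact hm

/-- A graded module given by its components is finitely generated when finitely many components are
finitely generated over the base ring, and the following ones are generated by them. -/
lemma finite (j₀ : ℕ) (h : ∀ j ≤ j₀, Module.Finite R (X.obj j)) (h' : ∀ j ≥ j₀, ∀ y,
    y ∈ Submodule.span R {z | ∃ v x, X.act j v x = z}) :
    Module.Finite (HC s)ᵐᵒᵖ X.toGrModule := by
  let P : Submodule (HC s)ᵐᵒᵖ X.Total :=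
    ⨆ i : Fin (j₀ + 1), Submodule.span _ (LinearMap.range (X.of i) : Set X.Total)
  have hP : P.FG := by
    refine Submodule.fg_iSup _ fun i => ?_
    have := h i (Nat.lt_succ_iff.1 i.2)
    obtain ⟨S, hS⟩ := (Module.Finite.fg_top (R := R) (M := X.obj i)).map (X.of i)
    refine ⟨S, le_antisymm (Submodule.span_mono ?_) (Submodule.span_le.2 ?_)⟩
    · intro x hx
      have : x ∈ Submodule.map (X.of i) ⊤ := hS ▸ Submodule.subset_span hx
      rwa [Submodule.map_top] at this
    · intro x hx
      have hx' : x ∈ Submodule.span R (S : Set X.Total) := by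
        rw [hS, Submodule.map_top]
        exact hx
      exact Submodule.span_le_restrictScalars R (HC s)ᵐᵒᵖ _ hx'
  have hle (j : ℕ) (hj : j ≤ j₀) (x : X.obj j) : X.of j x ∈ P :=
    Submodule.mem_iSup_of_mem (⟨j, Nat.lt_succ_of_le hj⟩ : Fin (j₀ + 1))
      (Submodule.subset_span ⟨x, rfl⟩)
  have hall (j : ℕ) : ∀ x : X.obj j, X.of j x ∈ P := by
    induction j with
    | zero => exact hle 0 (Nat.zero_le _)
    | succ j ih =>
      intro y
      rcases Nat.lt_or_ge j j₀ with hj | hj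
      · exact hle _ hj y
      · have := h' j hj y
        induction this using Submodule.span_induction with
        | zero => rw [map_zero]; exact zero_mem _
        | add x y _ _ hx hy => rw [map_add]; exact add_mem hx hy
        | smul r x _ hx =>
          rw [map_smul]
          exact (P.restrictScalars R).smul_mem r hx
        | mem z hz =>
          obtain ⟨v, x, rfl⟩ := hz
          rw [← gen_smul_of]
          exact P.smul_mem _ (ih x)
  refine ⟨?_⟩
  have hT : P = ⊤ := by
    refine eq_top_iff.2 fun x _ => ?_
    induction x using induction with
    | zero => exact zero_mem _
    | add x y hx hy => exact add_mem (hx trivial) (hy trivial)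
    | of j x => exact hall j x
  exact hT ▸ hP

end GrFamily

/-- A map of modules over the homogeneous Clifford algebra which is compatible with the action of the
generators is compatible with the action of the algebra. -/
lemma map_op_smul_of_gen (F : FormMap s s') {M M' : Type*} [AddCommGroup M] [Module R M]
    [Module (HC s)ᵐᵒᵖ M] [IsScalarTower R (HC s)ᵐᵒᵖ M] [AddCommGroup M'] [Module R' M']
    [Module (HC s')ᵐᵒᵖ M'] [IsScalarTower R' (HC s')ᵐᵒᵖ M'] (f : M →ₛₗ[F.φ] M')
    (h : ∀ v m, f (MulOpposite.op (HC.gen s v) • m) = MulOpposite.op (HC.gen s' (F.fE v)) • f m)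
    (b : HC s) (m : M) : f (MulOpposite.op b • m) = MulOpposite.op (HC.map F b) • f m := by
  induction b using HC.induction generalizing m with
  | algebraMap r =>
    rw [HC.map_algebraMap, ← MulOpposite.algebraMap_apply, ← MulOpposite.algebraMap_apply,
      algebraMap_smul, algebraMap_smul, LinearMap.map_smulₛₗ]
  | gen v => rw [HC.map_gen, h]
  | mul x y hx hy => rw [map_mul, MulOpposite.op_mul, MulOpposite.op_mul, mul_smul, mul_smul, hy, hx]
  | add x y hx hy =>
    rw [map_add, MulOpposite.op_add, MulOpposite.op_add, add_smul, add_smul, map_add, hx, hy]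

lemma map_op_smul_of_gen_id {M M' : Type*} [AddCommGroup M] [Module R M]
    [Module (HC s)ᵐᵒᵖ M] [IsScalarTower R (HC s)ᵐᵒᵖ M] [AddCommGroup M'] [Module R M']
    [Module (HC s)ᵐᵒᵖ M'] [IsScalarTower R (HC s)ᵐᵒᵖ M'] (f : M →ₗ[R] M')
    (h : ∀ v m, f (MulOpposite.op (HC.gen s v) • m) = MulOpposite.op (HC.gen s v) • f m)
    (b : HC s) (m : M) : f (MulOpposite.op b • m) = MulOpposite.op b • f m := by
  have := map_op_smul_of_gen (FormMap.id s) f h b m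
  rwa [HC.map_id_apply] at this

namespace GrFamily

variable {X : GrFamily s} {X' : GrFamily s'}

/-- The semilinear map given by maps of the components. -/
def semilinearMap {φ : R →+* R'} (α : ∀ j, X.obj j →ₛₗ[φ] X'.obj j) : X.Total →ₛₗ[φ] X'.Total :=
  directSumMap α

lemma semilinearMap_of {φ : R →+* R'} (α : ∀ j, X.obj j →ₛₗ[φ] X'.obj j) (j : ℕ) (x : X.obj j) :
    semilinearMap α (X.of j x) = X'.of j (α j x) := directSumMap_lof α j x

/-- The map of graded modules given by maps of the components. -/
def mapRes (F : FormMap s s') (α : ∀ j, X.obj j →ₛₗ[F.φ] X'.obj j)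
    (h : ∀ j v x, α (j + 1) (X.act j v x) = X'.act j (F.fE v) (α j x)) :
    GrMap F X.toGrModule X'.toGrModule where
  toFun := semilinearMap α
  map_act := map_op_smul_of_gen F (semilinearMap α) fun v m => by
    induction m using induction with
    | zero => rw [smul_zero, map_zero, smul_zero]
    | add x y hx hy => rw [smul_add, map_add, map_add, smul_add, hx, hy]
    | of j x => rw [gen_smul_of, semilinearMap_of, semilinearMap_of, gen_smul_of, h]
  map_grade {k m} hm := by
    rcases mem_intGrade hm with ⟨n, rfl, x, rfl⟩ | rfl
    · exact ⟨α n x, (semilinearMap_of α n x).symm⟩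
    · exact (map_zero (semilinearMap α)).symm ▸ (X'.toGrModule.grade k).zero_mem

lemma mapRes_isExtensionOfScalars (F : FormMap s s') (α : ∀ j, X.obj j →ₛₗ[F.φ] X'.obj j)
    (h : ∀ j v x, α (j + 1) (X.act j v x) = X'.act j (F.fE v) (α j x))
    (hα : ∀ j, IsExtensionOfScalars F.φ (α j)) :
    IsExtensionOfScalars F.φ (mapRes F α h).toFun :=
  IsExtensionOfScalars.directSum hα

variable (Y : GrFamily s)

/-- The map of total modules given by linear maps of the components. -/
def map (α : ∀ j, X.obj j →ₗ[R] Y.obj j) : X.Total →ₗ[R] Y.Total :=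
  X.desc fun j => Y.of j ∘ₗ α j

variable {Y} (α : ∀ j, X.obj j →ₗ[R] Y.obj j)

lemma map_of (j : ℕ) (x : X.obj j) : map Y α (X.of j x) = Y.of j (α j x) := X.desc_of _ _ _

lemma map_op_smul (h : ∀ j v x, α (j + 1) (X.act j v x) = Y.act j v (α j x)) (b : HC s)
    (x : X.Total) : map Y α (MulOpposite.op b • x) = MulOpposite.op b • map Y α x := by
  refine map_op_smul_of_gen_id (map Y α) (fun v m => ?_) b x
  induction m using induction with
  | zero => rw [smul_zero, map_zero, smul_zero]
  | add x y hx hy => rw [smul_add, map_add, map_add, smul_add, hx, hy]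
  | of j x => rw [gen_smul_of, map_of, map_of, gen_smul_of, h]

lemma map_mem_grade {k : ℤ} {m : X.Total} (hm : m ∈ X.toGrModule.grade k) :
    map Y α m ∈ Y.toGrModule.grade k := by
  rcases mem_intGrade hm with ⟨n, rfl, x, rfl⟩ | rfl
  · exact ⟨α n x, (map_of α n x).symm⟩
  · rw [map_zero]
    exact zero_mem _

/-- A map of graded modules with finitely generated components which is bijective in large degrees has
finitely generated kernel and cokernel. -/
lemma map_finite_ker_coker [IsNoetherianRing R] (hX : ∀ j, Module.Finite R (X.obj j))
    (hY : ∀ j, Module.Finite R (Y.obj j)) (j₀ : ℕ)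
    (h : ∀ j ≥ j₀, Function.Bijective (α j)) :
    Module.Finite R (LinearMap.ker (map Y α)) ∧
      Module.Finite R (Y.Total ⧸ LinearMap.range (map Y α)) := by
  have hfg (Z : GrFamily s) (hZ : ∀ j, Module.Finite R (Z.obj j)) :
      (⨆ i : Fin j₀, LinearMap.range (Z.of i)).FG := by
    refine Submodule.fg_iSup _ fun i => ?_
    rw [← Submodule.map_top]
    exact (hZ i).fg_top.map _
  constructor
  · refine Module.Finite.iff_fg.2 ((hfg X hX).of_le fun x hx => ?_)
    have hc (j : ℕ) (z : X.Total) : Y.component j (map Y α z) = α j (X.component j z) := by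
      induction z using induction with
      | zero => simp only [map_zero]
      | add z w hz hw => simp only [map_add, hz, hw]
      | of i z =>
        rw [map_of]
        rcases eq_or_ne i j with rfl | hij
        · rw [component_of_self, component_of_self]
        · rw [component_of_ne _ hij, component_of_ne _ hij, map_zero]
    have hx0 (j : ℕ) (hj : j₀ ≤ j) : X.component j x = 0 := by
      refine (h j hj).1 ?_
      rw [map_zero, ← hc j x, LinearMap.mem_ker.1 hx, map_zero]
    classical
    have hsum := DirectSum.sum_support_of (show ⨁ j, X.obj j from x)
    have : x = ∑ i ∈ DFinsupp.support (show ⨁ j, X.obj j from x),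
      X.of i ((show ⨁ j, X.obj j from x) i) := hsum.symm
    rw [this]
    refine sum_mem fun i hi => ?_
    have hi' : i < j₀ := by
      by_contra hcon
      exact DFinsupp.mem_support_iff.1 hi (hx0 i (not_lt.1 hcon))
    exact Submodule.mem_iSup_of_mem (⟨i, hi'⟩ : Fin j₀) ⟨_, rfl⟩
  · have := Module.Finite.iff_fg.2 (hfg Y hY)
    refine Module.Finite.of_surjective ((LinearMap.range (map Y α)).mkQ ∘ₗ
      (⨆ i : Fin j₀, LinearMap.range (Y.of i)).subtype) fun y => ?_
    obtain ⟨y, rfl⟩ := Submodule.mkQ_surjective _ y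
    rw [← LinearMap.mem_range]
    induction y using induction with
    | zero => rw [map_zero]; exact zero_mem _
    | add y z hy hz => rw [map_add]; exact add_mem hy hz
    | of j y =>
      rcases Nat.lt_or_ge j j₀ with hj | hj
      · exact ⟨⟨Y.of j y, Submodule.mem_iSup_of_mem (⟨j, hj⟩ : Fin j₀) ⟨_, rfl⟩⟩, rfl⟩
      · obtain ⟨x, rfl⟩ := (h j hj).2 y
        refine ⟨0, ?_⟩
        rw [map_zero]
        refine ((Submodule.Quotient.mk_eq_zero _).2 ?_).symm
        rw [← map_of]
        exact ⟨_, rfl⟩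

end GrFamily

end Family


/-! ### The graded module associated with a module over the even part -/

section Adjoint

variable {R E L : Type u} [CommRing R] [AddCommGroup E] [Module R E] [AddCommGroup L] [Module R L]
variable {s : L →ₗ[R] E →ₗ[R] E →ₗ[R] R}

section GradeFamily

variable (M : GrModule s)

/-- The action of a generator on a component. -/
def GrModule.actGrade (j : ℤ) (k : ℤ) (h : j + 1 = k) : E →ₗ[R] M.grade j →ₗ[R] M.grade k :=
  LinearMap.mk₂ R (fun v m => ⟨MulOpposite.op (HC.gen s v) • (m : M), by
      subst h
      exact M.act_mem m.2 (HC.gen_mem_deg s v)⟩)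
    (fun v w m => Subtype.ext (by simp [add_smul]))
    (fun r v m => Subtype.ext (by simp))
    (fun v m m' => Subtype.ext (by simp))
    (fun r v m => Subtype.ext (smul_comm _ _ _))

lemma GrModule.coe_actGrade {j k : ℤ} (h : j + 1 = k) (v : E) (m : M.grade j) :
    (M.actGrade j k h v m : M) = MulOpposite.op (HC.gen s v) • (m : M) := rfl

lemma GrModule.actTwo_actGrade {i j k : ℤ} (h : i + 1 = j) (h' : j + 1 = k) (t : E ⊗[R] E)
    (m : M.grade i) : (actTwo (M.actGrade i j h) (M.actGrade j k h') t m : M) =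
      MulOpposite.op (HC.mk s (tensorTwo R E t)) • (m : M) := by
  induction t with
  | zero => simp
  | add t t' ht ht' =>
    rw [map_add, LinearMap.add_apply, Submodule.coe_add, ht, ht', map_add, map_add,
      MulOpposite.op_add, add_smul]
  | tmul v w =>
    rw [actTwo_tmul, coe_actGrade, coe_actGrade, ← mul_smul, ← MulOpposite.op_mul]
    simp [tensorTwo, HC.gen]

/-- The components of nonnegative degree of a graded module. -/
def GrModule.family : GrFamily s where
  obj j := M.grade j
  act j := M.actGrade j (j + 1 : ℕ) (by push_cast; rfl)
  act_rel j t ht := LinearMap.ext fun m => Subtype.ext <| by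
    rw [GrModule.actTwo_actGrade, HC.mk_tensorTwo_eq_zero s ht, MulOpposite.op_zero, zero_smul]
    rfl

/-- The inclusion of a component. -/
def GrModule.familyVal (j : ℕ) : M.family.obj j →ₗ[R] M := (M.grade j).subtype

lemma GrModule.familyVal_mem (j : ℕ) (m : M.family.obj j) : M.familyVal j m ∈ M.grade j := m.2

lemma GrModule.familyVal_injective (j : ℕ) : Function.Injective (M.familyVal j) :=
  Subtype.val_injective

lemma GrModule.exists_familyVal {j : ℕ} {m : M} (h : m ∈ M.grade j) : ∃ x, M.familyVal j x = m :=
  ⟨⟨m, h⟩, rfl⟩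

lemma GrModule.familyVal_act (j : ℕ) (v : E) (m : M.family.obj j) :
    M.familyVal (j + 1) (M.family.act j v m) = MulOpposite.op (HC.gen s v) • M.familyVal j m := rfl

/-- The inclusion in `M` of the sum of its components of nonnegative degree. -/
def GrModule.ofFamily : M.family.Total →ₗ[R] M := M.family.desc M.familyVal

lemma GrModule.ofFamily_of (j : ℕ) (m : M.family.obj j) :
    M.ofFamily (M.family.of j m) = M.familyVal j m := M.family.desc_of _ _ _

lemma GrModule.ofFamily_op_smul (b : HC s) (x : M.family.Total) :
    M.ofFamily (MulOpposite.op b • x) = MulOpposite.op b • M.ofFamily x := by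
  refine map_op_smul_of_gen_id M.ofFamily (fun v m => ?_) b x
  induction m using GrFamily.induction with
  | zero => simp only [smul_zero, map_zero]
  | add x y hx hy => simp only [smul_add, map_add, hx, hy]
  | of j x =>
    rw [GrFamily.gen_smul_of, GrModule.ofFamily_of, GrModule.ofFamily_of, GrModule.familyVal_act]

lemma GrModule.ofFamily_mem_grade {k : ℤ} {m : M.family.Total}
    (hm : m ∈ M.family.toGrModule.grade k) : M.ofFamily m ∈ M.grade k := by
  rcases mem_intGrade hm with ⟨n, rfl, x, rfl⟩ | rfl
  · rw [M.ofFamily_of]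
    exact M.familyVal_mem _ x
  · rw [map_zero]
    exact zero_mem _

lemma GrModule.proj_ofFamily (j : ℕ) (x : M.family.Total) :
    M.proj j (M.ofFamily x) = M.familyVal j (M.family.component j x) := by
  induction x using GrFamily.induction with
  | zero => simp only [map_zero]
  | add x y hx hy => simp only [map_add, hx, hy]
  | of i x =>
    rw [M.ofFamily_of]
    rcases eq_or_ne i j with rfl | h
    · rw [GrFamily.component_of_self, GrModule.proj_of_mem (M.familyVal_mem _ x)]
    · rw [GrFamily.component_of_ne _ h, map_zero,
        GrModule.proj_of_mem_ne (Nat.cast_injective.ne h) (M.familyVal_mem _ x)]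

lemma GrModule.ofFamily_injective : Function.Injective M.ofFamily := by
  refine (injective_iff_map_eq_zero _).2 fun x hx => ?_
  have h (j : ℕ) : M.family.component j x = 0 := by
    refine M.familyVal_injective j ?_
    rw [← M.proj_ofFamily, hx, map_zero, map_zero]
  exact DirectSum.ext_component R h

variable [IsNoetherianRing R] [NondegForm s] [Module.Finite (HC s)ᵐᵒᵖ M]

instance GrModule.finite_family_obj (j : ℕ) : Module.Finite R (M.family.obj j) :=
  Module.Finite.iff_fg.2 (M.grade_fg j)

lemma GrModule.ofFamily_finite_coker : Module.Finite R (M ⧸ LinearMap.range M.ofFamily) := by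
  obtain ⟨D, hD⟩ := M.exists_lower_bound
  have hfg : (⨆ i : Fin (-D).toNat, M.grade (D + i)).FG := Submodule.fg_iSup _ fun i => M.grade_fg _
  have := Module.Finite.iff_fg.2 hfg
  refine Module.Finite.of_surjective ((LinearMap.range M.ofFamily).mkQ ∘ₗ
    (⨆ i : Fin (-D).toNat, M.grade (D + i)).subtype) fun y => ?_
  obtain ⟨y, rfl⟩ := Submodule.mkQ_surjective _ y
  rw [← LinearMap.mem_range]
  induction y using GrModule.grade_induction with
  | add y z hy hz => rw [map_add]; exact add_mem hy hz
  | mem j y hy =>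
    rcases lt_or_ge j 0 with hj | hj
    · rcases lt_or_ge j D with hj' | hj'
      · rw [hD j hj', Submodule.mem_bot] at hy
        rw [hy, map_zero]
        exact zero_mem _
      · refine ⟨⟨y, Submodule.mem_iSup_of_mem (⟨(j - D).toNat, by omega⟩ : Fin (-D).toNat) ?_⟩, rfl⟩
        have : D + ((j - D).toNat : ℤ) = j := by omega
        change y ∈ M.grade (D + ((j - D).toNat : ℤ))
        rwa [this]
    · obtain ⟨n, rfl⟩ := Int.eq_ofNat_of_zero_le hj
      refine ⟨0, ?_⟩
      rw [map_zero]
      refine ((Submodule.Quotient.mk_eq_zero _).2 ?_).symm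
      obtain ⟨x, rfl⟩ := M.exists_familyVal hy
      exact ⟨M.family.of n x, M.ofFamily_of n x⟩

instance GrModule.family_finite : Module.Finite (HC s)ᵐᵒᵖ M.family.toGrModule := by
  obtain ⟨D, hD⟩ := M.exists_grade_succ_le
  refine M.family.finite D.toNat (fun j _ => inferInstance) fun j hj y => ?_
  obtain ⟨y, hy⟩ := y
  have hy' := hD j (by omega) (by push_cast at hy; exact hy)
  suffices H : ∀ y ∈ Submodule.span R {y | ∃ m ∈ M.grade j, ∃ v,
      MulOpposite.op (HC.gen s v) • m = y}, ∃ h : y ∈ M.grade (j + 1 : ℕ), (⟨y, h⟩ : M.family.obj _) ∈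
        Submodule.span R {z | ∃ v x, M.family.act j v x = z} from (H y hy').2
  intro y hy
  induction hy using Submodule.span_induction with
  | zero => exact ⟨zero_mem _, zero_mem _⟩
  | add x y _ _ hx hy =>
    obtain ⟨hx, hx'⟩ := hx
    obtain ⟨hy, hy'⟩ := hy
    exact ⟨add_mem hx hy, add_mem hx' hy'⟩
  | smul r x _ hx =>
    obtain ⟨hx, hx'⟩ := hx
    exact ⟨Submodule.smul_mem _ r hx, Submodule.smul_mem _ r hx'⟩
  | mem y hy =>
    obtain ⟨m, hm, v, rfl⟩ := hy
    exact ⟨_, Submodule.subset_span ⟨v, ⟨m, hm⟩, rfl⟩⟩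

end GradeFamily

section HomFamily

variable [NondegForm s] (N : Type u) [AddCommGroup N] [Module R N] [Module (B0 s)ᵐᵒᵖ N]
  [IsScalarTower R (B0 s)ᵐᵒᵖ N]

lemma FreeLim.mulLeft_comp {i i' : ℕ} {b b' : HC s} (hb : b ∈ HC.deg s i) (hb' : b' ∈ HC.deg s i')
    {k k' : ℕ} {z z' : SymmetricAlgebra R L} (hz : z ∈ tpow R L k) (hz' : z' ∈ tpow R L k')
    {j j' j'' : ℕ} (h : i + j' = 2 * k + j) (h' : i' + j'' = 2 * k' + j') {i₀ k₀ : ℕ} {b₀ : HC s}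
    {z₀ : SymmetricAlgebra R L} (hb₀ : b₀ ∈ HC.deg s i₀) (hz₀ : z₀ ∈ tpow R L k₀)
    (h₀ : i₀ + j'' = 2 * k₀ + j) (e : b' * b = b₀) (e' : z * z' = z₀) :
    FreeLim.mulLeft hb' hz' h' ∘ₗ FreeLim.mulLeft hb hz h = FreeLim.mulLeft hb₀ hz₀ h₀ := by
  subst e e'
  refine DirLim.hom_ext fun t (a : HC s) ha y hy => ?_
  obtain ⟨h₁, e₁⟩ := FreeLim.mulLeft_mk hb hz h t a ha y hy
  obtain ⟨h₂, e₂⟩ := FreeLim.mulLeft_mk hb' hz' h' _ _ h₁ _ (mul_mem_tpow hy hz)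
  obtain ⟨h₃, e₃⟩ := FreeLim.mulLeft_mk hb₀ hz₀ h₀ t a ha y hy
  rw [LinearMap.comp_apply, e₁, e₂, e₃]
  exact DirLim.mk_eq_mk _ _ _ _
    (congrArg₂ (fun (b : HC s) z => (b ⊗ₜ[R] z : HCL s)) (mul_assoc _ _ _).symm (mul_assoc _ _ _))

lemma FreeLim.mulLeft_add {i k : ℕ} {b b' : HC s} (hb : b ∈ HC.deg s i) (hb' : b' ∈ HC.deg s i)
    {z : SymmetricAlgebra R L} (hz : z ∈ tpow R L k) {j j' : ℕ} (h : i + j' = 2 * k + j) :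
    FreeLim.mulLeft (add_mem hb hb') hz h = FreeLim.mulLeft hb hz h + FreeLim.mulLeft hb' hz h := by
  refine DirLim.hom_ext fun t (a : HC s) ha y hy => ?_
  obtain ⟨h₁, e₁⟩ := FreeLim.mulLeft_mk hb hz h t a ha y hy
  obtain ⟨h₂, e₂⟩ := FreeLim.mulLeft_mk hb' hz h t a ha y hy
  obtain ⟨h₃, e₃⟩ := FreeLim.mulLeft_mk (add_mem hb hb') hz h t a ha y hy
  rw [LinearMap.add_apply, e₁, e₂, e₃]
  refine Eq.trans ?_ (DirLim.mk_add h₁ h₂ _)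
  exact DirLim.mk_congr _ _ _ (add_mul b b' a) rfl

lemma FreeLim.mulLeft_smul {i k : ℕ} (r : R) {b : HC s} (hb : b ∈ HC.deg s i)
    {z : SymmetricAlgebra R L} (hz : z ∈ tpow R L k) {j j' : ℕ} (h : i + j' = 2 * k + j)
    (x : FreeLim s j) : FreeLim.mulLeft (Submodule.smul_mem _ r hb) hz h x =
      r • FreeLim.mulLeft hb hz h x := by
  induction x using DirLim.induction with
  | zero => simp only [map_zero, smul_zero]
  | add x y hx hy => simp only [map_add, smul_add, hx, hy]
  | mk t a ha y hy =>
    obtain ⟨h₁, e₁⟩ := FreeLim.mulLeft_mk hb hz h t a ha y hy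
    obtain ⟨h₃, e₃⟩ := FreeLim.mulLeft_mk (Submodule.smul_mem _ r hb) hz h t a ha y hy
    rw [e₁, e₃]
    refine Eq.trans ?_ (DirLim.mk_smul r h₁ _)
    exact DirLim.mk_congr _ _ _ (smul_mul_assoc r b a) rfl

lemma FreeLim.mulLeft_congr {i k : ℕ} {b b' : HC s} (hb : b ∈ HC.deg s i) (hb' : b' ∈ HC.deg s i)
    {z : SymmetricAlgebra R L} (hz : z ∈ tpow R L k) {j j' : ℕ} (h : i + j' = 2 * k + j)
    (e : b = b') : FreeLim.mulLeft hb hz h = FreeLim.mulLeft hb' hz h := by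
  subst e
  rfl

lemma FreeLim.gen_add (j : ℕ) (v w : E) (x : FreeLim s (j + 1)) :
    FreeLim.gen s j (v + w) x = FreeLim.gen s j v x + FreeLim.gen s j w x :=
  DFunLike.congr_fun ((FreeLim.mulLeft_congr _ _ _ _ (map_add (HC.gen s) v w)).trans
    (FreeLim.mulLeft_add (HC.gen_mem_deg s v) (HC.gen_mem_deg s w) one_mem_tpow _)) x

lemma FreeLim.gen_smul (j : ℕ) (r : R) (v : E) (x : FreeLim s (j + 1)) :
    FreeLim.gen s j (r • v) x = r • FreeLim.gen s j v x :=
  (DFunLike.congr_fun (FreeLim.mulLeft_congr _ _ _ _ (map_smul (HC.gen s) r v)) x).trans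
    (FreeLim.mulLeft_smul r (HC.gen_mem_deg s v) one_mem_tpow _ x)

/-- The composition with the left multiplications by the generators. -/
def HomFree.act (j : ℕ) : E →ₗ[R] HomFree (s := s) N j →ₗ[R] HomFree (s := s) N (j + 1) :=
  LinearMap.mk₂ R (fun v f => f ∘ₗ FreeLim.gen s j v)
    (fun v w f => LinearMap.ext fun x => by
      rw [LinearMap.comp_apply, FreeLim.gen_add, map_add]
      rfl)
    (fun r v f => LinearMap.ext fun x => by
      rw [LinearMap.comp_apply, FreeLim.gen_smul, LinearMap.map_smul_of_tower]
      rfl)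
    (fun _ _ _ => rfl) (fun _ _ _ => rfl)

lemma HomFree.act_apply (j : ℕ) (v : E) (f : HomFree (s := s) N j) (x : FreeLim s (j + 1)) :
    HomFree.act N j v f x = f (FreeLim.gen s j v x) := rfl

end HomFamily

end Adjoint


/-! ### The graded module of the maps from the free modules -/

section HomFamily

variable {R E L : Type u} [CommRing R] [AddCommGroup E] [Module R E] [AddCommGroup L] [Module R L]
variable {s : L →ₗ[R] E →ₗ[R] E →ₗ[R] R} [NondegForm s]

section

variable (N : Type u) [AddCommGroup N] [Module R N] [Module (B0 s)ᵐᵒᵖ N]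
  [IsScalarTower R (B0 s)ᵐᵒᵖ N]

lemma FreeLim.mulLeft_algebraMap (r : R) {j : ℕ} (hr : algebraMap R (HC s) r ∈ HC.deg s 0)
    (h : 0 + j = 2 * 0 + j) (x : FreeLim s j) :
    FreeLim.mulLeft hr (one_mem_tpow (R := R) (L := L)) h x = r • x := by
  induction x using DirLim.induction with
  | zero => rw [map_zero, smul_zero]
  | add x y hx hy => rw [map_add, smul_add, hx, hy]
  | mk t a ha y hy =>
    obtain ⟨h₁, e₁⟩ := FreeLim.mulLeft_mk hr (one_mem_tpow (R := R) (L := L)) h t a ha y hy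
    rw [e₁, ← DirLim.mk_smul]
    exact DirLim.mk_congr _ _ _ (Algebra.smul_def (A := HC s) r a).symm (mul_one y)

lemma FreeLim.mulLeft_eq_zero {i k : ℕ} {b : HC s} (hb : b ∈ HC.deg s i)
    {z : SymmetricAlgebra R L} (hz : z ∈ tpow R L k) {j j' : ℕ} (h : i + j' = 2 * k + j)
    (e : b = 0) : FreeLim.mulLeft hb hz h = 0 :=
  LinearMap.ext fun x => by
    rw [FreeLim.mulLeft_congr hb (Submodule.smul_mem _ (0 : R) hb) hz h (by rw [e, smul_zero]),
      FreeLim.mulLeft_smul 0 hb hz h, zero_smul, LinearMap.zero_apply]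

lemma HomFree.act_eq (j : ℕ) (v : E) (f : HomFree (s := s) N j) :
    HomFree.act N j v f = f ∘ₗ FreeLim.gen s j v := rfl

lemma FreeLim.gen_comp_gen (j : ℕ) (v w : E) {b : HC s} (hb : b ∈ HC.deg s 2)
    (e : HC.gen s v * HC.gen s w = b) : FreeLim.gen s j v ∘ₗ FreeLim.gen s (j + 1) w =
      FreeLim.mulLeft hb (one_mem_tpow (R := R) (L := L)) (j := j + 1 + 1) (j' := j) (by ring) :=
  FreeLim.mulLeft_comp _ _ _ _ _ _ _ _ _ e (mul_one 1)

lemma FreeLim.mulLeft_comp_gen {n : ℕ} {b b' : HC s} (hb : b ∈ HC.deg s n)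
    (hb' : b' ∈ HC.deg s (n + 1)) (j : ℕ) (v : E) (e : b * HC.gen s v = b') :
    FreeLim.mulLeft hb (one_mem_tpow (R := R) (L := L)) (j := j + n) (j' := j) (by ring) ∘ₗ
        FreeLim.gen s (j + n) v =
      FreeLim.mulLeft hb' (one_mem_tpow (R := R) (L := L)) (j := j + (n + 1)) (j' := j) (by ring) :=
  FreeLim.mulLeft_comp _ _ _ _ _ _ _ _ _ e (mul_one 1)

/-- The successive action of two generators is the composition with the left multiplication by their
product, so that the relations of the homogeneous Clifford algebra act by zero. -/
lemma HomFree.actTwo_act (j : ℕ) (f : HomFree (s := s) N j) (t : E ⊗[R] E) :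
    ∃ hb : HC.mk s (tensorTwo R E t) ∈ HC.deg s 2,
      actTwo (HomFree.act N j) (HomFree.act N (j + 1)) t f =
        f ∘ₗ FreeLim.mulLeft hb (one_mem_tpow (R := R) (L := L)) (j := j + 1 + 1) (j' := j)
          (by ring) := by
  induction t with
  | zero =>
    have hb : HC.mk s (tensorTwo R E 0) ∈ HC.deg s 2 := by
      rw [map_zero, map_zero]
      exact zero_mem _
    refine ⟨hb, ?_⟩
    rw [map_zero, LinearMap.zero_apply, FreeLim.mulLeft_eq_zero hb _ _ (by rw [map_zero, map_zero]),
      LinearMap.comp_zero]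
  | add t t' ht ht' =>
    obtain ⟨h, e⟩ := ht
    obtain ⟨h', e'⟩ := ht'
    have hb : HC.mk s (tensorTwo R E (t + t')) ∈ HC.deg s 2 := by
      rw [map_add, map_add]
      exact add_mem h h'
    refine ⟨hb, ?_⟩
    rw [map_add, LinearMap.add_apply, e, e', FreeLim.mulLeft_congr hb (add_mem h h') _ _
      (by rw [map_add, map_add]), FreeLim.mulLeft_add, LinearMap.comp_add]
  | tmul v w =>
    have e : HC.mk s (tensorTwo R E (v ⊗ₜ w)) = HC.gen s v * HC.gen s w := by
      simp [tensorTwo, HC.gen]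
    have hb : HC.mk s (tensorTwo R E (v ⊗ₜ w)) ∈ HC.deg s 2 := e ▸ HC.gen_mul_gen_mem_deg s v w
    refine ⟨hb, ?_⟩
    rw [actTwo_tmul, HomFree.act_eq, HomFree.act_eq, LinearMap.comp_assoc,
      FreeLim.gen_comp_gen j v w hb e.symm]

/-- The graded module `⨁ Hom (HC⟨-j⟩, N)` associated with a module over the even part. -/
def homFamily : GrFamily s where
  obj j := HomFree (s := s) N j
  act := HomFree.act N
  act_rel j t ht := LinearMap.ext fun f => by
    obtain ⟨hb, e⟩ := HomFree.actTwo_act N j f t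
    rw [e, FreeLim.mulLeft_eq_zero hb _ _ (HC.mk_tensorTwo_eq_zero s ht), LinearMap.comp_zero]
    rfl

variable {N}

/-- The inclusion of the component of degree `j`. -/
def HomFree.incl (j : ℕ) : HomFree (s := s) N j →ₗ[R] (homFamily N : GrFamily s).Total :=
  (homFamily N).of j

lemma HomFree.gen_smul_incl (j : ℕ) (v : E) (f : HomFree (s := s) N j) :
    MulOpposite.op (HC.gen s v) • HomFree.incl j f = HomFree.incl (j + 1) (HomFree.act N j v f) :=
  (homFamily N).gen_smul_of v j f

lemma op_smul_of_homFamily {n : ℕ} {b : HC s} (hb : b ∈ HC.deg s n) (j : ℕ)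
    (f : HomFree (s := s) N j) :
    MulOpposite.op b • HomFree.incl j f = HomFree.incl (j + n)
      (f ∘ₗ FreeLim.mulLeft hb (one_mem_tpow (R := R) (L := L)) (by ring)) := by
  induction n generalizing b with
  | zero =>
    have hb' := hb
    rw [HC.deg, pow_zero, Submodule.mem_one] at hb'
    obtain ⟨r, rfl⟩ := hb'
    rw [← MulOpposite.algebraMap_apply, algebraMap_smul, ← map_smul]
    refine congrArg _ (LinearMap.ext fun x => ?_)
    refine Eq.trans ?_ (congrArg f (FreeLim.mulLeft_algebraMap r hb (by ring) x)).symm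
    exact (LinearMap.map_smul_of_tower f r x).symm
  | succ n ih =>
    have hb' : b ∈ HC.deg s n * LinearMap.range (HC.gen s) := by
      rwa [HC.deg, pow_succ] at hb
    suffices H : ∀ b ∈ HC.deg s n * LinearMap.range (HC.gen s), ∃ hb : b ∈ HC.deg s (n + 1),
        MulOpposite.op b • HomFree.incl j f = HomFree.incl (j + (n + 1))
          (f ∘ₗ FreeLim.mulLeft hb (one_mem_tpow (R := R) (L := L)) (by ring)) from (H b hb').2
    intro b hb
    induction hb using Submodule.mul_induction_on' with
    | mem_mul_mem x hx y hy =>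
      obtain ⟨v, rfl⟩ := hy
      have hxv : x * HC.gen s v ∈ HC.deg s (n + 1) := SetLike.mul_mem_graded hx (HC.gen_mem_deg s v)
      refine ⟨hxv, ?_⟩
      rw [MulOpposite.op_mul, mul_smul, ih hx, HomFree.gen_smul_incl, HomFree.act_eq,
        LinearMap.comp_assoc, FreeLim.mulLeft_comp_gen hx hxv j v rfl]
      rfl
    | add x _ y _ hx hy =>
      obtain ⟨hx, hx'⟩ := hx
      obtain ⟨hy, hy'⟩ := hy
      refine ⟨add_mem hx hy, ?_⟩
      rw [MulOpposite.op_add, add_smul, hx', hy', FreeLim.mulLeft_add, LinearMap.comp_add, map_add]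

/-- The composition with a map of the free modules. -/
def HomFree.precomp {j j' : ℕ} (g : FreeLim s j →ₗ[(B0 s)ᵐᵒᵖ] FreeLim s j') :
    HomFree (s := s) N j' →ₗ[R] HomFree (s := s) N j where
  toFun f := f ∘ₗ g
  map_add' _ _ := rfl
  map_smul' _ _ := rfl

/-- Every map on `HC⟨-j-1⟩` is a sum of products of maps on `HC⟨-j⟩` and generators. -/
lemma HomFree.sum_act (π : SqPartition s) (j : ℕ) (f : HomFree (s := s) N (j + 1)) :
    ∑ i, HomFree.act N j (π.v i) (f ∘ₗ FreeLim.genTwist s j (π.v i) (π.l i)) = f := by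
  refine LinearMap.ext fun x => ?_
  rw [LinearMap.sum_apply]
  refine Eq.trans ?_ (congrArg f (FreeLim.sum_genTwist π j x))
  rw [map_sum]
  rfl

lemma HomFree.sum_act_act (π : SqPartition s) (j : ℕ) (f : HomFree (s := s) N (j + 1 + 1)) :
    ∑ i, HomFree.act N (j + 1) (π.v i) (HomFree.act N j (π.v i)
      (f ∘ₗ FreeLim.twist s j (π.l i))) = f := by
  refine LinearMap.ext fun x => ?_
  rw [LinearMap.sum_apply]
  refine Eq.trans ?_ (congrArg f (FreeLim.sum_twist π j x))
  rw [map_sum]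
  rfl

instance homFamily_finite [Module.Finite R N] :
    Module.Finite (HC s)ᵐᵒᵖ (homFamily N : GrFamily s).toGrModule := by
  obtain ⟨π⟩ := NondegForm.exists_partition s
  refine (homFamily N : GrFamily s).finite 0 (fun j hj => ?_) fun j _ f => ?_
  · obtain rfl := Nat.le_zero.1 hj
    exact Module.Finite.equiv (homFreeZeroEquiv (s := s) N).symm
  · have := HomFree.sum_act π j f
    rw [← this]
    exact sum_mem fun i _ => Submodule.subset_span ⟨_, _, rfl⟩

/-- The map on `HC⟨-j⟩` given by the right action on an element `m` of a graded module, and by a section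
of a power of `L`. -/
def GrModule.toHomFree {M : GrModule s} {d : ℤ} {m : M} (hm : m ∈ M.grade d) {k : ℕ}
    {z : SymmetricAlgebra R L} (hz : z ∈ tpow R L k) {j : ℕ} (h : d = 2 * k + j) :
    HomFree (s := s) (DirLim M) j :=
  DirLim.mapShift (M := HC.free s j) (g := M.orbit m)
    (fun (b a : HC s) => mul_smul (MulOpposite.op b) (MulOpposite.op a) m)
    (by
      intro i a ha
      rcases mem_intGrade (R := R) (M := HC s) ha with ⟨n, hn, ha⟩ | ha
      · have := M.act_mem hm ha
        have e : d + n = 2 * ((i + k : ℕ) : ℤ) := by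
          push_cast
          linarith
        rwa [e] at this
      · have : M.orbit m a = 0 := (congrArg (M.orbit m) ha).trans (map_zero _)
        exact (congrArg (· ∈ M.grade _) this).mpr (zero_mem _)) hz

lemma GrModule.toHomFree_mk {M : GrModule s} {d : ℤ} {m : M} (hm : m ∈ M.grade d) {k : ℕ}
    {z : SymmetricAlgebra R L} (hz : z ∈ tpow R L k) {j : ℕ} (h : d = 2 * k + j) (i : ℕ) (a : HC s)
    (ha : a ∈ (HC.free s j).grade (2 * i)) (y : SymmetricAlgebra R L) (hy) :
    ∃ h' : MulOpposite.op a • m ∈ M.grade (2 * (i + k : ℕ)),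
      GrModule.toHomFree hm hz h (DirLim.mk (HC.free s j) i a ha y hy) =
        DirLim.mk M (i + k) (MulOpposite.op a • m) h' (y * z) (mul_mem_tpow hy hz) :=
  ⟨_, DirLim.mapShift_mk _ _ _ _ _ _ _ _⟩

end

section Restriction

variable {R' E' L' : Type u} [CommRing R'] [AddCommGroup E'] [Module R' E'] [AddCommGroup L']
  [Module R' L'] {s' : L' →ₗ[R'] E' →ₗ[R'] E' →ₗ[R'] R'} [NondegForm s'] (F : FormMap s s')

/-- The map of free modules induced by a change of base ring. -/
def HC.freeMap (j : ℕ) : GrMap F (HC.free s j) (HC.free s' j) where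
  toFun := HC.mapₛₗ F
  map_act := fun (b a : HC s) => map_mul (HC.map F) a b
  map_grade {k a} ha := by
    rcases mem_intGrade (R := R) (M := HC s) ha with ⟨n, hn, ha⟩ | ha
    · exact HC.mem_free (by linarith) (HC.map_mem_deg F ha)
    · have : HC.mapₛₗ F a = 0 := (congrArg (HC.mapₛₗ F) ha).trans (map_zero _)
      exact this.symm ▸ ((HC.free s' j).grade k).zero_mem

/-- The map `lim HC⟨-j⟩_{2k} ⊗ L^k → lim HC'⟨-j⟩_{2k} ⊗ L'^k` induced by a change of base ring. -/
def FreeLim.res (j : ℕ) : FreeLim s j →ₛₗ[F.φ] FreeLim s' j := DirLim.map (HC.freeMap F j)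

lemma FreeLim.res_mulLeft {i k : ℕ} {b : HC s} (hb : b ∈ HC.deg s i) {z : SymmetricAlgebra R L}
    (hz : z ∈ tpow R L k) {j j' : ℕ} (h : i + j' = 2 * k + j) {b' : HC s'} (hb' : b' ∈ HC.deg s' i)
    {z' : SymmetricAlgebra R' L'} (hz' : z' ∈ tpow R' L' k) (e : HC.map F b = b')
    (e' : symMap F.fL z = z') (x : FreeLim s j) :
    FreeLim.res F j' (FreeLim.mulLeft hb hz h x) = FreeLim.mulLeft hb' hz' h (FreeLim.res F j x) := by
  subst e e'
  induction x using DirLim.induction with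
  | zero => simp only [map_zero]
  | add x y hx hy => simp only [map_add, hx, hy]
  | mk t a ha y hy =>
    obtain ⟨h₁, e₁⟩ := FreeLim.mulLeft_mk hb hz h t a ha y hy
    obtain ⟨h₂, e₂⟩ := FreeLim.mulLeft_mk hb' hz' h t (HC.map F a) ((HC.freeMap F j).map_grade ha)
      (symMap F.fL y) (symMap_mem_tpow F.fL hy)
    refine (congrArg (FreeLim.res F j') e₁).trans (Eq.trans ?_ e₂.symm)
    refine (DirLim.map_mk (HC.freeMap F j') _ _ _ _ _).trans ?_
    exact DirLim.mk_congr _ _ _ (map_mul (HC.map F) b a) (map_mul (symMap F.fL) y z)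

lemma FreeLim.res_gen (j : ℕ) (v : E) (x : FreeLim s (j + 1)) :
    FreeLim.res F j (FreeLim.gen s j v x) =
      FreeLim.gen s' j (F.fE v) (FreeLim.res F (j + 1) x) :=
  FreeLim.res_mulLeft F _ _ _ _ _ (HC.map_gen F v) (map_one _) x

lemma FreeLim.res_genTwist (j : ℕ) (v : E) (l : L) (x : FreeLim s j) :
    FreeLim.res F (j + 1) (FreeLim.genTwist s j v l x) =
      FreeLim.genTwist s' j (F.fE v) (F.fL l) (FreeLim.res F j x) :=
  FreeLim.res_mulLeft F _ _ _ _ _ (HC.map_gen F v) (symMap_ι _ _) x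

lemma FreeLim.res_one : FreeLim.res F 0 (FreeLim.one s) = FreeLim.one s' :=
  (DirLim.map_mk (HC.freeMap F 0) _ _ _ _ _).trans
    (DirLim.mk_congr _ _ _ (map_one (HC.map F)) (map_one (symMap F.fL)))

variable {N : Type u} [AddCommGroup N] [Module R N] [Module (B0 s)ᵐᵒᵖ N]
  [IsScalarTower R (B0 s)ᵐᵒᵖ N] {N' : Type u} [AddCommGroup N'] [Module R' N']
  [Module (B0 s')ᵐᵒᵖ N'] [IsScalarTower R' (B0 s')ᵐᵒᵖ N']

/-- A map from `HC'⟨-j⟩` is determined by its values on the image of `HC⟨-j⟩`; the degree is lowered to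
zero, where the module is free of rank one. -/
lemma HomFree.res_unique {j : ℕ} {f g : HomFree (s := s') N' j}
    (h : ∀ x, f (FreeLim.res F j x) = g (FreeLim.res F j x)) : f = g := by
  induction j with
  | zero => exact FreeLim.zero_hom_ext N' (by simpa only [FreeLim.res_one] using h (FreeLim.one s))
  | succ j ih =>
    obtain ⟨π⟩ := NondegForm.exists_partition s
    rw [← HomFree.sum_act (π.map F) j f, ← HomFree.sum_act (π.map F) j g]
    refine Finset.sum_congr rfl fun i _ => congrArg _ (ih fun x => ?_)
    have := h (FreeLim.genTwist s j (π.v i) (π.l i) x)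
    rw [FreeLim.res_genTwist] at this
    exact this

omit [IsScalarTower R (B0 s)ᵐᵒᵖ N] in
/-- A map on the direct limit of `HC⟨-j⟩` extends along a change of base ring. -/
lemma HomFree.exists_res (ρ : N →ₛₗ[F.φ] N')
    (hρ : ∀ b x, ρ (MulOpposite.op b • x) = MulOpposite.op (B0.map F b) • ρ x) {j : ℕ}
    (f : HomFree (s := s) N j) :
    ∃ f' : HomFree (s := s') N' j, ∀ x, f' (FreeLim.res F j x) = ρ (f x) := by
  induction j with
  | zero =>
    refine ⟨FreeLim.ofElement (ρ (f (FreeLim.one s))), fun x => ?_⟩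
    obtain ⟨x, rfl⟩ := DirLim.proj_surjective x
    rw [FreeLim.eq_smul_one, LinearMap.map_smul f, hρ]
    refine (congrArg _ (DirLim.map_act (HC.freeMap F 0) _ _)).trans ?_
    refine (LinearMap.map_smul (FreeLim.ofElement _) _ _).trans (congrArg _ ?_)
    exact (congrArg _ (FreeLim.res_one F)).trans (FreeLim.ofElement_one _)
  | succ j ih =>
    obtain ⟨π⟩ := NondegForm.exists_partition s
    choose f' hf' using fun i => ih (f ∘ₗ FreeLim.genTwist s j (π.v i) (π.l i))
    refine ⟨∑ i, HomFree.act N' j (F.fE (π.v i)) (f' i), fun x => ?_⟩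
    rw [LinearMap.sum_apply]
    refine Eq.trans ?_ (congrArg (fun y => ρ (f y)) (FreeLim.sum_genTwist π j x))
    rw [map_sum, map_sum]
    refine Finset.sum_congr rfl fun i _ => ?_
    rw [HomFree.act_apply, ← FreeLim.res_gen, hf']
    rfl

/-- The restriction of maps from the free modules under a change of base ring. -/
def HomFree.res (ρ : N →ₛₗ[F.φ] N')
    (hρ : ∀ b x, ρ (MulOpposite.op b • x) = MulOpposite.op (B0.map F b) • ρ x) (j : ℕ) :
    HomFree (s := s) N j →ₛₗ[F.φ] HomFree (s := s') N' j where
  toFun f := (HomFree.exists_res F ρ hρ f).choose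
  map_add' f g := HomFree.res_unique F fun x => by
    rw [LinearMap.add_apply, (HomFree.exists_res F ρ hρ f).choose_spec,
      (HomFree.exists_res F ρ hρ g).choose_spec, (HomFree.exists_res F ρ hρ (f + g)).choose_spec,
      LinearMap.add_apply, map_add]
  map_smul' r f := HomFree.res_unique F fun x => by
    rw [LinearMap.smul_apply, (HomFree.exists_res F ρ hρ f).choose_spec,
      (HomFree.exists_res F ρ hρ (r • f)).choose_spec, LinearMap.smul_apply, LinearMap.map_smulₛₗ]

variable {ρ : N →ₛₗ[F.φ] N'}
  {hρ : ∀ b x, ρ (MulOpposite.op b • x) = MulOpposite.op (B0.map F b) • ρ x}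

lemma HomFree.res_apply_res {j : ℕ} (f : HomFree (s := s) N j) (x : FreeLim s j) :
    HomFree.res F ρ hρ j f (FreeLim.res F j x) = ρ (f x) :=
  (HomFree.exists_res F ρ hρ f).choose_spec x

lemma HomFree.eq_res {j : ℕ} {f : HomFree (s := s) N j} {f' : HomFree (s := s') N' j}
    (h : ∀ x, f' (FreeLim.res F j x) = ρ (f x)) : HomFree.res F ρ hρ j f = f' :=
  HomFree.res_unique F fun x => by rw [HomFree.res_apply_res, h]

lemma HomFree.res_act (j : ℕ) (v : E) (f : HomFree (s := s) N j) :
    HomFree.res F ρ hρ (j + 1) (HomFree.act N j v f) =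
      HomFree.act N' j (F.fE v) (HomFree.res F ρ hρ j f) :=
  HomFree.eq_res (hρ := hρ) F fun x => by
    rw [HomFree.act_apply, HomFree.act_apply, ← FreeLim.res_gen, HomFree.res_apply_res (hρ := hρ)]

/-- The formation of `Hom(HC⟨-j⟩, N)` commutes with extension of scalars, because it is a retract of a
power of `Hom(HC⟨-j+1⟩, N)`, and `Hom(HC, N) = N`. -/
lemma HomFree.res_isExtensionOfScalars (h : IsExtensionOfScalars F.φ ρ) (j : ℕ) :
    IsExtensionOfScalars F.φ (HomFree.res F ρ hρ j) := by
  obtain ⟨π⟩ := NondegForm.exists_partition s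
  induction j with
  | zero =>
    refine h.retract (homFreeZeroEquiv N).toLinearMap (homFreeZeroEquiv N).symm.toLinearMap
      (homFreeZeroEquiv N').toLinearMap (homFreeZeroEquiv N').symm.toLinearMap ?_ ?_
      (homFreeZeroEquiv N).symm_apply_apply (homFreeZeroEquiv N').symm_apply_apply
    · intro f
      refine (HomFree.res_apply_res (hρ := hρ) F f (FreeLim.one s)).symm.trans ?_
      rw [FreeLim.res_one]
      rfl
    · intro n
      refine (homFreeZeroEquiv (s := s') N').injective ?_
      refine Eq.trans ?_ ((homFreeZeroEquiv N').apply_symm_apply _).symm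
      refine (congrArg _ (FreeLim.res_one F)).symm.trans ?_
      refine (HomFree.res_apply_res (hρ := hρ) F _ (FreeLim.one s)).trans (congrArg ρ ?_)
      exact FreeLim.ofElement_one n
  | succ j ih =>
    refine (IsExtensionOfScalars.pi fun _ : Fin π.r => ih).retract
      (LinearMap.pi fun i => HomFree.precomp (FreeLim.genTwist s j (π.v i) (π.l i)))
      (∑ i, HomFree.act N j (π.v i) ∘ₗ LinearMap.proj i)
      (LinearMap.pi fun i =>
        HomFree.precomp (FreeLim.genTwist s' j (F.fE (π.v i)) (F.fL (π.l i))))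
      (∑ i, HomFree.act N' j (F.fE (π.v i)) ∘ₗ LinearMap.proj i) ?_ ?_ ?_ ?_
    · intro f
      refine funext fun i => HomFree.eq_res (hρ := hρ) F fun x => ?_
      change HomFree.res F ρ hρ (j + 1) f (FreeLim.genTwist s' j _ _ _) = _
      rw [← FreeLim.res_genTwist, HomFree.res_apply_res (hρ := hρ)]
      rfl
    · intro f
      rw [LinearMap.sum_apply, LinearMap.sum_apply, map_sum]
      exact Finset.sum_congr rfl fun i _ => HomFree.res_act F j (π.v i) (f i)
    · intro f
      rw [LinearMap.sum_apply]
      exact HomFree.sum_act π j f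
    · intro f
      rw [LinearMap.sum_apply]
      exact HomFree.sum_act (π.map F) j f

variable (ρ hρ) in
/-- The restriction of the associated graded modules under a change of base ring. -/
def homFamilyRes : GrMap F (homFamily N).toGrModule (homFamily N').toGrModule :=
  GrFamily.mapRes F (HomFree.res F ρ hρ) (HomFree.res_act F)

end Restriction

end HomFamily


/-! ### The unit: a graded module and the maps from the free modules to its direct limit -/

section Unit

variable {R E L : Type u} [CommRing R] [AddCommGroup E] [Module R E] [AddCommGroup L] [Module R L]
variable {s : L →ₗ[R] E →ₗ[R] E →ₗ[R] R} [NondegForm s] {M : GrModule s}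

namespace GrModule

lemma toHomFree_congr {d : ℤ} {m m' : M} (hm : m ∈ M.grade d) (hm' : m' ∈ M.grade d) {k : ℕ}
    {z z' : SymmetricAlgebra R L} (hz : z ∈ tpow R L k) (hz' : z' ∈ tpow R L k) {j : ℕ}
    (h : d = 2 * k + j) (e : m ⊗ₜ[R] z = m' ⊗ₜ z') : toHomFree hm hz h = toHomFree hm' hz' h := by
  refine DirLim.hom_ext fun i (a : HC s) ha y hy => ?_
  obtain ⟨h₁, e₁⟩ := toHomFree_mk hm hz h i a ha y hy
  obtain ⟨h₂, e₂⟩ := toHomFree_mk hm' hz' h i a ha y hy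
  rw [e₁, e₂]
  refine DirLim.mk_eq_mk _ _ _ _ ?_
  have := congrArg (actL M (a ⊗ₜ y)) e
  rwa [actL_tmul, actL_tmul, mul_comm, mul_comm z'] at this

lemma toHomFree_add {d : ℤ} {m m' : M} (hm : m ∈ M.grade d) (hm' : m' ∈ M.grade d) {k : ℕ}
    {z : SymmetricAlgebra R L} (hz : z ∈ tpow R L k) {j : ℕ} (h : d = 2 * k + j) :
    toHomFree (add_mem hm hm') hz h = toHomFree hm hz h + toHomFree hm' hz h := by
  refine DirLim.hom_ext fun i (a : HC s) ha y hy => ?_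
  obtain ⟨h₁, e₁⟩ := toHomFree_mk hm hz h i a ha y hy
  obtain ⟨h₂, e₂⟩ := toHomFree_mk hm' hz h i a ha y hy
  obtain ⟨h₃, e₃⟩ := toHomFree_mk (add_mem hm hm') hz h i a ha y hy
  rw [LinearMap.add_apply, e₁, e₂, e₃, ← DirLim.mk_add]
  exact DirLim.mk_congr _ _ _ (smul_add _ _ _) rfl

lemma toHomFree_add_right {d : ℤ} {m : M} (hm : m ∈ M.grade d) {k : ℕ}
    {z z' : SymmetricAlgebra R L} (hz : z ∈ tpow R L k) (hz' : z' ∈ tpow R L k) {j : ℕ}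
    (h : d = 2 * k + j) :
    toHomFree hm (add_mem hz hz') h = toHomFree hm hz h + toHomFree hm hz' h := by
  refine DirLim.hom_ext fun i (a : HC s) ha y hy => ?_
  obtain ⟨h₁, e₁⟩ := toHomFree_mk hm hz h i a ha y hy
  obtain ⟨h₂, e₂⟩ := toHomFree_mk hm hz' h i a ha y hy
  obtain ⟨h₃, e₃⟩ := toHomFree_mk hm (add_mem hz hz') h i a ha y hy
  rw [LinearMap.add_apply, e₁, e₂, e₃, ← DirLim.mk_tmul_add]
  exact DirLim.mk_congr _ _ _ rfl (mul_add _ _ _)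

lemma toHomFree_smul {d : ℤ} {m : M} (r : R) (hm : m ∈ M.grade d) {k : ℕ}
    {z : SymmetricAlgebra R L} (hz : z ∈ tpow R L k) {j : ℕ} (h : d = 2 * k + j) :
    toHomFree (Submodule.smul_mem _ r hm) hz h = r • toHomFree hm hz h := by
  refine DirLim.hom_ext fun i (a : HC s) ha y hy => ?_
  obtain ⟨h₁, e₁⟩ := toHomFree_mk hm hz h i a ha y hy
  obtain ⟨h₃, e₃⟩ := toHomFree_mk (Submodule.smul_mem _ r hm) hz h i a ha y hy
  rw [LinearMap.smul_apply, e₁, e₃, ← DirLim.mk_smul]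
  exact DirLim.mk_congr _ _ _ (smul_comm _ _ _) rfl

lemma act_toHomFree {d d' : ℤ} {m : M} (hm : m ∈ M.grade d) {k : ℕ} {z : SymmetricAlgebra R L}
    (hz : z ∈ tpow R L k) {j : ℕ} (h : d = 2 * k + j) (v : E)
    (hm' : MulOpposite.op (HC.gen s v) • m ∈ M.grade d') (h' : d' = 2 * k + (j + 1 : ℕ)) :
    HomFree.act (DirLim M) j v (toHomFree hm hz h) = toHomFree hm' hz h' := by
  refine DirLim.hom_ext fun i (a : HC s) ha y hy => ?_
  obtain ⟨h₁, e₁⟩ := FreeLim.mulLeft_mk (HC.gen_mem_deg s v)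
    (one_mem_tpow (R := R) (L := L)) (j := j + 1) (j' := j) (by ring) i a ha y hy
  obtain ⟨h₂, e₂⟩ := toHomFree_mk hm hz h _ _ h₁ _ (mul_mem_tpow hy one_mem_tpow)
  obtain ⟨h₃, e₃⟩ := toHomFree_mk hm' hz h' i a ha y hy
  rw [HomFree.act_apply, FreeLim.gen, e₁, e₂, e₃]
  exact DirLim.mk_eq_mk _ _ _ _ (by rw [mul_one, MulOpposite.op_mul, mul_smul])

/-- A section `l` of `L` and the square of `v` cancel up to the factor `σ_l(v, v)`. -/
lemma act_act_toHomFree {d : ℤ} {m : M} (hm : m ∈ M.grade d) {k : ℕ}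
    {z : SymmetricAlgebra R L} (hz : z ∈ tpow R L k) {j : ℕ} (l : L)
    (h : d = 2 * (k + 1 : ℕ) + j) (v : E) (h' : d = 2 * k + (j + 1 + 1 : ℕ)) :
    HomFree.act (DirLim M) (j + 1) v (HomFree.act (DirLim M) j v
      (toHomFree hm (mul_mem_tpow hz (ι_mem_tpow l)) h)) = s l v v • toHomFree hm hz h' := by
  have hv := M.act_mem hm (HC.gen_mem_deg s v)
  have hvv := M.act_mem hv (HC.gen_mem_deg s v)
  rw [act_toHomFree hm _ h v hv (by push_cast at h ⊢; linarith),
    act_toHomFree hv _ _ v hvv (by push_cast at h ⊢; linarith)]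
  refine DirLim.hom_ext fun i (a : HC s) ha y hy => ?_
  obtain ⟨h₁, e₁⟩ := toHomFree_mk hvv (mul_mem_tpow hz (ι_mem_tpow l))
    (j := j + 1 + 1) (by push_cast at h ⊢; linarith) i a ha y hy
  obtain ⟨h₂, e₂⟩ := toHomFree_mk hm hz h' i a ha y hy
  rw [e₁, LinearMap.smul_apply, e₂,
    ← DirLim.mk_sq v l h₂ (mul_mem_tpow hy hz) (sq_smul_mem_grade v h₂)]
  refine DirLim.mk_eq_mk _ _ _ _ ?_
  rw [← mul_smul, ← mul_smul, ← mul_smul, ← MulOpposite.op_mul, ← MulOpposite.op_mul,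
    ← MulOpposite.op_mul, mul_assoc, ← HC.sq_mul v a, mul_assoc]

variable (M) in
/-- The map from the component of degree `j` to the `B0`-linear maps on the module associated with
`HC⟨-j⟩`. -/
def toHom (j : ℕ) : M.family.obj j →ₗ[R] HomFree (s := s) (DirLim M) j where
  toFun m := toHomFree (M.familyVal_mem j m) (one_mem_tpow (R := R) (L := L)) (by simp)
  map_add' m m' := (toHomFree_congr _ (add_mem (M.familyVal_mem j m) (M.familyVal_mem j m')) _ _ _
    (by rw [map_add])).trans (toHomFree_add _ _ _ _)
  map_smul' r m := (toHomFree_congr _ (Submodule.smul_mem _ r (M.familyVal_mem j m)) _ _ _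
    (by rw [map_smul])).trans (toHomFree_smul _ _ _ _)

lemma toHom_apply (j : ℕ) {m : M} (hm : m ∈ M.grade j) (h : (j : ℤ) = 2 * (0 : ℕ) + j)
    (x : M.family.obj j) (e : M.familyVal j x = m) :
    M.toHom j x = toHomFree hm (one_mem_tpow (R := R) (L := L)) h := by
  subst e
  rfl

lemma toHom_act (j : ℕ) (v : E) (x : M.family.obj j) :
    M.toHom (j + 1) (M.family.act j v x) = HomFree.act (DirLim M) j v (M.toHom j x) := by
  have hv : MulOpposite.op (HC.gen s v) • M.familyVal j x ∈ M.grade (j + 1 : ℕ) :=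
    M.familyVal_mem (j + 1) (M.family.act j v x)
  rw [M.toHom_apply j (M.familyVal_mem j x) (by simp) x rfl, act_toHomFree _ _ _ v hv (by simp),
    M.toHom_apply (j + 1) hv (by simp) _ (M.familyVal_act j v x)]

variable (M) in
/-- When `M_{2K} ⊗ L^K` is the whole of the direct limit, the maps on `HC⟨-2i⟩` are given by the sections
of `M_{2K} ⊗ L^{K - i}`. -/
lemma mem_span_toHomFree (K : ℕ) (hK : Function.Surjective (DirLim.ofPiece M K)) (i k : ℕ)
    (h : i + k = K) (f : HomFree (s := s) (DirLim M) (2 * i)) :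
    f ∈ Submodule.span R {g | ∃ (m : M) (hm : m ∈ M.grade (2 * K)) (z : SymmetricAlgebra R L)
      (hz : z ∈ tpow R L k) (h : 2 * (K : ℤ) = 2 * k + (2 * i : ℕ)), g = toHomFree hm hz h} := by
  induction i generalizing k with
  | zero =>
    obtain rfl : k = K := by omega
    set P := Submodule.span R {g : HomFree (s := s) (DirLim M) (2 * 0) | ∃ (m : M)
      (hm : m ∈ M.grade (2 * k)) (z : SymmetricAlgebra R L)
      (hz : z ∈ tpow R L k) (h : 2 * (k : ℤ) = 2 * k + (2 * 0 : ℕ)), g = toHomFree hm hz h}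
    obtain ⟨⟨x, hx⟩, e⟩ := hK (f (FreeLim.one s))
    have H : ∃ hx : x ∈ piece M (2 * k) k, DirLim.ofPiece M k ⟨x, hx⟩ ∈
        P.map (homFreeZeroEquiv (s := s) (DirLim M)).toLinearMap := by
      refine map₂_induction (p := fun x => ∃ hx : x ∈ piece M (2 * k) k,
        DirLim.ofPiece M k ⟨x, hx⟩ ∈ P.map (homFreeZeroEquiv (s := s) (DirLim M)).toLinearMap)
        ⟨zero_mem _, ?_⟩ ?_ ?_ hx
      · exact (map_zero (DirLim.ofPiece M k)).symm ▸ zero_mem _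
      · rintro x y ⟨hx, hx'⟩ ⟨hy, hy'⟩
        refine ⟨add_mem hx hy, ?_⟩
        exact (map_add (DirLim.ofPiece M k) ⟨x, hx⟩ ⟨y, hy⟩).symm ▸ add_mem hx' hy'
      · intro m hm y hy
        refine ⟨tmul_mem_piece hm hy, toHomFree hm hy (by simp),
          Submodule.subset_span ⟨m, hm, y, hy, by simp, rfl⟩, ?_⟩
        obtain ⟨h₁, e₁⟩ := toHomFree_mk hm hy (j := 0) (by simp) 0 (1 : HC s)
          (HC.mem_free_zero.2 HC.one_mem_deg) 1 one_mem_tpow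
        refine Eq.trans e₁ ?_
        exact DirLim.mk_eq_mk _ _ hm hy (by rw [MulOpposite.op_one, one_smul, one_mul])
    obtain ⟨g, hg, hg'⟩ := H.2
    have : f = g := FreeLim.zero_hom_ext _ (e.symm.trans hg'.symm)
    rw [this]
    exact hg
  | succ i ih =>
    obtain ⟨π⟩ := NondegForm.exists_partition s
    have hs := HomFree.sum_act_act π (2 * i) f
    rw [← hs]
    refine sum_mem fun t _ => ?_
    have hf := ih (k + 1) (by omega) (f ∘ₗ FreeLim.twist s (2 * i) (π.l t))
    have hc : 2 * (K : ℤ) = 2 * k + (2 * (i + 1) : ℕ) := by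
      rw [← h]; push_cast; ring
    generalize f ∘ₗ FreeLim.twist s (2 * i) (π.l t) = f' at hf ⊢
    induction hf using Submodule.span_induction with
    | zero =>
      rw [map_zero, map_zero]
      exact zero_mem _
    | add x y _ _ hx hy =>
      rw [map_add, map_add]
      exact add_mem hx hy
    | smul r x _ hx =>
      rw [map_smul, map_smul]
      exact Submodule.smul_mem _ r hx
    | mem g hg =>
      obtain ⟨m, hm, z, hz, h', rfl⟩ := hg
      suffices H : ∃ hz : z ∈ tpow R L (k + 1), HomFree.act (DirLim M) (2 * i + 1) (π.v t)
          (HomFree.act (DirLim M) (2 * i) (π.v t) (toHomFree hm hz h')) ∈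
          Submodule.span R {g : HomFree (s := s) (DirLim M) (2 * (i + 1)) | ∃ (m : M)
            (hm : m ∈ M.grade (2 * K)) (z : SymmetricAlgebra R L)
            (hz : z ∈ tpow R L k) (h : 2 * (K : ℤ) = 2 * k + (2 * (i + 1) : ℕ)),
            g = toHomFree hm hz h} from H.2
      refine tpow_induction (p := fun z => ∃ hz : z ∈ tpow R L (k + 1),
        HomFree.act (DirLim M) (2 * i + 1) (π.v t)
          (HomFree.act (DirLim M) (2 * i) (π.v t) (toHomFree hm hz h')) ∈
          Submodule.span R {g : HomFree (s := s) (DirLim M) (2 * (i + 1)) | ∃ (m : M)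
            (hm : m ∈ M.grade (2 * K)) (z : SymmetricAlgebra R L)
            (hz : z ∈ tpow R L k) (h : 2 * (K : ℤ) = 2 * k + (2 * (i + 1) : ℕ)),
            g = toHomFree hm hz h}) ?_ ?_ hz
      · intro z hz l
        refine ⟨mul_mem_tpow hz (ι_mem_tpow l), ?_⟩
        rw [act_act_toHomFree hm hz l h' (π.v t) hc]
        exact Submodule.smul_mem _ _ (Submodule.subset_span ⟨m, hm, z, hz, hc, rfl⟩)
      · rintro z z' ⟨hz, e⟩ ⟨hz', e'⟩
        refine ⟨add_mem hz hz', ?_⟩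
        rw [toHomFree_add_right hm hz hz', map_add, map_add]
        exact add_mem e e'

variable [IsNoetherianRing R] [Module.Finite (HC s)ᵐᵒᵖ M]

variable (M) in
/-- In even degrees, `M_{2k} ⊗ L^k → lim M_{2k} ⊗ L^k` is injective for large `k`; in odd degrees, an
element in the kernel is killed by the squares. -/
lemma exists_toHom_injective : ∃ j₀, ∀ j ≥ j₀, Function.Injective (M.toHom j) := by
  obtain ⟨K, hK⟩ := DirLim.exists_bijective M
  obtain ⟨D, hD⟩ := M.exists_sq_faithful
  have heven (k : ℕ) (hk : K ≤ k) (x : M.family.obj (2 * k)) (hx : M.toHom (2 * k) x = 0) :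
      x = 0 := by
    refine M.familyVal_injective _ ?_
    rw [map_zero]
    refine eq_zero_of_tmul_eq_zero k fun l => ?_
    have hl := pow_mem_tpow (R := R) l k
    have hm : M.familyVal (2 * k) x ∈ M.grade (2 * (k : ℤ)) := M.familyVal_mem _ x
    obtain ⟨h₁, e₁⟩ := toHomFree_mk (M.familyVal_mem _ x) (one_mem_tpow (R := R) (L := L))
      (j := 2 * k) (by simp) k (1 : HC s) (HC.mem_free (by simp) HC.one_mem_deg) _ hl
    have h0 := (DFunLike.congr_fun hx _).symm.trans e₁
    have h1 : DirLim.ofPiece M k ⟨_, tmul_mem_piece hm hl⟩ = 0 := by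
      refine Eq.trans ?_ h0.symm
      exact DirLim.mk_eq_mk hm hl _ _ (by rw [MulOpposite.op_one, one_smul, mul_one])
    exact congrArg Subtype.val ((injective_iff_map_eq_zero _).1 (hK k hk).1 _ h1)
  refine ⟨2 * K + D.toNat, fun j hj => (injective_iff_map_eq_zero _).2 fun x hx => ?_⟩
  obtain ⟨k, rfl | rfl⟩ := j.even_or_odd'
  · exact heven k (by omega) x hx
  · refine M.familyVal_injective _ ?_
    rw [map_zero]
    refine hD _ (by push_cast; omega) _ (M.familyVal_mem _ x) fun v => ?_
    have h := heven (k + 1) (by omega) (M.family.act (2 * k + 1) v x)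
      ((M.toHom_act (2 * k + 1) v x).trans (by rw [hx, map_zero]))
    rw [MulOpposite.op_mul, mul_smul, ← M.familyVal_act]
    exact (congrArg (fun y => MulOpposite.op (HC.gen s v) • M.familyVal _ y) h).trans
      (by rw [map_zero, smul_zero])

variable (M) in
/-- In a large even degree `2K`, the maps on `HC⟨-2K⟩` are given by elements of `M_{2K}`; from there on,
every map is a sum of products of maps of smaller degree and generators. -/
lemma exists_toHom_surjective : ∃ j₀, ∀ j ≥ j₀, Function.Surjective (M.toHom j) := by
  obtain ⟨K, hK⟩ := DirLim.exists_bijective M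
  refine ⟨2 * K, fun j hj => ?_⟩
  induction j, hj using Nat.le_induction with
  | base =>
    intro f
    have hf := M.mem_span_toHomFree K (hK K le_rfl).2 K 0 (add_zero K) f
    rw [← LinearMap.mem_range]
    refine Submodule.span_le.2 ?_ hf
    rintro _ ⟨m, hm, z, hz, h, rfl⟩
    have hz' := hz
    rw [tpow, pow_zero, Submodule.mem_one] at hz'
    obtain ⟨r, rfl⟩ := hz'
    have hm' : r • m ∈ M.grade (2 * K : ℕ) := Submodule.smul_mem _ r hm
    obtain ⟨x, hx⟩ := M.exists_familyVal hm'
    refine ⟨x, (M.toHom_apply (2 * K) hm' (by simp) x hx).trans ?_⟩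
    refine toHomFree_congr _ hm _ hz _ ?_
    rw [TensorProduct.smul_tmul, Algebra.algebraMap_eq_smul_one]
  | succ j _ ih =>
    intro f
    obtain ⟨π⟩ := NondegForm.exists_partition s
    choose x hx using fun i => ih (f ∘ₗ FreeLim.genTwist s j (π.v i) (π.l i))
    refine ⟨∑ i, M.family.act j (π.v i) (x i), ?_⟩
    rw [map_sum, ← HomFree.sum_act π j f]
    exact Finset.sum_congr rfl fun i _ => by rw [toHom_act, hx]

variable (M) in
/-- The map `⨁_{j ≥ 0} M_j → ⨁ Hom(HC⟨-j⟩, lim M_{2k} ⊗ L^k)`. -/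
def unit : M.family.Total →ₗ[R] (homFamily (DirLim M) : GrFamily s).Total :=
  GrFamily.map _ M.toHom

end GrModule

instance homFamily_obj_finite [IsNoetherianRing R] (N : Type u) [AddCommGroup N] [Module R N]
    [Module (B0 s)ᵐᵒᵖ N] [IsScalarTower R (B0 s)ᵐᵒᵖ N] [Module.Finite R N] (j : ℕ) :
    Module.Finite R (HomFree (s := s) N j) := by
  obtain ⟨π⟩ := NondegForm.exists_partition s
  induction j with
  | zero => exact Module.Finite.equiv (homFreeZeroEquiv (s := s) N).symm
  | succ j ih =>
    refine Module.Finite.of_surjective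
      (∑ i : Fin π.r, HomFree.act N j (π.v i) ∘ₗ
        (LinearMap.proj i : (Fin π.r → HomFree (s := s) N j) →ₗ[R] _)) fun f =>
      ⟨fun i => f ∘ₗ FreeLim.genTwist s j (π.v i) (π.l i), ?_⟩
    rw [LinearMap.sum_apply]
    exact HomFree.sum_act π j f

/-- The unit is bijective in large degrees. -/
lemma GrModule.unit_finite_ker_coker [IsNoetherianRing R] [Module.Finite (HC s)ᵐᵒᵖ M] :
    Module.Finite R (LinearMap.ker M.unit) ∧
      Module.Finite R ((homFamily (DirLim M) : GrFamily s).Total ⧸ LinearMap.range M.unit) := by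
  obtain ⟨a, ha⟩ := M.exists_toHom_injective
  obtain ⟨b, hb⟩ := M.exists_toHom_surjective
  exact GrFamily.map_finite_ker_coker _ inferInstance (homFamily_obj_finite _) (a + b) fun j hj =>
    ⟨ha j (by omega), hb j (by omega)⟩

lemma GrModule.unit_op_smul (b : HC s) (x : M.family.Total) :
    M.unit (MulOpposite.op b • x) = MulOpposite.op b • M.unit x :=
  GrFamily.map_op_smul _ M.toHom_act b x

lemma GrModule.unit_of (j : ℕ) (x : M.family.obj j) :
    M.unit (M.family.of j x) = HomFree.incl j (M.toHom j x) := GrFamily.map_of _ j x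

lemma GrModule.unit_mem_grade {k : ℤ} {x : M.family.Total} (hx : x ∈ M.family.toGrModule.grade k) :
    M.unit x ∈ (homFamily (DirLim M) : GrFamily s).toGrModule.grade k :=
  GrFamily.map_mem_grade _ hx

end Unit


/-! ### The counit: the direct limit of the maps from the free modules -/

section Counit

variable {R E L : Type u} [CommRing R] [AddCommGroup E] [Module R E] [AddCommGroup L] [Module R L]
variable {s : L →ₗ[R] E →ₗ[R] E →ₗ[R] R} [NondegForm s]

/-- The elements `1 ⊗ y` of the module associated with `HC⟨-2k⟩`. -/
def FreeLim.ofTpow (k j : ℕ) (h : j = 2 * k) : tpow R L k →ₗ[R] FreeLim s j where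
  toFun y := DirLim.mk (HC.free s j) k (1 : HC s) (HC.mem_free (by simp [h]) HC.one_mem_deg) y.1 y.2
  map_add' y z := DirLim.mk_tmul_add _ _ _
  map_smul' r y := DirLim.mk_tmul_smul r _ _

/-- The elements `1 ⊗ y` of the module associated with `HC⟨-j⟩`, for `y` in the component of degree
`j / 2` of `Sym L`; the other components are sent to zero. -/
def FreeLim.ofSym (j : ℕ) : SymmetricAlgebra R L →ₗ[R] FreeLim s j :=
  if h : j = 2 * (j / 2) then FreeLim.ofTpow (j / 2) j h ∘ₗ symProj R L (j / 2) else 0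

lemma FreeLim.ofSym_of_mem {k : ℕ} {y : SymmetricAlgebra R L} (hy : y ∈ tpow R L k)
    (h1 : (1 : HC s) ∈ (HC.free s (2 * k)).grade (2 * k)) :
    FreeLim.ofSym (s := s) (2 * k) y = DirLim.mk (HC.free s (2 * k)) k (1 : HC s) h1 y hy := by
  have e : 2 * k / 2 = k := by omega
  have H (i : ℕ) (hi : i = k) (h : 2 * k = 2 * i) :
      FreeLim.ofTpow (s := s) i (2 * k) h (symProj R L i y) =
        DirLim.mk (HC.free s (2 * k)) k (1 : HC s) h1 y hy := by
    subst hi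
    rw [symProj_of_mem hy]
    rfl
  rw [FreeLim.ofSym, dif_pos (by rw [e])]
  exact H _ e (by rw [e])

section

variable (N : Type u) [AddCommGroup N] [Module R N] [Module (B0 s)ᵐᵒᵖ N]
  [IsScalarTower R (B0 s)ᵐᵒᵖ N]

/-- The map `f ↦ (y ↦ f (1 ⊗ y))` on the component of degree `j`. -/
def counitComponent (j : ℕ) : HomFree (s := s) N j →ₗ[R] SymmetricAlgebra R L →ₗ[R] N where
  toFun f := (f.restrictScalars R) ∘ₗ FreeLim.ofSym j
  map_add' _ _ := rfl
  map_smul' _ _ := rfl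

/-- The map `f ⊗ y ↦ f (1 ⊗ y)`. -/
def counitTensor : (homFamily N : GrFamily s).Total ⊗[R] SymmetricAlgebra R L →ₗ[R] N :=
  TensorProduct.lift ((homFamily N : GrFamily s).desc (counitComponent N))

variable {N}

lemma counitTensor_tmul (j : ℕ) (f : HomFree (s := s) N j) (y : SymmetricAlgebra R L) :
    counitTensor N (HomFree.incl j f ⊗ₜ y) = f (FreeLim.ofSym j y) :=
  DFunLike.congr_fun ((homFamily N : GrFamily s).desc_of (counitComponent N) j f) y

lemma HomFree.exists_incl {k : ℕ} {x : (homFamily N : GrFamily s).Total}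
    (hx : x ∈ (homFamily N).toGrModule.grade (2 * k)) :
    ∃ f : HomFree (s := s) N (2 * k), HomFree.incl (2 * k) f = x :=
  GrFamily.exists_of_mem_grade (by push_cast; rfl) hx

lemma HomFree.incl_mem {k : ℕ} (f : HomFree (s := s) N (2 * k)) :
    HomFree.incl (2 * k) f ∈ (homFamily N).toGrModule.grade (2 * k) :=
  (homFamily N : GrFamily s).of_mem_grade (2 * k) f

lemma counitTensor_actL {a : HCL s} (ha : a ∈ evenAlg s)
    {x : (homFamily N : GrFamily s).toGrModule ⊗[R] SymmetricAlgebra R L}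
    (hx : x ∈ colimSrc (homFamily N).toGrModule) : counitTensor N (actL (homFamily N).toGrModule a x) =
      MulOpposite.op (B0.mk s ⟨a, ha⟩) • counitTensor N x := by
  suffices H : ∃ ha : a ∈ evenAlg s, counitTensor N (actL (homFamily N).toGrModule a x) =
      MulOpposite.op (B0.mk s ⟨a, ha⟩) • counitTensor N x from H.2
  refine evenAlg_induction (p := fun a => ∃ ha : a ∈ evenAlg s,
    counitTensor N (actL (homFamily N).toGrModule a x) =
      MulOpposite.op (B0.mk s ⟨a, ha⟩) • counitTensor N x) ⟨zero_mem _, ?_⟩ ?_ ?_ ha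
  · have : (⟨0, zero_mem _⟩ : evenAlg s) = 0 := rfl
    rw [this, map_zero, map_zero, MulOpposite.op_zero, zero_smul]
    exact map_zero (counitTensor N)
  · rintro a b ⟨ha, ha'⟩ ⟨hb, hb'⟩
    refine ⟨add_mem ha hb, ?_⟩
    have : (⟨a + b, add_mem ha hb⟩ : evenAlg s) = ⟨a, ha⟩ + ⟨b, hb⟩ := rfl
    rw [this, map_add, map_add, MulOpposite.op_add, add_smul, ← ha', ← hb']
    exact map_add (counitTensor N) _ _
  · intro i b l hb hl
    have hbl : b ⊗ₜ l ∈ evenAlg s := Submodule.mem_iSup_of_mem (p := evenPiece s) i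
      (Submodule.apply_mem_map₂ (TensorProduct.mk R (HC s) (SymmetricAlgebra R L)) hb hl)
    refine ⟨hbl, ?_⟩
    refine colimSrc_induction (homFamily N).toGrModule (p := fun x =>
      counitTensor N (actL (homFamily N).toGrModule (b ⊗ₜ l) x) =
        MulOpposite.op (B0.mk s ⟨_, hbl⟩) • counitTensor N x) ?_ ?_ ?_ hx
    · rw [map_zero]
      exact (map_zero (counitTensor N)).trans ((congrArg _ (map_zero (counitTensor N))).trans
        (smul_zero _)).symm
    · intro x y hx hy
      rw [map_add]
      refine (map_add (counitTensor N) _ _).trans ?_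
      rw [hx, hy, ← smul_add]
      exact congrArg _ (map_add (counitTensor N) x y).symm
    · intro k x y hx hy
      obtain ⟨f, rfl⟩ := HomFree.exists_incl hx
      have h1 (k : ℕ) : (1 : HC s) ∈ (HC.free s (2 * k)).grade (2 * k) :=
        HC.mem_free (by simp) HC.one_mem_deg
      have e₁ := op_smul_of_homFamily hb (2 * k) f
      refine (congrArg (fun z => counitTensor N (z ⊗ₜ (y * l))) e₁).trans ?_
      refine (counitTensor_tmul (2 * k + 2 * i) _ (y * l)).trans ?_
      refine Eq.trans ?_ (congrArg _ (counitTensor_tmul (2 * k) f y)).symm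
      rw [FreeLim.ofSym_of_mem hy (h1 k)]
      have e₂ : FreeLim.ofSym (s := s) (2 * k + 2 * i) (y * l) =
          DirLim.mk (HC.free s (2 * k + 2 * i)) (k + i) (1 : HC s)
            (HC.mem_free (by push_cast; ring) HC.one_mem_deg) (y * l) (mul_mem_tpow hy hl) := by
        have H (j : ℕ) (hj : j = 2 * (k + i)) : FreeLim.ofSym (s := s) j (y * l) =
            DirLim.mk (HC.free s j) (k + i) (1 : HC s)
              (HC.mem_free (by rw [hj]; push_cast; ring) HC.one_mem_deg) (y * l)
                (mul_mem_tpow hy hl) := by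
          subst hj
          exact FreeLim.ofSym_of_mem _ _
        exact H _ (by ring)
      obtain ⟨h₃, e₃⟩ := FreeLim.mulLeft_mk hb (one_mem_tpow (R := R) (L := L)) (j := 2 * k + 2 * i)
        (j' := 2 * k) (by ring) (k + i) (1 : HC s)
        (HC.mem_free (by push_cast; ring) HC.one_mem_deg) (y * l) (mul_mem_tpow hy hl)
      rw [LinearMap.comp_apply, e₂, e₃, ← map_smul, DirLim.op_mk_smul]
      refine congrArg f (congrArg (DirLim.proj _) (Subtype.ext ?_))
      refine congrArg₂ (fun (b : HC s) z => (b ⊗ₜ[R] z : HCL s)) ?_ (mul_one _)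
      exact (mul_one b).trans (one_mul b).symm

variable (N) in
/-- The map `lim Hom(HC⟨-2k⟩, N) ⊗ L^k → N`. -/
def counit : DirLim (homFamily N : GrFamily s).toGrModule →ₗ[(B0 s)ᵐᵒᵖ] N :=
  DirLim.desc ((counitTensor N).domRestrict _) fun a x => counitTensor_actL a.2 x.2

lemma counit_mk {k : ℕ} (f : HomFree (s := s) N (2 * k)) (hf) {y : SymmetricAlgebra R L}
    (hy : y ∈ tpow R L k) (h1 : (1 : HC s) ∈ (HC.free s (2 * k)).grade (2 * k)) :
    counit N (DirLim.mk (homFamily N).toGrModule k (HomFree.incl (2 * k) f) hf y hy) =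
      f (DirLim.mk (HC.free s (2 * k)) k (1 : HC s) h1 y hy) :=
  (counitTensor_tmul (2 * k) f y).trans (congrArg f (FreeLim.ofSym_of_mem hy h1))

/-- The map `Hom(HC, N) → lim Hom(HC⟨-2k⟩, N) ⊗ L^k`. -/
def HomFree.toLim (f : HomFree (s := s) N 0) : DirLim (homFamily N : GrFamily s).toGrModule :=
  DirLim.mk (homFamily N).toGrModule 0 (HomFree.incl 0 f) (HomFree.incl_mem (k := 0) f) 1 one_mem_tpow

lemma HomFree.toLim_add (f g : HomFree (s := s) N 0) : (f + g).toLim = f.toLim + g.toLim := by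
  refine Eq.trans ?_ (DirLim.mk_add _ _ _)
  exact DirLim.mk_congr _ _ _ (map_add (HomFree.incl 0) f g) rfl

lemma HomFree.toLim_smul (r : R) (f : HomFree (s := s) N 0) : (r • f).toLim = r • f.toLim := by
  refine Eq.trans ?_ (DirLim.mk_smul _ _ _)
  exact DirLim.mk_congr _ _ _ (map_smul (HomFree.incl 0) r f) rfl

variable (N) in
/-- `HomFree.toLim` as a linear map. -/
def HomFree.toLimₗ : HomFree (s := s) N 0 →ₗ[R] DirLim (homFamily N : GrFamily s).toGrModule where
  toFun := HomFree.toLim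
  map_add' := HomFree.toLim_add
  map_smul' := HomFree.toLim_smul

/-- Every element of `lim Hom(HC⟨-2k⟩, N) ⊗ L^k` comes from `Hom(HC, N)`: the degree is lowered by means
of `∑ v_i² ⊗ l_i`. -/
lemma HomFree.mem_range_toLim (x : DirLim (homFamily N : GrFamily s).toGrModule) :
    x ∈ LinearMap.range (HomFree.toLimₗ (s := s) N) := by
  obtain ⟨π⟩ := NondegForm.exists_partition s
  induction x using DirLim.induction with
  | zero => exact zero_mem _
  | add x y hx hy => exact add_mem hx hy
  | mk k x hx y hy =>
    induction k generalizing x y with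
    | zero =>
      obtain ⟨f, rfl⟩ := HomFree.exists_incl hx
      have hy' := hy
      rw [tpow, pow_zero, Submodule.mem_one] at hy'
      obtain ⟨r, rfl⟩ := hy'
      refine ⟨r • f, (HomFree.toLim_smul r f).trans ?_⟩
      refine (DirLim.mk_tmul_smul r _ _).symm.trans ?_
      exact DirLim.mk_congr _ _ _ rfl (Algebra.algebraMap_eq_smul_one r).symm
    | succ k ih =>
      obtain ⟨f, rfl⟩ := HomFree.exists_incl hx
      suffices H : ∃ hy : y ∈ tpow R L (k + 1), DirLim.mk (homFamily N).toGrModule (k + 1)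
          (HomFree.incl (2 * (k + 1)) f) hx y hy ∈ LinearMap.range (HomFree.toLimₗ (s := s) N)
        from H.2
      refine tpow_induction (p := fun y => ∃ hy : y ∈ tpow R L (k + 1),
        DirLim.mk (homFamily N).toGrModule (k + 1) (HomFree.incl (2 * (k + 1)) f) hx y hy ∈
          LinearMap.range (HomFree.toLimₗ (s := s) N)) ?_ ?_ hy
      · intro y hy l
        refine ⟨mul_mem_tpow hy (ι_mem_tpow l), ?_⟩
        let g (i) : (homFamily N : GrFamily s).Total :=
          HomFree.incl (2 * k) (f ∘ₗ FreeLim.twist s (2 * k) (π.l i))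
        have hg (i) : g i ∈ (homFamily N).toGrModule.grade (2 * k) := HomFree.incl_mem _
        have e : HomFree.incl (2 * (k + 1)) f = ∑ i, MulOpposite.op (HC.sq s (π.v i)) • g i := by
          refine (congrArg (HomFree.incl (2 * k + 1 + 1)) (HomFree.sum_act_act π (2 * k) f)).symm.trans ?_
          rw [map_sum]
          refine Finset.sum_congr rfl fun i _ => ?_
          rw [MulOpposite.op_mul, mul_smul, HomFree.gen_smul_incl, HomFree.gen_smul_incl]
        have hs (i) := sq_smul_mem_grade (M := (homFamily N).toGrModule) (π.v i) (hg i)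
        have e' : DirLim.mk (homFamily N).toGrModule (k + 1) (HomFree.incl (2 * (k + 1)) f) hx
            (y * SymmetricAlgebra.ι R L l) (mul_mem_tpow hy (ι_mem_tpow l)) =
            ∑ i, DirLim.mk (homFamily N).toGrModule (k + 1)
              (MulOpposite.op (HC.sq s (π.v i)) • g i) (hs i)
              (y * SymmetricAlgebra.ι R L l) (mul_mem_tpow hy (ι_mem_tpow l)) := by
          refine Eq.trans ?_ (map_sum (DirLim.proj (homFamily N).toGrModule) (fun i =>
            ⟨_, tmul_mem_colimSrc _ (k + 1) (hs i) (mul_mem_tpow hy (ι_mem_tpow l))⟩) Finset.univ)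
          refine congrArg (DirLim.proj _) (Subtype.ext ?_)
          rw [AddSubmonoidClass.coe_finsetSum]
          refine Eq.trans ?_ (TensorProduct.sum_tmul _ _ _)
          exact congrArg (fun z => z ⊗ₜ[R] (y * SymmetricAlgebra.ι R L l)) e
        rw [e']
        refine sum_mem fun i _ => ?_
        refine (congrArg (· ∈ LinearMap.range (HomFree.toLimₗ (s := s) N))
          (DirLim.mk_sq (π.v i) l (hg i) hy (hs i))).mpr ?_
        exact Submodule.smul_mem _ _ (ih _ (hg i) _ hy)
      · rintro y z ⟨hy, hy'⟩ ⟨hz, hz'⟩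
        refine ⟨add_mem hy hz, ?_⟩
        rw [DirLim.mk_tmul_add hx hy hz]
        exact add_mem hy' hz'

lemma counit_toLim (f : HomFree (s := s) N 0) : counit N f.toLim = f (FreeLim.one s) :=
  counit_mk (k := 0) f _ _ _

/-- The counit is inverse to `Hom(HC, N) = N → lim Hom(HC⟨-2k⟩, N) ⊗ L^k`. -/
lemma counit_bijective : Function.Bijective (counit (s := s) N) := by
  constructor
  · refine (injective_iff_map_eq_zero _).2 fun x hx => ?_
    obtain ⟨f, rfl⟩ := HomFree.mem_range_toLim x
    have : f = 0 := FreeLim.zero_hom_ext N ((counit_toLim f).symm.trans hx)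
    rw [this, map_zero]
  · intro n
    exact ⟨HomFree.toLim (FreeLim.ofElement n), (counit_toLim _).trans (FreeLim.ofElement_one n)⟩

end

section Restriction

variable {R' E' L' : Type u} [CommRing R'] [AddCommGroup E'] [Module R' E'] [AddCommGroup L']
  [Module R' L'] {s' : L' →ₗ[R'] E' →ₗ[R'] E' →ₗ[R'] R'} [NondegForm s'] (F : FormMap s s')
variable {N : Type u} [AddCommGroup N] [Module R N] [Module (B0 s)ᵐᵒᵖ N]
  [IsScalarTower R (B0 s)ᵐᵒᵖ N] {N' : Type u} [AddCommGroup N'] [Module R' N']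
  [Module (B0 s')ᵐᵒᵖ N'] [IsScalarTower R' (B0 s')ᵐᵒᵖ N']
variable (ρ : N →ₛₗ[F.φ] N')
  (hρ : ∀ b x, ρ (MulOpposite.op b • x) = MulOpposite.op (B0.map F b) • ρ x)

lemma homFamilyRes_incl (j : ℕ) (f : HomFree (s := s) N j) :
    (homFamilyRes F ρ hρ).toFun (HomFree.incl j f) = HomFree.incl j (HomFree.res F ρ hρ j f) :=
  GrFamily.semilinearMap_of (X := homFamily N) (X' := homFamily N') (HomFree.res F ρ hρ) j f

lemma counit_res (x : DirLim (homFamily N : GrFamily s).toGrModule) :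
    counit N' (DirLim.map (homFamilyRes F ρ hρ) x) = ρ (counit N x) := by
  obtain ⟨f, rfl⟩ := HomFree.mem_range_toLim x
  refine Eq.trans ?_ (congrArg ρ (counit_toLim f)).symm
  rw [← HomFree.res_apply_res (hρ := hρ), FreeLim.res_one, ← counit_toLim]
  refine congrArg (counit N') ?_
  refine (DirLim.map_mk (homFamilyRes F ρ hρ) 0 (HomFree.incl 0 f) (HomFree.incl_mem (k := 0) f) 1
    one_mem_tpow).trans ?_
  exact DirLim.mk_congr _ _ _ (homFamilyRes_incl F ρ hρ 0 f) (map_one _)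

end Restriction

section Naturality

lemma GrModule.toHom_res {R' E' L' : Type u} [CommRing R'] [AddCommGroup E'] [Module R' E']
    [AddCommGroup L'] [Module R' L'] {s' : L' →ₗ[R'] E' →ₗ[R'] E' →ₗ[R'] R'} [NondegForm s']
    (F : FormMap s s') {M : GrModule s} {M' : GrModule s'} (g : GrMap F M M') (j : ℕ)
    (x : M.family.obj j) (x' : M'.family.obj j) (e : M'.familyVal j x' = g.toFun (M.familyVal j x))
    (y : FreeLim s j) : M'.toHom j x' (FreeLim.res F j y) = DirLim.map g (M.toHom j x y) := by
  induction y using DirLim.induction with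
  | zero => simp only [map_zero]
  | add x y hx hy => simp only [map_add, hx, hy]
  | mk t a ha y hy =>
    obtain ⟨h₁, e₁⟩ := GrModule.toHomFree_mk (M.familyVal_mem j x) (one_mem_tpow (R := R) (L := L))
      (j := j) (by simp) t a ha y hy
    obtain ⟨h₂, e₂⟩ := GrModule.toHomFree_mk (M'.familyVal_mem j x')
      (one_mem_tpow (R := R') (L := L')) (j := j) (by simp) t (HC.map F a)
      ((HC.freeMap F j).map_grade ha) (symMap F.fL y) (symMap_mem_tpow F.fL hy)
    refine (congrArg (M'.toHom j x') (DirLim.map_mk (HC.freeMap F j) _ _ _ _ _)).trans ?_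
    refine e₂.trans (Eq.trans ?_ (congrArg (DirLim.map g) e₁).symm)
    refine Eq.trans ?_ (DirLim.map_mk g _ _ _ _ _).symm
    refine DirLim.mk_congr _ _ _ ?_ ?_
    · rw [e]
      exact (g.map_act _ _).symm
    · rw [map_mul, map_one]

end Naturality

end Counit


/-! ### Functoriality of the unit and of the counit -/

section FamilyRestriction

variable {R E L : Type u} [CommRing R] [AddCommGroup E] [Module R E] [AddCommGroup L] [Module R L]
variable {R' E' L' : Type u} [CommRing R'] [AddCommGroup E'] [Module R' E'] [AddCommGroup L']
  [Module R' L']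
variable {s : L →ₗ[R] E →ₗ[R] E →ₗ[R] R} {s' : L' →ₗ[R'] E' →ₗ[R'] E' →ₗ[R'] R'}
variable {F : FormMap s s'} {M : GrModule s} {M' : GrModule s'}

/-- The map of the components of nonnegative degree induced by a map of graded modules. -/
def GrMap.family (g : GrMap F M M') (j : ℕ) : M.family.obj j →ₛₗ[F.φ] M'.family.obj j where
  toFun x := ⟨g.toFun (M.familyVal j x), g.map_grade (M.familyVal_mem j x)⟩
  map_add' x y := Subtype.ext (map_add g.toFun (M.familyVal j x) (M.familyVal j y))
  map_smul' r x := Subtype.ext (LinearMap.map_smulₛₗ g.toFun r (M.familyVal j x))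

lemma GrMap.familyVal_family (g : GrMap F M M') (j : ℕ) (x : M.family.obj j) :
    M'.familyVal j (g.family j x) = g.toFun (M.familyVal j x) := rfl

lemma GrMap.family_act (g : GrMap F M M') (j : ℕ) (v : E) (x : M.family.obj j) :
    g.family (j + 1) (M.family.act j v x) = M'.family.act j (F.fE v) (g.family j x) := by
  refine M'.familyVal_injective (j + 1) ?_
  rw [g.familyVal_family, GrModule.familyVal_act, GrModule.familyVal_act, g.familyVal_family,
    g.map_act, HC.map_gen]

/-- The projection to a component of nonnegative degree. -/
def GrModule.toFamily (M : GrModule s) (j : ℕ) : M →ₗ[R] M.family.obj j :=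
  (M.proj j).codRestrict (M.grade j) (M.proj_mem j)

lemma GrModule.familyVal_toFamily (M : GrModule s) (j : ℕ) (m : M) :
    M.familyVal j (M.toFamily j m) = M.proj j m := rfl

lemma GrMap.family_isExtensionOfScalars (g : GrMap F M M') (h : IsExtensionOfScalars F.φ g.toFun)
    (j : ℕ) : IsExtensionOfScalars F.φ (g.family j) :=
  h.retract (M.familyVal j) (M.toFamily j) (M'.familyVal j) (M'.toFamily j) (fun _ => rfl)
    (fun x => M'.familyVal_injective j (by
      rw [g.familyVal_family, M.familyVal_toFamily, M'.familyVal_toFamily, g.proj_apply]))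
    (fun x => M.familyVal_injective j (by
      rw [M.familyVal_toFamily, GrModule.proj_of_mem (M.familyVal_mem j x)]))
    (fun x => M'.familyVal_injective j (by
      rw [M'.familyVal_toFamily, GrModule.proj_of_mem (M'.familyVal_mem j x)]))

variable [NondegForm s] {N : Type u} [AddCommGroup N] [Module R N] [Module (B0 s)ᵐᵒᵖ N]
  [IsScalarTower R (B0 s)ᵐᵒᵖ N] {N' : Type u} [AddCommGroup N'] [Module R N'] [Module (B0 s)ᵐᵒᵖ N']
  [IsScalarTower R (B0 s)ᵐᵒᵖ N']

/-- The composition with a map of `B0`-modules. -/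
def HomFree.postcomp (g : N →ₗ[(B0 s)ᵐᵒᵖ] N') (j : ℕ) :
    HomFree (s := s) N j →ₗ[R] HomFree (s := s) N' j where
  toFun f := g ∘ₗ f
  map_add' _ _ := LinearMap.comp_add _ _ _
  map_smul' r _ := LinearMap.ext fun _ => LinearMap.map_smul_of_tower g r _

lemma HomFree.postcomp_apply (g : N →ₗ[(B0 s)ᵐᵒᵖ] N') (j : ℕ) (f : HomFree (s := s) N j)
    (x : FreeLim s j) : HomFree.postcomp g j f x = g (f x) := rfl

/-- The map of graded modules given by the composition with a map of `B0`-modules. -/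
def homFamilyMap (g : N →ₗ[(B0 s)ᵐᵒᵖ] N') :
    (homFamily N : GrFamily s).Total →ₗ[R] (homFamily N' : GrFamily s).Total :=
  GrFamily.map (X := homFamily N) (homFamily N') (HomFree.postcomp g)

lemma homFamilyMap_incl (g : N →ₗ[(B0 s)ᵐᵒᵖ] N') (j : ℕ) (f : HomFree (s := s) N j) :
    homFamilyMap g (HomFree.incl j f) = HomFree.incl j (HomFree.postcomp g j f) :=
  GrFamily.map_of (X := homFamily N) (Y := homFamily N') _ j f

lemma homFamily_induction {p : (homFamily N : GrFamily s).Total → Prop} (zero : p 0)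
    (add : ∀ x y, p x → p y → p (x + y)) (incl : ∀ j f, p (HomFree.incl j f)) (x) : p x :=
  GrFamily.induction zero add incl x

lemma counit_map (g : N →ₗ[(B0 s)ᵐᵒᵖ] N')
    (γ : GrMap (FormMap.id s) (homFamily N).toGrModule (homFamily N').toGrModule)
    (hγ : ∀ x, γ.toFun x = homFamilyMap g x) (x : DirLim (homFamily N : GrFamily s).toGrModule) :
    counit N' (DirLim.map γ x) = g (counit N x) := by
  obtain ⟨f, rfl⟩ := HomFree.mem_range_toLim x
  refine Eq.trans ?_ (congrArg g (counit_toLim f)).symm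
  refine Eq.trans ?_ (counit_toLim (HomFree.postcomp g 0 f))
  refine congrArg (counit N') ?_
  refine (DirLim.map_mk γ 0 (HomFree.incl 0 f) (HomFree.incl_mem (k := 0) f) 1
    one_mem_tpow).trans ?_
  exact DirLim.mk_congr _ _ _ ((hγ _).trans (homFamilyMap_incl g 0 f)) (map_one _)

lemma FreeLim.res_eq_self {F : FormMap s s} (hφ : ∀ r, F.φ r = r) (hE : ∀ b, HC.map F b = b)
    (hL : ∀ l, F.fL l = l) (j : ℕ) (x : FreeLim s j) : FreeLim.res F j x = x :=
  DirLim.map_eq_self (HC.freeMap F j) hφ hE hL x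

lemma GrModule.toHom_family {M' : GrModule s} (g : GrMap (FormMap.id s) M M') (j : ℕ)
    (x : M.family.obj j) (x' : M'.family.obj j) (e : M'.familyVal j x' = g.toFun (M.familyVal j x))
    (f : DirLim M →ₗ[(B0 s)ᵐᵒᵖ] DirLim M') (hf : ∀ y, f y = DirLim.map g y) :
    M'.toHom j x' = HomFree.postcomp f j (M.toHom j x) := LinearMap.ext fun y => by
  rw [HomFree.postcomp_apply, hf, ← GrModule.toHom_res (FormMap.id s) g j x x' e,
    FreeLim.res_eq_self (fun _ => rfl) HC.map_id_apply (fun _ => rfl)]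

end FamilyRestriction

lemma HC.map_eq_self {R E L : Type u} [CommRing R] [AddCommGroup E] [Module R E] [AddCommGroup L]
    [Module R L] {s : L →ₗ[R] E →ₗ[R] E →ₗ[R] R} {F : FormMap s s} (hφ : ∀ r, F.φ r = r)
    (hE : ∀ v, F.fE v = v) (b : HC s) : HC.map F b = b := by
  induction b using HC.induction with
  | algebraMap r => rw [HC.map_algebraMap, hφ]
  | gen v => rw [HC.map_gen, hE]
  | mul x y hx hy => rw [map_mul, hx, hy]
  | add x y hx hy => rw [map_add, hx, hy]

lemma HC.map_map {R E L R' E' L' R'' E'' L'' : Type u} [CommRing R] [AddCommGroup E] [Module R E]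
    [AddCommGroup L] [Module R L] [CommRing R'] [AddCommGroup E'] [Module R' E']
    [AddCommGroup L'] [Module R' L'] [CommRing R''] [AddCommGroup E''] [Module R'' E'']
    [AddCommGroup L''] [Module R'' L''] {s : L →ₗ[R] E →ₗ[R] E →ₗ[R] R}
    {s' : L' →ₗ[R'] E' →ₗ[R'] E' →ₗ[R'] R'} {s'' : L'' →ₗ[R''] E'' →ₗ[R''] E'' →ₗ[R''] R''}
    {F : FormMap s s'} {F' : FormMap s' s''} {F'' : FormMap s s''}
    (hφ : ∀ r, F'.φ (F.φ r) = F''.φ r) (hE : ∀ v, F'.fE (F.fE v) = F''.fE v) (b : HC s) :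
    HC.map F' (HC.map F b) = HC.map F'' b := by
  induction b using HC.induction with
  | algebraMap r => rw [HC.map_algebraMap, HC.map_algebraMap, HC.map_algebraMap, hφ]
  | gen v => rw [HC.map_gen, HC.map_gen, HC.map_gen, hE]
  | mul x y hx hy => rw [map_mul, map_mul, hx, hy, map_mul]
  | add x y hx hy => rw [map_add, map_add, hx, hy, map_add]

/-! ### The quasi-inverse functor -/

section Schemes

variable {S : Scheme.{u}}

variable (S) in
/-- The sections over the affine open subsets of `S` are noetherian rings in which `2` is a unit. -/
class IsNoetherianTwo : Prop where
  noetherian : ∀ U : S.affineOpens, IsNoetherianRing Γ(S, U)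
  two : ∀ U : S.affineOpens, IsUnit (2 : Γ(S, U))

instance [IsNoetherianTwo S] (U : S.affineOpens) : IsNoetherianRing Γ(S, U) :=
  IsNoetherianTwo.noetherian U

lemma resO_flat {U V : S.affineOpens} (h : V ≤ U) : (resO h).Flat := by
  have := (𝟙 S : S ⟶ S).flat_appLE U.2 V.2 h
  have e : ((𝟙 S : S ⟶ S).appLE U V h).hom = resO h := by
    exact RingHom.ext fun _ => rfl
  rwa [e] at this

variable {n : ℕ} {D : QuadricData S n} {W : S.Opens}

instance [IsNoetherianTwo S] (U : S.affineOpens) : NondegForm (D.form U) where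
  two := IsNoetherianTwo.two U
  symm := D.form_symm U
  span := D.nowhere_zero U
  invertible := D.isLineBundle.invertible U
  finite := D.isVectorBundle.finite U

instance (M : GrMod D W) (U : AffIn W) : Module.Finite (HC (D.form U.1))ᵐᵒᵖ (M.obj U) := M.finite U

/-- The sheaf of graded modules with given components, in nonnegative degrees. -/
def GrMod.ofFamilies (X : ∀ U : AffIn W, GrFamily (D.form U.1))
    (α : ∀ {U V : AffIn W} (h : V ≤ U) (j : ℕ), (X U).obj j →ₛₗ[(D.formMap h).φ] (X V).obj j)
    (act : ∀ {U V : AffIn W} (h : V ≤ U) (j : ℕ) v x,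
      α h (j + 1) ((X U).act j v x) = (X V).act j ((D.formMap h).fE v) (α h j x))
    (id : ∀ (U : AffIn W) (j : ℕ) x, α (le_refl U) j x = x)
    (comp : ∀ {U V T : AffIn W} (h : V ≤ U) (h' : T ≤ V) (j : ℕ) x,
      α h' j (α h j x) = α (h'.trans h) j x)
    (qcoh : ∀ {U V : AffIn W} (h : V ≤ U) (j : ℕ), IsExtensionOfScalars (D.formMap h).φ (α h j))
    (finite : ∀ U : AffIn W, Module.Finite (HC (D.form U.1))ᵐᵒᵖ (X U).toGrModule) : GrMod D W where
  obj U := (X U).toGrModule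
  res h := GrFamily.mapRes (D.formMap h) (α h) (act h)
  res_id U x := by
    refine GrFamily.induction (X := X U)
      (p := fun x => GrFamily.semilinearMap (X' := X U) (α (le_refl U)) x = x) ?_ ?_ ?_ x
    · exact map_zero _
    · intro x y hx hy
      rw [map_add, hx, hy]
    · intro j x
      rw [GrFamily.semilinearMap_of, id]
  res_comp {U V T} h h' x := by
    refine GrFamily.induction (X := X U)
      (p := fun x => GrFamily.semilinearMap (X' := X T) (α h')
        (GrFamily.semilinearMap (X' := X V) (α h) x) =
          GrFamily.semilinearMap (X' := X T) (α (h'.trans h)) x) ?_ ?_ ?_ x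
    · simp only [map_zero]
    · intro x y hx hy
      simp only [map_add, hx, hy]
    · intro j x
      rw [GrFamily.semilinearMap_of, GrFamily.semilinearMap_of, GrFamily.semilinearMap_of, comp]
  isQCoh h := GrFamily.mapRes_isExtensionOfScalars (D.formMap h) (α h) (act h) (qcoh h)
  finite := finite

variable (D W) in
/-- The truncation of a sheaf of graded modules to the nonnegative degrees. -/
def truncObj [IsNoetherianTwo S] (M : GrMod D W) : GrMod D W :=
  GrMod.ofFamilies (fun U => (M.obj U).family) (fun h => (M.res h).family)
    (fun h => (M.res h).family_act)
    (fun U j _ => (M.obj U).familyVal_injective j (M.res_id U _))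
    (fun {_ _ T} h h' j _ => (M.obj T).familyVal_injective j (M.res_comp h h' _))
    (fun h => (M.res h).family_isExtensionOfScalars (M.isQCoh h))
    (fun U => (M.obj U).family_finite)

/-- The map of the components of nonnegative degree induced by a morphism. -/
def GrMod.Hom.family {M N : GrMod D W} (f : GrMod.Hom M N) (U : AffIn W) (j : ℕ) :
    (M.obj U).family.obj j →ₗ[Γ(S, U.1)] (N.obj U).family.obj j := (f.grMap U).family j

variable (D W) in
/-- The truncation functor. -/
def trunc [IsNoetherianTwo S] : GrMod D W ⥤ GrMod D W where
  obj M := truncObj D W M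
  map {M N} f :=
    { app U := GrFamily.map (X := (M.obj U).family) (N.obj U).family (f.family U)
      map_act U := GrFamily.map_op_smul _ (f.grMap U).family_act
      map_grade U _ _ h := GrFamily.map_mem_grade _ h
      naturality {U V} h m := by
        refine GrFamily.induction (X := (M.obj U).family)
          (p := fun m => GrFamily.map (N.obj V).family (f.family V)
            (GrFamily.semilinearMap (M.res h).family m) =
            GrFamily.semilinearMap (N.res h).family
              (GrFamily.map (N.obj U).family (f.family U) m)) ?_ ?_ ?_ m
        · simp only [map_zero]
        · intro x y hx hy
          simp only [map_add, hx, hy]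
        · intro j x
          rw [GrFamily.semilinearMap_of, GrFamily.map_of, GrFamily.map_of, GrFamily.semilinearMap_of]
          exact congrArg _ ((N.obj V).familyVal_injective j (f.naturality h _)) }
  map_id M := GrMod.hom_ext fun U m => by
    refine GrFamily.induction (X := (M.obj U).family)
      (p := fun m => GrFamily.map (M.obj U).family (GrMod.Hom.family (𝟙 M) U) m = m) ?_ ?_ ?_ m
    · exact map_zero _
    · intro x y hx hy
      rw [map_add, hx, hy]
    · intro j x
      exact GrFamily.map_of _ _ _
  map_comp {M N P} f g := GrMod.hom_ext fun U m => by
    refine GrFamily.induction (X := (M.obj U).family)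
      (p := fun m => GrFamily.map (P.obj U).family (GrMod.Hom.family (f ≫ g) U) m =
        GrFamily.map (P.obj U).family (g.family U)
          (GrFamily.map (N.obj U).family (f.family U) m)) ?_ ?_ ?_ m
    · simp only [map_zero]
    · intro x y hx hy
      simp only [map_add, hx, hy]
    · intro j x
      rw [GrFamily.map_of, GrFamily.map_of, GrFamily.map_of]
      rfl

variable (D W) in
/-- The inclusion of the truncation. -/
def truncInclusion [IsNoetherianTwo S] : trunc D W ⟶ 𝟭 (GrMod D W) where
  app M :=
    { app U := (M.obj U).ofFamily
      map_act U := (M.obj U).ofFamily_op_smul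
      map_grade U _ _ h := (M.obj U).ofFamily_mem_grade h
      naturality {U V} h m := by
        refine GrFamily.induction (X := (M.obj U).family)
          (p := fun m => (M.obj V).ofFamily (GrFamily.semilinearMap (M.res h).family m) =
            (M.res h).toFun ((M.obj U).ofFamily m)) ?_ ?_ ?_ m
        · simp only [map_zero]
        · intro x y hx hy
          simp only [map_add, hx, hy]
        · intro j x
          rw [GrFamily.semilinearMap_of, GrModule.ofFamily_of, GrModule.ofFamily_of]
          rfl }
  naturality M N f := GrMod.hom_ext fun U m => by
    refine GrFamily.induction (X := (M.obj U).family)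
      (p := fun m => (N.obj U).ofFamily (GrFamily.map (N.obj U).family (f.family U) m) =
            f.app U ((M.obj U).ofFamily m)) ?_ ?_ ?_ m
    · simp only [map_zero]
    · intro x y hx hy
      simp only [map_add, hx, hy]
    · intro j x
      rw [GrFamily.map_of, GrModule.ofFamily_of, GrModule.ofFamily_of]
      rfl

lemma torsionIso_truncInclusion [IsNoetherianTwo S] (M : GrMod D W) :
    torsionIso D W ((truncInclusion D W).app M) := fun U => by
  have h : Module.Finite Γ(S, U.1) (LinearMap.ker (M.obj U).ofFamily) := by
    rw [LinearMap.ker_eq_bot.2 (M.obj U).ofFamily_injective]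
    infer_instance
  exact ⟨h, (M.obj U).ofFamily_finite_coker⟩

section

variable [IsNoetherianTwo S]

lemma isCoherent_dirLim (M : GrMod D W) : isCoherent D W ((dirLim D W).obj M) :=
  ⟨fun h => DirLim.map_isExtensionOfScalars (M.res h) (M.isQCoh h),
    fun U => DirLim.finite (M := M.obj U)⟩


omit [IsNoetherianTwo S] in
/-- A morphism of presheaves of modules which is bijective on sections is an isomorphism. -/
lemma PMod.isIso_of_bijective {M N : PMod D W} (f : M ⟶ N)
    (hf : ∀ U, Function.Bijective (f.app U)) : IsIso f := by
  let e (U : AffIn W) := LinearEquiv.ofBijective (f.app U) (hf U)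
  have he (U : AffIn W) (x : M.obj U) : e U x = f.app U x := rfl
  refine ⟨{ app U := (e U).symm, naturality {U V} h m := ?_ }, ?_, ?_⟩
  · refine (e V).injective (((e V).apply_symm_apply _).trans ?_)
    refine Eq.trans ?_ (f.naturality h ((e U).symm m)).symm
    exact congrArg _ ((e U).apply_symm_apply m).symm
  · exact PMod.hom_ext fun U x => (e U).symm_apply_apply x
  · exact PMod.hom_ext fun U x => (e U).apply_symm_apply x

variable (D W) in
/-- The functor `M ↦ lim M_{2k} ⊗ L^k` factors through the quotient category. -/
lemma dirLim_inverts : (torsionIso D W).IsInvertedBy (dirLim D W) := fun _ _ f hf =>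
  PMod.isIso_of_bijective _ fun U =>
    DirLim.map_bijective (f.grMap U) (f.app U) (fun _ => rfl) (hf U).1 (hf U).2

variable (D W) in
/-- The functor `M ↦ lim M_{2k} ⊗ L^k` to coherent sheaves. -/
def cohLim : GrMod D W ⥤ CohB0 D W := (isCoherent D W).lift (dirLim D W) isCoherent_dirLim

lemma FreeLim.res_id (U : S.affineOpens) (j : ℕ) (x : FreeLim (D.form U) j) :
    FreeLim.res (D.formMap (le_refl U)) j x = x :=
  FreeLim.res_eq_self (resO_id U) (HC.map_eq_self (resO_id U) (D.E.res_id U)) (D.L.res_id U) j x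

lemma FreeLim.res_res {U V T : S.affineOpens} (h : V ≤ U) (h' : T ≤ V) (j : ℕ)
    (x : FreeLim (D.form U) j) : FreeLim.res (D.formMap h') j (FreeLim.res (D.formMap h) j x) =
      FreeLim.res (D.formMap (h'.trans h)) j x :=
  DirLim.map_map (HC.freeMap (D.formMap h) j) (HC.freeMap (D.formMap h') j)
    (HC.freeMap (D.formMap (h'.trans h)) j) (resO_comp h h')
    (HC.map_map (resO_comp h h') (D.E.res_comp h h')) (D.L.res_comp h h') x

/-- The restriction of maps from the free modules. -/
def PMod.resHom (N : PMod D W) {U V : AffIn W} (h : V ≤ U) (j : ℕ) :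
    HomFree (s := D.form U.1) (N.obj U) j →ₛₗ[(D.formMap h).φ] HomFree (s := D.form V.1) (N.obj V) j :=
  HomFree.res (D.formMap h) (N.res h) (N.res_act h) j

lemma PMod.resHom_apply_res (N : PMod D W) {U V : AffIn W} (h : V ≤ U) (j : ℕ)
    (f : HomFree (s := D.form U.1) (N.obj U) j) (x : FreeLim (D.form U.1) j) :
    N.resHom h j f (FreeLim.res (D.formMap h) j x) = N.res h (f x) :=
  HomFree.res_apply_res (ρ := N.res h) (hρ := N.res_act h) (D.formMap h) f x

lemma PMod.eq_resHom (N : PMod D W) {U V : AffIn W} (h : V ≤ U) {j : ℕ}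
    {f : HomFree (s := D.form U.1) (N.obj U) j} {f' : HomFree (s := D.form V.1) (N.obj V) j}
    (e : ∀ x, f' (FreeLim.res (D.formMap h) j x) = N.res h (f x)) : N.resHom h j f = f' :=
  HomFree.eq_res (ρ := N.res h) (hρ := N.res_act h) (D.formMap h) e

lemma PMod.resHom_id (N : PMod D W) (U : AffIn W) (j : ℕ)
    (f : HomFree (s := D.form U.1) (N.obj U) j) : N.resHom (le_refl U) j f = f :=
  N.eq_resHom _ fun x => by rw [FreeLim.res_id, N.res_id]

lemma PMod.resHom_resHom (N : PMod D W) {U V T : AffIn W} (h : V ≤ U) (h' : T ≤ V) (j : ℕ)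
    (f : HomFree (s := D.form U.1) (N.obj U) j) :
    N.resHom h' j (N.resHom h j f) = N.resHom (h'.trans h) j f :=
  (N.eq_resHom _ fun x => by
    have e := FreeLim.res_res (D := D) h h' j x
    rw [← e, N.resHom_apply_res, N.resHom_apply_res, N.res_comp]).symm

/-- The restriction of the graded modules of maps from the free modules. -/
def PMod.familyRes (N : PMod D W) {U V : AffIn W} (h : V ≤ U) :
    (homFamily (N.obj U) : GrFamily (D.form U.1)).Total →ₛₗ[(D.formMap h).φ]
      (homFamily (N.obj V) : GrFamily (D.form V.1)).Total :=
  GrFamily.semilinearMap (X := homFamily (N.obj U)) (X' := homFamily (N.obj V)) (N.resHom h)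

lemma PMod.familyRes_incl (N : PMod D W) {U V : AffIn W} (h : V ≤ U) (j : ℕ)
    (f : HomFree (s := D.form U.1) (N.obj U) j) :
    N.familyRes h (HomFree.incl j f) = HomFree.incl j (N.resHom h j f) :=
  GrFamily.semilinearMap_of (X := homFamily (N.obj U)) (X' := homFamily (N.obj V)) (N.resHom h) j f

/-- The sheaf of graded modules `⨁ Hom(HC⟨-j⟩, N)`. -/
def gradedHomObj (N : CohB0 D W) : GrMod D W :=
  GrMod.ofFamilies (fun U => homFamily (N.obj.obj U)) (fun h => N.obj.resHom h)
    (fun h => HomFree.res_act (ρ := N.obj.res h) (hρ := N.obj.res_act h) (D.formMap h))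
    N.obj.resHom_id N.obj.resHom_resHom
    (fun h => HomFree.res_isExtensionOfScalars (ρ := N.obj.res h) (hρ := N.obj.res_act h)
      (D.formMap h) (N.property.1 h))
    (fun U => by
      have := N.property.2 U
      exact homFamily_finite)

variable (D W) in
/-- The functor `N ↦ ⨁ Hom(HC⟨-j⟩, N)`. -/
def gradedHom : CohB0 D W ⥤ GrMod D W where
  obj N := gradedHomObj N
  map {N N'} g :=
    { app U := homFamilyMap (g.hom.app U)
      map_act U := GrFamily.map_op_smul (X := homFamily (N.obj.obj U)) (Y := homFamily (N'.obj.obj U))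
        (HomFree.postcomp (g.hom.app U)) fun _ _ _ => rfl
      map_grade U _ _ h := GrFamily.map_mem_grade (X := homFamily (N.obj.obj U))
        (Y := homFamily (N'.obj.obj U)) (HomFree.postcomp (g.hom.app U)) h
      naturality {U V} h m := by
        refine homFamily_induction (p := fun m => homFamilyMap (g.hom.app V) (N.obj.familyRes h m) =
            N'.obj.familyRes h (homFamilyMap (g.hom.app U) m)) ?_ ?_ ?_ m
        · simp only [map_zero]
        · intro x y hx hy
          simp only [map_add, hx, hy]
        · intro j f
          rw [PMod.familyRes_incl, homFamilyMap_incl, homFamilyMap_incl, PMod.familyRes_incl]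
          refine congrArg _ (PMod.eq_resHom _ _ fun x => ?_).symm
          rw [HomFree.postcomp_apply, HomFree.postcomp_apply, PMod.resHom_apply_res,
            g.hom.naturality] }
  map_id N := GrMod.hom_ext fun U m => by
    refine homFamily_induction (p := fun m => homFamilyMap (PMod.Hom.app (𝟙 N.obj) U) m = m) ?_ ?_ ?_ m
    · exact map_zero _
    · intro x y hx hy
      rw [map_add, hx, hy]
    · intro j f
      exact homFamilyMap_incl _ _ _
  map_comp {N N' N''} f g := GrMod.hom_ext fun U m => by
    refine homFamily_induction (p := fun m => homFamilyMap (PMod.Hom.app (f.hom ≫ g.hom) U) m =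
      homFamilyMap (g.hom.app U) (homFamilyMap (f.hom.app U) m)) ?_ ?_ ?_ m
    · simp only [map_zero]
    · intro x y hx hy
      simp only [map_add, hx, hy]
    · intro j f
      rw [homFamilyMap_incl, homFamilyMap_incl, homFamilyMap_incl]
      rfl

end

end Schemes


/-! ### The equivalence of categories -/

section Equivalence

variable {S : Scheme.{u}} [IsNoetherianTwo S] {n : ℕ} {D : QuadricData S n} {W : S.Opens}

/-- The restriction of the graded modules of maps from the free modules to the direct limits. -/
def GrMod.limFamilyRes (M : GrMod D W) {U V : AffIn W} (h : V ≤ U) :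
    (homFamily (DirLim (M.obj U)) : GrFamily (D.form U.1)).Total →ₛₗ[(D.formMap h).φ]
      (homFamily (DirLim (M.obj V)) : GrFamily (D.form V.1)).Total :=
  (dirLimObj M).familyRes h

lemma GrMod.limFamilyRes_incl (M : GrMod D W) {U V : AffIn W} (h : V ≤ U) {j : ℕ}
    {f : HomFree (s := D.form U.1) (DirLim (M.obj U)) j}
    {f' : HomFree (s := D.form V.1) (DirLim (M.obj V)) j}
    (e : ∀ x, f' (FreeLim.res (D.formMap h) j x) = DirLim.map (M.res h) (f x)) :
    M.limFamilyRes h (HomFree.incl j f) = HomFree.incl j f' :=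
  ((dirLimObj M).familyRes_incl h j f).trans (congrArg _ ((dirLimObj M).eq_resHom h e))

/-- The map of direct limits induced by a morphism. -/
def GrMod.Hom.limMap {M N : GrMod D W} (f : GrMod.Hom M N) (U : AffIn W) :
    DirLim (M.obj U) →ₗ[(B0 (D.form U.1))ᵐᵒᵖ] DirLim (N.obj U) := ((dirLim D W).map f).app U

variable (D W) in
/-- The natural transformation given by the action on graded modules of the free modules. -/
def unitHom : trunc D W ⟶ cohLim D W ⋙ gradedHom D W where
  app M :=
    { app U := (M.obj U).unit
      map_act U := (M.obj U).unit_op_smul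
      map_grade U _ _ h := (M.obj U).unit_mem_grade h
      naturality {U V} h m := by
        refine GrFamily.induction (X := (M.obj U).family)
          (p := fun m => (M.obj V).unit (GrFamily.semilinearMap (M.res h).family m) =
            M.limFamilyRes h ((M.obj U).unit m)) ?_ ?_ ?_ m
        · simp only [map_zero]
        · intro x y hx hy
          simp only [map_add, hx, hy]
        · intro j x
          rw [GrFamily.semilinearMap_of, GrModule.unit_of, GrModule.unit_of]
          exact (M.limFamilyRes_incl h fun y =>
            GrModule.toHom_res (D.formMap h) (M.res h) j x _ rfl y).symm }
  naturality M N f := GrMod.hom_ext fun U m => by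
    refine GrFamily.induction (X := (M.obj U).family)
      (p := fun m => (N.obj U).unit (GrFamily.map (N.obj U).family (f.family U) m) =
        homFamilyMap (GrMod.Hom.limMap f U) ((M.obj U).unit m)) ?_ ?_ ?_ m
    · simp only [map_zero]
    · intro x y hx hy
      simp only [map_add, hx, hy]
    · intro j x
      rw [GrFamily.map_of, GrModule.unit_of, GrModule.unit_of]
      refine Eq.trans ?_ (homFamilyMap_incl _ j _).symm
      exact congrArg _ (GrModule.toHom_family (f.grMap U) j x _ rfl _ fun _ => rfl)

lemma torsionIso_unitHom (M : GrMod D W) : torsionIso D W ((unitHom D W).app M) := fun U =>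
  (M.obj U).unit_finite_ker_coker

/-- The morphism from the direct limit of the graded module of maps from the free modules to `N`. -/
def counitApp (N : CohB0 D W) : (dirLim D W).obj ((gradedHom D W).obj N) ⟶ N.obj where
  app U := counit (N.obj.obj U)
  naturality h x := counit_res (D.formMap h) (N.obj.res h) (N.obj.res_act h) x

instance isIso_counitApp (N : CohB0 D W) : IsIso (counitApp N) :=
  PMod.isIso_of_bijective _ fun _ => counit_bijective

/-- `counitApp` as an isomorphism. -/
def counitAppIso (N : CohB0 D W) : ((gradedHom D W ⋙ cohLim D W).obj N).obj ≅ N.obj :=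
  @asIso _ _ _ _ (counitApp N) (isIso_counitApp N)

variable (D W) in
/-- The counit isomorphism. -/
def counitIso : gradedHom D W ⋙ cohLim D W ≅ 𝟭 (CohB0 D W) :=
  NatIso.ofComponents (fun N => (isCoherent D W).isoMk (counitAppIso N)) fun {N N'} g => by
    refine ObjectProperty.hom_ext _ (PMod.hom_ext fun U x => ?_)
    exact counit_map (g.hom.app U) (GrMod.Hom.grMap ((gradedHom D W).map g) U) (fun _ => rfl) x

variable (D W) in
/-- The unit isomorphism, in the quotient category. -/
def unitIso : toQgr D W ≅ cohLim D W ⋙ gradedHom D W ⋙ toQgr D W :=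
  have h₁ (M : GrMod D W) := (torsionIso D W).Q_inverts _ (torsionIso_truncInclusion M)
  have h₂ (M : GrMod D W) := (torsionIso D W).Q_inverts _ (torsionIso_unitHom M)
  have : IsIso (Functor.whiskerRight (truncInclusion D W) (toQgr D W)) :=
    (NatTrans.isIso_iff_isIso_app _).2 h₁
  have : IsIso (Functor.whiskerRight (unitHom D W) (toQgr D W)) :=
    (NatTrans.isIso_iff_isIso_app _).2 h₂
  (asIso (Functor.whiskerRight (truncInclusion D W) (toQgr D W))).symm ≪≫
    asIso (Functor.whiskerRight (unitHom D W) (toQgr D W))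

section

omit [IsNoetherianTwo S]

lemma toQgr_pushforward (hinv : (torsionIso D W).IsInvertedBy (dirLim D W)) :
    toQgr D W ⋙ pushforward D W hinv = dirLim D W := Localization.Construction.fac _ _

lemma pushforward_map (hinv : (torsionIso D W).IsInvertedBy (dirLim D W)) {M N : GrMod D W}
    (f : M ⟶ N) : (pushforward D W hinv).map ((toQgr D W).map f) = (dirLim D W).map f := by
  exact (CategoryTheory.Functor.congr_hom (toQgr_pushforward hinv) f).trans
    ((Category.id_comp _).trans (Category.comp_id _))

lemma exists_toQgr_obj (X : Qgr D W) : ∃ M, (toQgr D W).obj M = X :=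
  ⟨_, (Localization.Construction.objEquiv (torsionIso D W)).apply_symm_apply X⟩

end

variable (D W) in
lemma isCoherent_pushforward (hinv : (torsionIso D W).IsInvertedBy (dirLim D W)) (X : Qgr D W) :
    isCoherent D W ((pushforward D W hinv).obj X) := by
  obtain ⟨M, rfl⟩ := exists_toQgr_obj X
  exact isCoherent_dirLim M

variable (hinv : (torsionIso D W).IsInvertedBy (dirLim D W))
  (hcoh : ∀ X : Qgr D W, isCoherent D W ((pushforward D W hinv).obj X))

lemma toQgr_lift_pushforward :
    toQgr D W ⋙ (isCoherent D W).lift (pushforward D W hinv) hcoh = cohLim D W := by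
  refine CategoryTheory.Functor.ext (fun M => rfl) fun M N f => ?_
  refine Eq.trans ?_ ((Category.id_comp _).trans (Category.comp_id _)).symm
  exact ObjectProperty.hom_ext _ (pushforward_map hinv f)

/-- The functor `q_*` is an equivalence: `⨁ Hom(HC⟨-j⟩, N)` defines a quasi-inverse. -/
def pushforwardEquivalence : Qgr D W ≌ CohB0 D W :=
  CategoryTheory.Equivalence.mk ((isCoherent D W).lift (pushforward D W hinv) hcoh)
    (gradedHom D W ⋙ toQgr D W)
    (Localization.liftNatIso (toQgr D W) (torsionIso D W) (toQgr D W)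
      (toQgr D W ⋙ (isCoherent D W).lift (pushforward D W hinv) hcoh ⋙ gradedHom D W ⋙ toQgr D W)
      _ _ (unitIso D W ≪≫ Functor.isoWhiskerRight (eqToIso (toQgr_lift_pushforward hinv hcoh).symm)
        (gradedHom D W ⋙ toQgr D W)))
    (Functor.isoWhiskerLeft (gradedHom D W) (eqToIso (toQgr_lift_pushforward hinv hcoh)) ≪≫
      counitIso D W)

lemma lift_pushforward_isEquivalence :
    ((isCoherent D W).lift (pushforward D W hinv) hcoh).IsEquivalence :=
  (pushforwardEquivalence hinv hcoh).isEquivalence_functor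

end Equivalence


/-! ### The abelian category of coherent sheaves of modules -/

section Extension

variable {R R' : Type u} [CommRing R] [CommRing R'] {φ : R →+* R'}
variable {A B A' B' : Type u} [AddCommGroup A] [Module R A] [AddCommGroup B] [Module R B]
  [AddCommGroup A'] [Module R' A'] [AddCommGroup B'] [Module R' B']

/-- The product of two semilinear maps. -/
def semilinearProd (α : A →ₛₗ[φ] A') (β : B →ₛₗ[φ] B') : A × B →ₛₗ[φ] A' × B' where
  toFun x := (α x.1, β x.2)
  map_add' x y := by simp
  map_smul' r x := by simp

lemma IsExtensionOfScalars.prod {α : A →ₛₗ[φ] A'} {β : B →ₛₗ[φ] B'}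
    (hα : IsExtensionOfScalars φ α) (hβ : IsExtensionOfScalars φ β) :
    IsExtensionOfScalars φ (semilinearProd α β) := by
  let : Algebra R R' := φ.toAlgebra
  let : Module R A' := Module.compHom A' φ
  let : Module R B' := Module.compHom B' φ
  have : IsScalarTower R R' A' := ⟨fun r x m => mul_smul (φ r) x m⟩
  have : IsScalarTower R R' B' := ⟨fun r x m => mul_smul (φ r) x m⟩
  exact IsBaseChange.prodMap
    ({ toFun := α, map_add' := α.map_add, map_smul' := α.map_smulₛₗ } : A →ₗ[R] A')
    ({ toFun := β, map_add' := β.map_add, map_smul' := β.map_smulₛₗ } : B →ₗ[R] B') hα hβ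

lemma IsExtensionOfScalars.of_subsingleton [Subsingleton A] [Subsingleton A'] (α : A →ₛₗ[φ] A') :
    IsExtensionOfScalars φ α := by
  let : Algebra R R' := φ.toAlgebra
  let : Module R A' := Module.compHom A' φ
  have : IsScalarTower R R' A' := ⟨fun r x m => mul_smul (φ r) x m⟩
  exact IsBaseChange.of_equiv (LinearEquiv.ofSubsingleton _ _) fun _ => Subsingleton.elim _ _

end Extension

section Abelian

variable {S : Scheme.{u}} {n : ℕ} {D : QuadricData S n} {W : S.Opens}

/-- The restriction maps of a presheaf of modules, as semilinear maps of modules over the even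
parts of Clifford algebras. -/
def PMod.resB (N : PMod D W) {U V : AffIn W} (h : V ≤ U) :
    N.obj U →ₛₗ[(D.resB0 h).op] N.obj V where
  toFun := N.res h
  map_add' := map_add _
  map_smul' b x := N.res_act h b.unop x

/-- The presheaf of kernels. -/
def PMod.ker {M N : PMod D W} (f : PMod.Hom M N) : PMod D W where
  obj U := LinearMap.ker (f.app U)
  res {U V} h :=
    { toFun x := ⟨M.res h x, by
        rw [LinearMap.mem_ker, f.naturality, LinearMap.mem_ker.1 x.2, map_zero]⟩
      map_add' x y := Subtype.ext (map_add (M.res h) _ _)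
      map_smul' r x := Subtype.ext ((M.res h).map_smulₛₗ r x) }
  res_act h b x := Subtype.ext (M.res_act h b x)
  res_id U x := Subtype.ext (M.res_id U x)
  res_comp h h' x := Subtype.ext (M.res_comp h h' x)

/-- The presheaf of cokernels. -/
def PMod.coker {M N : PMod D W} (f : PMod.Hom M N) : PMod D W where
  obj U := N.obj U ⧸ LinearMap.range (f.app U)
  res {U V} h :=
    { toFun := Submodule.mapQ _ _ (N.resB h) (by
        rintro _ ⟨x, rfl⟩
        exact ⟨M.res h x, f.naturality h x⟩)
      map_add' := map_add _
      map_smul' r x := by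
        obtain ⟨x, rfl⟩ := Submodule.mkQ_surjective _ x
        exact congrArg Submodule.Quotient.mk ((N.res h).map_smulₛₗ r x) }
  res_act h b x := by
    obtain ⟨x, rfl⟩ := Submodule.mkQ_surjective _ x
    exact congrArg Submodule.Quotient.mk (N.res_act h b x)
  res_id U x := by
    obtain ⟨x, rfl⟩ := Submodule.mkQ_surjective _ x
    exact congrArg Submodule.Quotient.mk (N.res_id U x)
  res_comp h h' x := by
    obtain ⟨x, rfl⟩ := Submodule.mkQ_surjective _ x
    exact congrArg Submodule.Quotient.mk (N.res_comp h h' x)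

/-- The projection to the presheaf of cokernels. -/
def PMod.cokerπ {M N : PMod D W} (f : PMod.Hom M N) : PMod.Hom N (PMod.coker f) where
  app U := (LinearMap.range (f.app U)).mkQ
  naturality _ _ := rfl

lemma PMod.cokerπ_exact {M N : PMod D W} (f : PMod.Hom M N) (U : AffIn W) :
    Function.Exact (f.app U) ((cokerπ f).app U) := fun _ => Submodule.Quotient.mk_eq_zero _

lemma PMod.cokerπ_surjective {M N : PMod D W} (f : PMod.Hom M N) (U : AffIn W) :
    Function.Surjective ((cokerπ f).app U) := Submodule.mkQ_surjective _

/-- The presheaf of products. -/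
def PMod.prod (M N : PMod D W) : PMod D W where
  obj U := M.obj U × N.obj U
  res h := semilinearProd (M.res h) (N.res h)
  res_act h b x := Prod.ext (M.res_act h b x.1) (N.res_act h b x.2)
  res_id U x := Prod.ext (M.res_id U x.1) (N.res_id U x.2)
  res_comp h h' x := Prod.ext (M.res_comp h h' x.1) (N.res_comp h h' x.2)

variable (D W) in
/-- The zero presheaf. -/
def PMod.zero : PMod D W where
  obj _ := PUnit.{u + 1}
  res _ := 0
  res_act _ _ _ := rfl
  res_id _ _ := rfl
  res_comp _ _ _ := rfl

lemma isCoherent_coker {M N : PMod D W} (f : PMod.Hom M N) (hM : isCoherent D W M)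
    (hN : isCoherent D W N) : isCoherent D W (PMod.coker f) := by
  refine ⟨fun {U V} h => ?_, fun U => ?_⟩
  · exact (hM.1 h).of_right_exact (γ := (PMod.coker f).res h)
      (f := (f.app U).restrictScalars Γ(S, U.1))
      (g := ((PMod.cokerπ f).app U).restrictScalars Γ(S, U.1))
      (f' := (f.app V).restrictScalars Γ(S, V.1))
      (g' := ((PMod.cokerπ f).app V).restrictScalars Γ(S, V.1))
      (hN.1 h) (fun x => (f.naturality h x).symm) (fun _ => rfl)
      (PMod.cokerπ_exact f U) (PMod.cokerπ_surjective f U) (PMod.cokerπ_exact f V)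
      (PMod.cokerπ_surjective f V)
  · have := hN.2 U
    exact Module.Finite.of_surjective
      (((PMod.cokerπ f).app U).restrictScalars Γ(S, U.1)) (PMod.cokerπ_surjective f U)

lemma isCoherent_prod {M N : PMod D W} (hM : isCoherent D W M)
    (hN : isCoherent D W N) : isCoherent D W (PMod.prod M N) :=
  ⟨fun h => (hM.1 h).prod (hN.1 h), fun U => by
    have := hM.2 U
    have := hN.2 U
    exact Module.Finite.prod⟩

variable (D W) in
lemma isCoherent_zero : isCoherent D W (PMod.zero D W) :=
  ⟨fun h => IsExtensionOfScalars.of_subsingleton (A := PUnit) (A' := PUnit) ((PMod.zero D W).res h),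
    fun U => inferInstanceAs (Module.Finite Γ(S, U.1) PUnit.{u + 1})⟩

instance : Limits.HasZeroObject (CohB0 D W) := by
  refine ⟨⟨⟨_, isCoherent_zero D W⟩, (Limits.IsZero.iff_id_eq_zero _).2 ?_⟩⟩
  exact ObjectProperty.hom_ext _ (PMod.hom_ext fun _ _ => rfl)

instance (M N : CohB0 D W) : Limits.HasBinaryBiproduct M N :=
  Limits.hasBinaryBiproduct_of_total
    { pt := ⟨PMod.prod M.obj N.obj, isCoherent_prod M.property N.property⟩
      fst := ⟨{ app _ := LinearMap.fst _ _ _, naturality _ _ := rfl }⟩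
      snd := ⟨{ app _ := LinearMap.snd _ _ _, naturality _ _ := rfl }⟩
      inl := ⟨{ app _ := LinearMap.inl _ _ _
                naturality h _ := Prod.ext rfl (map_zero (N.obj.res h)).symm }⟩
      inr := ⟨{ app _ := LinearMap.inr _ _ _
                naturality h _ := Prod.ext (map_zero (M.obj.res h)).symm rfl }⟩
      inl_fst := rfl
      inl_snd := rfl
      inr_fst := rfl
      inr_snd := rfl }
    (ObjectProperty.hom_ext _ (PMod.hom_ext fun _ x => Prod.ext (add_zero x.1) (zero_add x.2)))

instance : Limits.HasFiniteProducts (CohB0 D W) :=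
  have : Limits.HasBinaryBiproducts (CohB0 D W) := ⟨fun _ _ => inferInstance⟩
  hasFiniteProducts_of_has_binary_and_terminal

lemma CohB0.comp_eq_zero_iff {M N P : CohB0 D W} (f : M ⟶ N) (g : N ⟶ P) :
    f ≫ g = 0 ↔ ∀ U x, g.hom.app U (f.hom.app U x) = 0 :=
  ⟨fun h U x => congr(($h).hom.app U x),
    fun h => ObjectProperty.hom_ext _ (PMod.hom_ext h)⟩

section

variable {M N : CohB0 D W} (f : M ⟶ N)

/-- The cokernel of a morphism of coherent sheaves. -/
def CohB0.coker : CohB0 D W := ⟨PMod.coker f.hom, isCoherent_coker f.hom M.property N.property⟩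

/-- The projection to the cokernel. -/
def CohB0.cokerπ : N ⟶ coker f :=
  ⟨PMod.cokerπ f.hom⟩

lemma CohB0.comp_cokerπ : f ≫ cokerπ f = 0 :=
  (comp_eq_zero_iff _ _).2 fun _ x => (Submodule.Quotient.mk_eq_zero _).2 ⟨x, rfl⟩

/-- A surjection is the cokernel of a morphism `g`, if its kernel is the image of `g`. -/
def CohB0.isColimit {N' : CohB0 D W} (g : N' ⟶ M) (w : g ≫ f = 0)
    (hf : ∀ U, Function.Surjective (f.hom.app U))
    (hg : ∀ U x, f.hom.app U x = 0 → ∃ y, g.hom.app U y = x) :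
    Limits.IsColimit (Limits.CokernelCofork.ofπ f w) := by
  have hd {P : CohB0 D W} (k : M ⟶ P) (hk : g ≫ k = 0) (U : AffIn W) :
      LinearMap.ker (f.hom.app U) ≤ LinearMap.ker (k.hom.app U) := fun x hx => by
    obtain ⟨y, rfl⟩ := hg U x hx
    exact (comp_eq_zero_iff _ _).1 hk U y
  have hfac {P : CohB0 D W} (k : M ⟶ P) (hk : g ≫ k = 0) (U : AffIn W) (x : M.obj.obj U) :
      ((LinearMap.ker (f.hom.app U)).liftQ (k.hom.app U) (hd k hk U) ∘ₗ
        (LinearMap.quotKerEquivOfSurjective _ (hf U)).symm.toLinearMap) (f.hom.app U x) =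
      k.hom.app U x := by
    have : (LinearMap.quotKerEquivOfSurjective _ (hf U)).symm (f.hom.app U x) =
        Submodule.Quotient.mk x := (LinearEquiv.symm_apply_eq _).2 rfl
    exact congrArg ((LinearMap.ker (f.hom.app U)).liftQ (k.hom.app U) (hd k hk U)) this
  refine Limits.CokernelCofork.IsColimit.ofπ _ _ (fun {P} k hk => ⟨
    { app U := (LinearMap.ker (f.hom.app U)).liftQ (k.hom.app U) (hd k hk U) ∘ₗ
        (LinearMap.quotKerEquivOfSurjective _ (hf U)).symm.toLinearMap
      naturality {U V} h x := ?_ }⟩) ?_ ?_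
  · obtain ⟨x, rfl⟩ := hf U x
    have h₁ := hfac k hk V (M.obj.res h x)
    rw [f.hom.naturality, k.hom.naturality] at h₁
    exact h₁.trans (congrArg _ (hfac k hk U x).symm)
  · intro P k hk
    exact ObjectProperty.hom_ext _ (PMod.hom_ext fun U x => hfac k hk U x)
  · intro P k hk m hm
    refine ObjectProperty.hom_ext _ (PMod.hom_ext fun U x => ?_)
    obtain ⟨x, rfl⟩ := hf U x
    exact Eq.trans congr(($hm).hom.app U x) (hfac k hk U x).symm

end

instance : Limits.HasCokernels (CohB0 D W) where
  has_colimit f := Limits.HasColimit.mk ⟨_, CohB0.isColimit (CohB0.cokerπ f) f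
    (CohB0.comp_cokerπ f) (fun _ => Submodule.mkQ_surjective _)
    fun _ _ hx => (Submodule.Quotient.mk_eq_zero _).1 hx⟩

lemma CohB0.surjective_of_epi {M N : CohB0 D W} (f : M ⟶ N) [Epi f] (U : AffIn W) :
    Function.Surjective (f.hom.app U) := by
  have h : cokerπ f = 0 := (cancel_epi f).1 ((comp_cokerπ f).trans Limits.comp_zero.symm)
  intro x
  exact (Submodule.Quotient.mk_eq_zero _).1 congr(($h).hom.app U x)

section Noetherian

variable [IsNoetherianTwo S]

/-- The kernel of a morphism of coherent sheaves is coherent, as the restriction maps of the structure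
sheaf are flat. -/
lemma isCoherent_ker {M N : PMod D W} (f : PMod.Hom M N) (hM : isCoherent D W M)
    (hN : isCoherent D W N) : isCoherent D W (PMod.ker f) := by
  refine ⟨fun {U V} h => ?_, fun U => ?_⟩
  · refine IsExtensionOfScalars.of_left_exact
      (f := (LinearMap.ker (f.app U)).subtype.restrictScalars Γ(S, U.1))
      (g := (f.app U).restrictScalars Γ(S, U.1))
      (f' := (LinearMap.ker (f.app V)).subtype.restrictScalars Γ(S, V.1))
      (g' := (f.app V).restrictScalars Γ(S, V.1))
      (resO_flat h) (hM.1 h) (hN.1 h) (fun _ => rfl) (fun x => (f.naturality h x).symm)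
      ?_ Subtype.val_injective ?_ Subtype.val_injective
    · exact LinearMap.exact_subtype_ker_map (f.app U)
    · exact LinearMap.exact_subtype_ker_map (f.app V)
  · have := hM.2 U
    exact Module.Finite.of_injective
      ((LinearMap.ker (f.app U)).subtype.restrictScalars Γ(S, U.1)) Subtype.val_injective

section

variable {M N : CohB0 D W} (f : M ⟶ N)

/-- The kernel of a morphism of coherent sheaves. -/
def CohB0.ker : CohB0 D W := ⟨PMod.ker f.hom, isCoherent_ker f.hom M.property N.property⟩

/-- The inclusion of the kernel. -/
def CohB0.kerι : ker f ⟶ M :=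
  ⟨{ app U := (LinearMap.ker (f.hom.app U)).subtype, naturality _ _ := rfl }⟩

lemma CohB0.kerι_comp : kerι f ≫ f = 0 :=
  (comp_eq_zero_iff _ _).2 fun _ x => x.2

omit [IsNoetherianTwo S] in
/-- An injection is the kernel of a morphism `g`, if its image is the kernel of `g`. -/
def CohB0.isLimit {P : CohB0 D W} (g : N ⟶ P) (w : f ≫ g = 0)
    (hf : ∀ U, Function.Injective (f.hom.app U))
    (hg : ∀ U x, g.hom.app U x = 0 → ∃ y, f.hom.app U y = x) :
    Limits.IsLimit (Limits.KernelFork.ofι f w) := by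
  have hd {P : CohB0 D W} (k : P ⟶ N) (hk : k ≫ g = 0) (U : AffIn W) (x : P.obj.obj U) :
      k.hom.app U x ∈ LinearMap.range (f.hom.app U) := hg U _ ((comp_eq_zero_iff _ _).1 hk U x)
  have hfac {P : CohB0 D W} (k : P ⟶ N) (hk : k ≫ g = 0) (U : AffIn W) (x : P.obj.obj U) :
      f.hom.app U ((LinearEquiv.ofInjective (f.hom.app U) (hf U)).symm
        ⟨k.hom.app U x, hd k hk U x⟩) = k.hom.app U x :=
    congrArg Subtype.val ((LinearEquiv.ofInjective (f.hom.app U) (hf U)).apply_symm_apply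
      ⟨k.hom.app U x, hd k hk U x⟩)
  refine Limits.KernelFork.IsLimit.ofι _ _ (fun {P} k hk => ⟨
    { app U := (LinearEquiv.ofInjective (f.hom.app U) (hf U)).symm.toLinearMap ∘ₗ
        (k.hom.app U).codRestrict _ (hd k hk U)
      naturality {U V} h x := hf V ?_ }⟩) ?_ ?_
  · refine (hfac k hk V (P.obj.res h x)).trans ?_
    rw [k.hom.naturality]
    exact (congrArg _ (hfac k hk U x).symm).trans (f.hom.naturality h _).symm
  · intro P k hk
    exact ObjectProperty.hom_ext _ (PMod.hom_ext fun U x => hfac k hk U x)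
  · intro P k hk m hm
    refine ObjectProperty.hom_ext _ (PMod.hom_ext fun U x => hf U ?_)
    exact Eq.trans congr(($hm).hom.app U x) (hfac k hk U x).symm

end

instance : Limits.HasKernels (CohB0 D W) where
  has_limit f := Limits.HasLimit.mk ⟨_, CohB0.isLimit (CohB0.kerι f) f
    (CohB0.kerι_comp f) (fun _ => Subtype.val_injective) fun _ x hx => ⟨⟨x, hx⟩, rfl⟩⟩

lemma CohB0.injective_of_mono {M N : CohB0 D W} (f : M ⟶ N) [Mono f] (U : AffIn W) :
    Function.Injective (f.hom.app U) := by
  have h : kerι f = 0 := (cancel_mono f).1 ((kerι_comp f).trans Limits.zero_comp.symm)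
  refine (injective_iff_map_eq_zero (f.hom.app U)).2 fun x hx => ?_
  exact congr(($h).hom.app U ⟨x, hx⟩)

instance : Abelian (CohB0 D W) where
  normalMonoOfMono f _ := ⟨_, CohB0.cokerπ f, CohB0.comp_cokerπ f,
    CohB0.isLimit f _ _ (CohB0.injective_of_mono f)
      fun _ _ hx => (Submodule.Quotient.mk_eq_zero _).1 hx⟩
  normalEpiOfEpi f _ := ⟨_, CohB0.kerι f, CohB0.kerι_comp f,
    CohB0.isColimit f _ _ (CohB0.surjective_of_epi f) fun _ x hx => ⟨⟨x, hx⟩, rfl⟩⟩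

end Noetherian

end Abelian


/-! ### The abelian and linear structures of the quotient category -/

section Structures

variable {S : Scheme.{u}} {n : ℕ} {D : QuadricData S n} {W : S.Opens}

/-- Two natural maps from a direct limit coincide, if they coincide on the generators. -/
lemma PMod.dirLim_hom_ext {M : GrMod D W} {N : PMod D W} {f g : (dirLim D W).obj M ⟶ N}
    (h : ∀ (U : AffIn W) k m hm l hl, f.app U (DirLim.mk (M.obj U) k m hm l hl) =
      g.app U (DirLim.mk (M.obj U) k m hm l hl)) : f = g :=
  PMod.hom_ext fun U x => by
    refine DirLim.induction (p := fun x : DirLim (M.obj U) => f.app U x = g.app U x) ?_ ?_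
      (h U) x
    · exact (map_zero (f.app U)).trans (map_zero (g.app U)).symm
    · intro x y hx hy
      exact (map_add (f.app U) x y).trans
        ((congrArg₂ (· + ·) hx hy).trans (map_add (g.app U) x y).symm)

lemma symMap_id {R L : Type u} [CommRing R] [AddCommGroup L] [Module R L]
    (x : SymmetricAlgebra R L) : symMap (LinearMap.id : L →ₗ[R] L) x = x :=
  symMap_eq_self _ (fun _ => rfl) (fun _ => rfl) x

lemma dirLim_map_mk {M N : GrMod D W} (f : M ⟶ N) (U : AffIn W) (k m hm l hl) :
    ((dirLim D W).map f).app U (DirLim.mk (M.obj U) k m hm l hl) =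
      DirLim.mk (N.obj U) k (f.app U m) (f.map_grade U hm) l hl :=
  (DirLim.map_mk (f.grMap U) k m hm l hl).trans (DirLim.mk_congr _ _ _ rfl (symMap_id l))

instance : (dirLim D W).Additive where
  map_add {M N f g} := PMod.dirLim_hom_ext fun U k m hm l hl => by
    refine (dirLim_map_mk (f + g) U k m hm l hl).trans ?_
    refine Eq.trans ?_ (congrArg₂ (· + ·) (dirLim_map_mk f U k m hm l hl)
      (dirLim_map_mk g U k m hm l hl)).symm
    exact DirLim.mk_add _ _ _

instance : (dirLim D W).Linear Γ(S, W) where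
  map_smul {M N} f r := PMod.dirLim_hom_ext fun U k m hm l hl => by
    refine (dirLim_map_mk (r • f) U k m hm l hl).trans ?_
    refine Eq.trans ?_ (congrArg (resTo U r • ·) (dirLim_map_mk f U k m hm l hl)).symm
    exact DirLim.mk_smul _ _ _

variable [IsNoetherianTwo S]

variable (D W) in
/-- The functor `q_* : qgr → mod-B0`. -/
abbrev qStar : Qgr D W ⥤ CohB0 D W :=
  (isCoherent D W).lift (pushforward D W (dirLim_inverts D W)) (isCoherent_pushforward D W _)

instance : (qStar D W).IsEquivalence := lift_pushforward_isEquivalence _ _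

lemma qStar_map_toQgr {M N : GrMod D W} (f : M ⟶ N) :
    ((qStar D W).map ((toQgr D W).map f)).hom = (dirLim D W).map f :=
  pushforward_map (dirLim_inverts D W) f

variable (D W) in
/-- The preadditive structure of `qgr`, induced from `mod-B0`. -/
@[reducible] def qgrPreadditive : Preadditive (Qgr D W) :=
  Preadditive.ofFullyFaithful (Functor.FullyFaithful.ofFullyFaithful (qStar D W))

instance : Abelian (Qgr D W) :=
  letI := qgrPreadditive D W
  have : Limits.HasFiniteProducts (Qgr D W) :=
    ⟨fun _ => Adjunction.hasLimitsOfShape_of_equivalence (qStar D W)⟩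
  abelianOfEquivalence (qStar D W)

instance : (qStar D W).Additive :=
  (Functor.FullyFaithful.ofFullyFaithful (qStar D W)).additive_ofFullyFaithful

/-- The scalar multiplication on the morphisms of `qgr`, induced from `mod-B0`. -/
instance (X Y : Qgr D W) : SMul Γ(S, W) (X ⟶ Y) :=
  ⟨fun r f => (qStar D W).preimage (r • (qStar D W).map f)⟩

lemma qStar_map_smul {X Y : Qgr D W} (r : Γ(S, W)) (f : X ⟶ Y) :
    (qStar D W).map (r • f) = r • (qStar D W).map f :=
  (qStar D W).map_preimage _

instance : Linear Γ(S, W) (Qgr D W) where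
  homModule X Y := Function.Injective.module Γ(S, W) (qStar D W).mapAddHom
    (fun _ _ h => (qStar D W).map_injective h) qStar_map_smul
  smul_comp X Y Z r f g := (qStar D W).map_injective <| by
    refine ((qStar D W).map_comp _ _).trans ?_
    refine (congrArg (· ≫ (qStar D W).map g) (qStar_map_smul r f)).trans ?_
    exact (Linear.smul_comp _ _ _ _ _ _).trans
      ((congrArg (r • ·) ((qStar D W).map_comp f g).symm).trans (qStar_map_smul r _).symm)
  comp_smul X Y Z f r g := (qStar D W).map_injective <| by
    refine ((qStar D W).map_comp _ _).trans ?_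
    refine (congrArg ((qStar D W).map f ≫ ·) (qStar_map_smul r g)).trans ?_
    exact (Linear.comp_smul _ _ _ _ _ _).trans
      ((congrArg (r • ·) ((qStar D W).map_comp f g).symm).trans (qStar_map_smul r _).symm)

instance : (qStar D W).Linear Γ(S, W) := ⟨fun f r => qStar_map_smul r f⟩

instance : (toQgr D W).Additive where
  map_add {M N f g} := (qStar D W).map_injective <| ObjectProperty.hom_ext _ <| by
    refine (qStar_map_toQgr (f + g)).trans (((dirLim D W).map_add).trans ?_)
    refine Eq.trans ?_ congr(($((qStar D W).map_add (f := (toQgr D W).map f)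
      (g := (toQgr D W).map g))).hom).symm
    exact (congrArg₂ (· + ·) (qStar_map_toQgr f) (qStar_map_toQgr g)).symm

instance : (toQgr D W).Linear Γ(S, W) where
  map_smul {M N} f r := (qStar D W).map_injective <| ObjectProperty.hom_ext _ <| by
    refine (qStar_map_toQgr (r • f)).trans (((dirLim D W).map_smul r f).trans ?_)
    refine Eq.trans ?_ congr(($((qStar D W).map_smul r ((toQgr D W).map f))).hom).symm
    exact (congrArg (r • ·) (qStar_map_toQgr f)).symm

instance : (pushforward D W (dirLim_inverts D W)).Additive where
  map_add {_ _ f g} := congr(($((qStar D W).map_add (f := f) (g := g))).hom)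

instance : (pushforward D W (dirLim_inverts D W)).Linear Γ(S, W) where
  map_smul {_ _} f r := congr(($((qStar D W).map_smul r f)).hom)

/-- The functor `q_*` is fully faithful. -/
lemma pushforwardHom_bijective {M N : GrMod D W} :
    Function.Bijective fun g : (toQgr D W).obj M ⟶ (toQgr D W).obj N =>
      pushforwardHom (dirLim_inverts D W) g := by
  constructor
  · intro g g' h
    exact (qStar D W).map_injective (ObjectProperty.hom_ext _ h)
  · intro f
    obtain ⟨g, hg⟩ := (qStar D W).map_surjective (X := (toQgr D W).obj M) (Y := (toQgr D W).obj N)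
      ⟨f⟩
    exact ⟨g, congr(($hg).hom)⟩

end Structures

section Restriction

variable {S : Scheme.{u}} {n : ℕ} {D : QuadricData S n} {W W' : S.Opens}

lemma restr_pushforward (i : W' ≤ W) (hinv : (torsionIso D W).IsInvertedBy (dirLim D W))
    (hinv' : (torsionIso D W').IsInvertedBy (dirLim D W')) :
    Qgr.restr D i ⋙ pushforward D W' hinv' = pushforward D W hinv ⋙ PMod.restr D i := by
  refine Localization.Construction.uniq _ _ ?_
  have h₁ : toQgr D W ⋙ Qgr.restr D i = GrMod.restr D i ⋙ toQgr D W' :=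
    Localization.Construction.fac _ _
  rw [← Functor.assoc, h₁, Functor.assoc, toQgr_pushforward, ← Functor.assoc, toQgr_pushforward]
  rfl

end Restriction


/-! ### Shifts of the grading, over a fixed base ring -/

section ShiftMul

variable {R E L : Type u} [CommRing R] [AddCommGroup E] [Module R E] [AddCommGroup L] [Module R L]
variable {s : L →ₗ[R] E →ₗ[R] E →ₗ[R] R} {M M' : GrModule s}

lemma sq_pow_smul_mem_grade (v : E) (l : ℕ) {j : ℤ} {m : M} (hm : m ∈ M.grade j) :
    MulOpposite.op (HC.sq s v ^ l) • m ∈ M.grade (j + 2 * l) := by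
  have h : HC.sq s v ^ l ∈ HC.deg s (2 * l) := by
    rw [mul_comm]
    exact SetLike.pow_mem_graded (A := HC.deg s) l (HC.sq_mem_deg v)
  have := M.act_mem hm h
  push_cast at this
  exact this

/-- In the direct limit, the multiplication by `v^{2l} ⊗ z`, where `z` is a section of `L^l`, is
the multiplication by the value of `z` at `v`. -/
lemma DirLim.mk_sq_pow {k l : ℕ} {m : M} {y z : SymmetricAlgebra R L} (v : E)
    (hm : m ∈ M.grade (2 * k)) (hy : y ∈ tpow R L k) (hz : z ∈ tpow R L l)
    (hm' : MulOpposite.op (HC.sq s v ^ l) • m ∈ M.grade (2 * (k + l : ℕ))) :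
    DirLim.mk M (k + l) (MulOpposite.op (HC.sq s v ^ l) • m) hm' (y * z) (mul_mem_tpow hy hz) =
      evalSym s v z • DirLim.mk M k m hm y hy := by
  induction l generalizing z with
  | zero =>
    have hz' := hz
    rw [tpow, pow_zero, Submodule.mem_one] at hz'
    obtain ⟨r, rfl⟩ := hz'
    rw [AlgHom.commutes, Algebra.algebraMap_self, RingHom.id_apply, ← DirLim.mk_tmul_smul]
    refine DirLim.mk_congr _ _ _ ?_ ?_
    · rw [pow_zero, MulOpposite.op_one, one_smul]
    · rw [← Algebra.commutes, Algebra.smul_def]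
  | succ l ih =>
    have hm₁ : MulOpposite.op (HC.sq s v ^ l) • m ∈ M.grade (2 * (k + l : ℕ)) := by
      have := sq_pow_smul_mem_grade v l hm
      push_cast
      rwa [mul_add]
    have h (z) : ∀ hz : z ∈ tpow R L (l + 1), DirLim.mk M (k + (l + 1))
        (MulOpposite.op (HC.sq s v ^ (l + 1)) • m) hm' (y * z) (mul_mem_tpow hy hz) =
          evalSym s v z • DirLim.mk M k m hm y hy := fun hz => by
      suffices H : ∃ hz : z ∈ tpow R L (l + 1), DirLim.mk M (k + (l + 1))
          (MulOpposite.op (HC.sq s v ^ (l + 1)) • m) hm' (y * z) (mul_mem_tpow hy hz) =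
            evalSym s v z • DirLim.mk M k m hm y hy from H.2
      refine tpow_induction (p := fun z => ∃ hz : z ∈ tpow R L (l + 1), DirLim.mk M (k + (l + 1))
          (MulOpposite.op (HC.sq s v ^ (l + 1)) • m) hm' (y * z) (mul_mem_tpow hy hz) =
            evalSym s v z • DirLim.mk M k m hm y hy) ?_ ?_ hz
      · intro x hx t
        refine ⟨mul_mem_tpow hx (ι_mem_tpow t), ?_⟩
        rw [map_mul, evalSym_ι, mul_comm (evalSym s v x), mul_smul, ← ih hx hm₁]
        refine Eq.trans ?_ (DirLim.mk_sq v t hm₁ (mul_mem_tpow hy hx) (sq_smul_mem_grade v hm₁))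
        refine DirLim.mk_congr _ _ _ ?_ ?_
        · rw [pow_succ, MulOpposite.op_mul, mul_smul]
        · rw [mul_assoc]
      · rintro x z ⟨hx, ex⟩ ⟨hz, ez⟩
        refine ⟨add_mem hx hz, ?_⟩
        rw [map_add, add_smul, ← ex, ← ez, ← DirLim.mk_tmul_add]
        exact DirLim.mk_congr _ _ _ rfl (mul_add _ _ _)
    exact h z hz

/-- The map `lim M_{2k} ⊗ L^k ⊗ L^l → lim M'_{2k} ⊗ L^k`, `m ⊗ y ⊗ z ↦ g m ⊗ y z`, for a map `g`
which shifts the degree by `2l`. -/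
def DirLim.shiftMul (g : M →ₗ[R] M')
    (hg : ∀ (b : HC s) m, g (MulOpposite.op b • m) = MulOpposite.op b • g m) {l : ℕ}
    (hl : ∀ (i : ℕ) m, m ∈ M.grade (2 * i) → g m ∈ M'.grade (2 * (i + l : ℕ))) :
    DirLim M ⊗[R] tpow R L l →ₗ[(B0 s)ᵐᵒᵖ] DirLim M' :=
  TensorProduct.AlgebraTensorModule.lift
    { toFun x :=
        { toFun z := DirLim.mapShift hg hl z.2 x
          map_add' z z' := by
            induction x using DirLim.induction with
            | zero => simp only [map_zero, add_zero]
            | add x y hx hy =>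
              rw [map_add, map_add, map_add, hx, hy]
              exact add_add_add_comm _ _ _ _
            | mk k m hm y hy =>
              rw [DirLim.mapShift_mk, DirLim.mapShift_mk, DirLim.mapShift_mk,
                ← DirLim.mk_tmul_add]
              exact DirLim.mk_congr _ _ _ rfl (mul_add _ _ _)
          map_smul' r z := by
            induction x using DirLim.induction with
            | zero => simp only [map_zero, smul_zero]
            | add x y hx hy => rw [map_add, map_add, hx, hy, smul_add]
            | mk k m hm y hy =>
              rw [DirLim.mapShift_mk, DirLim.mapShift_mk, RingHom.id_apply,
                ← DirLim.mk_tmul_smul]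
              exact DirLim.mk_congr _ _ _ rfl (mul_smul_comm _ _ _) }
      map_add' x y := LinearMap.ext fun z => map_add (DirLim.mapShift hg hl z.2) x y
      map_smul' b x := LinearMap.ext fun z => map_smul (DirLim.mapShift hg hl z.2) b x }

lemma DirLim.shiftMul_mk (g : M →ₗ[R] M')
    (hg : ∀ (b : HC s) m, g (MulOpposite.op b • m) = MulOpposite.op b • g m) {l : ℕ}
    (hl : ∀ (i : ℕ) m, m ∈ M.grade (2 * i) → g m ∈ M'.grade (2 * (i + l : ℕ))) (k : ℕ)
    (m : M) (hm) (y : SymmetricAlgebra R L) (hy) (z : tpow R L l) :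
    DirLim.shiftMul g hg hl (DirLim.mk M k m hm y hy ⊗ₜ z) =
      DirLim.mk M' (k + l) (g m) (hl k m hm) (y * z) (mul_mem_tpow hy z.2) := rfl

lemma DirLim.tmul_induction {l : ℕ} {p : DirLim M ⊗[R] tpow R L l → Prop} (zero : p 0)
    (add : ∀ x y, p x → p y → p (x + y))
    (mk : ∀ k m hm y hy z, p (DirLim.mk M k m hm y hy ⊗ₜ z)) (x) : p x := by
  induction x with
  | zero => exact zero
  | add x y hx hy => exact add x y hx hy
  | tmul x z =>
    induction x using DirLim.induction with
    | zero => rw [TensorProduct.zero_tmul]; exact zero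
    | add x y hx hy => rw [TensorProduct.add_tmul]; exact add _ _ hx hy
    | mk k m hm y hy => exact mk k m hm y hy z

/-- `L^l`, as an element of the tensor power. -/
def tpow.pow (t : L) (l : ℕ) : tpow R L l := ⟨SymmetricAlgebra.ι R L t ^ l, pow_mem_tpow t l⟩

lemma sum_evalSym_smul_pow [NondegForm s] (π : SqPartition s) {l : ℕ} {c : Fin π.r → R}
    (hc : ∑ i, c i * s (π.l i) (π.v i) (π.v i) ^ l = 1) (z : tpow R L l) :
    ∑ i, (c i * evalSym s (π.v i) z) • tpow.pow (R := R) (π.l i) l = z := by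
  have h (i) : (c i * evalSym s (π.v i) z) • tpow.pow (R := R) (π.l i) l =
      (c i * s (π.l i) (π.v i) (π.v i) ^ l) • z := by
    rw [mul_smul, mul_smul]
    refine congrArg (c i • ·) (Subtype.ext ?_)
    refine (evalSym_smul_comm (π.v i) z.2 (pow_mem_tpow (π.l i) l)).trans ?_
    rw [map_pow, evalSym_ι]
    rfl
  rw [Finset.sum_congr rfl fun i _ => h i, ← Finset.sum_smul, hc, one_smul]

/-- The inverse is `m ⊗ y ↦ ∑ c_i e⁻¹(m) v_i^{2l} ⊗ y ⊗ l_i^l`, where `∑ c_i σ_{l_i}(v_i, v_i)^l = 1`. -/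
lemma DirLim.shiftMul_bijective [NondegForm s] (e : M ≃ₗ[R] M')
    (he : ∀ (b : HC s) m, e (MulOpposite.op b • m) = MulOpposite.op b • e m) {l : ℕ}
    (hl : ∀ (i : ℕ) m, m ∈ M.grade (2 * i) → e m ∈ M'.grade (2 * (i + l : ℕ)))
    (hl' : ∀ (i : ℕ) m, m ∈ M'.grade (2 * i) → e.symm m ∈ M.grade (2 * i - 2 * l)) :
    Function.Bijective (DirLim.shiftMul e.toLinearMap he hl) := by
  obtain ⟨π⟩ := NondegForm.exists_partition s
  obtain ⟨c, hc⟩ := π.exists_pow l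
  have he' (b : HC s) (m : M') : e.symm (MulOpposite.op b • m) = MulOpposite.op b • e.symm m := by
    rw [LinearEquiv.symm_apply_eq, he, LinearEquiv.apply_symm_apply]
  let g (v : E) : M' →ₗ[R] M := Algebra.lsmul R R M (MulOpposite.op (HC.sq s v ^ l)) ∘ₗ
    e.symm.toLinearMap
  have hg (v : E) (b : HC s) (m : M') : g v (MulOpposite.op b • m) = MulOpposite.op b • g v m := by
    change MulOpposite.op (HC.sq s v ^ l) • e.symm (MulOpposite.op b • m) =
      MulOpposite.op b • MulOpposite.op (HC.sq s v ^ l) • e.symm m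
    rw [he', ← mul_smul, ← mul_smul, ← MulOpposite.op_mul, ← MulOpposite.op_mul]
    have : Commute (HC.sq s v) b := HC.sq_mul v b
    rw [(this.pow_left l).eq]
  have hg₀ (v : E) (i : ℕ) (m : M') (hm : m ∈ M'.grade (2 * i)) :
      g v m ∈ M.grade (2 * (i + 0 : ℕ)) := by
    have := sq_pow_smul_mem_grade v l (hl' i m hm)
    rwa [sub_add_cancel] at this
  let γ (v : E) : DirLim M' →ₗ[(B0 s)ᵐᵒᵖ] DirLim M := DirLim.mapShift (hg v) (hg₀ v)
    (z := 1) (by rw [tpow, pow_zero]; exact Submodule.one_le.1 le_rfl)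
  have hγ (v : E) (k m hm y hy) : γ v (DirLim.mk M' k m hm y hy) =
      DirLim.mk M k (g v m) (hg₀ v k m hm) y hy :=
    (DirLim.mapShift_mk _ _ _ _ _ _ _ _).trans (DirLim.mk_congr _ _ _ rfl (mul_one y))
  let β := DirLim.shiftMul e.toLinearMap he hl
  let inv : DirLim M' →+ DirLim M ⊗[R] tpow R L l :=
    { toFun x := ∑ i, c i • (γ (π.v i) x ⊗ₜ tpow.pow (R := R) (π.l i) l)
      map_zero' := by simp only [map_zero, TensorProduct.zero_tmul, smul_zero, Finset.sum_const_zero]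
      map_add' x y := by
        simp only [map_add, TensorProduct.add_tmul, smul_add, Finset.sum_add_distrib] }
  refine Function.bijective_iff_has_inverse.2 ⟨inv, fun x => ?_, fun x => ?_⟩
  · refine DirLim.tmul_induction (p := fun x => inv (β x) = x) ?_ ?_ ?_ x
    · rw [map_zero, map_zero]
    · intro x y hx hy
      rw [map_add, map_add, hx, hy]
    · intro k m hm y hy z
      refine Eq.trans (b := ∑ i, c i • (γ (π.v i) (DirLim.mk M' (k + l) (e m) (hl k m hm) (y * z)
        (mul_mem_tpow hy z.2)) ⊗ₜ tpow.pow (R := R) (π.l i) l)) rfl ?_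
      refine Eq.trans ?_ (congrArg (DirLim.mk M k m hm y hy ⊗ₜ[R] ·) (sum_evalSym_smul_pow π hc z))
      rw [TensorProduct.tmul_sum]
      refine Finset.sum_congr rfl fun i _ => ?_
      have hm' : MulOpposite.op (HC.sq s (π.v i) ^ l) • m ∈ M.grade (2 * (k + l : ℕ)) := by
        have := sq_pow_smul_mem_grade (π.v i) l hm
        push_cast
        rwa [mul_add]
      rw [hγ, TensorProduct.tmul_smul, mul_smul]
      refine congrArg (c i • ·) ?_
      rw [TensorProduct.smul_tmul', ← DirLim.mk_sq_pow (π.v i) hm hy z.2 hm']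
      refine congrArg (· ⊗ₜ _) (DirLim.mk_congr _ _ _ ?_ rfl)
      exact congrArg _ (e.symm_apply_apply m)
  · induction x using DirLim.induction with
    | zero => rw [map_zero, map_zero]
    | add x y hx hy => rw [map_add, map_add, hx, hy]
    | mk k m hm y hy =>
      have h (i : Fin π.r) : β (c i • (γ (π.v i) (DirLim.mk M' k m hm y hy) ⊗ₜ
          tpow.pow (R := R) (π.l i) l)) =
            (c i * s (π.l i) (π.v i) (π.v i) ^ l) • DirLim.mk M' k m hm y hy := by
        have hm' : MulOpposite.op (HC.sq s (π.v i) ^ l) • m ∈ M'.grade (2 * (k + l : ℕ)) := by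
          have := sq_pow_smul_mem_grade (π.v i) l hm
          push_cast
          rwa [mul_add]
        refine (LinearMap.map_smul_of_tower β _ _).trans ?_
        rw [hγ, mul_smul]
        refine congrArg (c i • ·) ?_
        refine (DirLim.shiftMul_mk _ _ _ _ _ _ _ _ _).trans ?_
        have := DirLim.mk_sq_pow (π.v i) hm hy (pow_mem_tpow (π.l i) l) hm'
        rw [map_pow, evalSym_ι] at this
        refine Eq.trans (DirLim.mk_congr _ _ _ ?_ rfl) this
        exact (he _ _).trans (congrArg _ (e.apply_symm_apply m))
      change β (∑ i, c i • (γ (π.v i) (DirLim.mk M' k m hm y hy) ⊗ₜ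
          tpow.pow (R := R) (π.l i) l)) = _
      rw [map_sum, Finset.sum_congr rfl fun i _ => h i, ← Finset.sum_smul, hc, one_smul]

end ShiftMul

section Pairing

/-! ### The pairing of `(L^*)^l` and `L^l` -/

variable {R E L : Type u} [CommRing R] [AddCommGroup E] [Module R E] [AddCommGroup L] [Module R L]
variable {s : L →ₗ[R] E →ₗ[R] E →ₗ[R] R}

/-- The evaluation of elements of `Sym (L^*)` at an element of `L`. -/
def evalDual (t : L) : SymmetricAlgebra R (Module.Dual R L) →ₐ[R] R :=
  SymmetricAlgebra.lift (Module.Dual.eval R L t)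

lemma evalDual_ι (t : L) (f : Module.Dual R L) : evalDual t (SymmetricAlgebra.ι R _ f) = f t :=
  SymmetricAlgebra.lift_ι_apply _ _

lemma evalDual_mul_pow [Module.Invertible R L] (g : Module.Dual R L) (t t' : L) {l : ℕ}
    {f : SymmetricAlgebra R (Module.Dual R L)} (hf : f ∈ tpow R (Module.Dual R L) l) :
    evalDual t f * g t' ^ l = evalDual t' f * g t ^ l := by
  induction l generalizing f with
  | zero =>
    rw [tpow, pow_zero, Submodule.mem_one] at hf
    obtain ⟨r, rfl⟩ := hf
    simp
  | succ l ih =>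
    refine tpow_induction (L := Module.Dual R L) (k := l)
      (p := fun f : SymmetricAlgebra R (Module.Dual R L) =>
        evalDual t f * g t' ^ (l + 1) = evalDual t' f * g t ^ (l + 1)) ?_ ?_ hf
    · intro x hx h
      have e : h t * g t' = h t' * g t := by
        have := congrArg g (dual_smul_comm h t t')
        rwa [map_smul, map_smul] at this
      rw [map_mul, map_mul, evalDual_ι, evalDual_ι, pow_succ, pow_succ, mul_mul_mul_comm, ih hx, e,
        mul_mul_mul_comm]
    · intro x y hx hy
      rw [map_add, map_add, add_mul, add_mul, hx, hy]

/-- The pairing of `(L^*)^l` and `L^l`, for a choice of elements `l_i`, `v_i`, `c_i` such that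
`∑ c_i σ_{l_i}(v_i, v_i)^l = 1`. It does not depend on the choice by `tpowPairing_mul`. -/
def tpowPairing (π : SqPartition s) {l : ℕ} (c : Fin π.r → R) :
    tpow R L l →ₗ[R] tpow R (Module.Dual R L) l →ₗ[R] R :=
  ∑ i, c i • (LinearMap.lsmul R (Module.Dual R (tpow R (Module.Dual R L) l))).flip
    ((evalDual (π.l i)).toLinearMap ∘ₗ Submodule.subtype _) ∘ₗ
      ((evalSym s (π.v i)).toLinearMap ∘ₗ Submodule.subtype _)

lemma tpowPairing_apply (π : SqPartition s) {l : ℕ} (c : Fin π.r → R) (z : tpow R L l)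
    (f : tpow R (Module.Dual R L) l) : tpowPairing π c z f =
      ∑ i, c i * (evalSym s (π.v i) z * evalDual (π.l i) f) := by
  simp [tpowPairing]

/-- This formula determines the pairing. -/
lemma tpowPairing_mul [h : NondegForm s] (π : SqPartition s) {l : ℕ} {c : Fin π.r → R}
    (hc : ∑ i, c i * s (π.l i) (π.v i) (π.v i) ^ l = 1) (z : tpow R L l)
    (f : tpow R (Module.Dual R L) l) (t : L) (v : E) :
    tpowPairing π c z f * s t v v ^ l = evalSym s v z * evalDual t f := by
  have := h.invertible
  rw [tpowPairing_apply, Finset.sum_mul]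
  have e (i) : c i * (evalSym s (π.v i) z * evalDual (π.l i) f) * s t v v ^ l =
      c i * s (π.l i) (π.v i) (π.v i) ^ l * (evalSym s v z * evalDual t f) := by
    have h₁ := evalDual_mul_pow (R := R) ((s.flip v).flip v) (π.l i) t f.2
    have h₂ := congrArg (evalSym s v) (evalSym_smul_comm (s := s) (π.v i) z.2 (pow_mem_tpow (π.l i) l))
    rw [map_smul, map_smul, map_pow, map_pow, evalSym_ι, evalSym_ι, smul_eq_mul, smul_eq_mul] at h₂
    simp only [LinearMap.flip_apply] at h₁
    linear_combination c i * evalSym s (π.v i) z * h₁ + c i * evalDual t f * h₂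
  rw [Finset.sum_congr rfl fun i _ => e i, ← Finset.sum_mul, hc, one_mul]

lemma tpowPairing_eq [NondegForm s] (π π' : SqPartition s) {l : ℕ} {c : Fin π.r → R}
    {c' : Fin π'.r → R} (hc : ∑ i, c i * s (π.l i) (π.v i) (π.v i) ^ l = 1)
    (hc' : ∑ i, c' i * s (π'.l i) (π'.v i) (π'.v i) ^ l = 1) (z : tpow R L l)
    (f : tpow R (Module.Dual R L) l) : tpowPairing π c z f = tpowPairing π' c' z f := by
  rw [← mul_one (tpowPairing π c z f), ← hc', Finset.mul_sum, tpowPairing_apply π']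
  refine Finset.sum_congr rfl fun i _ => ?_
  rw [mul_left_comm, tpowPairing_mul π hc]

/-- The pairing of `z` with the power of the functional `l ↦ σ_l(v, v)` is the value of `z` at `v`. -/
lemma tpowPairing_pow [NondegForm s] (π : SqPartition s) {l : ℕ} {c : Fin π.r → R}
    (hc : ∑ i, c i * s (π.l i) (π.v i) (π.v i) ^ l = 1) (z : tpow R L l) (v : E) :
    tpowPairing π c z (tpow.pow ((s.flip v).flip v) l) = evalSym s v z := by
  rw [tpowPairing_apply, ← mul_one (evalSym s v z), ← hc, Finset.mul_sum]
  refine Finset.sum_congr rfl fun i _ => ?_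
  have h₁ : evalDual (π.l i) (tpow.pow (R := R) ((s.flip v).flip v) l).1 = s (π.l i) v v ^ l :=
    (map_pow _ _ _).trans (congrArg (· ^ l) (evalDual_ι _ _))
  have h₂ := congrArg (evalSym s (π.v i))
    (evalSym_smul_comm (s := s) v z.2 (pow_mem_tpow (π.l i) l))
  rw [map_smul, map_smul, map_pow, map_pow, evalSym_ι, evalSym_ι, smul_eq_mul, smul_eq_mul] at h₂
  rw [h₁]
  linear_combination -c i * h₂

lemma tpowPairing_smul_pow [h : NondegForm s] (π : SqPartition s) {l : ℕ} {c : Fin π.r → R}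
    (hc : ∑ i, c i * s (π.l i) (π.v i) (π.v i) ^ l = 1) (z : tpow R L l)
    (f : tpow R (Module.Dual R L) l) (t : L) :
    tpowPairing π c z f • tpow.pow (R := R) t l = evalDual t f.1 • z := by
  have := h.invertible
  have e (i) : (c i * (evalSym s (π.v i) z * evalDual (π.l i) f)) • tpow.pow (R := R) t l =
      (c i * s (π.l i) (π.v i) (π.v i) ^ l * evalDual t f.1) • z := by
    have h₁ := evalDual_mul_pow (R := R) ((s.flip (π.v i)).flip (π.v i)) (π.l i) t f.2
    have h₂ : evalSym s (π.v i) z • tpow.pow (R := R) t l = s t (π.v i) (π.v i) ^ l • z := by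
      refine Subtype.ext ((evalSym_smul_comm (s := s) (π.v i) z.2 (pow_mem_tpow t l)).trans ?_)
      rw [map_pow, evalSym_ι]
      rfl
    simp only [LinearMap.flip_apply] at h₁
    rw [mul_comm (evalSym s (π.v i) z.1), ← mul_assoc, mul_smul, h₂, smul_smul, mul_assoc, h₁]
    congr 1
    ring
  rw [tpowPairing_apply, Finset.sum_smul, Finset.sum_congr rfl fun i _ => e i, ← Finset.sum_smul,
    ← Finset.sum_mul, hc, one_mul]

lemma evalDual_smul_pow [Module.Invertible R L] (g : Module.Dual R L) (t : L) {l : ℕ}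
    (f : tpow R (Module.Dual R L) l) :
    evalDual t f.1 • tpow.pow (R := R) g l = g t ^ l • f := by
  refine Subtype.ext ?_
  change evalDual t f.1 • SymmetricAlgebra.ι R (Module.Dual R L) g ^ l = g t ^ l • f.1
  obtain ⟨f, hf⟩ := f
  change evalDual t f • SymmetricAlgebra.ι R (Module.Dual R L) g ^ l = g t ^ l • f
  induction l generalizing f with
  | zero =>
    rw [tpow, pow_zero, Submodule.mem_one] at hf
    obtain ⟨r, rfl⟩ := hf
    simp [Algebra.algebraMap_eq_smul_one]
  | succ l ih =>
    refine tpow_induction (L := Module.Dual R L) (k := l)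
      (p := fun f : SymmetricAlgebra R (Module.Dual R L) =>
        evalDual t f • SymmetricAlgebra.ι R (Module.Dual R L) g ^ (l + 1) = g t ^ (l + 1) • f)
      ?_ ?_ hf
    · intro x hx h
      have e : h t • g = g t • h := LinearMap.ext fun t' => by
        have := congrArg g (dual_smul_comm h t t')
        rw [map_smul, map_smul] at this
        exact this.trans (mul_comm _ _)
      rw [map_mul, evalDual_ι, pow_succ, mul_smul_mul_comm, ih x hx, ← map_smul, e, map_smul,
        pow_succ, mul_smul_mul_comm]
    · intro x y hx hy
      rw [map_add, add_smul, hx, hy, smul_add]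

lemma tpowPairing_map {R' E' L' : Type u} [CommRing R'] [AddCommGroup E'] [Module R' E']
    [AddCommGroup L'] [Module R' L'] {s' : L' →ₗ[R'] E' →ₗ[R'] E' →ₗ[R'] R'} (F : FormMap s s')
    (fd : Module.Dual R L →ₛₗ[F.φ] Module.Dual R' L') (h : ∀ a t, fd a (F.fL t) = F.φ (a t))
    (π : SqPartition s) {l : ℕ} (c : Fin π.r → R) (z : tpow R L l)
    (f : tpow R (Module.Dual R L) l) :
    tpowPairing (π.map F) (fun i => F.φ (c i)) (tpowMap F.fL l z) (tpowMap fd l f) =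
      F.φ (tpowPairing π c z f) := by
  have h₁ (v : E) (x : SymmetricAlgebra R L) :
      evalSym s' (F.fE v) (symMap F.fL x) = F.φ (evalSym s v x) := by
    induction x using SymmetricAlgebra.induction with
    | algebraMap r => simp
    | ι t => simp [F.compat]
    | mul x y hx hy => simp only [map_mul, hx, hy]
    | add x y hx hy => simp only [map_add, hx, hy]
  have h₂ (t : L) (x : SymmetricAlgebra R (Module.Dual R L)) :
      evalDual (F.fL t) (symMap fd x) = F.φ (evalDual t x) := by
    induction x using SymmetricAlgebra.induction with
    | algebraMap r => rw [symMap_algebraMap, AlgHom.commutes, AlgHom.commutes]; rfl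
    | ι a => rw [symMap_ι, evalDual_ι, evalDual_ι, h]
    | mul x y hx hy => simp only [map_mul, hx, hy]
    | add x y hx hy => simp only [map_add, hx, hy]
  rw [tpowPairing_apply, tpowPairing_apply, map_sum]
  refine Finset.sum_congr rfl fun i _ => ?_
  rw [map_mul, map_mul]
  exact congrArg₂ (fun a b => F.φ (c i) * (a * b)) (h₁ _ _) (h₂ _ _)

section Contraction

variable {A N : Type u} [Ring A] [Algebra R A] [AddCommGroup N] [Module R N] [Module A N]
  [IsScalarTower R A N] {l : ℕ}

variable (A N) in
/-- The contraction `(N ⊗ L^l) ⊗ (L^*)^l → N`. -/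
def tpowContract (p : tpow R L l →ₗ[R] tpow R (Module.Dual R L) l →ₗ[R] R) :
    (N ⊗[R] tpow R L l) ⊗[R] tpow R (Module.Dual R L) l →ₗ[A] N :=
  let c (f : tpow R (Module.Dual R L) l) : N ⊗[R] tpow R L l →ₗ[A] N :=
    (TensorProduct.AlgebraTensorModule.rid R A N).toLinearMap ∘ₗ
      TensorProduct.AlgebraTensorModule.map LinearMap.id (p.flip f)
  TensorProduct.AlgebraTensorModule.lift
    { toFun x :=
        { toFun f := c f x
          map_add' f f' := by
            induction x with
            | zero => simp
            | add x y hx hy => rw [map_add, map_add, map_add, hx, hy, add_add_add_comm]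
            | tmul n z => simp [c, add_smul]
          map_smul' r f := by
            induction x with
            | zero => simp
            | add x y hx hy => rw [map_add, map_add, hx, hy, smul_add]
            | tmul n z => simp [c, mul_smul] }
      map_add' x y := LinearMap.ext fun f => map_add (c f) x y
      map_smul' a x := LinearMap.ext fun f => map_smul (c f) a x }

lemma tpowContract_tmul (p : tpow R L l →ₗ[R] tpow R (Module.Dual R L) l →ₗ[R] R) (n : N)
    (z : tpow R L l) (f : tpow R (Module.Dual R L) l) :
    tpowContract A N p ((n ⊗ₜ z) ⊗ₜ f) = p z f • n := by
  change TensorProduct.AlgebraTensorModule.rid R A N (n ⊗ₜ p z f) = p z f • n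
  simp

/-- The inverse is `n ↦ ∑ c_i n ⊗ l_i^l ⊗ g_i^l`, where `g_i` is the functional `l ↦ σ_l(v_i, v_i)`. -/
lemma tpowContract_bijective [h : NondegForm s] (π : SqPartition s) {c : Fin π.r → R}
    (hc : ∑ i, c i * s (π.l i) (π.v i) (π.v i) ^ l = 1) :
    Function.Bijective (tpowContract A N (tpowPairing π (l := l) c)) := by
  have := h.invertible
  let g (i : Fin π.r) : Module.Dual R L := (s.flip (π.v i)).flip (π.v i)
  let inv : N →+ (N ⊗[R] tpow R L l) ⊗[R] tpow R (Module.Dual R L) l :=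
    { toFun n := ∑ i, c i • ((n ⊗ₜ tpow.pow (R := R) (π.l i) l) ⊗ₜ tpow.pow (R := R) (g i) l)
      map_zero' := by simp only [TensorProduct.zero_tmul, smul_zero, Finset.sum_const_zero]
      map_add' x y := by
        simp only [TensorProduct.add_tmul, smul_add, Finset.sum_add_distrib] }
  refine Function.bijective_iff_has_inverse.2 ⟨inv, fun x => ?_, fun n => ?_⟩
  · induction x with
    | zero => rw [map_zero, map_zero]
    | add x y hx hy => rw [map_add, map_add, hx, hy]
    | tmul x f =>
      induction x with
      | zero => rw [TensorProduct.zero_tmul, map_zero, map_zero]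
      | add x y hx hy => rw [TensorProduct.add_tmul, map_add, map_add, hx, hy]
      | tmul n z =>
        rw [tpowContract_tmul]
        change ∑ i, c i • (((tpowPairing π c z f • n) ⊗ₜ tpow.pow (R := R) (π.l i) l) ⊗ₜ
          tpow.pow (R := R) (g i) l) = _
        have e (i) : c i • (((tpowPairing π c z f • n) ⊗ₜ[R] tpow.pow (R := R) (π.l i) l) ⊗ₜ[R]
          tpow.pow (R := R) (g i) l) = (c i * s (π.l i) (π.v i) (π.v i) ^ l) • ((n ⊗ₜ z) ⊗ₜ f) := by
          rw [TensorProduct.smul_tmul, tpowPairing_smul_pow π hc, TensorProduct.tmul_smul,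
            TensorProduct.smul_tmul, evalDual_smul_pow, TensorProduct.tmul_smul, mul_smul]
          rfl
        rw [Finset.sum_congr rfl fun i _ => e i, ← Finset.sum_smul, hc, one_smul]
  · change tpowContract A N (tpowPairing π (l := l) c) (∑ i, c i •
      ((n ⊗ₜ tpow.pow (R := R) (π.l i) l) ⊗ₜ tpow.pow (R := R) (g i) l)) = n
    have e (i) : tpowContract A N (tpowPairing π (l := l) c) (c i •
        ((n ⊗ₜ tpow.pow (R := R) (π.l i) l) ⊗ₜ tpow.pow (R := R) (g i) l)) =
          (c i * s (π.l i) (π.v i) (π.v i) ^ l) • n := by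
      rw [LinearMap.map_smul_of_tower, tpowContract_tmul, tpowPairing_pow π hc, mul_smul]
      refine congrArg (c i • · • n) ?_
      exact (map_pow _ _ _).trans (congrArg (· ^ l) (evalSym_ι _ _))
    rw [map_sum, Finset.sum_congr rfl fun i _ => e i, ← Finset.sum_smul, hc, one_smul]

end Contraction

end Pairing


/-! ### Shifts of the grading and twists by line bundles -/

section BaseChange

variable {R E L : Type u} [CommRing R] [AddCommGroup E] [Module R E] [AddCommGroup L] [Module R L]
variable {R' E' L' : Type u} [CommRing R'] [AddCommGroup E'] [Module R' E'] [AddCommGroup L']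
  [Module R' L']
variable {s : L →ₗ[R] E →ₗ[R] E →ₗ[R] R} {s' : L' →ₗ[R'] E' →ₗ[R'] E' →ₗ[R'] R'}
variable {F : FormMap s s'}

lemma tpowContract_twistMap {A A' N N' : Type u} [Ring A] [Algebra R A] [AddCommGroup N]
    [Module R N] [Module A N] [IsScalarTower R A N] [Ring A'] [Algebra R' A'] [AddCommGroup N']
    [Module R' N'] [Module A' N'] [IsScalarTower R' A' N'] {φ : R →+* R'} (ρ : N →ₛₗ[φ] N')
    (fL : L →ₛₗ[φ] L') (fd : Module.Dual R L →ₛₗ[φ] Module.Dual R' L') {l : ℕ}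
    (p : tpow R L l →ₗ[R] tpow R (Module.Dual R L) l →ₗ[R] R)
    (p' : tpow R' L' l →ₗ[R'] tpow R' (Module.Dual R' L') l →ₗ[R'] R')
    (hp : ∀ z f, p' (tpowMap fL l z) (tpowMap fd l f) = φ (p z f))
    (x : (N ⊗[R] tpow R L l) ⊗[R] tpow R (Module.Dual R L) l) :
    tpowContract A' N' p' (twistMap (twistMap ρ fL l) fd l x) = ρ (tpowContract A N p x) := by
  induction x with
  | zero => simp only [map_zero]
  | add x y hx hy => simp only [map_add, hx, hy]
  | tmul x f =>
    induction x with
    | zero => simp only [TensorProduct.zero_tmul, map_zero]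
    | add x y hx hy => simp only [TensorProduct.add_tmul, map_add, hx, hy]
    | tmul n z =>
      rw [twistMap_tmul, twistMap_tmul, tpowContract_tmul, tpowContract_tmul, hp,
        LinearMap.map_smulₛₗ]

lemma tpowContract_map {A N N' : Type u} [Ring A] [Algebra R A] [AddCommGroup N]
    [Module R N] [Module A N] [IsScalarTower R A N] [AddCommGroup N']
    [Module R N'] [Module A N'] [IsScalarTower R A N'] (f : N →ₗ[A] N') {l : ℕ}
    (p : tpow R L l →ₗ[R] tpow R (Module.Dual R L) l →ₗ[R] R)
    (x : (N ⊗[R] tpow R L l) ⊗[R] tpow R (Module.Dual R L) l) :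
    tpowContract A N' p (TensorProduct.AlgebraTensorModule.map
      (TensorProduct.AlgebraTensorModule.map f LinearMap.id) LinearMap.id x) =
        f (tpowContract A N p x) := by
  induction x with
  | zero => simp only [map_zero]
  | add x y hx hy => simp only [map_add, hx, hy]
  | tmul x g =>
    induction x with
    | zero => simp only [TensorProduct.zero_tmul, map_zero]
    | add x y hx hy => simp only [TensorProduct.add_tmul, map_add, hx, hy]
    | tmul n z =>
      rw [tpowContract_tmul, LinearMap.map_smul_of_tower]
      exact tpowContract_tmul _ _ _ _

lemma DirLim.map_shiftMul {M M₁ : GrModule s} {M' M₁' : GrModule s'} (e : M →ₗ[R] M₁)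
    (e' : M' →ₗ[R'] M₁') (he he') {l : ℕ} (hl hl') (g : GrMap F M M') (g₁ : GrMap F M₁ M₁')
    (h : ∀ m, g₁.toFun (e m) = e' (g.toFun m)) (x : DirLim M ⊗[R] tpow R L l) :
    DirLim.map g₁ (DirLim.shiftMul e he hl x) =
      DirLim.shiftMul e' he' hl' (twistMap (DirLim.map g) F.fL l x) := by
  induction x using DirLim.tmul_induction with
  | zero => simp only [map_zero]
  | add x y hx hy => simp only [map_add, hx, hy]
  | mk k m hm y hy z =>
    rw [twistMap_tmul, DirLim.shiftMul_mk, DirLim.map_mk, DirLim.map_mk, DirLim.shiftMul_mk]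
    exact DirLim.mk_congr _ _ _ (h m) (map_mul _ _ _)

end BaseChange

section Schemes

variable {S : Scheme.{u}} {n : ℕ} {D : QuadricData S n} {W : S.Opens}

section

variable {M M' : GrMod D W} (e : ∀ U : AffIn W, M.obj U ≃ₗ[Γ(S, U.1)] M'.obj U)
  (he : ∀ (U : AffIn W) (b : HC (D.form U.1)) m, e U (MulOpposite.op b • m) = MulOpposite.op b • e U m) {l : ℕ}
  (hl : ∀ (U : AffIn W) (i : ℕ) m, m ∈ (M.obj U).grade (2 * i) → e U m ∈ (M'.obj U).grade (2 * (i + l : ℕ)))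
  (hn : ∀ {U V : AffIn W} (h : V ≤ U) m, (M'.res h).toFun (e U m) = e V ((M.res h).toFun m))

/-- The morphism `lim M_{2k} ⊗ L^k ⊗ L^l → lim M'_{2k} ⊗ L^k`, `m ⊗ y ⊗ z ↦ e m ⊗ y z`, for an
isomorphism `e` which shifts the degree by `2l`. -/
def shiftMulHom : (twist D W D.L l).obj ((dirLim D W).obj M) ⟶ (dirLim D W).obj M' where
  app U := DirLim.shiftMul (M := M.obj U) (M' := M'.obj U) (e U).toLinearMap (he U) (hl U)
  naturality {U V} h x := (DirLim.map_shiftMul (e U).toLinearMap (e V).toLinearMap (he U) (he V)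
    (hl U) (hl V) (M.res h) (M'.res h) (hn h) x).symm

variable [IsNoetherianTwo S]

lemma isIso_shiftMulHom
    (hl' : ∀ (U : AffIn W) (i : ℕ) m, m ∈ (M'.obj U).grade (2 * i) →
      (e U).symm m ∈ (M.obj U).grade (2 * i - 2 * l)) : IsIso (shiftMulHom e he hl hn) :=
  PMod.isIso_of_bijective _ fun U => DirLim.shiftMul_bijective (e U) (he U) (hl U) (hl' U)

end

lemma shiftMulHom_naturality {M M' M₁ M₁' : GrMod D W} (e : ∀ U : AffIn W, M.obj U ≃ₗ[Γ(S, U.1)] M'.obj U)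
    (he) {l : ℕ} (hl) (hn) (e₁ : ∀ U : AffIn W, M₁.obj U ≃ₗ[Γ(S, U.1)] M₁'.obj U) (he₁) (hl₁) (hn₁)
    (f : M ⟶ M₁) (f' : M' ⟶ M₁') (h : ∀ (U : AffIn W) m, f'.app U (e U m) = e₁ U (f.app U m)) :
    (twist D W D.L l).map ((dirLim D W).map f) ≫ shiftMulHom e₁ he₁ hl₁ hn₁ =
      shiftMulHom e he hl hn ≫ (dirLim D W).map f' :=
  PMod.hom_ext fun U x => by
    refine Eq.symm ((DirLim.map_shiftMul (e U).toLinearMap (e₁ U).toLinearMap (he U) (he₁ U)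
      (hl U) (hl₁ U) (GrMod.Hom.grMap f U) (GrMod.Hom.grMap f' U) (h U) x).trans ?_)
    refine congrArg (DirLim.shiftMul (M := M₁.obj U) (M' := M₁'.obj U) (e₁ U).toLinearMap (he₁ U)
      (hl₁ U)) ?_
    induction x using DirLim.tmul_induction with
    | zero => rfl
    | add x y hx hy => exact (map_add _ _ _).trans ((congrArg₂ (· + ·) hx hy).trans (map_add _ _ _).symm)
    | mk k m hm y hy z => 
      exact congrArg (_ ⊗ₜ ·) (Subtype.ext (symMap_id z.1))

variable [IsNoetherianTwo S]

omit [IsNoetherianTwo S] in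
lemma mem_grade_shift_neg (M : GrMod D W) (l : ℕ) (U : AffIn W) (i : ℕ) (m : M.obj U)
    (hm : m ∈ (M.obj U).grade (2 * i)) :
    m ∈ (((GrMod.shift D W (-(2 * l))).obj M).obj U).grade (2 * (i + l : ℕ)) := by
  have e : 2 * ((i + l : ℕ) : ℤ) + -(2 * l) = 2 * i := by push_cast; ring
  change m ∈ (M.obj U).grade (2 * ((i + l : ℕ) : ℤ) + -(2 * l))
  rwa [e]

/-- The morphism `lim M_{2k} ⊗ L^k ⊗ L^l → lim M_{2k-2l} ⊗ L^k`. -/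
def shiftNegHom (M : GrMod D W) (l : ℕ) : (twist D W D.L l).obj ((dirLim D W).obj M) ⟶
    (dirLim D W).obj ((GrMod.shift D W (-(2 * l))).obj M) :=
  shiftMulHom (M := M) (M' := (GrMod.shift D W (-(2 * l))).obj M)
    (fun U : AffIn W => LinearEquiv.refl Γ(S, U.1) (M.obj U)) (fun _ _ _ => rfl) (mem_grade_shift_neg M l)
    fun _ _ => rfl

instance isIso_shiftNegHom (M : GrMod D W) (l : ℕ) : IsIso (shiftNegHom M l) :=
  isIso_shiftMulHom (M := M) (M' := (GrMod.shift D W (-(2 * l))).obj M)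
    (fun U : AffIn W => LinearEquiv.refl Γ(S, U.1) (M.obj U)) (fun _ _ _ => rfl)
    (mem_grade_shift_neg M l) (fun _ _ => rfl) fun _ _ _ hm => hm

variable (D W) in
/-- The isomorphism `lim M_{2k} ⊗ L^k ⊗ L^l ≅ lim M_{2k-2l} ⊗ L^k`. -/
def shiftNegIso (l : ℕ) :
    dirLim D W ⋙ twist D W D.L l ≅ GrMod.shift D W (-(2 * l)) ⋙ dirLim D W :=
  NatIso.ofComponents (fun M => @asIso _ _ _ _ (shiftNegHom M l) (isIso_shiftNegHom M l))
    fun {M N} f => shiftMulHom_naturality (M := M) (M₁ := N)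
      (M' := (GrMod.shift D W (-(2 * l))).obj M) (M₁' := (GrMod.shift D W (-(2 * l))).obj N) (fun U : AffIn W => LinearEquiv.refl Γ(S, U.1) (M.obj U))
      (fun _ _ _ => rfl) (mem_grade_shift_neg M l) (fun _ _ => rfl)
      (fun U : AffIn W => LinearEquiv.refl Γ(S, U.1) (N.obj U)) (fun _ _ _ => rfl) (mem_grade_shift_neg N l)
      (fun _ _ => rfl) f ((GrMod.shift D W (-(2 * l))).map f) fun _ _ => rfl

omit [IsNoetherianTwo S] in
lemma mem_grade_of_shift (M : GrMod D W) (l : ℕ) (U : AffIn W) (i : ℕ) (m : M.obj U)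
    (hm : m ∈ (((GrMod.shift D W (2 * l)).obj M).obj U).grade (2 * i)) :
    m ∈ (M.obj U).grade (2 * (i + l : ℕ)) :=
  GrModule.mem_of_mem_shift hm

/-- The morphism `lim M_{2k+2l} ⊗ L^k ⊗ L^l → lim M_{2k} ⊗ L^k`. -/
def shiftTwistHom (M : GrMod D W) (l : ℕ) : (twist D W D.L l).obj ((dirLim D W).obj
    ((GrMod.shift D W (2 * l)).obj M)) ⟶ (dirLim D W).obj M :=
  shiftMulHom (M := (GrMod.shift D W (2 * l)).obj M) (M' := M)
    (fun U : AffIn W => LinearEquiv.refl Γ(S, U.1) (M.obj U)) (fun _ _ _ => rfl) (mem_grade_of_shift M l)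
    fun _ _ => rfl

instance isIso_shiftTwistHom (M : GrMod D W) (l : ℕ) : IsIso (shiftTwistHom M l) :=
  isIso_shiftMulHom (M := (GrMod.shift D W (2 * l)).obj M) (M' := M)
    (fun U : AffIn W => LinearEquiv.refl Γ(S, U.1) (M.obj U)) (fun _ _ _ => rfl)
    (mem_grade_of_shift M l) (fun _ _ => rfl) fun U i m hm => by
    change m ∈ (M.obj U).grade (2 * i - 2 * l + 2 * l)
    rwa [sub_add_cancel]

variable (D W) in
/-- The isomorphism `lim M_{2k+2l} ⊗ L^k ⊗ L^l ≅ lim M_{2k} ⊗ L^k`. -/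
def shiftTwistIso (l : ℕ) :
    GrMod.shift D W (2 * l) ⋙ dirLim D W ⋙ twist D W D.L l ≅ dirLim D W :=
  NatIso.ofComponents (fun M => @asIso _ _ _ _ (shiftTwistHom M l) (isIso_shiftTwistHom M l))
    fun {M N} f => shiftMulHom_naturality (M := (GrMod.shift D W (2 * l)).obj M)
      (M₁ := (GrMod.shift D W (2 * l)).obj N) (fun U : AffIn W => LinearEquiv.refl Γ(S, U.1) (M.obj U))
      (fun _ _ _ => rfl) (mem_grade_of_shift M l) (fun _ _ => rfl)
      (fun U : AffIn W => LinearEquiv.refl Γ(S, U.1) (N.obj U)) (fun _ _ _ => rfl) (mem_grade_of_shift N l)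
      (fun _ _ => rfl) ((GrMod.shift D W (2 * l)).map f) f fun _ _ => rfl

lemma exists_partition (D : QuadricData S n) (l : ℕ) (U : S.affineOpens) :
    ∃ (π : SqPartition (D.form U)) (c : Fin π.r → Γ(S, U)),
      ∑ i, c i * D.form U (π.l i) (π.v i) (π.v i) ^ l = 1 := by
  obtain ⟨π⟩ := NondegForm.exists_partition (D.form U)
  exact ⟨π, π.exists_pow l⟩

/-- The pairing of `(L^*)^l` and `L^l` over an affine open subset. -/
def QuadricData.pairing (D : QuadricData S n) (l : ℕ) (U : S.affineOpens) :
    tpow Γ(S, U) (D.L.obj U) l →ₗ[Γ(S, U)]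
      tpow Γ(S, U) (Module.Dual Γ(S, U) (D.L.obj U)) l →ₗ[Γ(S, U)] Γ(S, U) :=
  tpowPairing (exists_partition D l U).choose (exists_partition D l U).choose_spec.choose

lemma QuadricData.pairing_res (D : QuadricData S n) (l : ℕ) {U V : S.affineOpens} (h : V ≤ U)
    (z : tpow Γ(S, U) (D.L.obj U) l) (f : tpow Γ(S, U) (Module.Dual Γ(S, U) (D.L.obj U)) l) :
    D.pairing l V (tpowMap (D.L.res h) l z)
      (tpowMap ((D.L.dual D.isLineBundle.isQCoh).res h) l f) = resO h (D.pairing l U z f) := by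
  have hc := (exists_partition D l U).choose_spec.choose_spec
  have hc' := (exists_partition D l V).choose_spec.choose_spec
  refine Eq.trans (tpowPairing_eq (s := D.form V) _
    ((exists_partition D l U).choose.map (D.formMap h))
    (c' := fun i => resO h ((exists_partition D l U).choose_spec.choose i)) hc' ?_ _ _)
    (tpowPairing_map (D.formMap h) ((D.L.dual D.isLineBundle.isQCoh).res h)
      (fun a t => (D.isLineBundle.isQCoh h).dualMap_apply a t) _ _ z f)
  have := congrArg (resO h) hc
  rw [map_sum, map_one] at this
  refine Eq.trans (Finset.sum_congr rfl fun i _ => ?_) this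
  rw [map_mul, map_pow, ← D.form_res h]
  rfl

variable (D W) in
/-- The isomorphism `N ⊗ L^l ⊗ (L^*)^l ≅ N`. -/
def contractIso (l : ℕ) :
    twist D W D.L l ⋙ twist D W (D.L.dual D.isLineBundle.isQCoh) l ≅ 𝟭 (PMod D W) :=
  let c (N : PMod D W) :
      (twist D W (D.L.dual D.isLineBundle.isQCoh) l).obj ((twist D W D.L l).obj N) ⟶ N :=
    { app U := tpowContract (HomogClifford.B0 (D.form U.1))ᵐᵒᵖ (N.obj U) (D.pairing l U.1)
      naturality {U V} h x := tpowContract_twistMap (A := (HomogClifford.B0 (D.form U.1))ᵐᵒᵖ)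
        (A' := (HomogClifford.B0 (D.form V.1))ᵐᵒᵖ) (N.res h) (D.L.res h)
        ((D.L.dual D.isLineBundle.isQCoh).res h) (D.pairing l U.1) (D.pairing l V.1)
        (D.pairing_res l h) x }
  have (N : PMod D W) : IsIso (c N) := PMod.isIso_of_bijective _ fun U =>
    tpowContract_bijective _ (exists_partition D l U.1).choose_spec.choose_spec
  NatIso.ofComponents (fun N => @asIso _ _ _ _ (c N) (this N)) fun f =>
    PMod.hom_ext fun U x => tpowContract_map (f.app U) (D.pairing l U.1) x

variable (D W) in
/-- The isomorphism `lim M_{2k} ⊗ L^k ⊗ (L^*)^l ≅ lim M_{2k+2l} ⊗ L^k`. -/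
def shiftIso (l : ℕ) : dirLim D W ⋙ twist D W (D.L.dual D.isLineBundle.isQCoh) l ≅
    GrMod.shift D W (2 * l) ⋙ dirLim D W :=
  Functor.isoWhiskerRight (shiftTwistIso D W l).symm (twist D W (D.L.dual D.isLineBundle.isQCoh) l) ≪≫
    Functor.associator _ _ _ ≪≫ Functor.isoWhiskerLeft (GrMod.shift D W (2 * l))
      (Functor.associator _ _ _ ≪≫ Functor.isoWhiskerLeft (dirLim D W) (contractIso D W l) ≪≫
        Functor.rightUnitor _)

omit [IsNoetherianTwo S]

lemma toQgr_shift (j : ℤ) : toQgr D W ⋙ Qgr.shift D W j = GrMod.shift D W j ⋙ toQgr D W :=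
  Localization.Construction.fac _ _

variable (hinv : (torsionIso D W).IsInvertedBy (dirLim D W))

/-- An isomorphism between the direct limit of the shifted modules and a twist extends to the
quotient category. -/
def liftShiftIso {j : ℤ} {G : PMod D W ⥤ PMod D W}
    (e : dirLim D W ⋙ G ≅ GrMod.shift D W j ⋙ dirLim D W) :
    Qgr.shift D W j ⋙ pushforward D W hinv ≅ pushforward D W hinv ⋙ G :=
  Localization.liftNatIso (toQgr D W) (torsionIso D W)
    (toQgr D W ⋙ Qgr.shift D W j ⋙ pushforward D W hinv) (toQgr D W ⋙ pushforward D W hinv ⋙ G) _ _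
    (eqToIso (by rw [← Functor.assoc, toQgr_shift, Functor.assoc, toQgr_pushforward]) ≪≫ e.symm ≪≫
      eqToIso (by rw [← Functor.assoc, toQgr_pushforward]))

end Schemes


/-! ### The direct image of the local `Hom` -/

section LinearAlgebra

variable {R E L : Type u} [CommRing R] [AddCommGroup E] [Module R E] [AddCommGroup L] [Module R L]
variable {s : L →ₗ[R] E →ₗ[R] E →ₗ[R] R} {M M' : GrModule s}

lemma DirLim.shiftMul_tmul_smul (g : M →ₗ[R] M')
    (hg : ∀ (b : HC s) m, g (MulOpposite.op b • m) = MulOpposite.op b • g m) {l : ℕ}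
    (hl : ∀ (i : ℕ) m, m ∈ M.grade (2 * i) → g m ∈ M'.grade (2 * (i + l : ℕ))) (x : DirLim M)
    (r : R) (z : tpow R L l) :
    DirLim.shiftMul g hg hl (x ⊗ₜ (r • z)) = r • DirLim.shiftMul g hg hl (x ⊗ₜ z) := by
  rw [TensorProduct.tmul_smul]
  exact LinearMap.map_smul_of_tower _ _ _

/-- An element of `L`, as an element of `L^1`. -/
def tpow.one (t : L) : tpow R L 1 := ⟨SymmetricAlgebra.ι R L t, ι_mem_tpow t⟩

variable (R L) in
/-- The unit of the symmetric algebra. -/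
def tpow.zero : tpow R L 0 := ⟨1, by rw [tpow, pow_zero]; exact Submodule.one_le.1 le_rfl⟩

lemma tpow.exists_eq_smul_zero (z : tpow R L 0) : ∃ r : R, z = r • tpow.zero R L := by
  obtain ⟨z, hz⟩ := z
  rw [tpow, pow_zero] at hz
  obtain ⟨r, rfl⟩ := Submodule.mem_one.1 hz
  exact ⟨r, Subtype.ext (Algebra.algebraMap_eq_smul_one r)⟩

lemma tpow.mem_of_tpowMul_mem {k : ℕ} (p : Submodule R (tpow R L (k + 1)))
    (h : ∀ (x : tpow R L k) (t : L), tpowMul x t ∈ p) (z : tpow R L (k + 1)) : z ∈ p := by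
  obtain ⟨z, hz⟩ := z
  suffices H : ∃ hz : z ∈ tpow R L (k + 1), (⟨z, hz⟩ : tpow R L (k + 1)) ∈ p from H.2
  refine tpow_induction (p := fun z => ∃ hz : z ∈ tpow R L (k + 1),
    (⟨z, hz⟩ : tpow R L (k + 1)) ∈ p) ?_ ?_ hz
  · exact fun x hx t => ⟨mul_mem_tpow hx (ι_mem_tpow t), h ⟨x, hx⟩ t⟩
  · exact fun x y ⟨hx, ex⟩ ⟨hy, ey⟩ => ⟨add_mem hx hy, add_mem ex ey⟩

end LinearAlgebra

section LocalHom

variable {S : Scheme.{u}} {n : ℕ} {D : QuadricData S n}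

lemma tpowMap_tpowMap (P : AffPresheaf S) {U V T : S.affineOpens} (h : V ≤ U) (h' : T ≤ V) (j : ℕ)
    (l : P.pow j U) :
    tpowMap (P.res h') j (tpowMap (P.res h) j l) = tpowMap (P.res (h'.trans h)) j l :=
  Subtype.ext (symMap_comp _ _ _ (resO_comp h h') (P.res_comp h h') l.1)

section MulHom

variable {U : S.affineOpens} {M M' : GrMod D U}
  (e : ∀ V : AffIn U.1, M.obj V ≃ₗ[Γ(S, V.1)] M'.obj V)
  (he : ∀ (V : AffIn U.1) (b : HC (D.form V.1)) m,
    e V (MulOpposite.op b • m) = MulOpposite.op b • e V m) {l : ℕ}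
  (hl : ∀ (V : AffIn U.1) (i : ℕ) m,
    m ∈ (M.obj V).grade (2 * i) → e V m ∈ (M'.obj V).grade (2 * (i + l : ℕ)))
  (hn : ∀ {V T : AffIn U.1} (h : T ≤ V) m, (M'.res h).toFun (e V m) = e T ((M.res h).toFun m))

/-- The morphism `lim M_{2k} ⊗ L^k → lim M'_{2k} ⊗ L^k`, `m ⊗ y ↦ e m ⊗ y z`, for an
isomorphism `e` which shifts the degree by `2l` and a section `z` of `L^l`. -/
def mulHom (z : D.L.pow l U) : (dirLim D U).obj M ⟶ (dirLim D U).obj M' where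
  app V := DirLim.mapShift (M := M.obj V) (M' := M'.obj V) (g := (e V).toLinearMap) (he V) (hl V)
    (tpowMap (D.L.res V.2) l z).2
  naturality {V T} h x := by
    have e₁ := (shiftMulHom e he hl hn).naturality h
      (x ⊗ₜ[Γ(S, V.1)] tpowMap (D.L.res V.2) l z : DirLim (M.obj V) ⊗[Γ(S, V.1)] D.L.pow l V.1)
    refine Eq.trans ?_ e₁
    refine congrArg (fun z => DirLim.shiftMul (M := M.obj T) (M' := M'.obj T) (e T).toLinearMap
      (he T) (hl T) (DirLim.map (M.res h) x ⊗ₜ z)) ?_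
    exact (tpowMap_tpowMap D.L (U := U) (V := V.1) (T := T.1) V.2 h l z).symm

lemma mulHom_add (z z' : D.L.pow l U) :
    mulHom e he hl hn (z + z') = mulHom e he hl hn z + mulHom e he hl hn z' :=
  PMod.hom_ext fun V x => by
    refine Eq.trans (congrArg (fun t => DirLim.shiftMul (M := M.obj V) (M' := M'.obj V)
      (e V).toLinearMap (he V) (hl V) (x ⊗ₜ t)) (map_add (tpowMap (D.L.res V.2) l) z z')) ?_
    exact (congrArg (DirLim.shiftMul (M := M.obj V) (M' := M'.obj V) (e V).toLinearMap (he V) (hl V))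
      (TensorProduct.tmul_add x _ _)).trans (map_add _ _ _)

lemma mulHom_smul (r : Γ(S, U)) (z : D.L.pow l U) :
    mulHom e he hl hn (r • z) = r • mulHom e he hl hn z :=
  PMod.hom_ext fun V x => by
    refine Eq.trans (congrArg (fun t => DirLim.shiftMul (M := M.obj V) (M' := M'.obj V)
      (e V).toLinearMap (he V) (hl V) (x ⊗ₜ t)) ((tpowMap (D.L.res V.2) l).map_smulₛₗ r z)) ?_
    exact DirLim.shiftMul_tmul_smul (M := M.obj V) (M' := M'.obj V) (e V).toLinearMap (he V) (hl V) x
      (resO V.2 r) (tpowMap (D.L.res V.2) l z)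

end MulHom

variable {U : S.affineOpens}

/-- The multiplication `lim N_{2j+2k} ⊗ L^k → lim N_{2k} ⊗ L^k` by a section of `L^j`. -/
def mulTpow (N : GrMod D U) (j : ℕ) (l : D.L.pow j U) :
    (dirLim D U).obj ((GrMod.shift D U (2 * (j : ℤ))).obj N) ⟶ (dirLim D U).obj N :=
  mulHom (M := (GrMod.shift D U (2 * (j : ℤ))).obj N) (M' := N)
    (fun V : AffIn U.1 => LinearEquiv.refl Γ(S, V.1) (N.obj V)) (fun _ _ _ => rfl)
    (mem_grade_of_shift N j) (fun _ _ => rfl) l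

lemma isMulTpow_mulTpow (N : GrMod D U) (j : ℕ) (l : D.L.pow j U) :
    IsMulTpow N j l (mulTpow N j l) := fun _ _ _ _ _ => rfl

lemma mem_grade_shift_succ (N : GrMod D U) (k : ℕ) (V : AffIn U.1) (i : ℕ) (m : N.obj V)
    (hm : m ∈ (((GrMod.shift D U (2 * ((k + 1 : ℕ) : ℤ))).obj N).obj V).grade (2 * i)) :
    m ∈ (((GrMod.shift D U (2 * (k : ℤ))).obj N).obj V).grade (2 * (i + 1 : ℕ)) := by
  have e : 2 * ((i + 1 : ℕ) : ℤ) + 2 * k = 2 * i + 2 * (k + 1 : ℕ) := by push_cast; ring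
  change m ∈ (N.obj V).grade (2 * ((i + 1 : ℕ) : ℤ) + 2 * k)
  rwa [e]

/-- The multiplication `lim N_{2(k+1)+2i} ⊗ L^i → lim N_{2k+2i} ⊗ L^i` by a section of `L`. -/
def mulSection (N : GrMod D U) (k : ℕ) (t : D.L.obj U) :
    (dirLim D U).obj ((GrMod.shift D U (2 * ((k + 1 : ℕ) : ℤ))).obj N) ⟶
      (dirLim D U).obj ((GrMod.shift D U (2 * (k : ℤ))).obj N) :=
  mulHom (M := (GrMod.shift D U (2 * ((k + 1 : ℕ) : ℤ))).obj N)
    (M' := (GrMod.shift D U (2 * (k : ℤ))).obj N)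
    (fun V : AffIn U.1 => LinearEquiv.refl Γ(S, V.1) (N.obj V)) (fun _ _ _ => rfl)
    (mem_grade_shift_succ N k) (fun _ _ => rfl) (tpow.one t)

section

variable [IsNoetherianTwo S]

/-- The multiplication by `v²`, where `v` is a section of `E`. -/
def mulSq (N : GrMod D U) (k : ℕ) (v : D.E.obj U) : (GrMod.shift D U (2 * (k : ℤ))).obj N ⟶
    (GrMod.shift D U (2 * ((k + 1 : ℕ) : ℤ))).obj N where
  app V := Algebra.lsmul Γ(S, V.1) Γ(S, V.1) (N.obj V)
    (MulOpposite.op (HC.sq (D.form V.1) (D.E.res V.2 v)))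
  map_act V b m := by
    change MulOpposite.op (HC.sq (D.form V.1) (D.E.res V.2 v)) • MulOpposite.op b • (m : N.obj V) =
      MulOpposite.op b • MulOpposite.op (HC.sq (D.form V.1) (D.E.res V.2 v)) • (m : N.obj V)
    rw [← mul_smul, ← mul_smul, ← MulOpposite.op_mul, ← MulOpposite.op_mul, HC.sq_mul]
  map_grade V k' m hm := by
    have h := (N.obj V).act_mem hm (HC.sq_mem_deg (s := D.form V.1) (D.E.res V.2 v))
    have e : k' + 2 * k + (2 : ℕ) = k' + 2 * ((k + 1 : ℕ) : ℤ) := by push_cast; ring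
    rw [e] at h
    exact h
  naturality {V T} h m := by
    refine Eq.trans ?_ ((N.res h).map_act (HC.sq (D.form V.1) (D.E.res V.2 v)) m).symm
    refine congrArg (fun b : HC (D.form T.1) => MulOpposite.op b • ((N.res h).toFun m : N.obj T)) ?_
    refine Eq.trans ?_ (map_mul (HC.map (D.formMap h)) (HC.gen (D.form V.1) (D.E.res V.2 v))
      (HC.gen (D.form V.1) (D.E.res V.2 v))).symm
    rw [HC.map_gen]
    have := D.E.res_comp (U := U) (V := V.1) (T := T.1) V.2 h v
    exact congrArg (HC.sq (D.form T.1)) this.symm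

lemma isMulSq_mulSq (N : GrMod D U) (k : ℕ) (v : D.E.obj U) : IsMulSq N k v (mulSq N k v) :=
  fun _ _ => rfl

omit [IsNoetherianTwo S] in
lemma form_res_res (t : D.L.obj U) (v : D.E.obj U) (V : AffIn U.1) :
    D.form V.1 (D.L.res V.2 t) (D.E.res V.2 v) (D.E.res V.2 v) = resTo V (D.form U t v v) :=
  D.form_res (U := U) (V := V.1) V.2 t v v

omit [IsNoetherianTwo S] in
lemma map_mulSq_comp_mulTpow (N : GrMod D U) (k : ℕ) (v : D.E.obj U) (μ) (hμ : IsMulSq N k v μ)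
    (l : D.L.pow k U) (t : D.L.obj U) :
    (dirLim D U).map μ ≫ mulTpow N (k + 1) (tpowMul l t) = D.form U t v v • mulTpow N k l :=
  PMod.dirLim_hom_ext fun V i m hm y hy => by
    have h := congrArg ((mulTpow N (k + 1) (tpowMul l t)).app V) (dirLim_map_mk μ V i m hm y hy)
    refine h.trans ?_
    have hm' : m ∈ (N.obj V).grade (2 * (i + k : ℕ)) := GrModule.mem_of_mem_shift hm
    refine Eq.trans ?_ ((DirLim.mk_sq (M := N.obj V) (D.E.res V.2 v) (D.L.res V.2 t) hm'
      (mul_mem_tpow hy (tpowMap (D.L.res V.2) k l).2) (sq_smul_mem_grade _ hm')).trans ?_)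
    · refine DirLim.mk_congr (N.obj V) (k := i + (k + 1)) (m := μ.app V m)
        (GrModule.mem_of_mem_shift (μ.map_grade V hm))
        (mul_mem_tpow hy (tpowMap (D.L.res V.2) (k + 1) (tpowMul l t)).2) (hμ V m) ?_
      change y * symMap (D.L.res V.2) (l.1 * SymmetricAlgebra.ι _ _ t) = _
      rw [map_mul, symMap_ι, ← mul_assoc]
      rfl
    · rw [form_res_res]
      rfl

/-- In the direct limit, the multiplications by `t` and by `v²` compose to the multiplication by
`σ_t(v, v)`. -/
lemma mulSection_comp_map_mulSq (N : GrMod D U) (k : ℕ) (v : D.E.obj U) (t : D.L.obj U) :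
    mulSection N k t ≫ (dirLim D U).map (mulSq N k v) = D.form U t v v • 𝟙 _ :=
  PMod.dirLim_hom_ext fun V i m hm y hy => by
    have hy' : y * (tpowMap (D.L.res V.2) 1 (tpow.one t)).1 ∈ tpow _ _ (i + 1) :=
      mul_mem_tpow hy (tpowMap (D.L.res V.2) 1 (tpow.one t)).2
    refine (dirLim_map_mk (mulSq N k v) V (i + 1) m (mem_grade_shift_succ N k V i m hm) _ hy').trans ?_
    refine Eq.trans ?_ ((DirLim.mk_sq
      (M := ((GrMod.shift D U (2 * ((k + 1 : ℕ) : ℤ))).obj N).obj V) (D.E.res V.2 v) (D.L.res V.2 t)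
      hm hy (sq_smul_mem_grade _ hm)).trans ?_)
    · refine DirLim.mk_congr _ _ _ rfl ?_
      exact congrArg (y * ·) (symMap_ι _ _)
    · rw [form_res_res]
      rfl

end

section

variable (N : GrMod D U)

lemma grade_shift_zero (V : AffIn U.1) (k : ℤ) :
    (((GrMod.shift D U (2 * ((0 : ℕ) : ℤ))).obj N).obj V).grade k = (N.obj V).grade k := by
  have e : k + 2 * ((0 : ℕ) : ℤ) = k := by simp
  exact congrArg (N.obj V).grade e

/-- The isomorphism `N⟨0⟩ ≅ N`. -/
def shiftZeroIso : (GrMod.shift D U (2 * ((0 : ℕ) : ℤ))).obj N ≅ N where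
  hom :=
    { app _ := LinearMap.id
      map_act _ _ _ := rfl
      map_grade V k m hm := by rwa [grade_shift_zero] at hm
      naturality _ _ := rfl }
  inv :=
    { app _ := LinearMap.id
      map_act _ _ _ := rfl
      map_grade V k m hm := by rwa [grade_shift_zero]
      naturality _ _ := rfl }
  hom_inv_id := rfl
  inv_hom_id := rfl

lemma mulTpow_zero : mulTpow N 0 (tpow.zero _ _) = (dirLim D U).map (shiftZeroIso N).hom :=
  PMod.dirLim_hom_ext fun V i m hm y hy => by
    refine Eq.trans ?_ (dirLim_map_mk (shiftZeroIso N).hom V i m hm y hy).symm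
    refine DirLim.mk_congr (N.obj V) (mem_grade_of_shift N 0 V i m hm)
      (mul_mem_tpow hy (tpowMap (D.L.res V.2) 0 (tpow.zero _ _)).2) rfl ?_
    change y * symMap (D.L.res V.2) 1 = y
    rw [map_one, mul_one]

end

variable [IsNoetherianTwo S] (M N : GrMod D U)

variable {M N} in
lemma pushforwardHom_add (g g' : (toQgr D U).obj M ⟶ (toQgr D U).obj N) :
    pushforwardHom (dirLim_inverts D U.1) (g + g') =
      pushforwardHom (dirLim_inverts D U.1) g + pushforwardHom (dirLim_inverts D U.1) g' :=
  (pushforward D U.1 (dirLim_inverts D U.1)).map_add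

variable {M N} in
lemma pushforwardHom_smul (r : Γ(S, U)) (g : (toQgr D U).obj M ⟶ (toQgr D U).obj N) :
    pushforwardHom (dirLim_inverts D U.1) (r • g) = r • pushforwardHom (dirLim_inverts D U.1) g :=
  (pushforward D U.1 (dirLim_inverts D U.1)).map_smul r g

variable {M N} in
lemma pushforwardHom_comp_map {N' : GrMod D U} (g : (toQgr D U).obj M ⟶ (toQgr D U).obj N)
    (μ : N ⟶ N') : pushforwardHom (dirLim_inverts D U.1) (g ≫ (toQgr D U).map μ) =
      pushforwardHom (dirLim_inverts D U.1) g ≫ (dirLim D U).map μ :=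
  ((pushforward D U.1 _).map_comp g ((toQgr D U).map μ)).trans
    (congrArg (_ ≫ ·) (pushforward_map _ μ))

omit [IsNoetherianTwo S] in
lemma mulTpow_add (j : ℕ) (l l' : D.L.pow j U) :
    mulTpow N j (l + l') = mulTpow N j l + mulTpow N j l' := mulHom_add _ _ _ (fun _ _ => rfl) l l'

omit [IsNoetherianTwo S] in
lemma mulTpow_smul (j : ℕ) (r : Γ(S, U)) (l : D.L.pow j U) :
    mulTpow N j (r • l) = r • mulTpow N j l := mulHom_smul _ _ _ (fun _ _ => rfl) r l

/-- The map `Hom_{qgr}(M, N⟨2j⟩) ⊗ L^j → Hom_{B0}(q_* M, q_* N)`. -/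
def homSumComponent (j : ℕ) :
    TensorProduct Γ(S, U)
      ((toQgr D U).obj M ⟶ (toQgr D U).obj ((GrMod.shift D U (2 * (j : ℤ))).obj N)) (D.L.pow j U)
      →ₗ[Γ(S, U)] ((dirLim D U).obj M ⟶ (dirLim D U).obj N) :=
  TensorProduct.lift <| LinearMap.mk₂ Γ(S, U)
    (fun g l => pushforwardHom (dirLim_inverts D U.1) g ≫ mulTpow N j l)
    (fun g g' l => by rw [pushforwardHom_add, Preadditive.add_comp])
    (fun r g l => by rw [pushforwardHom_smul, Linear.smul_comp])
    (fun g l l' => by rw [mulTpow_add, Preadditive.comp_add])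
    (fun r g l => by rw [mulTpow_smul, Linear.comp_smul])

/-- The map `⨁ Hom_{qgr}(M, N⟨2j⟩) ⊗ L^j → Hom_{B0}(q_* M, q_* N)`. -/
def homSumMap : HomSum M N →ₗ[Γ(S, U)] ((dirLim D U).obj M ⟶ (dirLim D U).obj N) :=
  DirectSum.toModule Γ(S, U) ℕ _ (homSumComponent M N)

variable {M N}

lemma homSumMap_of (j : ℕ)
    (g : (toQgr D U).obj M ⟶ (toQgr D U).obj ((GrMod.shift D U (2 * (j : ℤ))).obj N))
    (l : D.L.pow j U) : homSumMap M N (HomSum.of j g l) =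
      pushforwardHom (dirLim_inverts D U.1) g ≫ mulTpow N j l := by
  rw [homSumMap, HomSum.of, DirectSum.toModule_lof]
  rfl

lemma rel_le_ker_homSumMap : HomSum.rel M N ≤ LinearMap.ker (homSumMap M N) := by
  refine Submodule.span_le.2 ?_
  rintro _ ⟨k, g, l, v, t, μ, hμ, rfl⟩
  refine LinearMap.mem_ker.2 ?_
  rw [map_sub, map_smul, homSumMap_of, homSumMap_of, sub_eq_zero]
  rw [pushforwardHom_comp_map, Category.assoc, map_mulSq_comp_mulTpow N k v μ hμ]
  exact Linear.comp_smul _ _ _ _ _ _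

variable (M N) in
/-- The map `lim Hom_{qgr}(M, N⟨2j⟩) ⊗ L^j → Hom_{B0}(q_* M, q_* N)`. -/
def homLimMap : HomLim M N →ₗ[Γ(S, U)] ((dirLim D U).obj M ⟶ (dirLim D U).obj N) :=
  (HomSum.rel M N).liftQ (homSumMap M N) rel_le_ker_homSumMap

lemma homLimMap_mk (j : ℕ)
    (g : (toQgr D U).obj M ⟶ (toQgr D U).obj ((GrMod.shift D U (2 * (j : ℤ))).obj N))
    (l : D.L.pow j U) : homLimMap M N (HomLim.mk j g l) =
      pushforwardHom (dirLim_inverts D U.1) g ≫ mulTpow N j l :=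
  homSumMap_of j g l

variable (M N) in
/-- The map from the `k`-th module to the direct limit. -/
def homLimStage (k : ℕ) : TensorProduct Γ(S, U)
    ((toQgr D U).obj M ⟶ (toQgr D U).obj ((GrMod.shift D U (2 * (k : ℤ))).obj N)) (D.L.pow k U)
      →ₗ[Γ(S, U)] HomLim M N :=
  (HomSum.rel M N).mkQ ∘ₗ DirectSum.lof Γ(S, U) ℕ (fun k : ℕ => TensorProduct Γ(S, U)
    ((toQgr D U).obj M ⟶ (toQgr D U).obj ((GrMod.shift D U (2 * (k : ℤ))).obj N)) (D.L.pow k U)) k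

variable (M N) in
/-- The map from `Hom_{qgr}(M, N)` to the direct limit. -/
def homLimZero :
    ((toQgr D U).obj M ⟶ (toQgr D U).obj ((GrMod.shift D U (2 * ((0 : ℕ) : ℤ))).obj N))
      →ₗ[Γ(S, U)] HomLim M N :=
  homLimStage M N 0 ∘ₗ (TensorProduct.mk Γ(S, U) _ (D.L.pow 0 U)).flip (tpow.zero _ _)

lemma HomLim.mk_succ (k : ℕ)
    (g : (toQgr D U).obj M ⟶ (toQgr D U).obj ((GrMod.shift D U (2 * (k : ℤ))).obj N))
    (l : D.L.pow k U) (v : D.E.obj U) (t : D.L.obj U) :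
    HomLim.mk (k + 1) (g ≫ (toQgr D U).map (mulSq N k v)) (tpowMul l t) =
      D.form U t v v • HomLim.mk k g l := by
  refine (Submodule.Quotient.eq _).2 (Submodule.subset_span ?_)
  exact ⟨k, g, l, v, t, mulSq N k v, isMulSq_mulSq N k v, rfl⟩

/-- Up to the functions `σ_t(v, v)`, a morphism to `N⟨2k+2⟩` is divisible by `v²`. -/
lemma exists_comp_mulSq (k : ℕ)
    (g : (toQgr D U).obj M ⟶ (toQgr D U).obj ((GrMod.shift D U (2 * ((k + 1 : ℕ) : ℤ))).obj N))
    (v : D.E.obj U) (t : D.L.obj U) :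
    ∃ g' : (toQgr D U).obj M ⟶ (toQgr D U).obj ((GrMod.shift D U (2 * (k : ℤ))).obj N),
      g' ≫ (toQgr D U).map (mulSq N k v) = D.form U t v v • g := by
  obtain ⟨g', hg'⟩ := pushforwardHom_bijective.2
    (pushforwardHom (dirLim_inverts D U.1) g ≫ mulSection N k t)
  refine ⟨g', pushforwardHom_bijective.1 ?_⟩
  change pushforwardHom (dirLim_inverts D U.1) g' = _ at hg'
  change pushforwardHom (dirLim_inverts D U.1) _ = pushforwardHom (dirLim_inverts D U.1) _
  rw [pushforwardHom_comp_map, pushforwardHom_smul, hg', Category.assoc, mulSection_comp_map_mulSq,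
    Linear.comp_smul, Category.comp_id]

/-- Every class comes from the stage zero: as `∑ σ_{l_i}(v_i, v_i) = 1`, the class of `g ⊗ y t` is the
sum of the classes of `σ_t(v_i, v_i) g_i ⊗ y`, where `g_i v_i² = σ_{l_i}(v_i, v_i) g`. -/
lemma homLimStage_mem_range (k : ℕ)
    (g : (toQgr D U).obj M ⟶ (toQgr D U).obj ((GrMod.shift D U (2 * (k : ℤ))).obj N))
    (l : D.L.pow k U) :
    homLimStage M N k (g ⊗ₜ[Γ(S, U)] l) ∈ LinearMap.range (homLimZero M N) := by
  induction k with
  | zero =>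
    obtain ⟨r, rfl⟩ := tpow.exists_eq_smul_zero l
    rw [TensorProduct.tmul_smul, map_smul]
    exact Submodule.smul_mem _ r ⟨g, rfl⟩
  | succ k ih =>
    let p := (LinearMap.range (homLimZero M N)).comap
      (homLimStage M N (k + 1) ∘ₗ TensorProduct.mk Γ(S, U) _ (D.L.pow (k + 1) U) g)
    refine tpow.mem_of_tpowMul_mem p (fun y t => ?_) l
    obtain ⟨π⟩ := NondegForm.exists_partition (D.form U)
    choose g' hg' using fun i => exists_comp_mulSq k g (π.v i) (π.l i)
    change HomLim.mk (k + 1) g (tpowMul y t) ∈ LinearMap.range (homLimZero M N)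
    have e (i) : D.form U (π.l i) (π.v i) (π.v i) • HomLim.mk (k + 1) g (tpowMul y t) =
        D.form U t (π.v i) (π.v i) • HomLim.mk k (g' i) y := by
      rw [← HomLim.mk_succ k (g' i) y (π.v i) t, hg']
      refine ((homLimStage M N (k + 1)).map_smul _ _).symm.trans ?_
      exact congrArg (homLimStage M N (k + 1)) (TensorProduct.smul_tmul' _ _ _)
    rw [← one_smul Γ(S, U) (HomLim.mk (k + 1) g (tpowMul y t)), ← π.sum_eq, Finset.sum_smul]
    refine sum_mem fun i _ => ?_
    rw [e]
    exact Submodule.smul_mem _ _ (ih (g' i) y)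

lemma homLimZero_surjective : Function.Surjective (homLimZero M N) := by
  intro x
  obtain ⟨x, rfl⟩ := Submodule.mkQ_surjective _ x
  change _ ∈ LinearMap.range (homLimZero M N)
  induction x using DirectSum.induction_on with
  | zero => rw [map_zero]; exact zero_mem _
  | add x y hx hy => rw [map_add]; exact add_mem hx hy
  | of k x =>
    change homLimStage M N k x ∈ _
    induction x with
    | zero => rw [map_zero]; exact zero_mem _
    | add x y hx hy => rw [map_add]; exact add_mem hx hy
    | tmul g l => exact homLimStage_mem_range k g l

lemma homLimMap_homLimZero (g) : homLimMap M N (homLimZero M N g) =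
    pushforwardHom (dirLim_inverts D U.1) g ≫ (dirLim D U).map (shiftZeroIso N).hom := by
  rw [← mulTpow_zero]
  exact homLimMap_mk 0 g (tpow.zero _ _)

/-- On the stage zero, which surjects onto the direct limit, the map is given by the fully faithful
functor `q_*`. -/
lemma homLimMap_bijective : Function.Bijective (homLimMap M N) := by
  constructor
  · intro x y h
    obtain ⟨g, rfl⟩ := homLimZero_surjective x
    obtain ⟨g', rfl⟩ := homLimZero_surjective y
    rw [homLimMap_homLimZero, homLimMap_homLimZero, cancel_mono] at h
    rw [pushforwardHom_bijective.1 h]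
  · intro f
    obtain ⟨g, hg⟩ := pushforwardHom_bijective.2 (f ≫ (dirLim D U).map (shiftZeroIso N).inv)
    refine ⟨homLimZero M N g, ?_⟩
    change pushforwardHom (dirLim_inverts D U.1) g = _ at hg
    rw [homLimMap_homLimZero, hg, Category.assoc, ← Functor.map_comp, Iso.inv_hom_id,
      (dirLim D U).map_id, Category.comp_id]

variable (M N) in
/-- The isomorphism `lim Hom_{qgr}(M, N⟨2j⟩) ⊗ L^j ≅ Hom_{B0}(q_* M, q_* N)`. -/
def homLimEquiv : HomLim M N ≃ₗ[Γ(S, U)] ((dirLim D U).obj M ⟶ (dirLim D U).obj N) :=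
  LinearEquiv.ofBijective (homLimMap M N) homLimMap_bijective

end LocalHom

section Restriction

variable {S : Scheme.{u}} {n : ℕ} {D : QuadricData S n} [IsNoetherianTwo S]

lemma pushforwardHom_restrQgrHom {W W' : S.Opens} (i : W' ≤ W) {M N : GrMod D ⊤} {j : ℤ}
    (g : (toQgr D W).obj (M.on W) ⟶ (toQgr D W).obj ((GrMod.shift D W j).obj (N.on W))) :
    pushforwardHom (dirLim_inverts D W') (restrQgrHom i g) =
      (PMod.restr D i).map (pushforwardHom (dirLim_inverts D W) g) :=
  (Functor.congr_hom (restr_pushforward i (dirLim_inverts D W) (dirLim_inverts D W')) g).trans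
    ((Category.id_comp _).trans (Category.comp_id _))

omit [IsNoetherianTwo S] in
lemma restr_mulTpow {U V : S.affineOpens} (i : V ≤ U) (N : GrMod D ⊤) (j : ℕ) (l : D.L.pow j U) :
    (PMod.restr D i).map (mulTpow (N.on U) j l) =
      mulTpow (N.on V) j (tpowMap (D.L.res i) j l) :=
  PMod.dirLim_hom_ext (M := (GrMod.shift D V (2 * (j : ℤ))).obj (N.on V)) fun T k m hm y hy => by
    refine DirLim.mk_congr (N.obj (T.incl le_top)) (k := k + j) (m := m)
      (mem_grade_of_shift (N.on V) j T k m hm)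
      (mul_mem_tpow hy (tpowMap (D.L.res (T.2.trans i)) j l).2) rfl ?_
    exact congrArg (fun z : tpow _ _ j => y * z.1) (tpowMap_tpowMap D.L i T.2 j l).symm

lemma homLimEquiv_restr (M N : GrMod D ⊤) {U V : S.affineOpens} (i : V ≤ U) (j : ℕ)
    (g : (toQgr D U).obj (M.on U) ⟶
      (toQgr D U).obj ((GrMod.shift D U (2 * (j : ℤ))).obj (N.on U))) (l : D.L.pow j U) :
    homLimEquiv (M.on V) (N.on V) (HomLim.mk j (restrQgrHom i g) (tpowMap (D.L.res i) j l)) =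
      restrDirLimHom i (homLimEquiv (M.on U) (N.on U) (HomLim.mk j g l)) := by
  refine (homLimMap_mk j (restrQgrHom i g) (tpowMap (D.L.res i) j l)).trans ?_
  rw [pushforwardHom_restrQgrHom, ← restr_mulTpow]
  refine Eq.trans ?_ (congrArg (restrDirLimHom i) (homLimMap_mk j g l)).symm
  exact ((PMod.restr D i).map_comp _ _).symm

end Restriction


/-! ### Schemes over a field of characteristic zero -/

/-- Smoothness is used only through local finiteness over a field, and characteristic zero only through
the invertibility of `2`. -/
lemma isNoetherianTwo_of_smooth {k : Type u} [Field k] [CharZero k] {S : Scheme.{u}}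
    (f : S ⟶ Spec (CommRingCat.of k)) [Smooth f] : IsNoetherianTwo S where
  noetherian U := by
    have : IsLocallyNoetherian S := LocallyOfFiniteType.isLocallyNoetherian f
    exact IsLocallyNoetherian.component_noetherian U
  two U := by
    let φ : k →+* Γ(S, U) := (f.appLE ⊤ U le_top).hom.comp
      (Scheme.ΓSpecIso (CommRingCat.of k)).inv.hom
    have h : IsUnit (φ 2) := (IsUnit.mk0 (2 : k) two_ne_zero).map φ
    rwa [map_ofNat] at h

end HomogClifford

end

open HomogClifford in
theorem proposition3p9 {k : Type u} [Field k] [IsAlgClosed k] [CharZero k] {S : Scheme.{u}}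
    (f : S ⟶ Spec (CommRingCat.of k)) [Smooth f] [IsSeparated f] [QuasiCompact f]
    {n : ℕ} (D : QuadricData S n) :
    -- the functor `q_*` is defined on `qgr` over each open subset, and it has coherent values
    ∃ (hinv : ∀ W : S.Opens, (torsionIso D W).IsInvertedBy (dirLim D W))
      (hcoh : ∀ (W : S.Opens) (X : Qgr D W), isCoherent D W ((pushforward D W (hinv W)).obj X))
      (_ : ∀ W : S.Opens, Abelian (Qgr D W))
      (_ : ∀ W : S.Opens, Linear Γ(S, W) (Qgr D W)),
      -- the abelian and linear structures are the ones induced from the graded modules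
      (∀ W : S.Opens, ∃ _ : (toQgr D W).Additive, (toQgr D W).Linear Γ(S, W)) ∧
      -- `q_*` is an exact equivalence of abelian categories
      (∀ W : S.Opens, Nonempty (Abelian (CohB0 D W)) ∧
        ((isCoherent D W).lift (pushforward D W (hinv W)) (hcoh W)).IsEquivalence ∧
        Limits.PreservesFiniteLimits
          ((isCoherent D W).lift (pushforward D W (hinv W)) (hcoh W)) ∧
        Limits.PreservesFiniteColimits
          ((isCoherent D W).lift (pushforward D W (hinv W)) (hcoh W)) ∧
        ∃ _ : (pushforward D W (hinv W)).Additive,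
          (pushforward D W (hinv W)).Linear Γ(S, W)) ∧
      -- shifts of the grading
      (∀ (W : S.Opens) (l : ℕ),
        Nonempty (Qgr.shift D W (2 * l) ⋙ pushforward D W (hinv W) ≅
          pushforward D W (hinv W) ⋙ twist D W (D.L.dual D.isLineBundle.isQCoh) l) ∧
        Nonempty (Qgr.shift D W (-(2 * l)) ⋙ pushforward D W (hinv W) ≅
          pushforward D W (hinv W) ⋙ twist D W D.L l)) ∧
      -- compatibility with restriction to open subsets
      (∀ {W W' : S.Opens} (i : W' ≤ W),
        Qgr.restr D i ⋙ pushforward D W' (hinv W') =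
          pushforward D W (hinv W) ⋙ PMod.restr D i) ∧
      -- compatibility with local `Hom` over `S`
      (∀ (W : S.Opens) (M N : GrMod D ⊤), Function.Bijective
        fun g : (toQgr D W).obj (M.on W) ⟶ (toQgr D W).obj (N.on W) =>
          pushforwardHom (hinv W) g) ∧
      -- compatibility with the direct image of the local `Hom`
      ∀ M N : GrMod D ⊤, ∃ Φ : ∀ U : S.affineOpens, HomLim (M.on U) (N.on U) ≃ₗ[Γ(S, U)]
          ((dirLim D U).obj (M.on U) ⟶ (dirLim D U).obj (N.on U)),
        (∀ (U : S.affineOpens) (j : ℕ)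
          (g : (toQgr D U).obj (M.on U) ⟶
            (toQgr D U).obj ((GrMod.shift D U (2 * (j : ℤ))).obj (N.on U)))
          (l : D.L.pow j U), ∃ μ, IsMulTpow (N.on U) j l μ ∧
            Φ U (HomLim.mk j g l) = pushforwardHom (hinv U) g ≫ μ) ∧
        ∀ {U V : S.affineOpens} (i : V ≤ U) (j : ℕ)
          (g : (toQgr D U).obj (M.on U) ⟶
            (toQgr D U).obj ((GrMod.shift D U (2 * (j : ℤ))).obj (N.on U)))
          (l : D.L.pow j U),
          Φ V (HomLim.mk j (restrQgrHom i g) (tpowMap (D.L.res i) j l)) =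
            restrDirLimHom i (Φ U (HomLim.mk j g l)) := by
  have : IsNoetherianTwo S := isNoetherianTwo_of_smooth f
  refine ⟨fun W => dirLim_inverts D W, fun W X => isCoherent_pushforward D W _ X,
    fun W => inferInstance, fun W => inferInstance, fun W => ⟨inferInstance, inferInstance⟩,
    fun W => ?_, fun W l => ⟨⟨liftShiftIso _ (shiftIso D W l)⟩, ⟨liftShiftIso _ (shiftNegIso D W l)⟩⟩,
    fun i => restr_pushforward i _ _, fun W M N => pushforwardHom_bijective,
    fun M N => ⟨fun U => homLimEquiv (M.on U) (N.on U),
      fun U j g l => ⟨mulTpow (N.on U) j l, isMulTpow_mulTpow (N.on U) j l, homLimMap_mk j g l⟩,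
      fun i j g l => homLimEquiv_restr M N i j g l⟩⟩
  have := lift_pushforward_isEquivalence (D := D) (W := W) (dirLim_inverts D W)
    (isCoherent_pushforward D W _)
  exact ⟨⟨inferInstance⟩, this, inferInstance, inferInstance, inferInstance, inferInstance⟩
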